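/- **Branched crystals.** A (one-coloured) branched crystal is a nonempty set $B$ with maps $\tilde e,\tilde f:B\sqcup\{0\}\to B\sqcup\{0\}$ and $\mathrm{wt},\varepsilon,\varphi:B\to\mathbb Z$ such that (i) $\tilde e0=\tilde f0=0$; if $\tilde eb\in B$ then $\mathrm{wt}(\tilde eb)=\mathrm{wt}(b)+2$; if $\tilde fb\in B$ then $\mathrm{wt}(\tilde fb)=\mathrm{wt}(b)-2$; (ii) if $\tilde fb\in B$ then $\tilde e\tilde fb=b$; (iii) if $b\neq b'$ in $B$ satisfy $\tilde eb,\tilde eb'\in B$, $\tilde f\tilde eb\ne b$, $\tilde f\tilde eb'\neq b'$, then $\tilde eb\ne\tilde eb'$; (iv) $\varepsilon(b)=\min\{s\in\mathbb Z_{\ge0}:\tilde f\tilde e^{s+1}b\neq\tilde e^sb\}$ (in particular this set is nonempty); (v) $\varphi(b)=\mathrm{wt}(b)+\varepsilon(b)$; if $l>0$, $\tilde f^{l-1}b\ne0$ and $\tilde f^lb=0$, then $l=\varphi(b)+1$; if $\tilde eb\in B$ and $\tilde f\tilde eb\neq b$, then $\varphi(\tilde eb)=0$. An element $b$ with $\tilde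 eb\in B$ and $\tilde f\tilde eb\ne b$ is a *branch point*. An isomorphism $B\cong B'$ is a bijection $B\sqcup\{0\}\to B'\sqcup\{0\}$ fixing $0$, preserving $\mathrm{wt}$ and $\varepsilon$, and commuting with $\tilde e$ and $\tilde f$. Direct sums are disjoint unions; the empty crystal is allowed as the direct sum of the empty family. **Tensor product.** Let $\psi(b)=\max\{\varepsilon(b),\varepsilon(b)-\varphi(b)-1\}$. Then $B\otimes B'$ is the set $B\times B'$ with $\mathrm{wt}(b\otimes b')=\mathrm{wt}(b)+\mathrm{wt}(b')$, with $0\otimes b'=b\otimes0=0$, and - $\tilde f(b\otimes b')=\tilde fb\otimes b'$ if $\varphi(b)<0$ or $\psi(b')<\varphi(b)$; - $\tilde f(b\otimes b')=b\otimes\tilde fb'$ if $\tilde fb'\ne0$ and $\psi(b')\ge\varphi(b)\ge0$; - $\tilde f(b\otimes b')=\tilde f^{\varphi(b)+1}b\otimes\tilde e^{\varphi(b)}b'$ if $\tilde fb'=0$ and $\psi(b')\ge\varphi(b)\ge0$; - $\tilde e(b\otimes b')=\tilde eb\otimes b'$ if $\mathrm{wt}(b)<\varphi(b)<-1$ or $\psi(b')\le\varphi(b)$;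 - $\tilde e(b\otimes b')=b\otimes\tilde eb'$ if $\psi(b')>\varphi(b)\ge0$; - $\tilde e(b\otimes b')=\tilde e^{\varphi(b')+1}b\otimes\tilde f^{\varphi(b')}b'$ if either $\varphi(b)=-1$, $\tilde f^{\varphi(b')+1}b'=0$ and $0\le\varphi(b')\le\varepsilon(b)-1$, or $b$ is a branch point, $b'$ is not of the form $\tilde e^la'$ with $a'$ a branch point of $B'$ and $l\ge0$, and $0\le\varphi(b')\le-\mathrm{wt}(b)-2$; - $\tilde e(b\otimes b')=\tilde f^{-\mathrm{wt}(b)-\mathrm{wt}(b')-2}b\otimes\tilde e^{-\mathrm{wt}(b)-\mathrm{wt}(b')-1}b'$ if $-\mathrm{wt}(b)-1\le\varphi(b')\le-\mathrm{wt}(b)-2+\varepsilon(b')$ and either $\varphi(b)=-1$, $\tilde eb\in B$, or $\varphi(b)<0$, $\varepsilon(b)=0$; - $\tilde e(b\otimes b')=0$ otherwise. The functions $\varepsilon$ and $\varphi=\mathrm{wt}+\varepsilon$ on $B\otimes B'$ are defined by the formulas in (iv) and (v). **Modules.** Let $U_q(\mathfrak{sl}_2)$ be the $\mathbb C(q)$-algebra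 generated by $e,f,k^{\pm1}$ with $kk^{-1}=k^{-1}k=1$, $kek^{-1}=q^2e$, $kfk^{-1}=q^{-2}f$, $ef-fe=(k-k^{-1})/(q-q^{-1})$, with comultiplication $\Delta(e)=e\otimes k+1\otimes e$, $\Delta(f)=f\otimes1+k^{-1}\otimes f$, $\Delta(k)=k\otimes k$, and Casimir element $\Omega=fe+(qk+q^{-1}k^{-1})(q-q^{-1})^{-2}$. Category $\mathcal O$ consists of the modules $M=\bigoplus_{r\in\mathbb Z}M_r$, $M_r=\{m:km=q^rm\}$, with all $M_r$ finite dimensional and $M_r=0$ for all sufficiently large $r$. Consider the modules - $M(s)$, $s\in\mathbb Z$: generated by $m_s$ with relations $em_s=0$, $km_s=q^sm_s$; - $V(r)$, $r\ge0$: the unique irreducible quotient of $M(r)$; - $T(r)$, $r\ge0$: generated by $t_r$ with relations $e^{r+2}t_r=0$, $kt_r=q^{-r-2}t_r$, $(\Omega-(q^{r+1}+q^{-r-1})(q-q^{-1})^{-2})^2t_r=0$; - $M(r)^\sigma$, $r\ge0$: the restricted dual of $M(r)$, i.e. the functionals $m^*$ vanishing on all but finitely many weight spaces, with $(um^*)(m)=m^*(\sigma(u)m)$,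 where $\sigma$ is the antiautomorphism with $\sigma(e)=f$, $\sigma(f)=e$, $\sigma(k)=k^{-1}$, $\sigma(q)=q^{-1}$ (functionals are taken semilinear with respect to $q\mapsto q^{-1}$, so that this formula also holds for scalars $u$). Their crystals, with $r\ge 0$ and $\tilde f$, $\tilde e$ equal to $0$ where no value is given, are: - $B(V(r))=\{b_j:0\le j\le r\}$ and $B(M(s))=\{b_j:j\ge0\}$, with $\tilde fb_j=b_{j+1}$, $\tilde eb_j=b_{j-1}$, $\varepsilon(b_j)=j$, and $\mathrm{wt}(b_j)=r-2j$, $\varphi(b_j)=r-j$, respectively $\mathrm{wt}(b_j)=s-2j$, $\varphi(b_j)=s-j$ (where $b_{-1}=0$, and $b_{r+1}=0$ in $B(V(r))$); - $B(T(r))=\{b_{(j)}:j\ge0\}\sqcup\{b_j:j\ge0\}$ and $B(M(r)^\sigma)=\{b_{(j)}:0\le j\le r\}\sqcup\{b_j:j\ge0\}$, with $\tilde fb_{(j)}=b_{(j+1)}$, $\tilde eb_{(j)}=b_{(j-1)}$, $\mathrm{wt}(b_{(j)})=r-2j$, $\varepsilon(b_{(j)})=j$, $\varphi(b_{(j)})=r-j$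 (where $b_{(-1)}=0$, and $b_{(r+1)}=0$ in $B(M(r)^\sigma)$), and $\tilde fb_j=b_{j+1}$, $\tilde eb_{j+1}=b_j$, $\tilde eb_0=b_{(r)}$, $\mathrm{wt}(b_j)=-r-2-2j$, $\varepsilon(b_j)=j$, $\varphi(b_j)=-r-2-j$. **Theorem.** Every $V\in\mathcal O$ is isomorphic to $\bigoplus_WW^{\oplus n_V(W)}$, with $W$ running over the modules listed above, for unique integers $n_V(W)\ge0$. Hence $B(V)=\bigoplus_WB(W)^{\oplus n_V(W)}$ is well defined; it is a branched crystal if $V\ne0$. For all $U,V,W\in\mathcal O$ we have $U\otimes V\in\mathcal O$ and 1. $B(U)\otimes B(V)\cong B(U\otimes V)=B(V\otimes U)\cong B(V)\otimes B(U)$; 2. $B(U)\otimes(B(V)\otimes B(W))\cong B(U\otimes(V\otimes W))=B((U\otimes V)\otimes W)\cong(B(U)\otimes B(V))\otimes B(W)$. Moreover, for all branched crystals $X,Y,Z$, the tensor product $X\otimes Y$ is a branched crystal, $X\otimes Y\cong Y\otimes X$ and $X\otimes(Y\otimes Z)\cong(X\otimes Y)\otimes Z$. -/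

import Mathlib

open scoped TensorProduct

universe u v

/-! ## Branched crystals -/

/-- The data underlying a (one-coloured) branched crystal: a set `B` with maps `ẽ, f̃` from
`B ⊔ {0}` to itself and `wt, ε, φ` from `B` to `ℤ`. Here `B ⊔ {0}` is `Option B`, with `0` being
`none`. The axioms are in `CrystalData.IsBranched`. -/
structure CrystalData : Type (u + 1) where
  carrier : Type u
  e : Option carrier → Option carrier
  f : Option carrier → Option carrier
  wt : carrier → ℤ
  ε : carrier → ℤ
  φ : carrier → ℤ

namespace CrystalData

/-- The axioms of a branched crystal. -/
structure IsBranched (B : CrystalData.{u}) : Prop where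
  nonempty : Nonempty B.carrier
  e_zero : B.e none = none
  f_zero : B.f none = none
  wt_e : ∀ b b', B.e (some b) = some b' → B.wt b' = B.wt b + 2
  wt_f : ∀ b b', B.f (some b) = some b' → B.wt b' = B.wt b - 2
  e_f : ∀ b, B.f (some b) ≠ none → B.e (B.f (some b)) = some b
  e_inj : ∀ b b', b ≠ b' → B.e (some b) ≠ none → B.e (some b') ≠ none →
    B.f (B.e (some b)) ≠ some b → B.f (B.e (some b')) ≠ some b' →
    B.e (some b) ≠ B.e (some b')
  ε_min : ∀ b, ∃ s : ℕ, B.ε b = s ∧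
    IsLeast {s : ℕ | B.f (B.e^[s + 1] (some b)) ≠ B.e^[s] (some b)} s
  φ_eq : ∀ b, B.φ b = B.wt b + B.ε b
  φ_string : ∀ b, ∀ l : ℕ, 0 < l → B.f^[l - 1] (some b) ≠ none → B.f^[l] (some b) = none →
    (l : ℤ) = B.φ b + 1
  φ_branch : ∀ b b', B.e (some b) = some b' → B.f (B.e (some b)) ≠ some b → B.φ b' = 0

/-- `b` is a branch point: `ẽ b ∈ B` but `f̃ ẽ b ≠ b`. -/
def IsBranchPoint (B : CrystalData.{u}) (b : B.carrier) : Prop :=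
  B.e (some b) ≠ none ∧ B.f (B.e (some b)) ≠ some b

/-- Morphisms of branched crystals. -/
structure IsMorphism (B : CrystalData.{u}) (B' : CrystalData.{v})
    (Φ : Option B.carrier → Option B'.carrier) : Prop where
  map_zero : Φ none = none
  map_wt_ε : ∀ b b', Φ (some b) = some b' → B'.wt b' = B.wt b ∧ B'.ε b' = B.ε b
  map_f : ∀ b, Φ (some b) ≠ none → Φ (B.f (some b)) ≠ none →
    Φ (B.f (some b)) = B'.f (Φ (some b))
  map_e : ∀ b, Φ (some b) ≠ none → Φ (B.e (some b)) ≠ none →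
    Φ (B.e (some b)) = B'.e (Φ (some b))

/-- Strict morphisms of branched crystals: they commute with `ẽ` and `f̃` everywhere. -/
structure IsStrictMorphism (B : CrystalData.{u}) (B' : CrystalData.{v})
    (Φ : Option B.carrier → Option B'.carrier) : Prop extends IsMorphism B B' Φ where
  strict_f : ∀ b, Φ (B.f (some b)) = B'.f (Φ (some b))
  strict_e : ∀ b, Φ (B.e (some b)) = B'.e (Φ (some b))

/-- `B` and `B'` are isomorphic: there is a bijective strict morphism `B ⊔ {0} → B' ⊔ {0}`;
equivalently, a bijective morphism whose inverse is a morphism. -/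
def Iso (B : CrystalData.{u}) (B' : CrystalData.{v}) : Prop :=
  ∃ Φ : Option B.carrier → Option B'.carrier, IsStrictMorphism B B' Φ ∧ Function.Bijective Φ

/-- The direct sum of a family: the disjoint union with all maps defined componentwise. -/
def directSum {J : Type u} (B : J → CrystalData.{v}) : CrystalData.{max u v} where
  carrier := Σ j, (B j).carrier
  e := fun x => x.bind fun b => ((B b.1).e (some b.2)).map (Sigma.mk b.1)
  f := fun x => x.bind fun b => ((B b.1).f (some b.2)).map (Sigma.mk b.1)
  wt := fun b => (B b.1).wt b.2
  ε := fun b => (B b.1).ε b.2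
  φ := fun b => (B b.1).φ b.2

/-! ### The tensor product -/

/-- `ψ(b) = max {ε(b), ε(b) - φ(b) - 1}`. -/
def ψ (B : CrystalData.{u}) (b : B.carrier) : ℤ := max (B.ε b) (B.ε b - B.φ b - 1)

/-- `x ⊗ x'`, with `0 ⊗ x' = x ⊗ 0 = 0`. -/
def pair {X : Type u} {Y : Type v} : Option X → Option Y → Option (X × Y) :=
  Option.map₂ Prod.mk

section
variable (B : CrystalData.{u}) (B' : CrystalData.{v}) (b : B.carrier) (b' : B'.carrier)

/-- Condition `F1`. -/
def F1 : Prop := B.φ b < 0 ∨ B'.ψ b' < B.φ b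

/-- Condition `F1'`. -/
def F1' : Prop := B'.f (some b') ≠ none ∧ B.φ b ≤ B'.ψ b' ∧ 0 ≤ B.φ b

/-- Condition `F2`. -/
def F2 : Prop := B'.f (some b') = none ∧ B.φ b ≤ B'.ψ b' ∧ 0 ≤ B.φ b

/-- Condition `E1`. -/
def E1 : Prop := (B.wt b < B.φ b ∧ B.φ b < -1) ∨ B'.ψ b' ≤ B.φ b

/-- Condition `E1'`. -/
def E1' : Prop := B.φ b < B'.ψ b' ∧ 0 ≤ B.φ b

/-- Condition `E2`. -/
def E2 : Prop :=
  (B.φ b = -1 ∧ B'.f^[(B'.φ b' + 1).toNat] (some b') = none ∧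
    0 ≤ B'.φ b' ∧ B'.φ b' ≤ B.ε b - 1) ∨
  (B.IsBranchPoint b ∧
    (¬ ∃ a', B'.IsBranchPoint a' ∧ ∃ l : ℕ, some b' = B'.e^[l] (some a')) ∧
    0 ≤ B'.φ b' ∧ B'.φ b' ≤ -B.wt b - 2)

/-- Condition `E2'`. -/
def E2' : Prop :=
  (B.φ b = -1 ∧ B.e (some b) ≠ none ∧
    -B.wt b - 1 ≤ B'.φ b' ∧ B'.φ b' ≤ -B.wt b - 2 + B'.ε b') ∨
  (B.φ b < 0 ∧ B.ε b = 0 ∧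
    -B.wt b - 1 ≤ B'.φ b' ∧ B'.φ b' ≤ -B.wt b - 2 + B'.ε b')

open Classical in
/-- `f̃ (b ⊗ b')`. -/
noncomputable def tensorF : Option (B.carrier × B'.carrier) :=
  if F1 B B' b b' then pair (B.f (some b)) (some b')
  else if F1' B B' b b' then pair (some b) (B'.f (some b'))
  else if F2 B B' b b' then
    pair (B.f^[(B.φ b + 1).toNat] (some b)) (B'.e^[(B.φ b).toNat] (some b'))
  else none

open Classical in
/-- `ẽ (b ⊗ b')`. -/
noncomputable def tensorE : Option (B.carrier × B'.carrier) :=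
  if E1 B B' b b' then pair (B.e (some b)) (some b')
  else if E1' B B' b b' then pair (some b) (B'.e (some b'))
  else if E2 B B' b b' then
    pair (B.e^[(B'.φ b' + 1).toNat] (some b)) (B'.f^[(B'.φ b').toNat] (some b'))
  else if E2' B B' b b' then
    pair (B.f^[(-B.wt b - B'.wt b' - 2).toNat] (some b))
      (B'.e^[(-B.wt b - B'.wt b' - 1).toNat] (some b'))
  else none

/-- `ẽ` on `(B × B') ⊔ {0}`. -/
noncomputable def tensorE₀ (x : Option (B.carrier × B'.carrier)) :
    Option (B.carrier × B'.carrier) :=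
  x.bind fun p => tensorE B B' p.1 p.2

/-- `f̃` on `(B × B') ⊔ {0}`. -/
noncomputable def tensorF₀ (x : Option (B.carrier × B'.carrier)) :
    Option (B.carrier × B'.carrier) :=
  x.bind fun p => tensorF B B' p.1 p.2

/-- `ε (b ⊗ b') = min {s : f̃ ẽ^(s+1) (b ⊗ b') ≠ ẽ^s (b ⊗ b')}`. (If there were no such `s`, the
axiom `IsBranched.ε_min` would fail for the tensor product.) -/
noncomputable def tensorε (x : B.carrier × B'.carrier) : ℤ :=
  ((sInf {s : ℕ | tensorF₀ B B' ((tensorE₀ B B')^[s + 1] (some x)) ≠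
    (tensorE₀ B B')^[s] (some x)} : ℕ) : ℤ)

/-- The tensor product `B ⊗ B'`. -/
noncomputable def tensor : CrystalData.{max u v} where
  carrier := B.carrier × B'.carrier
  e := tensorE₀ B B'
  f := tensorF₀ B B'
  wt := fun x => B.wt x.1 + B'.wt x.2
  ε := tensorε B B'
  φ := fun x => B.wt x.1 + B'.wt x.2 + tensorε B B' x

end

/-! ### The four families of indecomposable branched crystals -/

/-- The element `b_j` of `{b_0, …, b_r}`, which is `0` when `j > r`. -/
def finElt (r : ℕ) (j : ℕ) : Option (Fin (r + 1)) :=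
  if h : j < r + 1 then some ⟨j, h⟩ else none

/-- `ẽ b_j = b_(j-1)` on `{b_0, …, b_r}`, with `b_(-1) = 0`. -/
def finE (r : ℕ) (j : Fin (r + 1)) : Option (Fin (r + 1)) :=
  if (j : ℕ) = 0 then none else finElt r (j - 1)

/-- `ẽ b_j = b_(j-1)` on `{b_0, b_1, …}`, with `b_(-1) = 0`. -/
def natE (j : ℕ) : Option ℕ := if j = 0 then none else some (j - 1)

/-- The crystal `B(V(r))`. -/
def simple (r : ℕ) : CrystalData.{0} where
  carrier := Fin (r + 1)
  e := fun x => x.bind fun j => finE r j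
  f := fun x => x.bind fun j => finElt r (j + 1)
  wt := fun j => (r : ℤ) - 2 * j
  ε := fun j => ((j : ℕ) : ℤ)
  φ := fun j => (r : ℤ) - j

/-- The crystal `B(M(s))`. -/
def verma (s : ℤ) : CrystalData.{0} where
  carrier := ℕ
  e := fun x => x.bind fun j => natE j
  f := fun x => x.bind fun j => some (j + 1)
  wt := fun j => s - 2 * j
  ε := fun j => j
  φ := fun j => s - j

/-- The crystal `B(T(r))`; `Sum.inl j` is the element `b_((j))`, and `Sum.inr j` is `b_j`. -/
def tilting (r : ℕ) : CrystalData.{0} where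
  carrier := ℕ ⊕ ℕ
  e := fun x => x.bind fun
    | .inl j => (natE j).map Sum.inl
    | .inr j => if j = 0 then some (Sum.inl r) else some (Sum.inr (j - 1))
  f := fun x => x.bind fun
    | .inl j => some (Sum.inl (j + 1))
    | .inr j => some (Sum.inr (j + 1))
  wt := fun
    | .inl j => (r : ℤ) - 2 * j
    | .inr j => -(r : ℤ) - 2 - 2 * j
  ε := fun
    | .inl j => j
    | .inr j => j
  φ := fun
    | .inl j => (r : ℤ) - j
    | .inr j => -(r : ℤ) - 2 - j

/-- The crystal `B(M(r)^σ)`; `Sum.inl j` is the element `b_((j))`, and `Sum.inr j` is `b_j`. -/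
def dualVerma (r : ℕ) : CrystalData.{0} where
  carrier := Fin (r + 1) ⊕ ℕ
  e := fun x => x.bind fun
    | .inl j => (finE r j).map Sum.inl
    | .inr j => if j = 0 then some (Sum.inl (Fin.last r)) else some (Sum.inr (j - 1))
  f := fun x => x.bind fun
    | .inl j => (finElt r (j + 1)).map Sum.inl
    | .inr j => some (Sum.inr (j + 1))
  wt := fun
    | .inl j => (r : ℤ) - 2 * j
    | .inr j => -(r : ℤ) - 2 - 2 * j
  ε := fun
    | .inl j => ((j : ℕ) : ℤ)
    | .inr j => j
  φ := fun
    | .inl j => (r : ℤ) - j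
    | .inr j => -(r : ℤ) - 2 - j

end CrystalData

/-! ## The quantized enveloping algebra of `sl₂` -/

namespace QuantumSl2

/-- The field `ℂ(q)`. -/
abbrev Kq : Type := RatFunc ℂ

/-- The indeterminate `q`. -/
noncomputable abbrev q : Kq := RatFunc.X

theorem q_ne_zero : q ≠ 0 := RatFunc.X_ne_zero

/-- Names for the generators `e, f, k, k⁻¹`. -/
inductive Gen : Type
  | e | f | k | kinv

/-- The defining relations on the free algebra. -/
inductive Rel : FreeAlgebra Kq Gen → FreeAlgebra Kq Gen → Prop
  | k_kinv : Rel (FreeAlgebra.ι Kq .k * FreeAlgebra.ι Kq .kinv) 1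
  | kinv_k : Rel (FreeAlgebra.ι Kq .kinv * FreeAlgebra.ι Kq .k) 1
  | k_e : Rel (FreeAlgebra.ι Kq .k * FreeAlgebra.ι Kq .e * FreeAlgebra.ι Kq .kinv)
      (q ^ 2 • FreeAlgebra.ι Kq .e)
  | k_f : Rel (FreeAlgebra.ι Kq .k * FreeAlgebra.ι Kq .f * FreeAlgebra.ι Kq .kinv)
      ((q ^ 2)⁻¹ • FreeAlgebra.ι Kq .f)
  | e_f : Rel (FreeAlgebra.ι Kq .e * FreeAlgebra.ι Kq .f -
        FreeAlgebra.ι Kq .f * FreeAlgebra.ι Kq .e)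
      ((q - q⁻¹)⁻¹ • (FreeAlgebra.ι Kq .k - FreeAlgebra.ι Kq .kinv))

/-- The algebra `U_q(sl₂)` over `ℂ(q)`. -/
abbrev Uq : Type := RingQuot Rel

/-- The generators of `U_q(sl₂)`. -/
noncomputable def gen (g : Gen) : Uq := RingQuot.mkAlgHom Kq Rel (FreeAlgebra.ι Kq g)

noncomputable def E : Uq := gen .e
noncomputable def F : Uq := gen .f
noncomputable def K : Uq := gen .k
noncomputable def Kinv : Uq := gen .kinv

/-- Four elements of an algebra satisfy the defining relations of `U_q(sl₂)`. -/
structure Satisfies {A : Type u} [Ring A] [Algebra Kq A] (x y k k' : A) : Prop where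
  k_kinv : k * k' = 1
  kinv_k : k' * k = 1
  k_e : k * x * k' = q ^ 2 • x
  k_f : k * y * k' = (q ^ 2)⁻¹ • y
  e_f : x * y - y * x = (q - q⁻¹)⁻¹ • (k - k')

theorem satisfies_gen : Satisfies E F K Kinv where
  k_kinv := by simpa [K, Kinv, gen] using RingQuot.mkAlgHom_rel Kq Rel.k_kinv
  kinv_k := by simpa [K, Kinv, gen] using RingQuot.mkAlgHom_rel Kq Rel.kinv_k
  k_e := by simpa [K, Kinv, E, gen] using RingQuot.mkAlgHom_rel Kq Rel.k_e
  k_f := by simpa [K, Kinv, F, gen] using RingQuot.mkAlgHom_rel Kq Rel.k_f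
  e_f := by simpa [K, Kinv, E, F, gen] using RingQuot.mkAlgHom_rel Kq Rel.e_f

/-- The values of an algebra map on the generators. -/
def genVal {A : Type u} (x y k k' : A) : Gen → A
  | .e => x
  | .f => y
  | .k => k
  | .kinv => k'

/-- The universal property of `U_q(sl₂)`: `e ↦ x`, `f ↦ y`, `k ↦ k`, `k⁻¹ ↦ k'`. -/
noncomputable def lift {A : Type u} [Ring A] [Algebra Kq A] {x y k k' : A}
    (h : Satisfies x y k k') : Uq →ₐ[Kq] A :=
  RingQuot.liftAlgHom Kq ⟨FreeAlgebra.lift Kq (genVal x y k k'), by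
    intro a b hab
    cases hab with
    | k_kinv => simpa [genVal] using h.k_kinv
    | kinv_k => simpa [genVal] using h.kinv_k
    | k_e => simpa [genVal] using h.k_e
    | k_f => simpa [genVal] using h.k_f
    | e_f => simpa [genVal] using h.e_f⟩

theorem lift_gen {A : Type u} [Ring A] [Algebra Kq A] {x y k k' : A}
    (h : Satisfies x y k k') (g : Gen) : lift h (gen g) = genVal x y k k' g := by
  simp [lift, gen]

/-- The quantum Casimir element, `Ω = f e + (q k + q⁻¹ k⁻¹) / (q - q⁻¹)²`. -/
noncomputable def Casimir : Uq := F * E + ((q - q⁻¹) ^ 2)⁻¹ • (q • K + q⁻¹ • Kinv)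

theorem K_mul_E : (K * E : Uq) = q ^ 2 • (E * K) := by
  have h := congrArg (· * K) satisfies_gen.k_e
  simpa [mul_assoc, satisfies_gen.kinv_k] using h

theorem K_mul_F : (K * F : Uq) = (q ^ 2)⁻¹ • (F * K) := by
  have h := congrArg (· * K) satisfies_gen.k_f
  simpa [mul_assoc, satisfies_gen.kinv_k] using h

theorem E_mul_Kinv : (E * Kinv : Uq) = q ^ 2 • (Kinv * E) := by
  have h := congrArg (fun x => Kinv * (x * Kinv)) K_mul_E
  simpa [mul_assoc, satisfies_gen.k_kinv, ← mul_assoc Kinv K, satisfies_gen.kinv_k] using h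

/-- The elements giving the comultiplication satisfy the relations. -/
theorem satisfies_comul : Satisfies (A := Uq ⊗[Kq] Uq)
    (E ⊗ₜ K + 1 ⊗ₜ E) (F ⊗ₜ 1 + Kinv ⊗ₜ F) (K ⊗ₜ K) (Kinv ⊗ₜ Kinv) where
  k_kinv := by simp [satisfies_gen.k_kinv, Algebra.TensorProduct.one_def]
  kinv_k := by simp [satisfies_gen.kinv_k, Algebra.TensorProduct.one_def]
  k_e := by
    simp only [mul_add, add_mul, Algebra.TensorProduct.tmul_mul_tmul, satisfies_gen.k_e,
      satisfies_gen.k_kinv, mul_assoc, mul_one, smul_add]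
    simp only [TensorProduct.smul_tmul', TensorProduct.tmul_smul]
  k_f := by
    simp only [mul_add, add_mul, Algebra.TensorProduct.tmul_mul_tmul, satisfies_gen.k_f,
      satisfies_gen.k_kinv, mul_one, smul_add]
    rw [one_mul]
    simp only [TensorProduct.smul_tmul', TensorProduct.tmul_smul]
  e_f := by
    have h1 : (E * Kinv : Uq) ⊗ₜ[Kq] (K * F) = (Kinv * E) ⊗ₜ[Kq] (F * K) := by
      rw [E_mul_Kinv, K_mul_F, TensorProduct.tmul_smul, TensorProduct.smul_tmul', smul_smul,
        inv_mul_cancel₀ (pow_ne_zero 2 q_ne_zero), one_smul]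
    have h2 : (E * F : Uq) = F * E + (q - q⁻¹)⁻¹ • (K - Kinv) := by
      rw [← satisfies_gen.e_f]; abel
    simp only [mul_add, add_mul, Algebra.TensorProduct.tmul_mul_tmul, mul_one, one_mul, h1, h2,
      TensorProduct.add_tmul, TensorProduct.tmul_add, TensorProduct.smul_tmul',
      TensorProduct.tmul_smul, TensorProduct.sub_tmul, TensorProduct.tmul_sub, smul_sub]
    abel

/-- The comultiplication of the Hopf algebra `U_q(sl₂)`:
`Δ(e) = e ⊗ k + 1 ⊗ e`, `Δ(f) = f ⊗ 1 + k⁻¹ ⊗ f`, `Δ(k) = k ⊗ k`. -/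
noncomputable def comul : Uq →ₐ[Kq] Uq ⊗[Kq] Uq := lift satisfies_comul

/-! ### Modules -/

/-- A `U_q(sl₂)`-module: a `ℂ(q)`-vector space with a representation of the algebra. -/
structure UqMod : Type (u + 1) where
  carrier : Type u
  [addCommGroup : AddCommGroup carrier]
  [module : Module Kq carrier]
  ρ : Uq →ₐ[Kq] Module.End Kq carrier

namespace UqMod

attribute [instance] UqMod.addCommGroup UqMod.module

/-- Two modules are isomorphic. -/
def Iso (M : UqMod.{u}) (N : UqMod.{v}) : Prop :=
  ∃ g : M.carrier ≃ₗ[Kq] N.carrier, ∀ (a : Uq) (m : M.carrier), g (M.ρ a m) = N.ρ a (g m)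

/-- The tensor product of modules, through the comultiplication. -/
noncomputable def tensor (M : UqMod.{u}) (N : UqMod.{v}) : UqMod.{max u v} where
  carrier := M.carrier ⊗[Kq] N.carrier
  ρ := ((Module.endTensorEndAlgHom (R := Kq) (S := Kq) (A := Kq)
      (M := M.carrier) (N := N.carrier)).comp (Algebra.TensorProduct.map M.ρ N.ρ)).comp comul

/-- The direct sum of a family of modules. -/
noncomputable def directSum {I : Type u} (M : I → UqMod.{v}) : UqMod.{max u v} where
  carrier := Π₀ i, (M i).carrier
  ρ := AlgHom.ofLinearMap
    { toFun := fun a => DFinsupp.mapRange.linearMap fun i => (M i).ρ a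
      map_add' := fun a b => by ext; simp
      map_smul' := fun c a => by ext; simp }
    (by ext; simp) (fun a b => by ext; simp)

/-- The weight space `M_r = {m : k m = q^r m}`. -/
noncomputable def wt (M : UqMod.{u}) (r : ℤ) : Submodule Kq M.carrier :=
  LinearMap.ker (M.ρ K - algebraMap Kq (Module.End Kq M.carrier) (q ^ r))

theorem mem_wt {M : UqMod.{u}} {r : ℤ} {m : M.carrier} : m ∈ M.wt r ↔ M.ρ K m = q ^ r • m := by
  simp [wt, sub_eq_zero, Module.algebraMap_end_apply]

/-- Membership in the category `𝒪`: the module is the direct sum of its (integral, type 1) weight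
spaces, which are finite dimensional and vanish for all large weights. -/
structure InO (M : UqMod.{u}) : Prop where
  isInternal : DirectSum.IsInternal M.wt
  finite : ∀ r, Module.Finite Kq (M.wt r)
  bounded : ∃ n : ℤ, ∀ r, n ≤ r → M.wt r = ⊥

/-- A module over the ring `U_q(sl₂)` in the sense of `Module`, as an object of `UqMod`. -/
noncomputable def of (X : Type u) [AddCommGroup X] [Module Kq X] [Module Uq X]
    [IsScalarTower Kq Uq X] : UqMod.{u} where
  carrier := X
  ρ := Algebra.lsmul Kq Kq X

/-- The cyclic left module `U_q(sl₂) / (left ideal generated by S)`. -/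
abbrev CyclicType (S : Set Uq) : Type := Uq ⧸ Submodule.span Uq S

/-- The space underlying the Verma module `M(s)`, generated by `m_s` with the relations
`e m_s = 0`, `k m_s = q^s m_s`. -/
abbrev VermaType (s : ℤ) : Type := CyclicType {E, K - algebraMap Kq Uq (q ^ s)}

/-- The Verma module `M(s)`. -/
noncomputable def verma (s : ℤ) : UqMod.{0} := of (VermaType s)

/-- The simple module `V(r)`: the quotient of `M(r)` by the sum of all its proper submodules,
i.e. its unique irreducible quotient. -/
noncomputable def simple (r : ℕ) : UqMod.{0} :=
  of (VermaType r ⧸ sSup {N : Submodule Uq (VermaType r) | N ≠ ⊤})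

/-- The Casimir eigenvalue `(q^(r+1) + q^(-r-1)) / (q - q⁻¹)²`. -/
noncomputable def casimirValue (r : ℤ) : Kq :=
  (q ^ (r + 1) + q ^ (-r - 1)) * ((q - q⁻¹) ^ 2)⁻¹

/-- The module `T(r)`, generated by `t_r` with the relations `e^(r+2) t_r = 0`,
`k t_r = q^(-r-2) t_r`, `(Ω - (q^(r+1) + q^(-r-1)) (q - q⁻¹)⁻²)² t_r = 0`. -/
noncomputable def tilting (r : ℕ) : UqMod.{0} :=
  of (CyclicType {E ^ (r + 2), K - algebraMap Kq Uq (q ^ (-(r : ℤ) - 2)),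
    (Casimir - algebraMap Kq Uq (casimirValue r)) ^ 2})

/-! ### Restricted duals -/

theorem aeval_qinv_injective :
    Function.Injective (Polynomial.aeval (R := ℂ) (q⁻¹ : Kq)) := by
  rw [← transcendental_iff_injective]
  exact fun h => RatFunc.transcendental_X (K := ℂ) (IsAlgebraic.inv_iff.mp h)

/-- The `ℂ`-algebra homomorphism `ℂ(q) → ℂ(q)` with `q ↦ q⁻¹`. -/
noncomputable def bar : Kq →+* Kq :=
  RatFunc.liftRingHom (Polynomial.aeval (R := ℂ) (q⁻¹ : Kq)).toRingHom
    (nonZeroDivisors_le_comap_nonZeroDivisors_of_injective _ aeval_qinv_injective)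

theorem bar_q : bar q = q⁻¹ := by
  simp [bar, q]

theorem K_wt {M : UqMod.{u}} {r : ℤ} {m : M.carrier} (h : m ∈ M.wt r) :
    M.ρ K m ∈ M.wt (r + 0) := by
  rw [add_zero, mem_wt.mp h]
  exact Submodule.smul_mem _ _ h

theorem Kinv_wt {M : UqMod.{u}} {r : ℤ} {m : M.carrier} (h : m ∈ M.wt r) :
    M.ρ Kinv m ∈ M.wt (r + 0) := by
  have h1 : M.ρ K (M.ρ Kinv m) = M.ρ Kinv (M.ρ K m) := by
    rw [← Module.End.mul_apply, ← Module.End.mul_apply, ← map_mul, ← map_mul,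
      satisfies_gen.k_kinv, satisfies_gen.kinv_k]
  rw [add_zero, mem_wt, h1, mem_wt.mp h, map_smul]

theorem E_wt {M : UqMod.{u}} {r : ℤ} {m : M.carrier} (h : m ∈ M.wt r) :
    M.ρ E m ∈ M.wt (r + 2) := by
  rw [mem_wt, ← Module.End.mul_apply, ← map_mul, K_mul_E, map_smul, map_mul,
    LinearMap.smul_apply, Module.End.mul_apply, mem_wt.mp h, map_smul, smul_smul,
    zpow_add₀ q_ne_zero, mul_comm]
  norm_cast

theorem F_wt {M : UqMod.{u}} {r : ℤ} {m : M.carrier} (h : m ∈ M.wt r) :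
    M.ρ F m ∈ M.wt (r + -2) := by
  rw [mem_wt, ← Module.End.mul_apply, ← map_mul, K_mul_F, map_smul, map_mul,
    LinearMap.smul_apply, Module.End.mul_apply, mem_wt.mp h, map_smul, smul_smul,
    zpow_add₀ q_ne_zero, mul_comm, zpow_neg]
  norm_cast

/-- The space underlying the restricted dual `M^σ`: the functionals on `M` that vanish on all but
finitely many weight spaces. Since the antiautomorphism `σ` of `U_q(sl₂)` given by
`σ(e) = f`, `σ(f) = e`, `σ(k) = k⁻¹`, `σ(q) = q⁻¹` is not linear over `ℂ(q)`, functionals are taken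
to be semilinear for `q ↦ q⁻¹`; thus `(c m*)(m) = m*(σ(c) m)` for scalars `c`. -/
noncomputable def dualSpace (M : UqMod.{u}) : Submodule Kq (M.carrier →ₛₗ[bar] Kq) where
  carrier := {g | {r : ℤ | ∃ m ∈ M.wt r, g m ≠ 0}.Finite}
  zero_mem' := by simp
  add_mem' := by
    intro g h hg hh
    refine (Set.Finite.union hg hh).subset ?_
    rintro r ⟨m, hm, hne⟩
    by_cases h0 : g m = 0
    · exact Or.inr ⟨m, hm, fun h1 => hne (by simp [h0, h1])⟩
    · exact Or.inl ⟨m, hm, h0⟩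
  smul_mem' := by
    intro c g hg
    refine Set.Finite.subset hg ?_
    rintro r ⟨m, hm, hne⟩
    exact ⟨m, hm, fun h0 => hne (by simp [h0])⟩

/-- Precomposition with an operator that shifts weights by `t`, on the restricted dual. -/
noncomputable def transpose (M : UqMod.{u}) (a : Uq) (t : ℤ)
    (h : ∀ {r : ℤ} {m : M.carrier}, m ∈ M.wt r → M.ρ a m ∈ M.wt (r + t)) :
    Module.End Kq M.dualSpace where
  toFun g := ⟨g.1.comp (M.ρ a), by
    refine (Set.Finite.preimage (f := fun r : ℤ => r + t)
      (fun x _ y _ hxy => by simpa using hxy) g.2).subset ?_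
    rintro r ⟨m, hm, hne⟩
    exact ⟨M.ρ a m, h hm, hne⟩⟩
  map_add' _ _ := rfl
  map_smul' _ _ := rfl

theorem satisfies_dual (M : UqMod.{u}) :
    Satisfies (M.transpose F (-2) F_wt) (M.transpose E 2 E_wt)
      (M.transpose Kinv 0 Kinv_wt) (M.transpose K 0 K_wt) := by
  have key : ∀ (a b : Uq) (m : M.carrier), M.ρ a (M.ρ b m) = M.ρ (a * b) m := by
    intro a b m
    rw [map_mul, Module.End.mul_apply]
  constructor
  · ext g m
    change g.1 (M.ρ K (M.ρ Kinv m)) = g.1 m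
    rw [key, satisfies_gen.k_kinv, map_one, Module.End.one_apply]
  · ext g m
    change g.1 (M.ρ Kinv (M.ρ K m)) = g.1 m
    rw [key, satisfies_gen.kinv_k, map_one, Module.End.one_apply]
  · ext g m
    change g.1 (M.ρ K (M.ρ F (M.ρ Kinv m))) = q ^ 2 * g.1 (M.ρ F m)
    rw [key, key, satisfies_gen.k_f, map_smul, LinearMap.smul_apply,
      LinearMap.map_smulₛₗ, map_inv₀, map_pow, bar_q, inv_pow, inv_inv, smul_eq_mul]
  · ext g m
    change g.1 (M.ρ K (M.ρ E (M.ρ Kinv m))) = (q ^ 2)⁻¹ * g.1 (M.ρ E m)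
    rw [key, key, satisfies_gen.k_e, map_smul, LinearMap.smul_apply,
      LinearMap.map_smulₛₗ, map_pow, bar_q, inv_pow, smul_eq_mul]
  · ext g m
    change g.1 (M.ρ E (M.ρ F m)) - g.1 (M.ρ F (M.ρ E m)) =
      (q - q⁻¹)⁻¹ * (g.1 (M.ρ Kinv m) - g.1 (M.ρ K m))
    rw [key, key, ← map_sub, ← LinearMap.sub_apply, ← map_sub, satisfies_gen.e_f, map_smul,
      LinearMap.smul_apply, LinearMap.map_smulₛₗ, map_sub, LinearMap.sub_apply, map_sub, map_inv₀,
      map_sub, map_inv₀, bar_q, inv_inv, smul_eq_mul, ← neg_sub q q⁻¹]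
    rw [inv_neg (a := q - q⁻¹)]
    ring

/-- The restricted dual `M^σ`, with the action `(u m*)(m) = m*(σ(u) m)`. -/
noncomputable def dual (M : UqMod.{u}) : UqMod.{u} where
  carrier := M.dualSpace
  ρ := lift M.satisfies_dual

end UqMod

/-! ### From modules to crystals -/

/-- Labels for the indecomposable modules of `𝒪`: `V(r)`, `M(s)`, `T(r)` and `M(r)^σ`, where
`r ≥ 0` and `s ∈ ℤ`. -/
inductive Label : Type
  | simple (r : ℕ) | verma (s : ℤ) | tilting (r : ℕ) | dualVerma (r : ℕ)

/-- The indecomposable module with a given label. -/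
noncomputable def Label.toMod : Label → UqMod.{0}
  | .simple r => UqMod.simple r
  | .verma s => UqMod.verma s
  | .tilting r => UqMod.tilting r
  | .dualVerma r => (UqMod.verma r).dual

/-- The branched crystal of the indecomposable module with a given label. -/
def Label.crystal : Label → CrystalData.{0}
  | .simple r => CrystalData.simple r
  | .verma s => CrystalData.verma s
  | .tilting r => CrystalData.tilting r
  | .dualVerma r => CrystalData.dualVerma r

namespace UqMod

/-- `V` is isomorphic to the direct sum of the indecomposable modules `W`, each taken `n W`
times. -/
def HasMult (V : UqMod.{u}) (n : Label → ℕ) : Prop :=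
  Iso V (directSum fun p : Σ W : Label, Fin (n W) => p.1.toMod)

/-- The multiplicities `n_V(W)` of the indecomposable modules `W` in `V`. -/
noncomputable def mult (V : UqMod.{u}) : Label → ℕ := Classical.epsilon V.HasMult

/-- The branched crystal `B(V) = ⨁_W B(W)^{⊕ n_V(W)}`. -/
noncomputable def crystal (V : UqMod.{u}) : CrystalData.{0} :=
  CrystalData.directSum fun p : Σ W : Label, Fin (V.mult W) => p.1.crystal

end UqMod

end QuantumSl2

/-!
*Crystals.* A branched crystal is a disjoint union of `f̃`-strings, some of which hang by a branch
point below an element with `φ = 0` of another string; `CrystalData.Axioms` expresses the axioms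
along one step of a string. Two properties of an element `b` suffice to know everything else:
`FinStr b`, that its string is finite, and `Pos b`, that `φ(b) ≥ 0` and `b` is not of the form
`ẽ^l a` with `a` a branch point. Each connected component contains one element killed by `ẽ`, and it
is determined by the weight of this element and the two properties (`Axioms.decomposition`). Hence
a crystal with finitely many elements of each weight is determined by the numbers of elements of
each weight for which the two properties have given truth values (`equivalent_of_ncard_stratum`).
The list of branch points of a tensor product (`tensor_branch_cases`) shows that it satisfies the
axioms and that both properties are multiplicative: each holds for `b ⊗ b'` if and only if it holds
for `b` and for `b'` (`tensor_finStr`, `tensor_pos`). So the numbers agree for `X ⊗ Y` and `Y ⊗ X`,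
and for the two ways to bracket a triple product. This settles crystals with finitely many elements
of each weight and weights bounded above; a general crystal is a direct sum of such, and the tensor
product distributes over direct sums (`tensor_directSum`).

*Modules.* A crystal `B` has a module `ofCrystal` with basis `B`, on which `f` acts as `f̃` and `k`
by the weights. For the crystal of one of the modules `W` of the theorem it is isomorphic to `W`
(`label_iso`). The two properties can be read off from the module: the basis vectors with `FinStr`
span the vectors killed by a power of `f`, and those without `Pos` span the `e`-divisible vectors
(`crystalBasis_ofCrystal`). The same holds for the tensor product of two such modules with respect
to the tensor product of the crystals (`exists_crystalBasis_tensor`). As these subspaces and the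
weight spaces are intrinsic, any two such bases of a module in `𝒪` belong to equivalent
crystals (`CrystalBasis.equivalent`). This gives both the uniqueness of the multiplicities and the
isomorphism of `B(U ⊗ V)` with `B(U) ⊗ B(V)`.

*Existence of the decomposition.* For a module in `𝒪` and `r ≥ 0`, the highest weight vectors of
weight `r` and the vectors of weight `-r - 2` in the block of `r`, together with `f^(r+1)` and a
multiple of `e^(r+1)`, form a representation of a quiver with two arrows `a`, `b` and the relation
`b ∘ a = 0`. Its decomposition (`exists_quiver_decomposition`) provides generators of indecomposable
modules. The resulting map from their direct sum is injective, because it is injective on the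
vectors killed by `e`. It is surjective by the Fitting decomposition of the Casimir element on the
finite-dimensional weight spaces (`InO.eq_top`).
-/


universe w w'

namespace CrystalData

/-! ### Strings and branch points -/

/-- `a` is a branch point lying over `z`: `ẽ a = z` although `f̃ z ≠ a`. -/
def Branch (B : CrystalData.{u}) (a z : B.carrier) : Prop :=
  B.e (some a) = some z ∧ B.f (some z) ≠ some a

/-- The axioms of a branched crystal without nonemptiness, with `ε` and `φ` described by their
behaviour along one step of an `f̃`-string. -/
structure Axioms (B : CrystalData.{u}) : Prop where
  e_zero : B.e none = none
  f_zero : B.f none = none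
  wt_e : ∀ {b c}, B.e (some b) = some c → B.wt c = B.wt b + 2
  e_f : ∀ {b c}, B.f (some b) = some c → B.e (some c) = some b
  branch_inj : ∀ {a a' z}, B.Branch a z → B.Branch a' z → a = a'
  ε_nonneg : ∀ b, 0 ≤ B.ε b
  ε_top : ∀ {b}, B.f (B.e (some b)) ≠ some b → B.ε b = 0
  ε_f : ∀ {b c}, B.f (some b) = some c → B.ε c = B.ε b + 1
  φ_eq : ∀ b, B.φ b = B.wt b + B.ε b
  φ_bottom : ∀ {b}, B.f (some b) = none → B.φ b = 0
  φ_branch : ∀ {a z}, B.Branch a z → B.φ z = 0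

/-- `c = f̃ⁿ b`. -/
def Down (B : CrystalData.{u}) (n : ℕ) (b c : B.carrier) : Prop :=
  B.f^[n] (some b) = some c

/-- The `f̃`-string of `b` is finite. -/
def FinStr (B : CrystalData.{u}) (b : B.carrier) : Prop := ∃ n : ℕ, B.f^[n] (some b) = none

/-- `b` is of the form `ẽˡ a` with `a` a branch point. -/
def Up (B : CrystalData.{u}) (b : B.carrier) : Prop :=
  ∃ a, B.IsBranchPoint a ∧ ∃ l : ℕ, some b = B.e^[l] (some a)

/-- `b` lies in the upper half of its string, and no branch point lies below it. -/
def Pos (B : CrystalData.{u}) (b : B.carrier) : Prop := 0 ≤ B.φ b ∧ ¬ B.Up b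

namespace Axioms

variable {B : CrystalData.{u}} (hB : B.Axioms)
include hB

omit hB in
theorem branch_iff {a : B.carrier} : B.IsBranchPoint a ↔ ∃ z, B.Branch a z := by
  constructor
  · rintro ⟨h, h'⟩
    obtain ⟨z, hz⟩ := Option.ne_none_iff_exists'.mp h
    exact ⟨z, hz, hz ▸ h'⟩
  · rintro ⟨z, hz, h⟩
    exact ⟨by simp [hz], hz ▸ h⟩

theorem wt_f {b c : B.carrier} (h : B.f (some b) = some c) : B.wt c = B.wt b - 2 := by
  have := hB.wt_e (hB.e_f h); omega

theorem φ_f {b c : B.carrier} (h : B.f (some b) = some c) : B.φ c = B.φ b - 1 := by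
  have := hB.wt_f h; have := hB.ε_f h; have := hB.φ_eq b; have := hB.φ_eq c; omega

theorem e_cases {b c : B.carrier} :
    B.e (some b) = some c ↔ B.f (some c) = some b ∨ B.Branch b c := by
  constructor
  · intro h
    by_cases h' : B.f (some c) = some b
    · exact Or.inl h'
    · exact Or.inr ⟨h, h'⟩
  · rintro (h | h)
    exacts [hB.e_f h, h.1]

theorem f_inj {b b' c : B.carrier} (h : B.f (some b) = some c) (h' : B.f (some b') = some c) :
    b = b' := by
  have := (hB.e_f h).symm.trans (hB.e_f h'); simpa using this

theorem exists_f_of_ε_pos {c : B.carrier} (h : 0 < B.ε c) : ∃ b, B.f (some b) = some c := by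
  by_contra hn
  push Not at hn
  have : B.f (B.e (some c)) ≠ some c := by
    intro h'
    cases hc : B.e (some c) with
    | none => rw [hc, hB.f_zero] at h'; simp at h'
    | some b => exact hn b (hc ▸ h')
  have := hB.ε_top this
  omega

theorem branch_ε {a z : B.carrier} (h : B.Branch a z) : B.ε a = 0 :=
  hB.ε_top (by rw [h.1]; exact h.2)

theorem branch_φ {a z : B.carrier} (h : B.Branch a z) : B.φ a = - B.ε z - 2 := by
  have := hB.wt_e h.1; have := hB.φ_eq a; have := hB.φ_eq z
  have := hB.branch_ε h; have := hB.φ_branch h; omega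

theorem iter_none (n : ℕ) : B.f^[n] none = none :=
  Function.iterate_fixed hB.f_zero n

theorem e_iter_none (n : ℕ) : B.e^[n] none = none :=
  Function.iterate_fixed hB.e_zero n

omit hB in
theorem down_zero {b c : B.carrier} : B.Down 0 b c ↔ b = c := by simp [Down]

omit hB in
theorem down_one {b c : B.carrier} : B.Down 1 b c ↔ B.f (some b) = some c := by simp [Down]

theorem down_succ {n : ℕ} {b c : B.carrier} :
    B.Down (n + 1) b c ↔ ∃ d, B.Down n b d ∧ B.f (some d) = some c := by
  rw [Down, Function.iterate_succ_apply']
  constructor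
  · intro h
    cases hd : B.f^[n] (some b) with
    | none => rw [hd, hB.f_zero] at h; simp at h
    | some d => exact ⟨d, hd, hd ▸ h⟩
  · rintro ⟨d, hd, h⟩
    rw [Down] at hd
    rw [hd, h]

theorem down_ε {n : ℕ} {b c : B.carrier} (h : B.Down n b c) : B.ε c = B.ε b + n := by
  induction n generalizing c with
  | zero => rw [down_zero] at h; simp [h]
  | succ n ih =>
    obtain ⟨d, hd, h⟩ := hB.down_succ.mp h
    have := ih hd; have := hB.ε_f h; push_cast; omega

theorem down_φ {n : ℕ} {b c : B.carrier} (h : B.Down n b c) : B.φ c = B.φ b - n := by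
  induction n generalizing c with
  | zero => rw [down_zero] at h; simp [h]
  | succ n ih =>
    obtain ⟨d, hd, h⟩ := hB.down_succ.mp h
    have := ih hd; have := hB.φ_f h; push_cast; omega

theorem down_e {n : ℕ} {b c : B.carrier} (h : B.Down n b c) : B.e^[n] (some c) = some b := by
  induction n generalizing c with
  | zero => rw [down_zero] at h; simp [h]
  | succ n ih =>
    obtain ⟨d, hd, h⟩ := hB.down_succ.mp h
    rw [Function.iterate_succ_apply, hB.e_f h, ih hd]

theorem down_inj {n : ℕ} {b b' c : B.carrier} (h : B.Down n b c) (h' : B.Down n b' c) : b = b' := by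
  have := (hB.down_e h).symm.trans (hB.down_e h'); simpa using this

omit hB in
theorem down_fun {n : ℕ} {b c c' : B.carrier} (h : B.Down n b c) (h' : B.Down n b c') : c = c' := by
  have := h.symm.trans h'; simpa using this

theorem exists_down_of_le {n : ℕ} {c : B.carrier} (h : (n : ℤ) ≤ B.ε c) : ∃ b, B.Down n b c := by
  induction n generalizing c with
  | zero => exact ⟨c, rfl⟩
  | succ n ih =>
    push_cast at h
    obtain ⟨d, hd⟩ := hB.exists_f_of_ε_pos (c := c) (by omega)
    have := hB.ε_f hd
    obtain ⟨b, hb⟩ := ih (c := d) (by omega)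
    exact ⟨b, hB.down_succ.mpr ⟨d, hb, hd⟩⟩

theorem iter_eq_none {n : ℕ} {b : B.carrier} (h : B.f^[n] (some b) = none) :
    0 ≤ B.φ b ∧ B.φ b < n := by
  induction n generalizing b with
  | zero => simp at h
  | succ n ih =>
    rw [Function.iterate_succ_apply] at h
    cases hc : B.f (some b) with
    | none => have := hB.φ_bottom hc; push_cast; omega
    | some c =>
      have := ih (b := c) (hc ▸ h); have := hB.φ_f hc; push_cast; omega

theorem fin_φ {b : B.carrier} (h : B.FinStr b) : 0 ≤ B.φ b := by
  obtain ⟨n, hn⟩ := h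
  exact (hB.iter_eq_none hn).1

theorem fin_iff {b : B.carrier} {n : ℕ} (hn : B.φ b < n) :
    B.f^[n] (some b) = none ↔ B.FinStr b := by
  refine ⟨fun h => ⟨n, h⟩, fun ⟨m, hm⟩ => ?_⟩
  by_contra hne
  obtain ⟨c, hc⟩ := Option.ne_none_iff_exists'.mp hne
  have h1 := hB.down_φ (n := n) hc
  have h2 : B.f^[m] (some c) = none := by
    rw [← hc, ← Function.iterate_add_apply, add_comm, Function.iterate_add_apply, hm, hB.iter_none]
  have := (hB.iter_eq_none h2).1
  omega

theorem exists_down {n : ℕ} {b : B.carrier} (h : B.FinStr b → (n : ℤ) ≤ B.φ b) :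
    ∃ c, B.Down n b c := by
  apply Option.ne_none_iff_exists'.mp
  intro hn
  have := (hB.iter_eq_none hn).2
  have := h ⟨n, hn⟩
  omega

theorem f_none_iff {b : B.carrier} : B.f (some b) = none ↔ B.FinStr b ∧ B.φ b = 0 := by
  constructor
  · intro h; exact ⟨⟨1, h⟩, hB.φ_bottom h⟩
  · rintro ⟨h, h0⟩
    exact (hB.fin_iff (n := 1) (by omega)).mpr h

theorem down_fin {n : ℕ} {b c : B.carrier} (h : B.Down n b c) : B.FinStr b ↔ B.FinStr c := by
  constructor
  · rintro ⟨m, hm⟩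
    refine ⟨m, ?_⟩
    rw [← h, ← Function.iterate_add_apply, add_comm, Function.iterate_add_apply, hm, hB.iter_none]
  · rintro ⟨m, hm⟩
    refine ⟨m + n, ?_⟩
    rw [Function.iterate_add_apply, h, hm]

theorem f_fin {b c : B.carrier} (h : B.f (some b) = some c) : B.FinStr b ↔ B.FinStr c :=
  hB.down_fin (down_one.mpr h)

theorem branch_not_fin {a z : B.carrier} (h : B.Branch a z) : ¬ B.FinStr a := by
  intro hf
  have := hB.fin_φ hf; have := hB.branch_φ h; have := hB.ε_nonneg z; omega

omit hB in
theorem branch_up {a z : B.carrier} (h : B.Branch a z) : B.Up z :=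
  ⟨a, branch_iff.mpr ⟨z, h⟩, 1, by simp [h.1]⟩

theorem up_of_f {b c : B.carrier} (h : B.f (some b) = some c) (hc : B.Up c) : B.Up b := by
  obtain ⟨a, ha, l, hl⟩ := hc
  exact ⟨a, ha, l + 1, by rw [Function.iterate_succ_apply', ← hl, hB.e_f h]⟩

/-- An element above a branch point is a branch point, or lies in the string over which a branch
point lies. -/
theorem up_cases {b : B.carrier} (h : B.Up b) :
    B.IsBranchPoint b ∨ (∃ a, B.Branch a b) ∨ ∃ c, B.f (some b) = some c ∧ B.Up c := by
  obtain ⟨a, ha, l, hl⟩ := h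
  cases l with
  | zero =>
    obtain rfl : b = a := by simpa using hl
    exact Or.inl ha
  | succ l =>
    rw [Function.iterate_succ_apply'] at hl
    cases hc : B.e^[l] (some a) with
    | none => rw [hc, hB.e_zero] at hl; simp at hl
    | some c =>
      rw [hc] at hl
      rcases hB.e_cases.mp hl.symm with h | h
      · exact Or.inr (Or.inr ⟨c, h, a, ha, l, hc.symm⟩)
      · exact Or.inr (Or.inl ⟨c, h⟩)

theorem up_φ {b : B.carrier} (h : B.Up b) : B.IsBranchPoint b ∨ 0 ≤ B.φ b := by
  obtain ⟨a, ha, l, hl⟩ := h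
  induction l generalizing b with
  | zero =>
    obtain rfl : b = a := by simpa using hl
    exact Or.inl ha
  | succ l ih =>
    right
    rw [Function.iterate_succ_apply'] at hl
    cases hc : B.e^[l] (some a) with
    | none => rw [hc, hB.e_zero] at hl; simp at hl
    | some c =>
      rw [hc] at hl
      rcases hB.e_cases.mp hl.symm with h | h
      · rcases ih (b := c) hc.symm with h' | h'
        · refine absurd ?_ h'.2
          rw [hB.e_f h]
          exact h
        · have := hB.φ_f h; omega
      · exact (hB.φ_branch h).ge

theorem not_branch_of_φ {a : B.carrier} (h : -1 ≤ B.φ a) : ¬ B.IsBranchPoint a := by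
  intro ha
  obtain ⟨z, hz⟩ := branch_iff.mp ha
  have := hB.branch_φ hz; have := hB.ε_nonneg z; omega

theorem up_f_iff {b c : B.carrier} (h : B.f (some b) = some c) (hc : 0 ≤ B.φ c) :
    B.Up b ↔ B.Up c := by
  refine ⟨fun hb => ?_, hB.up_of_f h⟩
  have := hB.φ_f h
  rcases hB.up_cases hb with h' | ⟨a, ha⟩ | ⟨d, hd, hu⟩
  · exact absurd h' (hB.not_branch_of_φ (by omega))
  · have := hB.φ_branch ha; omega
  · obtain rfl : c = d := by simpa using h.symm.trans hd
    exact hu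

theorem up_iff_of_φ_eq_zero {b : B.carrier} (h : B.φ b = 0) : B.Up b ↔ ∃ a, B.Branch a b := by
  refine ⟨fun hb => ?_, fun ⟨a, ha⟩ => branch_up ha⟩
  rcases hB.up_cases hb with h' | ha | ⟨d, hd, hu⟩
  · exact absurd h' (hB.not_branch_of_φ (by omega))
  · exact ha
  · have := hB.φ_f hd
    rcases hB.up_φ hu with h1 | h1
    · exact absurd h1 (hB.not_branch_of_φ (by omega))
    · omega

theorem pos_f_iff {b c : B.carrier} (h : B.f (some b) = some c) (hc : 0 ≤ B.φ c) :
    B.Pos b ↔ B.Pos c := by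
  have := hB.φ_f h
  have := hB.up_f_iff h hc
  constructor
  · rintro ⟨h1, h2⟩; exact ⟨by omega, by tauto⟩
  · rintro ⟨h1, h2⟩; exact ⟨by omega, by tauto⟩

theorem pos_of_pos {b c : B.carrier} (h : B.f (some b) = some c) (hc : B.Pos c) : B.Pos b :=
  (hB.pos_f_iff h hc.1).mpr hc

end Axioms

/-! ### The two forms of the axioms -/

theorem IsBranched.axioms {B : CrystalData.{u}} (h : B.IsBranched) : B.Axioms := by
  have ef : ∀ {b c}, B.f (some b) = some c → B.e (some c) = some b := by
    intro b c hbc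
    have := h.e_f b (by simp [hbc])
    rwa [hbc] at this
  have brf : ∀ {a z}, B.Branch a z → B.e (some a) ≠ none ∧ B.f (B.e (some a)) ≠ some a := by
    rintro a z ⟨h1, h2⟩
    exact ⟨by simp [h1], h1 ▸ h2⟩
  refine ⟨h.e_zero, h.f_zero, fun {b c} hb => h.wt_e b c hb, ef, ?_, ?_, ?_, ?_, h.φ_eq, ?_, ?_⟩
  · intro a a' z ha ha'
    by_contra hne
    exact h.e_inj a a' hne (brf ha).1 (brf ha').1 (brf ha).2 (brf ha').2 (ha.1.trans ha'.1.symm)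
  · intro b
    obtain ⟨s, hs, -⟩ := h.ε_min b
    omega
  · intro b hb
    obtain ⟨s, hs, -, hmin⟩ := h.ε_min b
    have : s ≤ 0 := hmin (by simpa using hb)
    omega
  · intro b c hbc
    obtain ⟨s, hs, hs1, hs2⟩ := h.ε_min b
    obtain ⟨t, ht, ht1, ht2⟩ := h.ε_min c
    have key : ∀ n : ℕ, B.e^[n + 1] (some c) = B.e^[n] (some b) := by
      intro n; rw [Function.iterate_succ_apply, ef hbc]
    have h1 : t ≤ s + 1 := ht2 (by
      simp only [Set.mem_ofPred_eq] at hs1 ⊢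
      rwa [key, key])
    have h2 : t ≠ 0 := by
      rintro rfl
      simp only [Set.mem_ofPred_eq] at ht1
      rw [key] at ht1
      exact ht1 hbc
    obtain ⟨t, rfl⟩ := Nat.exists_eq_succ_of_ne_zero h2
    have h3 : s ≤ t := hs2 (by
      simp only [Set.mem_ofPred_eq, Nat.succ_eq_add_one] at ht1 ⊢
      rwa [key, key] at ht1)
    rw [hs, ht]
    push_cast
    omega
  · intro b hb
    have := h.φ_string b 1 (by omega) (by simp) (by simpa using hb)
    omega
  · intro a z ha
    exact h.φ_branch a z ha.1 (brf ha).2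

theorem Axioms.isBranched {B : CrystalData.{u}} (h : B.Axioms) (hne : Nonempty B.carrier) :
    B.IsBranched := by
  refine ⟨hne, h.e_zero, h.f_zero, fun b b' => h.wt_e, fun b b' => h.wt_f, ?_, ?_, ?_, h.φ_eq, ?_,
    ?_⟩
  · intro b hb
    obtain ⟨c, hc⟩ := Option.ne_none_iff_exists'.mp hb
    rw [hc]; exact h.e_f hc
  · intro b b' hne h1 h2 h3 h4 h5
    obtain ⟨c, hc⟩ := Option.ne_none_iff_exists'.mp h1
    exact hne (h.branch_inj (z := c) ⟨hc, hc ▸ h3⟩ ⟨h5 ▸ hc, by rw [hc] at h5; rwa [← h5] at h4⟩)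
  · intro b
    obtain ⟨n, hn⟩ := Int.eq_ofNat_of_zero_le (h.ε_nonneg b)
    refine ⟨n, hn, ?_⟩
    induction n generalizing b with
    | zero =>
      refine ⟨?_, fun _ _ => Nat.zero_le _⟩
      simp only [Set.mem_ofPred_eq, zero_add, Function.iterate_one, Function.iterate_zero, id]
      intro hb
      cases hc : B.e (some b) with
      | none => rw [hc, h.f_zero] at hb; simp at hb
      | some c =>
        have := h.ε_f (hc ▸ hb); have := h.ε_nonneg c
        simp at hn
        omega
    | succ n ih =>
      obtain ⟨c, hc⟩ := h.exists_f_of_ε_pos (c := b) (by omega)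
      have hε := h.ε_f hc
      have key : ∀ n : ℕ, B.e^[n + 1] (some b) = B.e^[n] (some c) := by
        intro n; rw [Function.iterate_succ_apply, h.e_f hc]
      obtain ⟨ih1, ih2⟩ := ih c (by push_cast at hn; omega)
      constructor
      · simp only [Set.mem_ofPred_eq] at ih1 ⊢
        rwa [key, key]
      · intro s hs
        cases s with
        | zero =>
          simp only [Set.mem_ofPred_eq] at hs
          rw [key] at hs
          exact absurd hc hs
        | succ s =>
          have : n ≤ s := ih2 (by
            simp only [Set.mem_ofPred_eq] at hs ⊢
            rwa [key, key] at hs)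
          omega
  · intro b l hl h1 h2
    obtain ⟨l, rfl⟩ := Nat.exists_eq_succ_of_ne_zero hl.ne'
    simp only [Nat.succ_eq_add_one, Nat.add_sub_cancel] at h1
    obtain ⟨c, hc⟩ := Option.ne_none_iff_exists'.mp h1
    rw [Nat.succ_eq_add_one, Function.iterate_succ_apply', hc] at h2
    have := h.φ_bottom h2; have := h.down_φ hc
    push_cast; omega
  · intro b b' hb hb'
    exact h.φ_branch ⟨hb, hb ▸ hb'⟩

end CrystalData

namespace CrystalData

/-! ### The operators on a tensor product -/

section Tensor

variable {B : CrystalData.{u}} {B' : CrystalData.{v}}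

theorem pair_eq_some_iff {X : Type u} {Y : Type v} {x : Option X} {y : Option Y} {a : X} {b : Y} :
    pair x y = some (a, b) ↔ x = some a ∧ y = some b := by
  cases x <;> cases y <;> simp [pair]

theorem pair_eq_none_iff {X : Type u} {Y : Type v} {x : Option X} {y : Option Y} :
    pair x y = none ↔ x = none ∨ y = none := by
  cases x <;> cases y <;> simp [pair]

/-- The values of `f̃` on a tensor product. -/
theorem tensorF_eq_some_iff (hB' : B'.Axioms) {b c : B.carrier}
    {b' c' : B'.carrier} : tensorF B B' b b' = some (c, c') ↔
      ((B.φ b < 0 ∨ B'.ψ b' < B.φ b) ∧ B.f (some b) = some c ∧ b' = c') ∨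
      (0 ≤ B.φ b ∧ B.φ b ≤ B'.ψ b' ∧ b = c ∧ B'.f (some b') = some c') ∨
      (0 ≤ B.φ b ∧ B.φ b ≤ B'.ε b' ∧ B'.f (some b') = none ∧
        ∃ n : ℕ, (n : ℤ) = B.φ b ∧ B.Down (n + 1) b c ∧ B'.Down n c' b') := by
  have hε := hB'.ε_nonneg b'
  unfold tensorF
  split_ifs with h1 h2 h3
  · rw [pair_eq_some_iff]
    simp only [Option.some.injEq]
    unfold F1 at h1
    constructor
    · rintro h; exact Or.inl ⟨h1, h⟩
    · rintro (h | h | h)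
      · exact h.2
      · omega
      · have : B'.ε b' ≤ B'.ψ b' := le_max_left _ _
        omega
  · rw [pair_eq_some_iff]
    simp only [Option.some.injEq]
    unfold F1 at h1
    unfold F1' at h2
    constructor
    · rintro h; exact Or.inr (Or.inl ⟨h2.2.2, h2.2.1, h⟩)
    · rintro (h | h | h)
      · tauto
      · exact h.2.2
      · tauto
  · rw [pair_eq_some_iff]
    unfold F1 at h1
    unfold F1' at h2
    unfold F2 at h3
    have hφ := hB'.φ_bottom h3.1
    have hψ : B'.ψ b' = B'.ε b' := by unfold ψ; omega
    obtain ⟨n, hn⟩ := Int.eq_ofNat_of_zero_le h3.2.2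
    rw [show (B.φ b + 1).toNat = n + 1 by omega, show (B.φ b).toNat = n by omega]
    obtain ⟨d, hd⟩ := hB'.exists_down_of_le (n := n) (c := b') (by omega)
    constructor
    · rintro ⟨h4, h5⟩
      refine Or.inr (Or.inr ⟨h3.2.2, hψ ▸ h3.2.1, h3.1, n, hn.symm, h4, ?_⟩)
      rw [hB'.down_e hd] at h5
      simp only [Option.some.injEq] at h5
      exact h5 ▸ hd
    · rintro (h | h | ⟨-, -, -, m, hm, h4, h5⟩)
      · tauto
      · have h6 := h.2.2.2
        rw [h3.1] at h6
        simp at h6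
      · obtain rfl : m = n := by omega
        exact ⟨h4, hB'.down_e h5⟩
  · unfold F1 at h1
    unfold F1' at h2
    unfold F2 at h3
    constructor
    · simp
    · rintro (h | h | h)
      · tauto
      · refine absurd ⟨?_, h.2.1, h.1⟩ h2
        simp [h.2.2.2]
      · refine absurd ⟨h.2.2.1, ?_, h.1⟩ h3
        exact h.2.1.trans (le_max_left _ _)

/-- In a tensor product `f̃` vanishes exactly on the last elements of the hooks formed by two finite
strings. -/
theorem tensorF_eq_none_iff (hB : B.Axioms) (hB' : B'.Axioms) {b : B.carrier} {b' : B'.carrier} :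
    tensorF B B' b b' = none ↔
      B.FinStr b ∧ B'.FinStr b' ∧ 0 ≤ B.φ b ∧ B.φ b ≤ B'.ε b' ∧ B'.φ b' = 0 := by
  have hε := hB'.ε_nonneg b'
  have hψε : B'.ε b' ≤ B'.ψ b' := le_max_left _ _
  unfold tensorF
  split_ifs with h1 h2 h3
  · rw [pair_eq_none_iff]
    unfold F1 at h1
    have : B.f (some b) ≠ none := by
      intro h; have := hB.φ_bottom h; omega
    simp only [reduceCtorEq, or_false, this, false_iff]
    omega
  · rw [pair_eq_none_iff]
    unfold F1' at h2
    simp only [reduceCtorEq, false_or, h2.1, false_iff]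
    rintro h
    exact h2.1 (hB'.f_none_iff.mpr ⟨h.2.1, h.2.2.2.2⟩)
  · rw [pair_eq_none_iff]
    unfold F2 at h3
    have hφ := hB'.φ_bottom h3.1
    have hψ : B'.ψ b' = B'.ε b' := by unfold ψ; omega
    obtain ⟨n, hn⟩ := Int.eq_ofNat_of_zero_le h3.2.2
    rw [show (B.φ b + 1).toNat = n + 1 by omega, show (B.φ b).toNat = n by omega]
    obtain ⟨d, hd⟩ := hB'.exists_down_of_le (n := n) (c := b') (by omega)
    rw [hB'.down_e hd, hB.fin_iff (by push_cast; omega)]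
    simp only [reduceCtorEq, or_false]
    exact ⟨fun h => ⟨h, (hB'.f_none_iff.mp h3.1).1, h3.2.2, by omega, hφ⟩, fun h => h.1⟩
  · unfold F1 at h1
    unfold F1' at h2
    unfold F2 at h3
    by_cases h4 : B'.f (some b') = none
    · exact absurd ⟨h4, by omega, by omega⟩ h3
    · exact absurd ⟨h4, by omega, by omega⟩ h2

/-- The values of `ẽ` on a tensor product. The conditions of the five cases exclude each other. -/
theorem tensorE_eq_some_iff (hB : B.Axioms) (hB' : B'.Axioms) {b c : B.carrier}
    {b' c' : B'.carrier} : tensorE B B' b b' = some (c, c') ↔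
      ((B.φ b < -1 ∨ B'.ψ b' ≤ B.φ b) ∧ B.f (some c) = some b ∧ b' = c') ∨
      (0 ≤ B.φ b ∧ B.φ b < B'.ψ b' ∧ b = c ∧ B'.e (some b') = some c') ∨
      (B.φ b = -1 ∧ B'.FinStr b' ∧
        ∃ n : ℕ, (n : ℤ) = B'.φ b' ∧ B.Down (n + 1) c b ∧ B'.Down n b' c') ∨
      (∃ z, B.Branch b z ∧ ¬ B'.Up b' ∧
        ∃ n : ℕ, (n : ℤ) = B'.φ b' ∧ B.Down n c z ∧ B'.Down n b' c') ∨
      (B.φ b < 0 ∧ (B.φ b = -1 ∨ B.ε b = 0) ∧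
        ∃ n : ℕ, B.φ b - B.ε b + B'.φ b' - B'.ε b' + 2 + n = 0 ∧
          B.Down n b c ∧ B'.Down (n + 1) c' b') := by
  have hε := hB.ε_nonneg b
  have hε' := hB'.ε_nonneg b'
  have hψε : B'.ε b' ≤ B'.ψ b' := le_max_left _ _
  have hw := hB.φ_eq b
  have hw' := hB'.φ_eq b'
  constructor
  · intro h
    unfold tensorE at h
    split_ifs at h with h1 h2 h3 h4
    · rw [pair_eq_some_iff] at h
      unfold E1 at h1
      refine Or.inl ⟨by omega, ?_, by simpa using h.2⟩
      rcases hB.e_cases.mp h.1 with h5 | h5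
      · exact h5
      · have := hB.branch_ε h5; have := hB.branch_φ h5; have := hB.ε_nonneg c; omega
    · rw [pair_eq_some_iff] at h
      unfold E1' at h2
      exact Or.inr (Or.inl ⟨h2.2, h2.1, by simpa using h.1, h.2⟩)
    · rw [pair_eq_some_iff] at h
      unfold E2 at h3
      rcases h3 with h3 | h3
      · obtain ⟨n, hn⟩ := Int.eq_ofNat_of_zero_le h3.2.2.1
        rw [show (B'.φ b' + 1).toNat = n + 1 by omega] at h h3
        rw [show (B'.φ b').toNat = n by omega] at h
        obtain ⟨d, hd⟩ := hB.exists_down_of_le (n := n + 1) (c := b) (by push_cast; omega)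
        have h5 := h.1
        rw [hB.down_e hd] at h5
        obtain rfl : d = c := by simpa using h5
        exact Or.inr (Or.inr (Or.inl ⟨h3.1, ⟨_, h3.2.1⟩, n, by omega, hd, h.2⟩))
      · obtain ⟨n, hn⟩ := Int.eq_ofNat_of_zero_le h3.2.2.1
        rw [show (B'.φ b' + 1).toNat = n + 1 by omega, show (B'.φ b').toNat = n by omega] at h
        obtain ⟨z, hz⟩ := Axioms.branch_iff.mp h3.1
        have h5 := h.1
        rw [Function.iterate_succ_apply, hz.1] at h5
        have := hB.branch_ε hz; have := hB.branch_φ hz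
        obtain ⟨d, hd⟩ := hB.exists_down_of_le (n := n) (c := z) (by omega)
        rw [hB.down_e hd] at h5
        obtain rfl : d = c := by simpa using h5
        exact Or.inr (Or.inr (Or.inr (Or.inl ⟨z, hz, h3.2.1, n, by omega, hd, h.2⟩)))
    · rw [pair_eq_some_iff] at h
      unfold E1 at h1
      unfold E2' at h4
      obtain ⟨n, hn⟩ := Int.eq_ofNat_of_zero_le
        (show 0 ≤ - B.wt b - B'.wt b' - 2 by omega)
      rw [show (- B.wt b - B'.wt b' - 2).toNat = n by omega,
        show (- B.wt b - B'.wt b' - 1).toNat = n + 1 by omega] at h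
      obtain ⟨d, hd⟩ := hB'.exists_down_of_le (n := n + 1) (c := b') (by push_cast; omega)
      have h5 := h.2
      rw [hB'.down_e hd] at h5
      obtain rfl : d = c' := by simpa using h5
      exact Or.inr (Or.inr (Or.inr (Or.inr ⟨by omega, by omega, n, by omega, h.1, hd⟩)))
  · have hbr : ∀ z, B.Branch b z → B.ε b = 0 ∧ B.φ b < -1 ∧ B.φ b = - B.ε z - 2 := by
      intro z hz
      have := hB.branch_ε hz; have := hB.branch_φ hz; have := hB.ε_nonneg z; omega
    rintro (⟨h1, h2, rfl⟩ | ⟨h1, h2, rfl, h3⟩ | ⟨h1, h2, n, hn, h3, h4⟩ |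
      ⟨z, hz, h2, n, hn, h3, h4⟩ | ⟨h1, h2, n, hn, h3, h4⟩)
    · have := hB.ε_f h2; have := hB.ε_nonneg c
      have h3 : E1 B B' b b' := by unfold E1; omega
      rw [tensorE, if_pos h3, pair_eq_some_iff]
      exact ⟨hB.e_f h2, rfl⟩
    · have h4 : ¬ E1 B B' b b' := by unfold E1; omega
      have h5 : E1' B B' b b' := ⟨h2, h1⟩
      rw [tensorE, if_neg h4, if_pos h5, pair_eq_some_iff]
      exact ⟨rfl, h3⟩
    · have h5 : ¬ E1 B B' b b' := by unfold E1; omega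
      have h6 : ¬ E1' B B' b b' := by unfold E1'; omega
      have := hB.down_ε h3; have := hB.ε_nonneg c
      have h7 : E2 B B' b b' := by
        refine Or.inl ⟨h1, ?_, by omega, by push_cast at *; omega⟩
        rwa [hB'.fin_iff (by omega)]
      rw [tensorE, if_neg h5, if_neg h6, if_pos h7, pair_eq_some_iff,
        show (B'.φ b' + 1).toNat = n + 1 by omega, show (B'.φ b').toNat = n by omega]
      exact ⟨hB.down_e h3, h4⟩
    · have := hbr z hz
      have h5 : ¬ E1 B B' b b' := by unfold E1; omega
      have h6 : ¬ E1' B B' b b' := by unfold E1'; omega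
      have := hB.down_ε h3; have := hB.ε_nonneg c
      have h7 : E2 B B' b b' :=
        Or.inr ⟨Axioms.branch_iff.mpr ⟨z, hz⟩, h2, by omega, by omega⟩
      rw [tensorE, if_neg h5, if_neg h6, if_pos h7, pair_eq_some_iff,
        show (B'.φ b' + 1).toNat = n + 1 by omega, show (B'.φ b').toNat = n by omega]
      exact ⟨by rw [Function.iterate_succ_apply, hz.1, hB.down_e h3], h4⟩
    · have h5 : ¬ E1 B B' b b' := by unfold E1; omega
      have h6 : ¬ E1' B B' b b' := by unfold E1'; omega
      have := hB'.down_ε h4; have := hB'.ε_nonneg c'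
      push_cast at *
      have h7 : ¬ E2 B B' b b' := by
        rintro (h | ⟨h, -, h'⟩)
        · omega
        · omega
      have h8 : E2' B B' b b' := by
        by_cases h9 : B.ε b = 0
        · exact Or.inr ⟨h1, h9, by omega, by omega⟩
        · refine Or.inl ⟨by omega, ?_, by omega, by omega⟩
          obtain ⟨d, hd⟩ := hB.exists_f_of_ε_pos (c := b) (by omega)
          simp [hB.e_f hd]
      rw [tensorE, if_neg h5, if_neg h6, if_neg h7, if_pos h8, pair_eq_some_iff,
        show (- B.wt b - B'.wt b' - 2).toNat = n by omega,
        show (- B.wt b - B'.wt b' - 1).toNat = n + 1 by omega]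
      exact ⟨h3, hB'.down_e h4⟩

end Tensor

end CrystalData

namespace CrystalData

/-! ### The tensor product is a branched crystal -/

namespace Axioms

/-- While `φ ≥ 0`, a branch point lies below the end of a string segment if and only if it lies
below its beginning. -/
theorem down_up {B : CrystalData.{u}} (hB : B.Axioms) {n : ℕ} {b c : B.carrier}
    (h : B.Down n b c) (hc : 0 ≤ B.φ c) : B.Up b ↔ B.Up c := by
  induction n generalizing c with
  | zero => rw [down_zero] at h; rw [h]
  | succ n ih =>
    obtain ⟨d, hd, h⟩ := hB.down_succ.mp h
    have := hB.φ_f h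
    rw [ih hd (by omega), hB.up_f_iff h hc]

section Tensor

variable {B : CrystalData.{u}} {B' : CrystalData.{v}}

theorem ψ_def {b : B.carrier} : B.ψ b = max (B.ε b) (B.ε b - B.φ b - 1) := rfl

theorem tensor_f_eq_some (hB' : B'.Axioms) {b c : B.carrier}
    {b' c' : B'.carrier} : (B.tensor B').f (some (b, b')) = some (c, c') ↔
      ((B.φ b < 0 ∨ B'.ψ b' < B.φ b) ∧ B.f (some b) = some c ∧ b' = c') ∨
      (0 ≤ B.φ b ∧ B.φ b ≤ B'.ψ b' ∧ b = c ∧ B'.f (some b') = some c') ∨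
      (0 ≤ B.φ b ∧ B.φ b ≤ B'.ε b' ∧ B'.f (some b') = none ∧
        ∃ n : ℕ, (n : ℤ) = B.φ b ∧ B.Down (n + 1) b c ∧ B'.Down n c' b') :=
  tensorF_eq_some_iff hB'

theorem tensor_f_eq_none (hB : B.Axioms) (hB' : B'.Axioms) {b : B.carrier} {b' : B'.carrier} :
    (B.tensor B').f (some (b, b')) = none ↔
      B.FinStr b ∧ B'.FinStr b' ∧ 0 ≤ B.φ b ∧ B.φ b ≤ B'.ε b' ∧ B'.φ b' = 0 :=
  tensorF_eq_none_iff hB hB'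

theorem tensor_e_eq_some (hB : B.Axioms) (hB' : B'.Axioms) {b c : B.carrier}
    {b' c' : B'.carrier} : (B.tensor B').e (some (b, b')) = some (c, c') ↔
      ((B.φ b < -1 ∨ B'.ψ b' ≤ B.φ b) ∧ B.f (some c) = some b ∧ b' = c') ∨
      (0 ≤ B.φ b ∧ B.φ b < B'.ψ b' ∧ b = c ∧ B'.e (some b') = some c') ∨
      (B.φ b = -1 ∧ B'.FinStr b' ∧
        ∃ n : ℕ, (n : ℤ) = B'.φ b' ∧ B.Down (n + 1) c b ∧ B'.Down n b' c') ∨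
      (∃ z, B.Branch b z ∧ ¬ B'.Up b' ∧
        ∃ n : ℕ, (n : ℤ) = B'.φ b' ∧ B.Down n c z ∧ B'.Down n b' c') ∨
      (B.φ b < 0 ∧ (B.φ b = -1 ∨ B.ε b = 0) ∧
        ∃ n : ℕ, B.φ b - B.ε b + B'.φ b' - B'.ε b' + 2 + n = 0 ∧
          B.Down n b c ∧ B'.Down (n + 1) c' b') :=
  tensorE_eq_some_iff hB hB'

variable (hB : B.Axioms) (hB' : B'.Axioms)
include hB hB'

theorem tensor_e_f {x y : B.carrier × B'.carrier} (h : (B.tensor B').f (some x) = some y) :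
    (B.tensor B').e (some y) = some x := by
  obtain ⟨b, b'⟩ := x
  obtain ⟨c, c'⟩ := y
  replace h := (tensor_f_eq_some hB').mp h
  refine (tensor_e_eq_some hB hB').mpr ?_
  have := hB'.ε_nonneg b'
  rcases h with ⟨h, h1, rfl⟩ | ⟨h, h1, rfl, h2⟩ | ⟨h, h1, h2, n, hn, h3, h4⟩
  · have := hB.φ_f h1
    exact Or.inl ⟨by omega, h1, rfl⟩
  · have := hB'.φ_f h2; have := hB'.ε_f h2
    refine Or.inr (Or.inl ⟨h, ?_, rfl, hB'.e_f h2⟩)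
    rw [ψ_def] at *
    omega
  · have := hB.down_φ h3; have := hB'.down_φ h4; have := hB'.φ_bottom h2
    refine Or.inr (Or.inr (Or.inl ⟨by push_cast at *; omega, ?_, n, by omega, h3, h4⟩))
    exact (hB'.down_fin h4).mpr ⟨1, h2⟩

theorem tensor_wt_e {x y : B.carrier × B'.carrier} (h : (B.tensor B').e (some x) = some y) :
    (B.tensor B').wt y = (B.tensor B').wt x + 2 := by
  obtain ⟨b, b'⟩ := x
  obtain ⟨c, c'⟩ := y
  replace h := (tensor_e_eq_some hB hB').mp h
  change B.wt c + B'.wt c' = B.wt b + B'.wt b' + 2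
  have h1 := hB.φ_eq b
  have h2 := hB'.φ_eq b'
  have h3 := hB.φ_eq c
  have h4 := hB'.φ_eq c'
  rcases h with ⟨-, h, rfl⟩ | ⟨-, -, rfl, h⟩ | ⟨-, -, n, -, h, h'⟩ | ⟨z, hz, -, n, -, h, h'⟩ |
    ⟨-, -, n, -, h, h'⟩
  · have := hB.wt_f h; omega
  · have := hB'.wt_e h; omega
  · have := hB.down_φ h; have := hB.down_ε h; have := hB'.down_φ h'; have := hB'.down_ε h'
    push_cast at *; omega
  · have := hB.down_φ h; have := hB.down_ε h; have := hB'.down_φ h'; have := hB'.down_ε h'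
    have := hB.wt_e hz.1; have := hB.φ_eq z
    omega
  · have := hB.down_φ h; have := hB.down_ε h; have := hB'.down_φ h'; have := hB'.down_ε h'
    push_cast at *; omega

omit hB hB' in
theorem tensor_ε_top {x : B.carrier × B'.carrier}
    (h : (B.tensor B').f ((B.tensor B').e (some x)) ≠ some x) : (B.tensor B').ε x = 0 := by
  change tensorε B B' x = 0
  unfold tensorε
  rw [Nat.cast_eq_zero, Nat.sInf_eq_zero]
  exact Or.inl h

/-- Each step up a string of the tensor product lowers `ε(b) + ε(b')` by one. -/
theorem tensor_ε_set_nonempty (x : B.carrier × B'.carrier) :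
    {s : ℕ | tensorF₀ B B' ((tensorE₀ B B')^[s + 1] (some x)) ≠
      (tensorE₀ B B')^[s] (some x)}.Nonempty := by
  obtain ⟨n, hn⟩ : ∃ n : ℕ, B.ε x.1 + B'.ε x.2 < n :=
    ⟨(B.ε x.1 + B'.ε x.2 + 1).toNat, by omega⟩
  induction n generalizing x with
  | zero => have := hB.ε_nonneg x.1; have := hB'.ε_nonneg x.2; push_cast at hn; omega
  | succ n ih =>
    by_cases h : (B.tensor B').f ((B.tensor B').e (some x)) = some x
    · cases hy : (B.tensor B').e (some x) with
      | none => rw [hy] at h; simp [tensor, tensorF₀] at h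
      | some y =>
        rw [hy] at h
        have hy' : B.ε y.1 + B'.ε y.2 < n := by
          obtain ⟨b, b'⟩ := y
          obtain ⟨c, c'⟩ := x
          replace h := (tensor_f_eq_some hB').mp h
          dsimp only at hn ⊢
          rcases h with ⟨h, h1, rfl⟩ | ⟨h, h1, rfl, h2⟩ | ⟨h, h1, h2, n, hn, h3, h4⟩
          · have := hB.ε_f h1; push_cast at hn; omega
          · have := hB'.ε_f h2; push_cast at hn; omega
          · have := hB.down_ε h3; have := hB'.down_ε h4
            push_cast at *; omega
        obtain ⟨s, hs⟩ := ih y hy'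
        refine ⟨s + 1, ?_⟩
        simp only [Set.mem_ofPred_eq] at hs ⊢
        rw [Function.iterate_succ_apply, Function.iterate_succ_apply (n := s)]
        change (B.tensor B').f ((B.tensor B').e^[s + 1] ((B.tensor B').e (some x))) ≠
          (B.tensor B').e^[s] ((B.tensor B').e (some x))
        rw [hy]
        exact hs
    · exact ⟨0, h⟩

theorem tensor_ε_f {x y : B.carrier × B'.carrier} (h : (B.tensor B').f (some x) = some y) :
    (B.tensor B').ε y = (B.tensor B').ε x + 1 := by
  have he := tensor_e_f hB hB' h
  change tensorε B B' y = tensorε B B' x + 1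
  unfold tensorε
  have key : ∀ n : ℕ, (tensorE₀ B B')^[n + 1] (some y) = (tensorE₀ B B')^[n] (some x) := by
    intro n
    rw [Function.iterate_succ_apply]
    exact congrArg _ he
  have hx := tensor_ε_set_nonempty hB hB' x
  set S := {s : ℕ | tensorF₀ B B' ((tensorE₀ B B')^[s + 1] (some x)) ≠
      (tensorE₀ B B')^[s] (some x)} with hS
  have h1 : ∀ s, s + 1 ∈ {s : ℕ | tensorF₀ B B' ((tensorE₀ B B')^[s + 1] (some y)) ≠
      (tensorE₀ B B')^[s] (some y)} ↔ s ∈ S := by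
    intro s
    rw [hS]
    simp only [Set.mem_ofPred_eq]
    rw [key, key]
  have h0 : 0 ∉ {s : ℕ | tensorF₀ B B' ((tensorE₀ B B')^[s + 1] (some y)) ≠
      (tensorE₀ B B')^[s] (some y)} := by
    simp only [Set.mem_ofPred_eq, not_not]
    rw [key]
    exact h
  have : IsLeast {s : ℕ | tensorF₀ B B' ((tensorE₀ B B')^[s + 1] (some y)) ≠
      (tensorE₀ B B')^[s] (some y)} (sInf S + 1) := by
    refine ⟨(h1 _).mpr (Nat.sInf_mem hx), fun s hs => ?_⟩
    cases s with
    | zero => exact absurd hs h0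
    | succ s => have := Nat.sInf_le ((h1 s).mp hs); omega
  rw [← this.csInf_eq.symm]
  push_cast
  rfl

omit hB hB' in
/-- An element without a predecessor under `f̃` has `ε = 0`. -/
theorem tensor_ε_of_top {x : B.carrier × B'.carrier}
    (h : ∀ y, (B.tensor B').f (some y) ≠ some x) : (B.tensor B').ε x = 0 := by
  apply tensor_ε_top
  intro hx
  cases hy : (B.tensor B').e (some x) with
  | none => rw [hy] at hx; simp [tensor, tensorF₀] at hx
  | some y => exact h y (hy ▸ hx)

theorem tensor_φ {b : B.carrier} {b' : B'.carrier} : (B.tensor B').φ (b, b') =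
    B.φ b - B.ε b + B'.φ b' - B'.ε b' + (B.tensor B').ε (b, b') := by
  have h1 := hB.φ_eq b
  have h2 := hB'.φ_eq b'
  have : (B.tensor B').φ (b, b') = B.wt b + B'.wt b' + (B.tensor B').ε (b, b') := rfl
  omega

/-- In the region `ψ(b') ≤ φ(b)` the strings move the first factor. -/
theorem tensor_ε_left {b : B.carrier} {b' : B'.carrier} (h : B'.ψ b' ≤ B.φ b) :
    (B.tensor B').ε (b, b') = B.ε b := by
  have h0 := hB'.ε_nonneg b'
  obtain ⟨n, hn⟩ := Int.eq_ofNat_of_zero_le (hB.ε_nonneg b)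
  induction n generalizing b with
  | zero =>
    rw [hn]
    apply tensor_ε_of_top
    rintro ⟨c, c'⟩ hc
    replace hc := (tensor_f_eq_some hB').mp hc
    simp only [Nat.cast_zero] at hn
    rcases hc with ⟨h, h1, rfl⟩ | ⟨h, h1, rfl, h2⟩ | ⟨h, h1, h2, n, hn, h3, h4⟩
    · have := hB.ε_f h1; have := hB.ε_nonneg c; omega
    · have := hB'.φ_f h2; have := hB'.ε_f h2
      rw [ψ_def] at *; omega
    · have := hB.down_φ h3
      rw [ψ_def] at *; push_cast at *; omega
  | succ n ih =>
    obtain ⟨c, hc⟩ := hB.exists_f_of_ε_pos (c := b) (by omega)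
    have := hB.φ_f hc; have := hB.ε_f hc
    have h1 := ih (b := c) (by omega) (by push_cast at hn; omega)
    have h2 : (B.tensor B').f (some (c, b')) = some (b, b') := by
      refine (tensor_f_eq_some hB').mpr ?_
      exact Or.inl ⟨by omega, hc, rfl⟩
    rw [tensor_ε_f hB hB' h2, h1]; omega

/-- In the region `0 ≤ φ(b) ≤ ε(b')`, `-1 ≤ φ(b')` the strings have the classical hook shape. -/
theorem tensor_ε_hook {b : B.carrier} {b' : B'.carrier} (h0 : 0 ≤ B.φ b) (h1 : B.φ b ≤ B'.ε b')
    (h2 : -1 ≤ B'.φ b') : (B.tensor B').ε (b, b') = B'.ε b' - B.φ b + B.ε b := by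
  obtain ⟨n, hn⟩ := Int.eq_ofNat_of_zero_le (show 0 ≤ B'.ε b' - B.φ b by omega)
  induction n generalizing b' with
  | zero =>
    rw [tensor_ε_left hB hB' (by rw [ψ_def]; simp at hn; omega)]
    simp at hn; omega
  | succ n ih =>
    obtain ⟨c', hc⟩ := hB'.exists_f_of_ε_pos (c := b') (by omega)
    have := hB'.φ_f hc; have := hB'.ε_f hc
    have h3 := ih (b' := c') (by push_cast at hn; omega) (by omega)
      (by push_cast at hn; omega)
    have h4 : (B.tensor B').f (some (b, c')) = some (b, b') := by
      refine (tensor_f_eq_some hB').mpr ?_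
      refine Or.inr (Or.inl ⟨h0, ?_, rfl, hc⟩)
      rw [ψ_def]; push_cast at hn; omega
    rw [tensor_ε_f hB hB' h4, h3]; omega

theorem tensor_ε_down {n : ℕ} {b c : B.carrier} {b' : B'.carrier} (h : B.Down n b c)
    (hb : B.φ b < 0) : (B.tensor B').ε (c, b') = (B.tensor B').ε (b, b') + n := by
  induction n generalizing c with
  | zero => rw [down_zero] at h; simp [h]
  | succ n ih =>
    obtain ⟨d, hd, h⟩ := hB.down_succ.mp h
    have h1 : (B.tensor B').f (some (d, b')) = some (c, b') := by
      refine (tensor_f_eq_some hB').mpr ?_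
      have := hB.down_φ hd
      exact Or.inl ⟨by omega, h, rfl⟩
    rw [tensor_ε_f hB hB' h1, ih hd]; push_cast; omega

/-- The tops of strings of a tensor product with `φ(b) < 0`. -/
theorem tensor_ε_edge {b : B.carrier} {b' : B'.carrier} (h : B.φ b < 0)
    (h1 : B.φ b = -1 ∨ B.ε b = 0) (h2 : B.φ b = -1 → B'.FinStr b' → B.ε b ≤ B'.φ b') :
    (B.tensor B').ε (b, b') = 0 := by
  apply tensor_ε_of_top
  rintro ⟨c, c'⟩ hc
  replace hc := (tensor_f_eq_some hB').mp hc
  rcases hc with ⟨h, h1, rfl⟩ | ⟨h, h1, rfl, h2⟩ | ⟨h, h1, h2', n, hn, h3, h4⟩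
  · have := hB.φ_f h1; have := hB.ε_f h1; have := hB.ε_nonneg c
    have := hB'.ε_nonneg c'
    rw [ψ_def] at *; omega
  · omega
  · have := hB.down_φ h3; have := hB.down_ε h3; have := hB.ε_nonneg c
    have := hB'.down_φ h4; have := hB'.φ_bottom h2'
    have := h2 (by push_cast at *; omega) ((hB'.down_fin h4).mpr ⟨1, h2'⟩)
    push_cast at *; omega

/-- An element with `φ(b) = -1` below a finite string of the second factor is reached by the case
`f̃^(φ+1) ⊗ ẽ^φ` of the tensor product, so that it is not the top of its string. -/
theorem tensor_ε_edge_fin {b : B.carrier} {b' : B'.carrier} (h : B.φ b = -1)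
    (h' : B'.FinStr b') (h1 : B'.φ b' < B.ε b) :
    (B.tensor B').ε (b, b') = B.ε b + B'.ε b' - B'.φ b' := by
  obtain ⟨n, hn⟩ := Int.eq_ofNat_of_zero_le (hB'.fin_φ h')
  obtain ⟨c, hc⟩ := hB.exists_down_of_le (n := n + 1) (c := b) (by push_cast; omega)
  obtain ⟨c', hc'⟩ := hB'.exists_down (n := n) (b := b') (by omega)
  have := hB.down_φ hc; have := hB'.down_φ hc'
  have := hB.down_ε hc; have := hB'.down_ε hc'
  have := hB'.ε_nonneg b'
  have h2 : (B.tensor B').f (some (c, c')) = some (b, b') := by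
    refine (tensor_f_eq_some hB').mpr ?_
    refine Or.inr (Or.inr ⟨by push_cast at *; omega, by push_cast at *; omega, ?_, n,
      by push_cast at *; omega, hc, hc'⟩)
    rw [hB'.f_none_iff]
    exact ⟨(hB'.down_fin hc').mp h', by omega⟩
  rw [tensor_ε_f hB hB' h2, tensor_ε_hook hB hB']
  all_goals push_cast at *; omega

/-- The four kinds of branch points of a tensor product. -/
theorem tensor_branch_cases {b c : B.carrier} {b' c' : B'.carrier}
    (h : (B.tensor B').Branch (b, b') (c, c')) :
    (b = c ∧ 0 ≤ B.φ c ∧ B.φ c ≤ B'.ε c' ∧ B'.Branch b' c') ∨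
    (b = c ∧ 0 ≤ B.φ c ∧ B'.φ c' < 0 ∧ B'.ε c' - B'.φ c' = B.φ c ∧ B'.f (some c') = some b') ∨
    (∃ z, B.Branch b z ∧ ¬ B'.Up c' ∧ B'.φ c' = 0 ∧
        ∃ n : ℕ, (n : ℤ) = B.φ c ∧ B.φ c ≤ B'.ε c' ∧ B.Down n c z ∧ B'.Down n b' c') ∨
    (B.φ b < 0 ∧ (B.φ b = -1 ∨ B.ε b = 0) ∧
        ∃ n : ℕ, B.φ c - B.ε c + B'.φ c' - B'.ε c' + n = 0 ∧
          B.Down n b c ∧ B'.Down (n + 1) c' b') := by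
  obtain ⟨h, hn⟩ := h
  replace h := (tensor_e_eq_some hB hB').mp h
  replace hn := fun hh => hn ((tensor_f_eq_some hB').mpr hh)
  have hε := hB'.ε_nonneg b'
  have hε1 := hB'.ε_nonneg c'
  rcases h with ⟨h, h1, rfl⟩ | ⟨h, h1, rfl, h2⟩ | ⟨h, h1, n, h2, h3, h4⟩ |
    ⟨z, hz, h1, n, h2, h3, h4⟩ | ⟨h, h1, n, h2, h3, h4⟩
  · have := hB.φ_f h1
    exact absurd (Or.inl ⟨by omega, h1, rfl⟩) hn
  · rcases hB'.e_cases.mp h2 with h3 | h3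
    · have := hB'.φ_f h3; have := hB'.ε_f h3
      by_cases h4 : B.φ b ≤ B'.ψ c'
      · exact absurd (Or.inr (Or.inl ⟨h, h4, rfl, h3⟩)) hn
      · refine Or.inr (Or.inl ⟨rfl, h, ?_, ?_, h3⟩)
        all_goals rw [ψ_def] at *; omega
    · have := hB'.branch_φ h3; have := hB'.branch_ε h3
      refine Or.inl ⟨rfl, h, ?_, h3⟩
      rw [ψ_def] at *; omega
  · have := hB.down_φ h3; have := hB'.down_φ h4
    have := hB.down_ε h3; have := hB'.down_ε h4
    refine absurd (Or.inr (Or.inr ⟨by push_cast at *; omega, by push_cast at *; omega, ?_, n,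
      by push_cast at *; omega, h3, h4⟩)) hn
    rw [hB'.f_none_iff]
    exact ⟨(hB'.down_fin h4).mp h1, by omega⟩
  · have := hB.down_φ h3; have := hB'.down_φ h4; have := hB'.down_ε h4; have := hB.φ_branch hz
    refine Or.inr (Or.inr (Or.inl ⟨z, hz, ?_, by omega, n, by omega, by omega, h3, h4⟩))
    rwa [← hB'.down_up h4 (by omega)]
  · have := hB.down_φ h3; have := hB'.down_φ h4
    have := hB.down_ε h3; have := hB'.down_ε h4
    exact Or.inr (Or.inr (Or.inr ⟨h, h1, n, by push_cast at *; omega, h3, h4⟩))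

theorem tensor : (B.tensor B').Axioms where
  e_zero := rfl
  f_zero := rfl
  wt_e := fun h => tensor_wt_e hB hB' h
  e_f := fun h => tensor_e_f hB hB' h
  branch_inj := by
    rintro ⟨a, a'⟩ ⟨b, b'⟩ ⟨z, z'⟩ ha hb
    have h1 := tensor_branch_cases hB hB' ha
    have h2 := tensor_branch_cases hB hB' hb
    rcases h1 with ⟨rfl, h1, h2', h3⟩ | ⟨rfl, h1, h2', h2'', h3⟩ |
        ⟨w, hw, h1, h2', n, hn, h2'', h3, h4⟩ | ⟨h1, h2', n, hn, h3, h4⟩ <;>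
      rcases h2 with ⟨rfl, k1, k2', k3⟩ | ⟨rfl, k1, k2', k2'', k3⟩ |
        ⟨x, kw, k1, k2', m, km, k2'', k3, k4⟩ | ⟨k1, k2', m, km, k3, k4⟩
    · rw [hB'.branch_inj h3 k3]
    · have := hB'.φ_branch h3; omega
    · exact absurd (branch_up h3) k1
    · have := hB.down_φ k3; omega
    · have := hB'.φ_branch k3; omega
    · rw [Option.some_injective _ (h3.symm.trans k3)]
    · omega
    · have := hB.down_φ k3; omega
    · exact absurd (branch_up k3) h1
    · omega
    · obtain rfl : m = n := by omega
      obtain rfl := down_fun h3 k3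
      rw [hB.branch_inj hw kw, hB'.down_inj h4 k4]
    · have := hB.down_φ k3; omega
    · have := hB.down_φ h3; omega
    · have := hB.down_φ h3; omega
    · have := hB.down_φ h3; omega
    · obtain rfl : m = n := by omega
      rw [hB.down_inj h3 k3, down_fun h4 k4]
  ε_nonneg := fun x => Int.natCast_nonneg _
  ε_top := fun h => tensor_ε_top h
  ε_f := fun h => tensor_ε_f hB hB' h
  φ_eq := fun _ => rfl
  φ_bottom := by
    rintro ⟨b, b'⟩ h
    replace h := (tensor_f_eq_none hB hB').mp h
    obtain ⟨-, -, h1, h2, h3⟩ := h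
    rw [tensor_φ hB hB', tensor_ε_hook hB hB' h1 h2 (by omega)]
    omega
  φ_branch := by
    rintro ⟨b, b'⟩ ⟨c, c'⟩ h
    rw [tensor_φ hB hB']
    rcases tensor_branch_cases hB hB' h with ⟨rfl, h1, h2', h3⟩ | ⟨rfl, h1, h2', h2'', h3⟩ |
        ⟨w, hw, h1, h2', n, hn, h2'', h3, h4⟩ | ⟨h1, h2', n, hn, h3, h4⟩
    · have := hB'.φ_branch h3
      rw [tensor_ε_hook hB hB' h1 h2' (by omega)]
      omega
    · have := hB'.ε_nonneg c'
      rw [tensor_ε_left hB hB' (by rw [ψ_def]; omega)]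
      omega
    · rw [tensor_ε_hook hB hB' (by omega) h2'' (by omega)]
      omega
    · have := hB.down_φ h3; have := hB'.down_φ h4
      have := hB.down_ε h3; have := hB'.down_ε h4
      have := hB'.ε_nonneg b'
      rw [tensor_ε_down hB hB' h3 h1, tensor_ε_edge hB hB' h1 h2']
      · omega
      · intro h5 _
        push_cast at *; omega

/-! ### Finite strings and positive elements of a tensor product -/

theorem tensor_φ_nonneg {b : B.carrier} {b' : B'.carrier} (h : 0 ≤ B.φ b) (h' : 0 ≤ B'.φ b') :
    0 ≤ (B.tensor B').φ (b, b') := by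
  rw [tensor_φ hB hB']
  by_cases h1 : B.φ b ≤ B'.ε b'
  · rw [tensor_ε_hook hB hB' h h1 (by omega)]; omega
  · have := hB'.ε_nonneg b'
    rw [tensor_ε_left hB hB' (by rw [ψ_def]; omega)]; omega

theorem tensor_f_fin {b c : B.carrier} {b' c' : B'.carrier}
    (h : (B.tensor B').f (some (b, b')) = some (c, c')) :
    (B.FinStr b ∧ B'.FinStr b') ↔ (B.FinStr c ∧ B'.FinStr c') := by
  replace h := (tensor_f_eq_some hB').mp h
  rcases h with ⟨h, h1, rfl⟩ | ⟨h, h1, rfl, h2⟩ | ⟨h, h1, h2, n, hn, h3, h4⟩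
  · rw [hB.f_fin h1]
  · rw [hB'.f_fin h2]
  · rw [hB.down_fin h3, hB'.down_fin h4]

/-- A string of a tensor product is finite if and only if it comes from two finite strings. -/
theorem tensor_finStr {b : B.carrier} {b' : B'.carrier} :
    (B.tensor B').FinStr (b, b') ↔ B.FinStr b ∧ B'.FinStr b' := by
  have hT := tensor hB hB'
  constructor
  · rintro ⟨n, hn⟩
    induction n generalizing b b' with
    | zero => simp at hn
    | succ n ih =>
      rw [Function.iterate_succ_apply] at hn
      cases hc : (B.tensor B').f (some (b, b')) with
      | none =>
        replace hc := (tensor_f_eq_none hB hB').mp hc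
        exact ⟨hc.1, hc.2.1⟩
      | some y =>
        obtain ⟨c, c'⟩ := y
        rw [hc] at hn
        exact (tensor_f_fin hB hB' hc).mpr (ih hn)
  · intro h
    obtain ⟨n, hn⟩ := Int.eq_ofNat_of_zero_le
      (tensor_φ_nonneg hB hB' (hB.fin_φ h.1) (hB'.fin_φ h.2))
    induction n generalizing b b' with
    | zero =>
      cases hc : (B.tensor B').f (some (b, b')) with
      | none => exact ⟨1, hc⟩
      | some y =>
        obtain ⟨c, c'⟩ := y
        have h1 := (tensor_f_fin hB hB' hc).mp h
        have h2 := tensor_φ_nonneg hB hB' (hB.fin_φ h1.1) (hB'.fin_φ h1.2)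
        have := hT.φ_f hc
        simp at hn; omega
    | succ n ih =>
      cases hc : (B.tensor B').f (some (b, b')) with
      | none => exact ⟨1, hc⟩
      | some y =>
        obtain ⟨c, c'⟩ := y
        have h1 := (tensor_f_fin hB hB' hc).mp h
        have := hT.φ_f hc
        rw [hT.f_fin hc]
        exact ih h1 (by push_cast at hn; omega)

/-- The value `φ(b ⊗ b') = 0`, over which branch points lie, does not occur in the region
`0 ≤ φ(b) < ψ(b')`, `φ(b') < 0`. -/
theorem tensor_φ_neg {b : B.carrier} {b' : B'.carrier} (h : 0 ≤ B.φ b) (h' : B'.φ b' < 0)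
    (h1 : B.φ b < B'.ψ b') : (B.tensor B').φ (b, b') < 0 := by
  have hT := tensor hB hB'
  obtain ⟨n, hn⟩ := Int.eq_ofNat_of_zero_le (hB'.ε_nonneg b')
  induction n generalizing b' with
  | zero =>
    simp at hn
    rw [tensor_φ hB hB', tensor_ε_of_top]
    · rw [ψ_def] at *; have := hB.ε_nonneg b; omega
    · rintro ⟨c, c'⟩ hc
      replace hc := (tensor_f_eq_some hB').mp hc
      rcases hc with ⟨h, h0, rfl⟩ | ⟨h, h0, rfl, h2⟩ | ⟨h, h0, h2, n, hn, h3, h4⟩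
      · have := hB.φ_f h0; omega
      · have := hB'.ε_f h2; have := hB'.ε_nonneg c'; omega
      · have := hB.down_φ h3; push_cast at *; omega
  | succ n ih =>
    by_cases htop : ∀ y, (B.tensor B').f (some y) ≠ some (b, b')
    · rw [tensor_φ hB hB', tensor_ε_of_top htop]
      rw [ψ_def] at *; have := hB.ε_nonneg b; omega
    · push Not at htop
      obtain ⟨⟨c, c'⟩, hc⟩ := htop
      have hφ := hT.φ_f hc
      replace hc := (tensor_f_eq_some hB').mp hc
      rcases hc with ⟨h2, h3, rfl⟩ | ⟨h2, h3, rfl, h4⟩ | ⟨h2, h3, h4, m, hm, h5, h6⟩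
      · have := hB.φ_f h3; omega
      · have h5 := hB'.φ_f h4; have h6 := hB'.ε_f h4
        have h7 := hB'.ε_nonneg c'
        by_cases h8 : B'.ψ c' ≤ B.φ c
        · rw [hφ, tensor_φ hB hB', tensor_ε_left hB hB' h8]
          rw [ψ_def] at *; omega
        · by_cases h9 : B'.φ c' < 0
          · have := ih (b' := c') h9 (by omega) (by
              push_cast at hn; omega)
            omega
          · rw [hφ, tensor_φ hB hB', tensor_ε_hook hB hB' h2 (by rw [ψ_def] at *; omega)
              (by omega)]
            rw [ψ_def] at *; omega
      · have := hB.down_φ h5; push_cast at *; omega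

/-- In a tensor product, a branch point lies over an element with `φ = 0` unless both factors
are positive. -/
theorem tensor_exists_branch {b : B.carrier} {b' : B'.carrier}
    (h : (B.tensor B').φ (b, b') = 0) (hQ : ¬ (B.Pos b ∧ B'.Pos b')) :
    ∃ y, (B.tensor B').Branch y (b, b') := by
  have hε := hB.ε_nonneg b
  have hε' := hB'.ε_nonneg b'
  by_cases h1 : B.φ b < 0
  · -- Climb from `b` to the first element with `φ = -1` or to the top of the string.
    obtain ⟨n, hn⟩ := Int.eq_ofNat_of_zero_le (show 0 ≤ min (B.ε b) (-1 - B.φ b) by omega)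
    obtain ⟨c, hc⟩ := hB.exists_down_of_le (n := n) (c := b) (by omega)
    have h2 := hB.down_φ hc; have h3 := hB.down_ε hc
    have h4 := tensor_ε_down hB hB' (b' := b') hc (by omega)
    have h5 := tensor_φ hB hB' (b := b) (b' := b')
    by_cases h6 : B.φ c = -1 ∧ B'.FinStr b' ∧ B'.φ b' < B.ε c
    · have := tensor_ε_edge_fin hB hB' h6.1 h6.2.1 h6.2.2
      omega
    · have h7 := tensor_ε_edge hB hB' (b := c) (b' := b') (by omega) (by omega)
        (fun h8 h9 => by by_contra h10; exact h6 ⟨h8, h9, by omega⟩)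
      obtain ⟨c', hc'⟩ := hB'.exists_down (n := n + 1) (b := b') (by intro; push_cast; omega)
      have h8 := hB'.down_φ hc'; have h9 := hB'.down_ε hc'
      refine ⟨(c, c'), ?_, ?_⟩
      · refine (tensor_e_eq_some hB hB').mpr ?_
        refine Or.inr (Or.inr (Or.inr (Or.inr ⟨by omega, by omega, n, ?_, hc, hc'⟩)))
        push_cast at *; omega
      · refine fun hh => absurd ((tensor_f_eq_some hB').mp hh) ?_
        rintro (⟨-, -, rfl⟩ | h | h)
        · push_cast at *; omega
        · omega
        · omega
  by_cases h2 : B'.φ b' < 0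
  · -- Here `φ(b) = ψ(b')`, and the branch point is `b ⊗ f̃ b'`.
    by_cases h3 : B.φ b < B'.ψ b'
    · have := tensor_φ_neg hB hB' (by omega) h2 h3; omega
    · rw [tensor_φ hB hB', tensor_ε_left hB hB' (by omega)] at h
      obtain ⟨c', hc'⟩ := hB'.exists_down (n := 1) (b := b') (fun hf => by
        have := hB'.fin_φ hf; omega)
      rw [down_one] at hc'
      have := hB'.φ_f hc'; have := hB'.ε_f hc'
      refine ⟨(b, c'), ?_, ?_⟩
      · refine (tensor_e_eq_some hB hB').mpr ?_
        refine Or.inr (Or.inl ⟨by omega, ?_, rfl, hB'.e_f hc'⟩)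
        rw [ψ_def]; omega
      · refine fun hh => absurd ((tensor_f_eq_some hB').mp hh) ?_
        rintro (⟨-, -, rfl⟩ | h' | h')
        · omega
        · rw [ψ_def] at *; omega
        · omega
  have h3 : B'.φ b' = 0 ∧ B.φ b ≤ B'.ε b' := by
    by_cases h4 : B.φ b ≤ B'.ε b'
    · rw [tensor_φ hB hB', tensor_ε_hook hB hB' (by omega) h4 (by omega)] at h; omega
    · rw [tensor_φ hB hB', tensor_ε_left hB hB' (by rw [ψ_def]; omega)] at h; omega
  by_cases h4 : B'.Up b'
  · -- A branch point `a'` over `b'` gives the branch point `b ⊗ a'`.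
    obtain ⟨a', ha'⟩ := (hB'.up_iff_of_φ_eq_zero h3.1).mp h4
    have h5 := hB'.branch_φ ha'; have h6 := hB'.branch_ε ha'
    refine ⟨(b, a'), ?_, ?_⟩
    · refine (tensor_e_eq_some hB hB').mpr ?_
      refine Or.inr (Or.inl ⟨by omega, ?_, rfl, ha'.1⟩)
      rw [ψ_def]; omega
    · refine fun hh => absurd ((tensor_f_eq_some hB').mp hh) ?_
      rintro (⟨-, -, rfl⟩ | ⟨-, -, -, h7⟩ | ⟨-, -, -, n, -, -, h7⟩)
      · omega
      · exact ha'.2 h7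
      · have := hB'.down_φ h7; omega
  · -- A branch point `a` over `f̃^φ(b) b` gives a branch point in which `a` is the first factor.
    have h5 : B.Up b := by
      by_contra h6
      exact hQ ⟨⟨by omega, h6⟩, ⟨by omega, h4⟩⟩
    obtain ⟨n, hn⟩ := Int.eq_ofNat_of_zero_le (show 0 ≤ B.φ b by omega)
    obtain ⟨z, hz⟩ := hB.exists_down (n := n) (b := b) (by omega)
    have h6 := hB.down_φ hz
    obtain ⟨a, ha⟩ := (hB.up_iff_of_φ_eq_zero (by omega)).mp ((hB.down_up hz (by omega)).mp h5)
    obtain ⟨c', hc'⟩ := hB'.exists_down_of_le (n := n) (c := b') (by omega)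
    have h7 := hB'.down_φ hc'
    have h8 := hB.branch_φ ha; have h9 := hB.ε_nonneg z
    refine ⟨(a, c'), ?_, ?_⟩
    · refine (tensor_e_eq_some hB hB').mpr ?_
      refine Or.inr (Or.inr (Or.inr (Or.inl ⟨z, ha, ?_, n, by omega, hz, hc'⟩)))
      rwa [hB'.down_up hc' (by omega)]
    · refine fun hh => absurd ((tensor_f_eq_some hB').mp hh) ?_
      rintro (⟨-, h', -⟩ | ⟨-, -, rfl, -⟩ | ⟨-, -, -, m, hm, h', -⟩)
      · have := hB.φ_f h'; omega
      · omega
      · have := hB.down_φ h'; push_cast at *; omega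

/-- An element of a tensor product is positive if and only if both of its factors are. -/
theorem tensor_pos {b : B.carrier} {b' : B'.carrier} :
    (B.tensor B').Pos (b, b') ↔ B.Pos b ∧ B'.Pos b' := by
  have hT := tensor hB hB'
  by_cases h : 0 ≤ (B.tensor B').φ (b, b')
  · obtain ⟨n, hn⟩ := Int.eq_ofNat_of_zero_le h
    induction n generalizing b b' with
    | zero =>
      simp only [Nat.cast_zero] at hn
      constructor
      · intro hp
        by_contra hQ
        exact hp.2 ((hT.up_iff_of_φ_eq_zero hn).mpr (tensor_exists_branch hB hB' hn hQ))
      · rintro ⟨h1, h2⟩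
        refine ⟨h, fun hu => ?_⟩
        obtain ⟨⟨a, a'⟩, ha⟩ := (hT.up_iff_of_φ_eq_zero hn).mp hu
        rcases tensor_branch_cases hB hB' ha with ⟨rfl, -, -, h3⟩ | ⟨rfl, -, h2', -, -⟩ |
          ⟨w, hw, -, -, n, hn, -, h3, -⟩ | ⟨h1', -, n, -, h3, -⟩
        · exact h2.2 (branch_up h3)
        · have := h2.1; omega
        · have := hB.φ_branch hw
          exact h1.2 ((hB.down_up h3 (by omega)).mpr (branch_up hw))
        · have := hB.down_φ h3; have := h1.1; omega
    | succ n ih =>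
      cases hc : (B.tensor B').f (some (b, b')) with
      | none => have := hT.φ_bottom hc; omega
      | some y =>
        obtain ⟨c, c'⟩ := y
        have h1 := hT.φ_f hc
        push_cast at hn
        refine (hT.pos_f_iff hc (by omega)).trans
          ((ih (b := c) (b' := c') (by omega) (by omega)).trans ?_)
        replace hc := (tensor_f_eq_some hB').mp hc
        rcases hc with ⟨h2, h3, rfl⟩ | ⟨h2, h3, rfl, h4⟩ | ⟨h2, h3, h4, m, hm, h5, h6⟩
        · constructor
          · rintro ⟨h4, h5⟩; exact ⟨hB.pos_of_pos h3 h4, h5⟩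
          · rintro ⟨h4, h5⟩
            have := h4.1; have := hB.φ_f h3; have := hB'.ε_nonneg b'
            exact ⟨(hB.pos_f_iff h3 (by rw [ψ_def] at *; omega)).mp h4, h5⟩
        · constructor
          · rintro ⟨h4', h5⟩; exact ⟨h4', hB'.pos_of_pos h4 h5⟩
          · rintro ⟨h4', h5⟩
            have h6 := h5.1
            have h7 := hB'.φ_f h4
            have := hB'.ε_nonneg b'
            rw [tensor_φ hB hB', tensor_ε_hook hB hB' h2 (by rw [ψ_def] at *; omega)
              (by omega)] at hn
            exact ⟨h4', (hB'.pos_f_iff h4 (by omega)).mp h5⟩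
        · have h7 := hB'.φ_bottom h4
          rw [tensor_φ hB hB', tensor_ε_hook hB hB' h2 h3 (by omega)] at hn
          omega
  · constructor
    · intro hp; exact absurd hp.1 h
    · rintro ⟨h1, h2⟩; exact absurd (tensor_φ_nonneg hB hB' h1.1 h2.1) h

end Tensor

end Axioms

end CrystalData

namespace CrystalData

/-! ### Strict maps, embeddings and direct sums -/

/-- A map of the underlying sets that preserves all the data of a crystal. -/
structure StrictMap (X : CrystalData.{u}) (Y : CrystalData.{v}) (i : X.carrier → Y.carrier) :
    Prop where
  map_f : ∀ x, Y.f (x.map i) = (X.f x).map i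
  map_e : ∀ x, Y.e (x.map i) = (X.e x).map i
  map_wt : ∀ b, Y.wt (i b) = X.wt b
  map_ε : ∀ b, Y.ε (i b) = X.ε b
  map_φ : ∀ b, Y.φ (i b) = X.φ b

/-- An injective strict map whose image is a union of connected components. -/
structure Embedding (X : CrystalData.{u}) (Y : CrystalData.{v}) (i : X.carrier → Y.carrier) :
    Prop extends StrictMap X Y i where
  inj : Function.Injective i
  closed : ∀ {a b}, Y.e (some a) = some (i b) → a ∈ Set.range i

/-- `X` and `Y` are related by a bijective strict map. -/
def Equivalent (X : CrystalData.{u}) (Y : CrystalData.{v}) : Prop :=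
  ∃ g : X.carrier ≃ Y.carrier, StrictMap X Y g

namespace StrictMap

variable {X : CrystalData.{u}} {Y : CrystalData.{v}} {i : X.carrier → Y.carrier}

theorem map_f_iter (h : StrictMap X Y i) (n : ℕ) (x) : Y.f^[n] (x.map i) = (X.f^[n] x).map i := by
  induction n generalizing x with
  | zero => rfl
  | succ n ih => rw [Function.iterate_succ_apply, Function.iterate_succ_apply, h.map_f, ih]

theorem map_e_iter (h : StrictMap X Y i) (n : ℕ) (x) : Y.e^[n] (x.map i) = (X.e^[n] x).map i := by
  induction n generalizing x with
  | zero => rfl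
  | succ n ih => rw [Function.iterate_succ_apply, Function.iterate_succ_apply, h.map_e, ih]

theorem map_ψ (h : StrictMap X Y i) (b) : Y.ψ (i b) = X.ψ b := by
  simp only [ψ, h.map_ε, h.map_φ]

theorem finStr_iff (h : StrictMap X Y i) {b} : Y.FinStr (i b) ↔ X.FinStr b := by
  unfold FinStr
  refine exists_congr fun n => ?_
  have := h.map_f_iter n (some b)
  rw [Option.map_some] at this
  rw [this, Option.map_eq_none_iff]

end StrictMap

namespace Embedding

variable {X : CrystalData.{u}} {Y : CrystalData.{v}} {i : X.carrier → Y.carrier}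

theorem isBranchPoint_iff (h : Embedding X Y i) {b} :
    Y.IsBranchPoint (i b) ↔ X.IsBranchPoint b := by
  have he : Y.e (some (i b)) = _ := h.map_e (some b)
  unfold IsBranchPoint
  rw [he, h.map_f]
  simp only [ne_eq, Option.map_eq_none_iff]
  rw [← Option.map_some, (Option.map_injective h.inj).eq_iff]

theorem mem_range_of_iter (h : Embedding X Y i) (h0 : Y.e none = none) {l : ℕ} {a b}
    (hl : some (i b) = Y.e^[l] (some a)) : a ∈ Set.range i := by
  induction l generalizing a with
  | zero => exact ⟨b, by simpa using hl⟩
  | succ l ih =>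
    rw [Function.iterate_succ_apply] at hl
    cases hc : Y.e (some a) with
    | none => rw [hc, Function.iterate_fixed h0] at hl; simp at hl
    | some c =>
      rw [hc] at hl
      obtain ⟨d, rfl⟩ := ih hl
      exact h.closed hc

theorem up_iff (h : Embedding X Y i) (h0 : Y.e none = none) {b} : Y.Up (i b) ↔ X.Up b := by
  constructor
  · rintro ⟨a, ha, l, hl⟩
    obtain ⟨a, rfl⟩ := h.mem_range_of_iter h0 hl
    refine ⟨a, h.isBranchPoint_iff.mp ha, l, Option.map_injective h.inj ?_⟩
    rw [← h.map_e_iter]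
    exact hl
  · rintro ⟨a, ha, l, hl⟩
    refine ⟨i a, h.isBranchPoint_iff.mpr ha, l, ?_⟩
    have := h.map_e_iter l (some a)
    rw [Option.map_some] at this
    rw [this, ← hl]
    rfl

theorem pos_iff (h : Embedding X Y i) (h0 : Y.e none = none) {b} : Y.Pos (i b) ↔ X.Pos b := by
  unfold Pos
  rw [h.map_φ, h.up_iff h0]

end Embedding

theorem pair_map {X X' : Type*} {Y Y' : Type*} (i : X → Y) (i' : X' → Y') (x : Option X)
    (x' : Option X') : pair (x.map i) (x'.map i') = (pair x x').map (Prod.map i i') := by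
  cases x <;> cases x' <;> rfl

section

variable {X : CrystalData.{u}} {Y : CrystalData.{v}} {i : X.carrier → Y.carrier}
  {X' : CrystalData.{u}} {Y' : CrystalData.{v}} {i' : X'.carrier → Y'.carrier}

theorem Embedding.tensorF (h : Embedding X Y i) (h' : Embedding X' Y' i') (b b') :
    CrystalData.tensorF Y Y' (i b) (i' b') =
      (CrystalData.tensorF X X' b b').map (Prod.map i i') := by
  have hf : Y.f (some (i b)) = _ := h.map_f (some b)
  have hf' : Y'.f (some (i' b')) = _ := h'.map_f (some b')
  have hfi : ∀ n, Y.f^[n] (some (i b)) = _ := fun n => h.map_f_iter n (some b)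
  have hei : ∀ n, Y'.e^[n] (some (i' b')) = _ := fun n => h'.map_e_iter n (some b')
  have h1 : F1 Y Y' (i b) (i' b') ↔ F1 X X' b b' := by
    simp only [F1, h.map_φ, h'.map_ψ]
  have h2 : F1' Y Y' (i b) (i' b') ↔ F1' X X' b b' := by
    simp only [F1', h.map_φ, h'.map_ψ, hf', ne_eq, Option.map_eq_none_iff]
  have h3 : F2 Y Y' (i b) (i' b') ↔ F2 X X' b b' := by
    simp only [F2, h.map_φ, h'.map_ψ, hf', Option.map_eq_none_iff]
  unfold CrystalData.tensorF
  classical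
  rw [if_congr h1 rfl (if_congr h2 rfl (if_congr h3 rfl rfl))]
  simp only [hf, hf', h.map_φ, hfi, hei]
  simp only [← Option.map_some, pair_map]
  split_ifs <;> rfl

theorem Embedding.tensorE (h : Embedding X Y i) (h' : Embedding X' Y' i')
    (h0 : Y'.e none = none) (b b') :
    CrystalData.tensorE Y Y' (i b) (i' b') =
      (CrystalData.tensorE X X' b b').map (Prod.map i i') := by
  have he : Y.e (some (i b)) = _ := h.map_e (some b)
  have he' : Y'.e (some (i' b')) = _ := h'.map_e (some b')
  have hfi : ∀ n, Y.f^[n] (some (i b)) = _ := fun n => h.map_f_iter n (some b)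
  have hei : ∀ n, Y.e^[n] (some (i b)) = _ := fun n => h.map_e_iter n (some b)
  have hei' : ∀ n, Y'.e^[n] (some (i' b')) = _ := fun n => h'.map_e_iter n (some b')
  have hfi' : ∀ n, Y'.f^[n] (some (i' b')) = _ := fun n => h'.map_f_iter n (some b')
  have h1 : E1 Y Y' (i b) (i' b') ↔ E1 X X' b b' := by
    simp only [E1, h.map_φ, h'.map_ψ, h.map_wt]
  have h2 : E1' Y Y' (i b) (i' b') ↔ E1' X X' b b' := by
    simp only [E1', h.map_φ, h'.map_ψ]
  have h3 : E2 Y Y' (i b) (i' b') ↔ E2 X X' b b' := by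
    have := h'.up_iff h0 (b := b')
    simp only [Up] at this
    simp only [E2, h.map_φ, h.map_wt, h.map_ε, h'.map_φ, this, hfi', Option.map_eq_none_iff,
      h.isBranchPoint_iff]
  have h4 : E2' Y Y' (i b) (i' b') ↔ E2' X X' b b' := by
    simp only [E2', h.map_φ, h.map_wt, h.map_ε, h'.map_φ, h'.map_ε, he, ne_eq,
      Option.map_eq_none_iff]
  unfold CrystalData.tensorE
  classical
  rw [if_congr h1 rfl (if_congr h2 rfl (if_congr h3 rfl (if_congr h4 rfl rfl)))]
  simp only [he, he', h'.map_φ, hfi, hei, hfi', hei', h.map_wt, h'.map_wt]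
  simp only [← Option.map_some, pair_map]
  split_ifs <;> rfl

theorem Embedding.tensor_strictMap (h : Embedding X Y i) (h' : Embedding X' Y' i')
    (h0 : Y'.e none = none) : StrictMap (X.tensor X') (Y.tensor Y') (Prod.map i i') := by
  have hf : ∀ x, tensorF₀ Y Y' (x.map (Prod.map i i')) =
      (tensorF₀ X X' x).map (Prod.map i i') := by
    rintro (_ | ⟨b, b'⟩)
    · rfl
    · exact h.tensorF h' b b'
  have he : ∀ x, tensorE₀ Y Y' (x.map (Prod.map i i')) =
      (tensorE₀ X X' x).map (Prod.map i i') := by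
    rintro (_ | ⟨b, b'⟩)
    · rfl
    · exact h.tensorE h' h0 b b'
  have hw : ∀ b, (Y.tensor Y').wt (Prod.map i i' b) = (X.tensor X').wt b := by
    rintro ⟨b, b'⟩
    change Y.wt (i b) + Y'.wt (i' b') = X.wt b + X'.wt b'
    rw [h.map_wt, h'.map_wt]
  have hε : ∀ b, (Y.tensor Y').ε (Prod.map i i' b) = (X.tensor X').ε b := by
    intro b
    have hei : ∀ n x, (tensorE₀ Y Y')^[n] (x.map (Prod.map i i')) =
        ((tensorE₀ X X')^[n] x).map (Prod.map i i') := by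
      intro n
      induction n with
      | zero => intro x; rfl
      | succ n ih =>
        intro x
        rw [Function.iterate_succ_apply, Function.iterate_succ_apply, he, ih]
    change tensorε Y Y' (Prod.map i i' b) = tensorε X X' b
    unfold tensorε
    congr 2
    ext s
    simp only [Set.mem_ofPred_eq]
    rw [← Option.map_some (f := Prod.map i i'), hei, hei, hf,
      (Option.map_injective (h.inj.prodMap h'.inj)).ne_iff]
  exact ⟨hf, he, hw, hε, fun b => congrArg₂ (· + ·) (hw b) (hε b)⟩

end

/-! ### Equivalence of crystals -/

namespace Equivalent

variable {X : CrystalData.{u}} {Y : CrystalData.{v}} {Z : CrystalData.{w}}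

theorem refl (X : CrystalData.{u}) : Equivalent X X :=
  ⟨Equiv.refl _, by constructor <;> simp⟩

theorem symm (h : Equivalent X Y) : Equivalent Y X := by
  obtain ⟨g, hg⟩ := h
  have hx : ∀ x : Option Y.carrier, (x.map g.symm).map g = x := by
    intro x; cases x <;> simp
  have hx' : ∀ x : Option X.carrier, (x.map g).map g.symm = x := by
    intro x; cases x <;> simp
  refine ⟨g.symm, fun x => ?_, fun x => ?_, fun b => ?_, fun b => ?_, fun b => ?_⟩
  · rw [← hx' (X.f _), ← hg.map_f, hx]
  · rw [← hx' (X.e _), ← hg.map_e, hx]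
  · rw [← hg.map_wt, Equiv.apply_symm_apply]
  · rw [← hg.map_ε, Equiv.apply_symm_apply]
  · rw [← hg.map_φ, Equiv.apply_symm_apply]

theorem trans (h : Equivalent X Y) (h' : Equivalent Y Z) : Equivalent X Z := by
  obtain ⟨g, hg⟩ := h
  obtain ⟨g', hg'⟩ := h'
  refine ⟨g.trans g', fun x => ?_, fun x => ?_, fun b => ?_, fun b => ?_, fun b => ?_⟩
  · rw [Equiv.coe_trans, ← Option.map_map, hg'.map_f, hg.map_f, Option.map_map]
  · rw [Equiv.coe_trans, ← Option.map_map, hg'.map_e, hg.map_e, Option.map_map]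
  · exact (hg'.map_wt _).trans (hg.map_wt _)
  · exact (hg'.map_ε _).trans (hg.map_ε _)
  · exact (hg'.map_φ _).trans (hg.map_φ _)

theorem embedding {g : X.carrier ≃ Y.carrier} (h : StrictMap X Y g) : Embedding X Y g :=
  { h with inj := g.injective, closed := fun {a _} _ => ⟨g.symm a, by simp⟩ }

theorem toIso (h : Equivalent X Y) : Iso X Y := by
  obtain ⟨g, hg⟩ := h
  refine ⟨Option.map g, ⟨⟨rfl, ?_, fun b _ _ => (hg.map_f (some b)).symm,
    fun b _ _ => (hg.map_e (some b)).symm⟩, fun b => (hg.map_f (some b)).symm,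
    fun b => (hg.map_e (some b)).symm⟩, (Equiv.optionCongr g).bijective⟩
  intro b b' h
  simp only [Option.map_some, Option.some.injEq] at h
  exact ⟨h ▸ hg.map_wt b, h ▸ hg.map_ε b⟩

theorem tensor {X' : CrystalData.{u}} {Y' : CrystalData.{v}} (h : Equivalent X Y)
    (h' : Equivalent X' Y') (h0 : Y'.e none = none) :
    Equivalent (X.tensor X') (Y.tensor Y') := by
  obtain ⟨g, hg⟩ := h
  obtain ⟨g', hg'⟩ := h'
  exact ⟨Equiv.prodCongr g g', (embedding hg).tensor_strictMap (embedding hg') h0⟩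

end Equivalent

/-! ### Direct sums -/

section directSum

variable {J : Type u} {B : J → CrystalData.{v}}

/-- The inclusion of a summand. -/
def incl (B : J → CrystalData.{v}) (j : J) (b : (B j).carrier) : (directSum B).carrier := ⟨j, b⟩

theorem incl_injective (j : J) : Function.Injective (incl B j) := by
  intro b c h
  cases h
  rfl

theorem directSum_embedding (hB : ∀ j, (B j).Axioms) (j : J) :
    Embedding (B j) (directSum B) (incl B j) where
  map_f := by
    rintro (_ | b)
    · rw [(hB j).f_zero]; rfl
    · rfl
  map_e := by
    rintro (_ | b)
    · rw [(hB j).e_zero]; rfl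
    · rfl
  map_wt _ := rfl
  map_ε _ := rfl
  map_φ _ := rfl
  inj := incl_injective j
  closed := by
    rintro ⟨j', a⟩ b h
    change ((B j').e (some a)).map (incl B j') = some ⟨j, b⟩ at h
    obtain ⟨c, -, hc⟩ := Option.map_eq_some_iff.mp h
    obtain rfl : j' = j := congrArg Sigma.fst hc
    exact ⟨a, rfl⟩

theorem directSum_f_eq_some {j : J} {b : (B j).carrier} {x : (directSum B).carrier} :
    (directSum B).f (some ⟨j, b⟩) = some x ↔ ∃ c, (B j).f (some b) = some c ∧ ⟨j, c⟩ = x := by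
  change ((B j).f (some b)).map (incl B j) = some x ↔ _
  exact Option.map_eq_some_iff

theorem directSum_e_eq_some {j : J} {b : (B j).carrier} {x : (directSum B).carrier} :
    (directSum B).e (some ⟨j, b⟩) = some x ↔ ∃ c, (B j).e (some b) = some c ∧ ⟨j, c⟩ = x := by
  change ((B j).e (some b)).map (incl B j) = some x ↔ _
  exact Option.map_eq_some_iff

theorem directSum_f_eq_none {j : J} {b : (B j).carrier} :
    (directSum B).f (some ⟨j, b⟩) = none ↔ (B j).f (some b) = none := by
  change ((B j).f (some b)).map (incl B j) = none ↔ _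
  exact Option.map_eq_none_iff

theorem directSum_branch {a z : (directSum B).carrier} (h : (directSum B).Branch a z) :
    ∃ j a' z', a = ⟨j, a'⟩ ∧ z = ⟨j, z'⟩ ∧ (B j).Branch a' z' := by
  obtain ⟨j, a⟩ := a
  obtain ⟨h1, h2⟩ := h
  obtain ⟨z', hz, rfl⟩ := directSum_e_eq_some.mp h1
  refine ⟨j, a, z', rfl, rfl, hz, fun h3 => h2 ?_⟩
  exact directSum_f_eq_some.mpr ⟨a, h3, rfl⟩

theorem directSum_axioms (hB : ∀ j, (B j).Axioms) : (directSum B).Axioms where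
  e_zero := rfl
  f_zero := rfl
  wt_e := by
    rintro ⟨j, b⟩ c h
    obtain ⟨c, hc, rfl⟩ := directSum_e_eq_some.mp h
    exact (hB j).wt_e hc
  e_f := by
    rintro ⟨j, b⟩ c h
    obtain ⟨c, hc, rfl⟩ := directSum_f_eq_some.mp h
    exact directSum_e_eq_some.mpr ⟨b, (hB j).e_f hc, rfl⟩
  branch_inj := by
    intro a a' z h h'
    obtain ⟨j, a, z, rfl, rfl, k⟩ := directSum_branch h
    obtain ⟨j', a', z', rfl, hz, k'⟩ := directSum_branch h'
    obtain rfl : j = j' := congrArg Sigma.fst hz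
    obtain rfl : z = z' := incl_injective j hz
    rw [(hB j).branch_inj k k']
  ε_nonneg b := (hB b.1).ε_nonneg b.2
  ε_top := by
    rintro ⟨j, b⟩ h
    refine (hB j).ε_top fun h' => h ?_
    have he : (directSum B).e (some ⟨j, b⟩) = _ := (directSum_embedding hB j).map_e (some b)
    rw [he, (directSum_embedding hB j).map_f, h']
    rfl
  ε_f := by
    rintro ⟨j, b⟩ c h
    obtain ⟨c, hc, rfl⟩ := directSum_f_eq_some.mp h
    exact (hB j).ε_f hc
  φ_eq b := (hB b.1).φ_eq b.2
  φ_bottom := by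
    rintro ⟨j, b⟩ h
    exact (hB j).φ_bottom (directSum_f_eq_none.mp h)
  φ_branch := by
    intro a z h
    obtain ⟨j, a, z, rfl, rfl, k⟩ := directSum_branch h
    exact (hB j).φ_branch k

theorem directSum_congr {J' : Type w} {C : J' → CrystalData.{w'}}
    (hC : ∀ j, (C j).Axioms) (g : J ≃ J') (h : ∀ j, Equivalent (B j) (C (g j))) :
    Equivalent (directSum B) (directSum C) := by
  choose k hk using h
  refine ⟨Equiv.sigmaCongr g k, ?_, ?_, ?_, ?_, ?_⟩
  · rintro (_ | ⟨j, b⟩)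
    · rfl
    · have h1 := (hk j).map_f (some b)
      have h2 := (directSum_embedding hC (g j)).map_f (some (k j b))
      refine h2.trans ?_
      rw [Option.map_some] at h1
      rw [h1]
      change _ = Option.map _ (((B j).f (some b)).map (incl B j))
      rw [Option.map_map, Option.map_map]
      rfl
  · rintro (_ | ⟨j, b⟩)
    · rfl
    · have h1 := (hk j).map_e (some b)
      have h2 := (directSum_embedding hC (g j)).map_e (some (k j b))
      refine h2.trans ?_
      rw [Option.map_some] at h1
      rw [h1]
      change _ = Option.map _ (((B j).e (some b)).map (incl B j))
      rw [Option.map_map, Option.map_map]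
      rfl
  · rintro ⟨j, b⟩; exact (hk j).map_wt b
  · rintro ⟨j, b⟩; exact (hk j).map_ε b
  · rintro ⟨j, b⟩; exact (hk j).map_φ b

/-- The tensor product distributes over direct sums. -/
theorem tensor_directSum {I : Type u} {J : Type u} {B : I → CrystalData.{v}}
    {C : J → CrystalData.{v}} (hB : ∀ i, (B i).Axioms) (hC : ∀ j, (C j).Axioms) :
    Equivalent (directSum fun p : I × J => (B p.1).tensor (C p.2))
      ((directSum B).tensor (directSum C)) := by
  have key := fun (p : I × J) => (directSum_embedding hB p.1).tensor_strictMap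
    (directSum_embedding hC p.2) rfl
  let g : (Σ p : I × J, (B p.1).carrier × (C p.2).carrier) ≃
      (Σ i, (B i).carrier) × (Σ j, (C j).carrier) :=
    { toFun := fun x => (⟨x.1.1, x.2.1⟩, ⟨x.1.2, x.2.2⟩)
      invFun := fun x => ⟨(x.1.1, x.2.1), (x.1.2, x.2.2)⟩
      left_inv := fun _ => rfl
      right_inv := fun _ => rfl }
  refine ⟨g, ?_, ?_, ?_, ?_, ?_⟩
  · rintro (_ | ⟨p, b⟩)
    · rfl
    · refine ((key p).map_f (some b)).trans ?_
      change _ = Option.map g (Option.map (Sigma.mk p) (((B p.1).tensor (C p.2)).f (some b)))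
      cases ((B p.1).tensor (C p.2)).f (some b) <;> rfl
  · rintro (_ | ⟨p, b⟩)
    · rfl
    · refine ((key p).map_e (some b)).trans ?_
      change _ = Option.map g (Option.map (Sigma.mk p) (((B p.1).tensor (C p.2)).e (some b)))
      cases ((B p.1).tensor (C p.2)).e (some b) <;> rfl
  · rintro ⟨p, b⟩; exact (key p).map_wt b
  · rintro ⟨p, b⟩; exact (key p).map_ε b
  · rintro ⟨p, b⟩; exact (key p).map_φ b

end directSum

end CrystalData

namespace CrystalData

/-! ### The indecomposable branched crystals -/

theorem finElt_eq_some {r j : ℕ} {k : Fin (r + 1)} : finElt r j = some k ↔ (k : ℕ) = j := by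
  unfold finElt
  split_ifs with h
  · rw [Option.some.injEq, Fin.ext_iff, eq_comm]
  · simp only [false_iff]; omega

theorem finElt_eq_none {r j : ℕ} : finElt r j = none ↔ r < j := by
  unfold finElt
  split_ifs with h <;> simp <;> omega

theorem finE_eq_some {r : ℕ} {j k : Fin (r + 1)} : finE r j = some k ↔ (k : ℕ) + 1 = j := by
  unfold finE
  split_ifs with h
  · simp only [false_iff]; omega
  · rw [finElt_eq_some]; omega

theorem finE_eq_none {r : ℕ} {j : Fin (r + 1)} : finE r j = none ↔ (j : ℕ) = 0 := by
  unfold finE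
  split_ifs with h
  · simp [h]
  · rw [finElt_eq_none]; omega

theorem natE_eq_some {j k : ℕ} : natE j = some k ↔ k + 1 = j := by
  unfold natE
  split_ifs with h
  · simp only [false_iff]; omega
  · rw [Option.some.injEq]; omega

theorem natE_eq_none {j : ℕ} : natE j = none ↔ j = 0 := by
  unfold natE
  split_ifs with h <;> simp [h]

theorem verma_axioms (s : ℤ) : (verma s).Axioms := by
  have hf : ∀ j c : ℕ, (verma s).f (some j) = some c ↔ j + 1 = c := fun j c => Option.some_inj
  have he : ∀ j c : ℕ, (verma s).e (some j) = some c ↔ c + 1 = j := fun j c => natE_eq_some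
  have hbr : ∀ a z : ℕ, ¬ (verma s).Branch a z := by
    rintro a z ⟨h1, h2⟩
    exact h2 ((hf _ _).mpr ((he _ _).mp h1))
  refine ⟨rfl, rfl, fun {b c} h => ?_, fun {b c} h => ?_, fun {a a' z} h => ?_, fun b => ?_,
    fun {b} h => ?_, fun {b c} h => ?_, fun b => ?_, fun {b} h => ?_, fun {a z} h => ?_⟩
  · have := (he _ _).mp h
    change ℕ at b c
    change s - 2 * (c : ℤ) = s - 2 * (b : ℤ) + 2; omega
  · exact (he _ _).mpr ((hf _ _).mp h)
  · exact absurd h (hbr _ _)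
  · exact Int.natCast_nonneg b
  · change ℕ at b
    rcases b with _ | b
    · rfl
    · exact absurd rfl h
  · have := (hf _ _).mp h
    change ℕ at b c
    change (c : ℤ) = b + 1; omega
  · change ℕ at b
    change s - (b : ℤ) = s - 2 * b + b; omega
  · exact absurd h (by change some _ ≠ none; simp)
  · exact absurd h (hbr _ _)

theorem simple_axioms (r : ℕ) : (simple r).Axioms := by
  have hf : ∀ j c : Fin (r + 1), (simple r).f (some j) = some c ↔ (c : ℕ) = j + 1 :=
    fun j c => finElt_eq_some
  have he : ∀ j c : Fin (r + 1), (simple r).e (some j) = some c ↔ (c : ℕ) + 1 = j :=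
    fun j c => finE_eq_some
  have hbr : ∀ a z : Fin (r + 1), ¬ (simple r).Branch a z := by
    rintro a z ⟨h1, h2⟩
    exact h2 ((hf _ _).mpr ((he _ _).mp h1).symm)
  refine ⟨rfl, rfl, fun {b c} h => ?_, fun {b c} h => ?_, fun {a a' z} h => ?_, fun b => ?_,
    fun {b} h => ?_, fun {b c} h => ?_, fun b => ?_, fun {b} h => ?_, fun {a z} h => ?_⟩
  · have := (he _ _).mp h
    change Fin (r + 1) at b c
    change (r : ℤ) - 2 * (c : ℕ) = r - 2 * (b : ℕ) + 2; omega
  · exact (he _ _).mpr ((hf _ _).mp h).symm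
  · exact absurd h (hbr _ _)
  · exact Int.natCast_nonneg _
  · change Fin (r + 1) at b
    by_contra hb
    have hb : (b : ℕ) ≠ 0 := fun h => hb (congrArg Nat.cast h)
    have h1 : (simple r).e (some b) = some (⟨b - 1, by omega⟩ : Fin (r + 1)) :=
      (he _ _).mpr (by simp; omega)
    rw [h1] at h
    exact h ((hf _ _).mpr (by simp; omega))
  · have := (hf _ _).mp h
    change Fin (r + 1) at b c
    change ((c : ℕ) : ℤ) = (b : ℕ) + 1; omega
  · change Fin (r + 1) at b
    change (r : ℤ) - (b : ℕ) = r - 2 * (b : ℕ) + (b : ℕ); omega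
  · have h' := finElt_eq_none.mp h
    change Fin (r + 1) at b
    have := b.2
    change (r : ℤ) - (b : ℕ) = 0; omega
  · exact absurd h (hbr _ _)

theorem tilting_axioms (r : ℕ) : (tilting r).Axioms := by
  have he : ∀ j c : ℕ, natE j = some c → c + 1 = j := fun j c => natE_eq_some.mp
  have el : ∀ j x, (tilting r).e (some (.inl j)) = some x → ∃ c, c + 1 = j ∧ .inl c = x := by
    intro j x h
    obtain ⟨c, hc, rfl⟩ := Option.map_eq_some_iff.mp h
    exact ⟨c, he _ _ hc, rfl⟩
  have er : ∀ j x, (tilting r).e (some (.inr j)) = some x →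
      (j = 0 ∧ .inl r = x) ∨ ∃ c, c + 1 = j ∧ .inr c = x := by
    intro j x h
    change (if j = 0 then some (Sum.inl r) else some (Sum.inr (j - 1))) = some x at h
    split_ifs at h with h0
    · exact Or.inl ⟨h0, Option.some_inj.mp h⟩
    · exact Or.inr ⟨j - 1, by omega, Option.some_inj.mp h⟩
  have hbr : ∀ a z, (tilting r).Branch a z → a = .inr 0 ∧ z = .inl r := by
    rintro (a | a) z ⟨h1, h2⟩
    · obtain ⟨c, rfl, rfl⟩ := el _ _ h1
      exact absurd rfl h2
    · rcases er _ _ h1 with ⟨rfl, rfl⟩ | ⟨c, rfl, rfl⟩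
      · exact ⟨rfl, rfl⟩
      · exact absurd rfl h2
  refine ⟨rfl, rfl, fun {b c} h => ?_, fun {b c} h => ?_, fun {a a' z} h h' => ?_, fun b => ?_,
    fun {b} h => ?_, fun {b c} h => ?_, fun b => ?_, fun {b} h => ?_, fun {a z} h => ?_⟩
  · rcases b with b | b
    · obtain ⟨c, rfl, rfl⟩ := el _ _ h
      simp only [tilting]; push_cast; ring
    · rcases er _ _ h with ⟨rfl, rfl⟩ | ⟨c, rfl, rfl⟩
      · simp only [tilting]; push_cast; ring
      · simp only [tilting]; push_cast; ring
  · rcases b with b | b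
    · obtain rfl : Sum.inl (b + 1) = c := Option.some_inj.mp h
      rfl
    · obtain rfl : Sum.inr (b + 1) = c := Option.some_inj.mp h
      rfl
  · rw [(hbr _ _ h).1, (hbr _ _ h').1]
  · rcases b with b | b <;> simp [tilting]
  · rcases b with (_ | b) | (_ | b)
    · rfl
    · exact absurd rfl h
    · rfl
    · exact absurd rfl h
  · rcases b with b | b
    · obtain rfl : Sum.inl (b + 1) = c := Option.some_inj.mp h
      simp [tilting]
    · obtain rfl : Sum.inr (b + 1) = c := Option.some_inj.mp h
      simp [tilting]
  · rcases b with b | b <;> simp only [tilting] <;> ring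
  · rcases b with b | b <;> exact absurd h (by change some _ ≠ none; simp)
  · obtain ⟨rfl, rfl⟩ := hbr _ _ h
    simp [tilting]

theorem dualVerma_axioms (r : ℕ) : (dualVerma r).Axioms := by
  have el : ∀ j x, (dualVerma r).e (some (.inl j)) = some x →
      ∃ c : Fin (r + 1), (c : ℕ) + 1 = j ∧ .inl c = x := by
    intro j x h
    obtain ⟨c, hc, rfl⟩ := Option.map_eq_some_iff.mp h
    exact ⟨c, finE_eq_some.mp hc, rfl⟩
  have el' : ∀ j c : Fin (r + 1), (c : ℕ) + 1 = j →
      (dualVerma r).e (some (.inl j)) = some (.inl c) := by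
    intro j c h
    exact Option.map_eq_some_iff.mpr ⟨c, finE_eq_some.mpr h, rfl⟩
  have fl : ∀ j x, (dualVerma r).f (some (.inl j)) = some x →
      ∃ c : Fin (r + 1), (c : ℕ) = j + 1 ∧ .inl c = x := by
    intro j x h
    obtain ⟨c, hc, rfl⟩ := Option.map_eq_some_iff.mp h
    exact ⟨c, finElt_eq_some.mp hc, rfl⟩
  have fl' : ∀ j c : Fin (r + 1), (c : ℕ) = j + 1 →
      (dualVerma r).f (some (.inl j)) = some (.inl c) := by
    intro j c h
    exact Option.map_eq_some_iff.mpr ⟨c, finElt_eq_some.mpr h, rfl⟩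
  have er : ∀ j x, (dualVerma r).e (some (.inr j)) = some x →
      (j = 0 ∧ .inl (Fin.last r) = x) ∨ ∃ c, c + 1 = j ∧ .inr c = x := by
    intro j x h
    change (if j = 0 then some (Sum.inl (Fin.last r)) else some (Sum.inr (j - 1))) = some x at h
    split_ifs at h with h0
    · exact Or.inl ⟨h0, Option.some_inj.mp h⟩
    · exact Or.inr ⟨j - 1, by omega, Option.some_inj.mp h⟩
  have hbr : ∀ a z, (dualVerma r).Branch a z → a = .inr 0 ∧ z = .inl (Fin.last r) := by
    rintro (a | a) z ⟨h1, h2⟩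
    · obtain ⟨c, hc, rfl⟩ := el _ _ h1
      exact absurd (fl' _ _ hc.symm) h2
    · rcases er _ _ h1 with ⟨rfl, rfl⟩ | ⟨c, rfl, rfl⟩
      · exact ⟨rfl, rfl⟩
      · exact absurd rfl h2
  refine ⟨rfl, rfl, fun {b c} h => ?_, fun {b c} h => ?_, fun {a a' z} h h' => ?_, fun b => ?_,
    fun {b} h => ?_, fun {b c} h => ?_, fun b => ?_, fun {b} h => ?_, fun {a z} h => ?_⟩
  · rcases b with b | b
    · obtain ⟨c, hc, rfl⟩ := el _ _ h
      simp only [dualVerma]; omega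
    · rcases er _ _ h with ⟨rfl, rfl⟩ | ⟨c, rfl, rfl⟩
      · simp only [dualVerma, Fin.val_last]; push_cast; ring
      · simp only [dualVerma]; push_cast; ring
  · rcases b with b | b
    · obtain ⟨c, hc, rfl⟩ := fl _ _ h
      exact el' _ _ hc.symm
    · obtain rfl : Sum.inr (b + 1) = c := Option.some_inj.mp h
      rfl
  · rw [(hbr _ _ h).1, (hbr _ _ h').1]
  · rcases b with b | b <;> simp [dualVerma]
  · rcases b with b | (_ | b)
    · by_contra hb
      have hb : (b : ℕ) ≠ 0 := fun h => hb (congrArg Nat.cast h)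
      rw [el' b ⟨b - 1, by omega⟩ (by simp; omega)] at h
      exact h (fl' _ _ (by simp; omega))
    · rfl
    · exact absurd rfl h
  · rcases b with b | b
    · obtain ⟨c, hc, rfl⟩ := fl _ _ h
      simp only [dualVerma]; omega
    · obtain rfl : Sum.inr (b + 1) = c := Option.some_inj.mp h
      simp [dualVerma]
  · rcases b with b | b <;> simp only [dualVerma] <;> ring
  · rcases b with b | b
    · have h' := finElt_eq_none.mp (Option.map_eq_none_iff.mp h)
      have := b.2
      simp only [dualVerma]; omega
    · exact absurd h (by change some _ ≠ none; simp)
  · obtain ⟨rfl, rfl⟩ := hbr _ _ h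
    simp [dualVerma]

end CrystalData

namespace QuantumSl2

theorem Label.crystal_axioms (W : Label) : W.crystal.Axioms := by
  cases W with
  | simple r => exact CrystalData.simple_axioms r
  | verma s => exact CrystalData.verma_axioms s
  | tilting r => exact CrystalData.tilting_axioms r
  | dualVerma r => exact CrystalData.dualVerma_axioms r

/-- The element of highest weight. -/
def Label.top : (W : Label) → W.crystal.carrier
  | .simple r => (0 : Fin (r + 1))
  | .verma _ => (0 : ℕ)
  | .tilting _ => Sum.inl (0 : ℕ)
  | .dualVerma r => Sum.inl (0 : Fin (r + 1))

theorem Label.e_eq_none_iff (W : Label) {c : W.crystal.carrier} :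
    W.crystal.e (some c) = none ↔ c = W.top := by
  cases W with
  | simple r =>
    change Fin (r + 1) at c
    change CrystalData.finE r c = none ↔ c = 0
    rw [CrystalData.finE_eq_none, Fin.ext_iff]; rfl
  | verma s =>
    change ℕ at c
    exact CrystalData.natE_eq_none
  | tilting r =>
    rcases c with c | c
    · refine Option.map_eq_none_iff.trans (CrystalData.natE_eq_none.trans ?_)
      exact Sum.inl_injective.eq_iff.symm
    · change (if c = 0 then some (Sum.inl r) else some (Sum.inr (c - 1))) = none ↔ _
      split_ifs <;> simp [Label.top]
  | dualVerma r =>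
    rcases c with c | c
    · refine Option.map_eq_none_iff.trans (CrystalData.finE_eq_none.trans ?_)
      exact (Fin.ext_iff (b := 0)).symm.trans Sum.inl_injective.eq_iff.symm
    · change (if c = 0 then some (Sum.inl (Fin.last r)) else some (Sum.inr (c - 1))) = none ↔ _
      split_ifs <;> simp [Label.top]

end QuantumSl2

namespace CrystalData

open QuantumSl2

/-! ### Decomposition of a branched crystal -/

variable {B : CrystalData.{u}}

/-- `f̃ⁿ x` as an element of `B`; it is `x` when `f̃ⁿ x = 0`. -/
def iterF (B : CrystalData.{u}) (x : B.carrier) (n : ℕ) : B.carrier :=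
  (B.f^[n] (some x)).getD x

open Classical in
/-- The label of the connected component of an element `x` with `ẽ x = 0`. -/
noncomputable def rootLabel (B : CrystalData.{u}) (x : B.carrier) : Label :=
  if B.wt x < 0 then .verma (B.wt x)
  else if B.FinStr x then
    if B.Pos x then .simple (B.wt x).toNat else .dualVerma (B.wt x).toNat
  else if B.Pos x then .verma (B.wt x) else .tilting (B.wt x).toNat

namespace Axioms

variable (hB : B.Axioms)
include hB

theorem down_iterF {x : B.carrier} {n : ℕ} (h : B.FinStr x → (n : ℤ) ≤ B.φ x) :
    B.Down n x (B.iterF x n) := by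
  obtain ⟨c, hc⟩ := hB.exists_down h
  have : B.iterF x n = c := by
    unfold iterF
    rw [show B.f^[n] (some x) = some c from hc]; rfl
  rwa [this]

theorem f_iterF {x : B.carrier} {n : ℕ} (h : B.FinStr x → (n : ℤ) + 1 ≤ B.φ x) :
    B.f (some (B.iterF x n)) = some (B.iterF x (n + 1)) := by
  obtain ⟨d, hd, h'⟩ := hB.down_succ.mp (hB.down_iterF (x := x) (n := n + 1)
    (by push_cast; exact h))
  rw [← down_fun hd (hB.down_iterF (fun h1 => by have := h h1; omega))]
  exact h'

theorem strictMap_of {X : CrystalData.{v}} (hX : X.Axioms) {i : X.carrier → B.carrier}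
    (hf : ∀ b, B.f (some (i b)) = (X.f (some b)).map i)
    (he : ∀ b, X.ε b = 0 → B.e (some (i b)) = (X.e (some b)).map i)
    (hw : ∀ b, B.wt (i b) = X.wt b) (hε : ∀ b, B.ε (i b) = X.ε b) : StrictMap X B i := by
  refine ⟨?_, ?_, hw, hε, fun b => by rw [hB.φ_eq, hX.φ_eq, hw, hε]⟩
  · rintro (_ | b)
    · simp [hB.f_zero, hX.f_zero]
    · exact hf b
  · rintro (_ | b)
    · simp [hB.e_zero, hX.e_zero]
    · rcases (hX.ε_nonneg b).eq_or_lt with h | h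
      · exact he b h.symm
      · obtain ⟨c, hc⟩ := hX.exists_f_of_ε_pos h
        have := hf c
        rw [hc] at this
        rw [hX.e_f hc]
        exact hB.e_f this

theorem exists_root (b : B.carrier) : ∃ l x, B.e (some x) = none ∧ B.e^[l] (some b) = some x := by
  obtain ⟨n, hn⟩ := Int.eq_ofNat_of_zero_le (hB.ε_nonneg b)
  obtain ⟨t, ht⟩ := hB.exists_down_of_le (n := n) (c := b) hn.ge
  have hb := hB.down_e ht
  cases hz : B.e (some t) with
  | none => exact ⟨n, t, hz, hb⟩
  | some z =>
    have hε := hB.down_ε ht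
    have htz : B.Branch t z := by
      rcases hB.e_cases.mp hz with h | h
      · have := hB.ε_f h; have := hB.ε_nonneg z; omega
      · exact h
    obtain ⟨m, hm⟩ := Int.eq_ofNat_of_zero_le (hB.ε_nonneg z)
    obtain ⟨x, hx⟩ := hB.exists_down_of_le (n := m) (c := z) hm.ge
    refine ⟨m + (1 + n), x, ?_, ?_⟩
    · by_contra hne
      have h1 := hB.down_ε hx
      have h2 := hB.down_φ hx
      have h3 := hB.φ_branch htz
      refine hB.not_branch_of_φ (a := x) (by omega) ⟨hne, fun h => ?_⟩
      obtain ⟨y, hy⟩ := Option.ne_none_iff_exists'.mp hne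
      rw [hy] at h
      have := hB.ε_f h; have := hB.ε_nonneg y; omega
    · rw [Function.iterate_add_apply, Function.iterate_add_apply, hb, Function.iterate_one, hz,
        hB.down_e hx]

theorem root_ε {x : B.carrier} (hx : B.e (some x) = none) : B.ε x = 0 :=
  hB.ε_top (by rw [hx, hB.f_zero]; simp)

theorem iterF_ne {x a : B.carrier} (hx : B.e (some x) = none) (ha : B.e (some a) ≠ none)
    (hε : B.ε a = 0) {m n : ℕ} (hm : B.FinStr x → (m : ℤ) ≤ B.φ x)
    (hn : B.FinStr a → (n : ℤ) ≤ B.φ a) : B.iterF x m ≠ B.iterF a n := by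
  intro h
  have h1 := hB.down_iterF hm
  have h2 := hB.down_iterF hn
  have h3 := hB.down_ε h1
  have h4 := hB.down_ε h2
  have h5 := hB.root_ε hx
  rw [h] at h1 h3
  obtain rfl : m = n := by omega
  rw [hB.down_inj h1 h2] at hx
  exact ha hx

end Axioms

end CrystalData

namespace CrystalData

open QuantumSl2

variable {B : CrystalData.{u}}

namespace Axioms

variable (hB : B.Axioms)
include hB

/-- A branch point is attached to the string of a root `x` at most at `f̃^φ(x) x`, where `φ = 0`. -/
theorem up_root_iff {x : B.carrier} (h0 : 0 ≤ B.φ x) :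
    B.Up x ↔ ∃ a, B.Branch a (B.iterF x (B.φ x).toNat) := by
  have h := hB.down_iterF (x := x) (n := (B.φ x).toNat) (by omega)
  have := hB.down_φ h
  rw [hB.down_up h (by omega), hB.up_iff_of_φ_eq_zero (by omega)]

theorem iterF_inj {x : B.carrier} {m n : ℕ} (hm : B.FinStr x → (m : ℤ) ≤ B.φ x)
    (hn : B.FinStr x → (n : ℤ) ≤ B.φ x) (h : B.iterF x m = B.iterF x n) : m = n := by
  have h1 := hB.down_ε (hB.down_iterF hm)
  have h2 := hB.down_ε (hB.down_iterF hn)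
  rw [h] at h1; omega

theorem ε_iterF {x : B.carrier} (hε : B.ε x = 0) {n : ℕ} (hn : B.FinStr x → (n : ℤ) ≤ B.φ x) :
    B.ε (B.iterF x n) = n := by
  have := hB.down_ε (hB.down_iterF hn); omega

theorem wt_iterF {x : B.carrier} {n : ℕ} (hn : B.FinStr x → (n : ℤ) ≤ B.φ x) :
    B.wt (B.iterF x n) = B.wt x - 2 * n := by
  have h1 := hB.down_ε (hB.down_iterF hn)
  have h2 := hB.down_φ (hB.down_iterF hn)
  have := hB.φ_eq x; have := hB.φ_eq (B.iterF x n); omega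

/-- An element above an element of an `f̃`-string lies in the string or is a branch point. -/
theorem e_iterF_cases {x b : B.carrier} {n : ℕ} (hn : B.FinStr x → (n : ℤ) ≤ B.φ x)
    (h : B.e (some b) = some (B.iterF x n)) :
    (b = B.iterF x (n + 1) ∧ (B.FinStr x → (n : ℤ) + 1 ≤ B.φ x)) ∨
      (B.Branch b (B.iterF x n) ∧ (n : ℤ) = B.φ x) := by
  have h1 := hB.down_iterF hn
  have h2 := hB.down_φ h1
  rcases hB.e_cases.mp h with h | h
  · left
    have h3 : B.FinStr x → (n : ℤ) + 1 ≤ B.φ x := by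
      intro hx
      have := hB.fin_φ ((hB.f_fin h).mp ((hB.down_fin h1).mp hx))
      have := hB.φ_f h; omega
    have := hB.f_iterF h3
    exact ⟨by simpa using h.symm.trans this, h3⟩
  · have := hB.φ_branch h
    exact Or.inr ⟨h, by omega⟩

/-- The component of a root of an infinite string is a Verma crystal if no branch point lies over
the string. -/
theorem embedding_verma {x : B.carrier} (hx : B.e (some x) = none) (hf : ¬ B.FinStr x)
    (hb : B.wt x < 0 ∨ B.Pos x) : Embedding (verma (B.wt x)) B (B.iterF x) := by
  have hn : ∀ n : ℕ, B.FinStr x → (n : ℤ) ≤ B.φ x := fun _ h => absurd h hf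
  have hε := hB.root_ε hx
  have h : StrictMap (verma (B.wt x)) B (B.iterF x) := by
    refine hB.strictMap_of (verma_axioms _) (fun j => ?_) (fun j hj => ?_) (fun j => ?_)
      (fun j => ?_)
    · exact hB.f_iterF (fun h => absurd h hf)
    · change ℕ at j
      obtain rfl : j = 0 := Int.natCast_eq_zero.mp hj
      exact hx
    · exact hB.wt_iterF (hn j)
    · exact hB.ε_iterF hε (hn j)
  refine ⟨h, fun m n hmn => hB.iterF_inj (hn m) (hn n) hmn, fun {a j} ha => ?_⟩
  rcases hB.e_iterF_cases (hn j) ha with ⟨rfl, -⟩ | ⟨h, h'⟩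
  · exact ⟨_, rfl⟩
  · exfalso
    have := hB.φ_eq x
    rcases hb with hb | hb
    · omega
    · change ℕ at j
      refine hb.2 ((hB.up_root_iff (by omega)).mpr ⟨a, ?_⟩)
      rwa [← h', Int.toNat_natCast]

/-- The component of a root of a finite string over which no branch point lies is the crystal of a
simple module. -/
theorem embedding_simple {x : B.carrier} (hx : B.e (some x) = none) (hf : B.FinStr x)
    (hb : B.Pos x) :
    Embedding (simple (B.wt x).toNat) B
      (fun j : Fin ((B.wt x).toNat + 1) => B.iterF x (j : ℕ)) := by
  have hε := hB.root_ε hx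
  have hφ := hB.φ_eq x
  have h0 := hB.fin_φ hf
  have hn : ∀ n : Fin ((B.wt x).toNat + 1), B.FinStr x → ((n : ℕ) : ℤ) ≤ B.φ x :=
    fun n _ => by omega
  have h : StrictMap (simple (B.wt x).toNat) B
      (fun j : Fin ((B.wt x).toNat + 1) => B.iterF x (j : ℕ)) := by
    refine hB.strictMap_of (simple_axioms _) (fun j => ?_) (fun j hj => ?_) (fun j => ?_)
      (fun j => ?_)
    · change Fin ((B.wt x).toNat + 1) at j
      change B.f (some (B.iterF x (j : ℕ))) = (finElt _ _).map _
      by_cases hj : (j : ℕ) + 1 < (B.wt x).toNat + 1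
      · rw [finElt_eq_some.mpr (show ((⟨j + 1, hj⟩ : Fin _) : ℕ) = j + 1 from rfl)]
        exact hB.f_iterF (fun _ => by omega)
      · rw [finElt_eq_none.mpr (by omega)]
        have h1 := hB.down_iterF (hn j)
        have := hB.down_φ h1
        exact hB.f_none_iff.mpr ⟨(hB.down_fin h1).mp hf, by omega⟩
    · change Fin ((B.wt x).toNat + 1) at j
      have hj : (j : ℕ) = 0 := Int.natCast_eq_zero.mp hj
      change B.e (some (B.iterF x (j : ℕ))) = (finE _ _).map _
      rw [finE_eq_none.mpr hj, hj]
      exact hx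
    · change Fin ((B.wt x).toNat + 1) at j
      change _ = ((B.wt x).toNat : ℤ) - 2 * (j : ℕ)
      rw [hB.wt_iterF (hn j)]
      omega
    · exact hB.ε_iterF hε (hn j)
  refine ⟨h, fun m n hmn => Fin.ext (hB.iterF_inj (hn m) (hn n) hmn), fun {a j} ha => ?_⟩
  rcases hB.e_iterF_cases (hn j) ha with ⟨rfl, h'⟩ | ⟨h, h'⟩
  · have := h' hf
    change Fin ((B.wt x).toNat + 1) at j
    exact ⟨(⟨j + 1, by omega⟩ : Fin ((B.wt x).toNat + 1)), rfl⟩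
  · exfalso
    change Fin ((B.wt x).toNat + 1) at j
    refine hb.2 ((hB.up_root_iff (by omega)).mpr ⟨a, ?_⟩)
    rwa [← h', Int.toNat_natCast]

/-- The component of a root of an infinite string over which the branch point `a` lies is
of type `B(T(r))`. -/
theorem embedding_tilting {x a : B.carrier} (hx : B.e (some x) = none) (hf : ¬ B.FinStr x)
    (h0 : 0 ≤ B.φ x) (ha : B.Branch a (B.iterF x (B.φ x).toNat)) :
    Embedding (tilting (B.wt x).toNat) B (Sum.elim (B.iterF x) (B.iterF a)) := by
  have hn : ∀ n : ℕ, B.FinStr x → (n : ℤ) ≤ B.φ x := fun _ h => absurd h hf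
  have hna : ∀ n : ℕ, B.FinStr a → (n : ℤ) ≤ B.φ a := fun _ h => absurd h (hB.branch_not_fin ha)
  have hε := hB.root_ε hx
  have hεa := hB.branch_ε ha
  have hφ := hB.φ_eq x
  have hφa := hB.branch_φ ha
  have hwa := hB.φ_eq a
  rw [hB.ε_iterF hε (hn _)] at hφa
  have hr : (B.φ x).toNat = (B.wt x).toNat := by omega
  have hea : B.e (some a) ≠ none := by rw [ha.1]; simp
  have h : StrictMap (tilting (B.wt x).toNat) B (Sum.elim (B.iterF x) (B.iterF a)) := by
    refine hB.strictMap_of (tilting_axioms _) ?_ ?_ ?_ ?_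
    · rintro (j | j)
      · exact hB.f_iterF (fun h => absurd h hf)
      · exact hB.f_iterF (fun h => absurd h (hB.branch_not_fin ha))
    · rintro (j | j) hj
      · obtain rfl : j = 0 := Int.natCast_eq_zero.mp hj
        exact hx
      · obtain rfl : j = 0 := Int.natCast_eq_zero.mp hj
        exact ha.1.trans (by rw [hr]; rfl)
    · rintro (j | j)
      · refine (hB.wt_iterF (hn j)).trans ?_
        simp only [tilting]; omega
      · refine (hB.wt_iterF (hna j)).trans ?_
        simp only [tilting]; omega
    · rintro (j | j)
      · exact hB.ε_iterF hε (hn j)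
      · exact hB.ε_iterF hεa (hna j)
  refine ⟨h, ?_, ?_⟩
  · rintro (m | m) (n | n) hmn
    · rw [hB.iterF_inj (hn m) (hn n) hmn]
    · exact absurd hmn (hB.iterF_ne hx hea hεa (hn m) (hna n))
    · exact absurd hmn.symm (hB.iterF_ne hx hea hεa (hn n) (hna m))
    · rw [hB.iterF_inj (hna m) (hna n) hmn]
  · rintro b (j | j) hb
    · rcases hB.e_iterF_cases (hn j) hb with ⟨rfl, -⟩ | ⟨h, h'⟩
      · exact ⟨.inl (j + 1), rfl⟩
      · rw [← h', Int.toNat_natCast] at ha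
        rw [hB.branch_inj h ha]
        exact ⟨.inr 0, rfl⟩
    · rcases hB.e_iterF_cases (hna j) hb with ⟨rfl, -⟩ | ⟨h, h'⟩
      · exact ⟨.inr (j + 1), rfl⟩
      · omega

/-- The component of a root of a finite string over which the branch point `a` lies is
of type `B(M(r)^σ)`. -/
theorem embedding_dualVerma {x a : B.carrier} (hx : B.e (some x) = none) (hf : B.FinStr x)
    (h0 : 0 ≤ B.φ x) (ha : B.Branch a (B.iterF x (B.φ x).toNat)) :
    Embedding (dualVerma (B.wt x).toNat) B
      (Sum.elim (fun j : Fin ((B.wt x).toNat + 1) => B.iterF x (j : ℕ)) (B.iterF a)) := by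
  have hε := hB.root_ε hx
  have hφ := hB.φ_eq x
  have hn : ∀ n : Fin ((B.wt x).toNat + 1), B.FinStr x → ((n : ℕ) : ℤ) ≤ B.φ x :=
    fun n _ => by omega
  have hna : ∀ n : ℕ, B.FinStr a → (n : ℤ) ≤ B.φ a := fun _ h => absurd h (hB.branch_not_fin ha)
  have hεa := hB.branch_ε ha
  have hφa := hB.branch_φ ha
  have hwa := hB.φ_eq a
  rw [hB.ε_iterF hε (fun _ => by omega)] at hφa
  have hr : (B.φ x).toNat = (B.wt x).toNat := by omega
  have hea : B.e (some a) ≠ none := by rw [ha.1]; simp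
  have h : StrictMap (dualVerma (B.wt x).toNat) B
      (Sum.elim (fun j : Fin ((B.wt x).toNat + 1) => B.iterF x (j : ℕ)) (B.iterF a)) := by
    refine hB.strictMap_of (dualVerma_axioms _) ?_ ?_ ?_ ?_
    · rintro (j | j)
      · change B.f (some (B.iterF x (j : ℕ))) = ((finElt _ _).map _).map _
        by_cases hj : (j : ℕ) + 1 < (B.wt x).toNat + 1
        · rw [finElt_eq_some.mpr (show ((⟨j + 1, hj⟩ : Fin _) : ℕ) = j + 1 from rfl)]
          exact hB.f_iterF (fun _ => by omega)
        · rw [finElt_eq_none.mpr (by omega)]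
          have h1 := hB.down_iterF (hn j)
          have := hB.down_φ h1
          exact hB.f_none_iff.mpr ⟨(hB.down_fin h1).mp hf, by omega⟩
      · exact hB.f_iterF (fun h => absurd h (hB.branch_not_fin ha))
    · rintro (j | j) hj
      · have hj : (j : ℕ) = 0 := Int.natCast_eq_zero.mp hj
        change B.e (some (B.iterF x (j : ℕ))) = ((finE _ _).map _).map _
        rw [finE_eq_none.mpr hj, hj]
        exact hx
      · obtain rfl : j = 0 := Int.natCast_eq_zero.mp hj
        exact ha.1.trans (by rw [hr]; rfl)
    · rintro (j | j)
      · refine (hB.wt_iterF (hn j)).trans ?_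
        simp only [dualVerma]; omega
      · refine (hB.wt_iterF (hna j)).trans ?_
        simp only [dualVerma]; omega
    · rintro (j | j)
      · exact hB.ε_iterF hε (hn j)
      · exact hB.ε_iterF hεa (hna j)
  refine ⟨h, ?_, ?_⟩
  · rintro (m | m) (n | n) hmn
    · rw [Fin.ext (hB.iterF_inj (hn m) (hn n) hmn)]
    · exact absurd hmn (hB.iterF_ne hx hea hεa (hn m) (hna n))
    · exact absurd hmn.symm (hB.iterF_ne hx hea hεa (hn n) (hna m))
    · rw [hB.iterF_inj (hna m) (hna n) hmn]
  · rintro b (j | j) hb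
    · rcases hB.e_iterF_cases (hn j) hb with ⟨rfl, h'⟩ | ⟨h, h'⟩
      · have := h' hf
        exact ⟨.inl ⟨j + 1, by omega⟩, rfl⟩
      · rw [← h', Int.toNat_natCast] at ha
        rw [hB.branch_inj h ha]
        exact ⟨.inr 0, rfl⟩
    · rcases hB.e_iterF_cases (hna j) hb with ⟨rfl, -⟩ | ⟨h, h'⟩
      · exact ⟨.inr (j + 1), rfl⟩
      · omega

/-- The connected component of a root `x` is the crystal with the label of `x`. -/
theorem exists_rootEmbedding {x : B.carrier} (hx : B.e (some x) = none) :
    ∃ i : (B.rootLabel x).crystal.carrier → B.carrier,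
      Embedding (B.rootLabel x).crystal B i ∧ i (B.rootLabel x).top = x := by
  have hε := hB.root_ε hx
  have hφ := hB.φ_eq x
  by_cases h1 : B.wt x < 0
  · rw [show B.rootLabel x = .verma (B.wt x) by simp [rootLabel, h1]]
    exact ⟨_, hB.embedding_verma hx (fun h => by have := hB.fin_φ h; omega) (Or.inl h1), rfl⟩
  have h0 : 0 ≤ B.φ x := by omega
  by_cases h2 : B.FinStr x <;> by_cases h3 : B.Pos x
  · rw [show B.rootLabel x = .simple (B.wt x).toNat by simp [rootLabel, h1, h2, h3]]
    exact ⟨_, hB.embedding_simple hx h2 h3, rfl⟩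
  · rw [show B.rootLabel x = .dualVerma (B.wt x).toNat by simp [rootLabel, h1, h2, h3]]
    obtain ⟨a, ha⟩ := (hB.up_root_iff h0).mp (by unfold Pos at h3; tauto)
    exact ⟨_, hB.embedding_dualVerma hx h2 h0 ha, rfl⟩
  · rw [show B.rootLabel x = .verma (B.wt x) by simp [rootLabel, h1, h2, h3]]
    exact ⟨_, hB.embedding_verma hx h2 (Or.inr h3), rfl⟩
  · rw [show B.rootLabel x = .tilting (B.wt x).toNat by simp [rootLabel, h1, h2, h3]]
    obtain ⟨a, ha⟩ := (hB.up_root_iff h0).mp (by unfold Pos at h3; tauto)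
    exact ⟨_, hB.embedding_tilting hx h2 h0 ha, rfl⟩

/-- A branched crystal is the disjoint union of indecomposable crystals, one for each element
killed by `ẽ`. -/
theorem decomposition :
    Equivalent (directSum fun x : {x // B.e (some x) = none} => (B.rootLabel x).crystal) B := by
  choose i hi hix using fun x : {x // B.e (some x) = none} => hB.exists_rootEmbedding x.2
  let g : (Σ x : {x // B.e (some x) = none}, (B.rootLabel x).crystal.carrier) → B.carrier :=
    fun y => i y.1 y.2
  -- Iterating `ẽ` leads from each element of a component to its root.
  have key : ∀ y : Σ x : {x // B.e (some x) = none}, (B.rootLabel x).crystal.carrier,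
      ∃ l, B.e^[l] (some (g y)) = some y.1.1 := by
    rintro ⟨x, c⟩
    obtain ⟨l, y, hy, hl⟩ := (B.rootLabel x).crystal_axioms.exists_root c
    rw [Label.e_eq_none_iff] at hy
    subst hy
    refine ⟨l, ?_⟩
    have := (hi x).map_e_iter l (some c)
    rw [hl, Option.map_some, Option.map_some, hix] at this
    exact this
  have hroot : ∀ {x y : {x // B.e (some x) = none}} {b l m}, B.e^[l] (some b) = some x.1 →
      B.e^[m] (some b) = some y.1 → l ≤ m → x = y := by
    intro x y b l m hl hm hlm
    obtain ⟨k, rfl⟩ := Nat.exists_eq_add_of_le hlm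
    rw [add_comm, Function.iterate_add_apply, hl] at hm
    cases k with
    | zero => exact Subtype.ext (by simpa using hm)
    | succ k => rw [Function.iterate_succ_apply, x.2, hB.e_iter_none] at hm; simp at hm
  have hg : Function.Bijective g := by
    constructor
    · intro y z h
      obtain ⟨l, hl⟩ := key y
      obtain ⟨m, hm⟩ := key z
      rw [h] at hl
      have hyz : y.1 = z.1 := by
        rcases le_total l m with hlm | hlm
        · exact hroot hl hm hlm
        · exact (hroot hm hl hlm).symm
      obtain ⟨x, c⟩ := y
      obtain ⟨x', c'⟩ := z
      obtain rfl : x = x' := hyz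
      rw [show c = c' from (hi x).inj h]
    · intro b
      obtain ⟨l, x, hx, hl⟩ := hB.exists_root b
      obtain ⟨c, hc⟩ := (hi ⟨x, hx⟩).mem_range_of_iter hB.e_zero (b := Label.top _)
        (l := l) (a := b) (by rw [hix, hl])
      exact ⟨⟨⟨x, hx⟩, c⟩, hc⟩
  refine ⟨Equiv.ofBijective g hg, ?_, ?_, fun y => (hi y.1).map_wt y.2, fun y => (hi y.1).map_ε y.2,
    fun y => (hi y.1).map_φ y.2⟩
  · rintro (_ | ⟨x, c⟩)
    · exact hB.f_zero
    · refine ((hi x).map_f (some c)).trans ?_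
      change _ = Option.map g (Option.map (Sigma.mk x) _)
      cases (B.rootLabel x).crystal.f (some c) <;> rfl
  · rintro (_ | ⟨x, c⟩)
    · exact hB.e_zero
    · refine ((hi x).map_e (some c)).trans ?_
      change _ = Option.map g (Option.map (Sigma.mk x) _)
      cases (B.rootLabel x).crystal.e (some c) <;> rfl

end Axioms

theorem Embedding.rootLabel_eq {X : CrystalData.{u}} {Y : CrystalData.{v}}
    {i : X.carrier → Y.carrier} (h : Embedding X Y i) (h0 : Y.e none = none) (b : X.carrier) :
    Y.rootLabel (i b) = X.rootLabel b := by
  unfold rootLabel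
  rw [h.map_wt]
  classical
  exact if_congr Iff.rfl rfl (if_congr h.finStr_iff (if_congr (h.pos_iff h0) rfl rfl)
    (if_congr (h.pos_iff h0) rfl rfl))

theorem rootLabel_top (W : Label) : W.crystal.rootLabel W.top = W := by
  have hW := W.crystal_axioms
  unfold rootLabel
  cases W with
  | simple r =>
    have hw : (Label.simple r).crystal.wt (Label.simple r).top = r := by
      change (r : ℤ) - 2 * (0 : ℕ) = r; simp
    have hfi : ∀ n, n < r + 1 → (simple r).f^[n] (some (0 : Fin (r + 1))) = finElt r n := by
      intro n hn
      induction n with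
      | zero => exact (finElt_eq_some.mpr rfl).symm
      | succ n ih =>
        rw [Function.iterate_succ_apply', ih (by omega),
          finElt_eq_some.mpr (show ((⟨n, by omega⟩ : Fin (r + 1)) : ℕ) = n from rfl)]
        rfl
    have hf : (Label.simple r).crystal.FinStr (Label.simple r).top := by
      refine ⟨r + 1, ?_⟩
      refine (Function.iterate_succ_apply' (simple r).f r (some (0 : Fin (r + 1)))).trans ?_
      rw [hfi r (by omega),
        finElt_eq_some.mpr (show ((⟨r, by omega⟩ : Fin (r + 1)) : ℕ) = r from rfl)]
      exact finElt_eq_none.mpr (by simp)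
    have hp : (Label.simple r).crystal.Pos (Label.simple r).top := by
      refine ⟨hW.fin_φ hf, ?_⟩
      rintro ⟨a, ⟨h1, h2⟩, -⟩
      change Fin (r + 1) at a
      obtain ⟨b, hb⟩ := Option.ne_none_iff_exists'.mp h1
      change Fin (r + 1) at b
      rw [hb] at h2
      exact h2 (finElt_eq_some.mpr (finE_eq_some.mp hb).symm)
    rw [hw, if_neg (by omega), if_pos hf, if_pos hp, Int.toNat_natCast]
  | verma s =>
    have hw : (Label.verma s).crystal.wt (Label.verma s).top = s := by
      change s - 2 * ((0 : ℕ) : ℤ) = s; simp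
    have hfi : ∀ n, (verma s).f^[n] (some (0 : ℕ)) = some n := by
      intro n
      induction n with
      | zero => rfl
      | succ n ih => rw [Function.iterate_succ_apply', ih]; rfl
    have hf : ¬ (Label.verma s).crystal.FinStr (Label.verma s).top := by
      rintro ⟨n, hn⟩
      have := (hfi n).symm.trans hn
      simp at this
    by_cases hs : s < 0
    · rw [hw, if_pos hs]
    have hp : (Label.verma s).crystal.Pos (Label.verma s).top := by
      refine ⟨?_, ?_⟩
      · change 0 ≤ s - ((0 : ℕ) : ℤ)
        simp; omega
      rintro ⟨a, ⟨h1, h2⟩, -⟩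
      change ℕ at a
      obtain ⟨b, hb⟩ := Option.ne_none_iff_exists'.mp h1
      change ℕ at b
      rw [hb] at h2
      exact h2 (congrArg some (natE_eq_some.mp hb))
    rw [hw, if_neg hs, if_neg hf, if_pos hp]
  | tilting r =>
    have hw : (Label.tilting r).crystal.wt (Label.tilting r).top = r := by
      change (r : ℤ) - 2 * ((0 : ℕ) : ℤ) = r; simp
    have hfi : ∀ n, (tilting r).f^[n] (some (.inl 0)) = some (.inl n) := by
      intro n
      induction n with
      | zero => rfl
      | succ n ih => rw [Function.iterate_succ_apply', ih]; rfl
    have hf : ¬ (Label.tilting r).crystal.FinStr (Label.tilting r).top := by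
      rintro ⟨n, hn⟩
      have := (hfi n).symm.trans hn
      simp at this
    have hp : ¬ (Label.tilting r).crystal.Pos (Label.tilting r).top := by
      intro h
      refine h.2 ((hW.down_up (c := Sum.inl r) (n := r) (hfi r) ?_).mpr
        (Axioms.branch_up (a := Sum.inr 0) ⟨rfl, ?_⟩))
      · change 0 ≤ (r : ℤ) - r; simp
      · change some _ ≠ some _; simp
    rw [hw, if_neg (by omega), if_neg hf, if_neg hp, Int.toNat_natCast]
  | dualVerma r =>
    have hw : (Label.dualVerma r).crystal.wt (Label.dualVerma r).top = r := by
      change (r : ℤ) - 2 * (0 : ℕ) = r; simp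
    have hfi : ∀ n, n < r + 1 →
        (dualVerma r).f^[n] (some (.inl 0)) = (finElt r n).map Sum.inl := by
      intro n hn
      induction n with
      | zero => exact (congrArg (Option.map Sum.inl) (finElt_eq_some.mpr rfl)).symm
      | succ n ih =>
        rw [Function.iterate_succ_apply', ih (by omega),
          finElt_eq_some.mpr (show ((⟨n, by omega⟩ : Fin (r + 1)) : ℕ) = n from rfl)]
        rfl
    have hr : (dualVerma r).f^[r] (some (.inl 0)) = some (.inl (Fin.last r)) := by
      rw [hfi r (by omega), finElt_eq_some.mpr (Fin.val_last r)]; rfl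
    have hf : (Label.dualVerma r).crystal.FinStr (Label.dualVerma r).top := by
      refine ⟨r + 1, ?_⟩
      refine (Function.iterate_succ_apply' (dualVerma r).f r (some (.inl 0))).trans ?_
      rw [hr]
      exact Option.map_eq_none_iff.mpr (finElt_eq_none.mpr (by simp))
    have hp : ¬ (Label.dualVerma r).crystal.Pos (Label.dualVerma r).top := by
      intro h
      refine h.2 ((hW.down_up (c := Sum.inl (Fin.last r)) (n := r) hr ?_).mpr
        (Axioms.branch_up (a := Sum.inr 0) ⟨rfl, ?_⟩))
      · change 0 ≤ (r : ℤ) - (Fin.last r : ℕ); simp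
      · intro h'
        obtain ⟨c, -, hc⟩ := Option.map_eq_some_iff.mp h'
        simp at hc
    rw [hw, if_neg (by omega), if_pos hf, if_neg hp, Int.toNat_natCast]

end CrystalData

/-- Two sets related by a one-to-one correspondence have the same cardinality. -/
theorem Set.ncard_eq_of_rel {α : Type u} {β : Type v} {s : Set α} {t : Set β} (R : α → β → Prop)
    (h1 : ∀ a ∈ s, ∃ b ∈ t, R a b) (h2 : ∀ b ∈ t, ∃ a ∈ s, R a b)
    (h3 : ∀ {a a' b}, R a b → R a' b → a = a') (h4 : ∀ {a b b'}, R a b → R a b' → b = b') :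
    s.ncard = t.ncard := by
  choose f hf hR using h1
  refine Set.ncard_congr f hf (fun a b ha hb h => h3 (hR a ha) (h ▸ hR b hb)) fun b hb => ?_
  obtain ⟨a, ha, hab⟩ := h2 b hb
  exact ⟨a, ha, h4 (hR a ha) hab⟩

theorem Set.ncard_split {α : Type u} {s : Set α} (hs : s.Finite) (p : α → Prop) :
    s.ncard = {a | a ∈ s ∧ p a}.ncard + {a | a ∈ s ∧ ¬ p a}.ncard := by
  rw [← Set.ncard_union_eq ?_ (hs.subset fun a h => h.1) (hs.subset fun a h => h.1)]
  · congr 1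
    ext a
    simp only [Set.mem_union, Set.mem_ofPred_eq]
    tauto
  · rw [Set.disjoint_left]
    rintro a ⟨-, h⟩ ⟨-, h'⟩
    exact h' h

namespace CrystalData

open QuantumSl2

/-! ### Counting -/

/-- There are finitely many elements of each weight. -/
def LocFinite (B : CrystalData.{u}) : Prop := ∀ s : ℤ, {b | B.wt b = s}.Finite

/-- The elements of weight `s` for which `FinStr` and `Pos` have given truth values. -/
def stratum (B : CrystalData.{u}) (s : ℤ) (i j : Prop) : Set B.carrier :=
  {b | B.wt b = s ∧ (B.FinStr b ↔ i) ∧ (B.Pos b ↔ j)}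

/-- The elements killed by `ẽ` whose component has label `W`. -/
def roots (B : CrystalData.{u}) (W : Label) : Set B.carrier :=
  {x | B.e (some x) = none ∧ B.rootLabel x = W}

variable {B : CrystalData.{u}} {C : CrystalData.{v}}

theorem LocFinite.stratum (h : B.LocFinite) (s : ℤ) (i j : Prop) : (B.stratum s i j).Finite :=
  (h s).subset fun _ hb => hb.1

theorem rootLabel_eq_simple {r : ℕ} {x : B.carrier} :
    B.rootLabel x = .simple r ↔ B.wt x = r ∧ B.FinStr x ∧ B.Pos x := by
  unfold rootLabel
  split_ifs <;> simp [*] <;> omega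

theorem rootLabel_eq_dualVerma {r : ℕ} {x : B.carrier} :
    B.rootLabel x = .dualVerma r ↔ B.wt x = r ∧ B.FinStr x ∧ ¬ B.Pos x := by
  unfold rootLabel
  split_ifs <;> simp [*] <;> omega

theorem rootLabel_eq_tilting {r : ℕ} {x : B.carrier} :
    B.rootLabel x = .tilting r ↔ B.wt x = r ∧ ¬ B.FinStr x ∧ ¬ B.Pos x := by
  unfold rootLabel
  split_ifs <;> simp [*] <;> omega

theorem rootLabel_eq_verma {s : ℤ} {x : B.carrier} :
    B.rootLabel x = .verma s ↔ B.wt x = s ∧ (s < 0 ∨ ¬ B.FinStr x ∧ B.Pos x) := by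
  unfold rootLabel
  split_ifs <;> simp [*] <;> omega

theorem wt_rootLabel {x : B.carrier} {W : Label} (h : B.rootLabel x = W) :
    B.wt x = W.crystal.wt W.top := by
  cases W with
  | simple r => rw [(rootLabel_eq_simple.mp h).1]; change (r : ℤ) = r - 2 * (0 : ℕ); simp
  | verma s => rw [(rootLabel_eq_verma.mp h).1]; change s = s - 2 * ((0 : ℕ) : ℤ); simp
  | tilting r => rw [(rootLabel_eq_tilting.mp h).1]; change (r : ℤ) = r - 2 * ((0 : ℕ) : ℤ); simp
  | dualVerma r => rw [(rootLabel_eq_dualVerma.mp h).1]; change (r : ℤ) = r - 2 * (0 : ℕ); simp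

theorem LocFinite.roots (h : B.LocFinite) (W : Label) : (B.roots W).Finite :=
  (h _).subset fun _ hb => wt_rootLabel hb.2

namespace Axioms

variable (hB : B.Axioms)
include hB

theorem e_eq_none_of_ε {x : B.carrier} (h : B.ε x = 0) (hn : ¬ B.IsBranchPoint x) :
    B.e (some x) = none := by
  by_contra hne
  refine hn ⟨hne, fun h' => ?_⟩
  obtain ⟨y, hy⟩ := Option.ne_none_iff_exists'.mp hne
  rw [hy] at h'
  have := hB.ε_f h'; have := hB.ε_nonneg y; omega

theorem e_eq_none_iff {x : B.carrier} (h : -1 ≤ B.wt x) : B.e (some x) = none ↔ B.ε x = 0 := by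
  refine ⟨hB.root_ε, fun h' => hB.e_eq_none_of_ε h' (hB.not_branch_of_φ ?_)⟩
  have := hB.φ_eq x; omega

/-- In nonnegative weights `f̃` maps the elements of weight `r + 2` onto those elements of weight
`r` which are not killed by `ẽ`. -/
theorem ncard_roots_add (hf : B.LocFinite) {r : ℤ} (hr : 0 ≤ r) (i j : Prop) :
    {x | B.e (some x) = none ∧ x ∈ B.stratum r i j}.ncard + (B.stratum (r + 2) i j).ncard =
      (B.stratum r i j).ncard := by
  rw [Set.ncard_split (hf.stratum r i j) fun x => B.e (some x) = none]
  congr 1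
  · simp only [and_comm]
  · refine Set.ncard_eq_of_rel (fun b c => B.f (some b) = some c) ?_ ?_ hB.f_inj
      fun h h' => by simpa using h.symm.trans h'
    · rintro b ⟨h1, h2, h3⟩
      have hφ := hB.φ_eq b
      have := hB.ε_nonneg b
      obtain ⟨c, hc⟩ := hB.exists_down (n := 1) (b := b) (by omega)
      rw [down_one] at hc
      refine ⟨c, ⟨⟨?_, ?_, ?_⟩, ?_⟩, hc⟩
      · have := hB.wt_f hc; omega
      · rw [← hB.f_fin hc, h2]
      · have := hB.φ_f hc
        rw [← hB.pos_f_iff hc (by omega), h3]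
      · rw [hB.e_f hc]; simp
    · rintro c ⟨⟨h1, h2, h3⟩, h4⟩
      rw [hB.e_eq_none_iff (by omega)] at h4
      have := hB.ε_nonneg c
      obtain ⟨b, hb⟩ := hB.exists_f_of_ε_pos (c := c) (by omega)
      refine ⟨b, ⟨?_, ?_, ?_⟩, hb⟩
      · have := hB.wt_f hb; omega
      · rw [hB.f_fin hb, h2]
      · have := hB.φ_eq c
        rw [hB.pos_f_iff hb (by omega), h3]

/-- In negative weights `f̃` maps the elements of weight `s + 2` in infinite strings onto those
elements of weight `s` in infinite strings which are not on top of a string. -/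
theorem ncard_tops_add (hf : B.LocFinite) {s : ℤ} (hs : s < 0) :
    {x | B.wt x = s ∧ B.ε x = 0}.ncard + {x | B.wt x = s + 2 ∧ ¬ B.FinStr x}.ncard =
      {x | B.wt x = s ∧ ¬ B.FinStr x}.ncard := by
  rw [Set.ncard_split (s := {x | B.wt x = s ∧ ¬ B.FinStr x}) ((hf s).subset fun _ hb => hb.1)
    fun x => B.ε x = 0]
  congr 1
  · congr 1
    ext x
    simp only [Set.mem_ofPred_eq]
    refine ⟨fun ⟨h1, h2⟩ => ⟨⟨h1, fun h => ?_⟩, h2⟩, fun h => ⟨h.1.1, h.2⟩⟩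
    have := hB.fin_φ h; have := hB.φ_eq x; omega
  · refine Set.ncard_eq_of_rel (fun b c => B.f (some b) = some c) ?_ ?_ hB.f_inj
      fun h h' => by simpa using h.symm.trans h'
    · rintro b ⟨h1, h2⟩
      obtain ⟨c, hc⟩ := hB.exists_down (n := 1) (b := b) (fun h => absurd h h2)
      rw [down_one] at hc
      refine ⟨c, ⟨⟨?_, ?_⟩, ?_⟩, hc⟩
      · have := hB.wt_f hc; omega
      · rw [← hB.f_fin hc]; exact h2
      · have := hB.ε_f hc; have := hB.ε_nonneg b; omega
    · rintro c ⟨⟨h1, h2⟩, h4⟩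
      have := hB.ε_nonneg c
      obtain ⟨b, hb⟩ := hB.exists_f_of_ε_pos (c := c) (by omega)
      refine ⟨b, ⟨?_, ?_⟩, hb⟩
      · have := hB.wt_f hb; omega
      · rw [hB.f_fin hb]; exact h2

/-- Branch points correspond to the roots of the strings over which they lie. -/
theorem ncard_branch (r : ℕ) :
    {a | B.wt a = -r - 2 ∧ B.IsBranchPoint a}.ncard =
      {x | B.e (some x) = none ∧ B.wt x = r ∧ ¬ B.Pos x}.ncard := by
  refine Set.ncard_eq_of_rel (fun a x => ∃ z, B.Down r x z ∧ B.Branch a z) ?_ ?_ ?_ ?_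
  · rintro a ⟨hw, ha⟩
    obtain ⟨z, hz⟩ := branch_iff.mp ha
    have h1 := hB.φ_branch hz
    have h2 := hB.branch_φ hz
    have h3 := hB.branch_ε hz
    have h4 := hB.φ_eq a
    have h5 := hB.φ_eq z
    obtain ⟨x, hx⟩ := hB.exists_down_of_le (n := r) (c := z) (by omega)
    have h6 := hB.down_φ hx
    have h7 := hB.down_ε hx
    have h8 := hB.φ_eq x
    refine ⟨x, ⟨?_, by omega, fun hp => ?_⟩, z, hx, hz⟩
    · exact hB.e_eq_none_of_ε (by omega) (hB.not_branch_of_φ (by omega))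
    · exact hp.2 ((hB.down_up hx h1.ge).mpr (branch_up hz))
  · rintro x ⟨hx, hw, hp⟩
    have h1 := hB.root_ε hx
    have h2 := hB.φ_eq x
    obtain ⟨a, ha⟩ := (hB.up_root_iff (x := x) (by omega)).mp (by
      by_contra h; exact hp ⟨by omega, h⟩)
    rw [show (B.φ x).toNat = r by omega] at ha
    have h3 := hB.down_iterF (x := x) (n := r) (by omega)
    have h4 := hB.down_ε h3
    have h5 := hB.branch_φ ha
    have h6 := hB.branch_ε ha
    have h7 := hB.φ_eq a
    exact ⟨a, ⟨by omega, branch_iff.mpr ⟨_, ha⟩⟩, _, h3, ha⟩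
  · rintro a a' x ⟨z, hz, ha⟩ ⟨z', hz', ha'⟩
    obtain rfl := down_fun hz hz'
    exact hB.branch_inj ha ha'
  · rintro a x x' ⟨z, hz, ha⟩ ⟨z', hz', ha'⟩
    obtain rfl : z = z' := by simpa using ha.1.symm.trans ha'.1
    exact hB.down_inj hz hz'

theorem branch_wt_neg_one : {a | B.wt a = -1 ∧ B.IsBranchPoint a} = ∅ := by
  ext a
  simp only [Set.mem_ofPred_eq, Set.mem_empty_iff_false, iff_false, not_and]
  intro h1
  refine hB.not_branch_of_φ ?_
  have := hB.φ_eq a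
  have := hB.ε_nonneg a
  omega

theorem ncard_negative_tops (hf : B.LocFinite) (s : ℤ) :
    {x | B.wt x = s ∧ B.ε x = 0}.ncard =
      {x | B.e (some x) = none ∧ B.wt x = s}.ncard +
        {a | B.wt a = s ∧ B.IsBranchPoint a}.ncard := by
  rw [Set.ncard_split ((hf s).subset fun _ hb => hb.1) fun x => B.e (some x) = none]
  congr 2
  · ext x
    simp only [Set.mem_ofPred_eq]
    exact ⟨fun h => ⟨h.2, h.1.1⟩, fun h => ⟨⟨h.2, hB.root_ε h.1⟩, h.1⟩⟩
  · ext x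
    simp only [Set.mem_ofPred_eq]
    refine ⟨fun h => ⟨h.1.1, ?_⟩, fun h => ⟨⟨h.1, ?_⟩, h.2.1⟩⟩
    · by_contra h'; exact h.2 (hB.e_eq_none_of_ε h.1.2 h')
    · obtain ⟨z, hz⟩ := branch_iff.mp h.2
      exact hB.branch_ε hz

end Axioms

section

variable (hB : B.Axioms) (hC : C.Axioms) (hfB : B.LocFinite) (hfC : C.LocFinite)
  (h : ∀ s i j, (B.stratum s i j).ncard = (C.stratum s i j).ncard)

include hB hC hfB hfC h

theorem ncard_nonneg_roots_eq {r : ℤ} (hr : 0 ≤ r) (i j : Prop) :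
    {x | B.e (some x) = none ∧ x ∈ B.stratum r i j}.ncard =
      {x | C.e (some x) = none ∧ x ∈ C.stratum r i j}.ncard := by
  have h1 := hB.ncard_roots_add hfB hr i j
  have h2 := hC.ncard_roots_add hfC hr i j
  have := h r i j; have := h (r + 2) i j; omega

omit hB hC in
theorem ncard_not_fin_eq (s : ℤ) :
    {x | B.wt x = s ∧ ¬ B.FinStr x}.ncard = {x | C.wt x = s ∧ ¬ C.FinStr x}.ncard := by
  rw [Set.ncard_split ((hfB s).subset fun _ hb => hb.1) B.Pos,
    Set.ncard_split ((hfC s).subset fun _ hb => hb.1) C.Pos]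
  have h1 := h s False True
  have h2 := h s False False
  simp only [stratum, iff_true, iff_false] at h1 h2
  simp only [Set.mem_ofPred_eq, and_assoc, h1, h2]

/-- Crystals with the same number of elements of each kind have the same components. -/
theorem ncard_roots_eq (W : Label) : (B.roots W).ncard = (C.roots W).ncard := by
  have key := fun r i j hr => ncard_nonneg_roots_eq hB hC hfB hfC h (r := r) hr i j
  cases W with
  | simple r =>
    have := key r True True (by omega)
    simpa only [roots, rootLabel_eq_simple, stratum, iff_true, Set.mem_ofPred_eq] using this
  | dualVerma r =>
    have := key r True False (by omega)
    simpa only [roots, rootLabel_eq_dualVerma, stratum, iff_true, iff_false,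
      Set.mem_ofPred_eq] using this
  | tilting r =>
    have := key r False False (by omega)
    simpa only [roots, rootLabel_eq_tilting, stratum, iff_false, Set.mem_ofPred_eq] using this
  | verma s =>
    by_cases hs : 0 ≤ s
    · have := key s False True hs
      simpa only [roots, rootLabel_eq_verma, stratum, iff_false, iff_true, not_lt.mpr hs,
        false_or, Set.mem_ofPred_eq] using this
    · simp only [roots, rootLabel_eq_verma, not_le.mp hs, true_or, and_true]
      have hbr : {a | B.wt a = s ∧ B.IsBranchPoint a}.ncard =
          {a | C.wt a = s ∧ C.IsBranchPoint a}.ncard := by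
        rcases eq_or_ne s (-1) with rfl | hs1
        · rw [hB.branch_wt_neg_one, hC.branch_wt_neg_one, Set.ncard_empty, Set.ncard_empty]
        · obtain ⟨r, rfl⟩ : ∃ r : ℕ, s = -r - 2 := ⟨(-s - 2).toNat, by omega⟩
          rw [hB.ncard_branch, hC.ncard_branch]
          rw [Set.ncard_split ((hfB r).subset fun _ hb => hb.2.1) B.FinStr,
            Set.ncard_split ((hfC r).subset fun _ hb => hb.2.1) C.FinStr]
          have h1 := key r True False (by omega)
          have h2 := key r False False (by omega)
          simp only [stratum, iff_true, iff_false, Set.mem_ofPred_eq] at h1 h2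
          simp only [Set.mem_ofPred_eq]
          convert congrArg₂ (· + ·) h1 h2 using 5 <;> tauto
      have h1 := hB.ncard_tops_add hfB (not_le.mp hs)
      have h2 := hC.ncard_tops_add hfC (not_le.mp hs)
      have h3 := ncard_not_fin_eq hfB hfC h s
      have h4 := ncard_not_fin_eq hfB hfC h (s + 2)
      have h5 := hB.ncard_negative_tops hfB s
      have h6 := hC.ncard_negative_tops hfC s
      omega

end

/-- The elements killed by `ẽ`, sorted by label. -/
noncomputable def rootsEquiv (B : CrystalData.{u}) :
    {x // B.e (some x) = none} ≃ Σ W, B.roots W where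
  toFun x := ⟨B.rootLabel x, x.1, x.2, rfl⟩
  invFun y := ⟨y.2.1, y.2.2.1⟩
  left_inv _ := rfl
  right_inv := by
    rintro ⟨W, x, hx, rfl⟩
    rfl

/-- Two locally finite crystals with equally many components of each kind are equivalent. -/
theorem equivalent_of_ncard_roots (hB : B.Axioms) (hC : C.Axioms) (hfB : B.LocFinite)
    (hfC : C.LocFinite) (h : ∀ W, (B.roots W).ncard = (C.roots W).ncard) : Equivalent B C := by
  have hW : ∀ W, Nonempty (B.roots W ≃ C.roots W) := by
    intro W
    have := (hfB.roots W).to_subtype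
    have := (hfC.roots W).to_subtype
    rw [← Finite.card_eq, Nat.card_coe_set_eq, Nat.card_coe_set_eq, h]
  let k := fun W => (hW W).some
  let g := (rootsEquiv B).trans ((Equiv.sigmaCongrRight k).trans (rootsEquiv C).symm)
  refine hB.decomposition.symm.trans (Equivalent.trans ?_ hC.decomposition)
  refine directSum_congr (fun _ => Label.crystal_axioms _) g fun x => ?_
  rw [show C.rootLabel (g x).1 = B.rootLabel x from (k _ ⟨x.1, x.2, rfl⟩).2.2]
  exact Equivalent.refl _

/-- Two locally finite crystals with equally many elements of each kind are equivalent. -/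
theorem equivalent_of_ncard_stratum (hB : B.Axioms) (hC : C.Axioms) (hfB : B.LocFinite)
    (hfC : C.LocFinite) (h : ∀ s i j, (B.stratum s i j).ncard = (C.stratum s i j).ncard) :
    Equivalent B C :=
  equivalent_of_ncard_roots hB hC hfB hfC (ncard_roots_eq hB hC hfB hfC h)

/-- Locally finite crystals are equivalent already if some bijection preserves the weight, `FinStr`
and `Pos`; it need not commute with `ẽ` and `f̃`. -/
theorem equivalent_of_equiv (hB : B.Axioms) (hC : C.Axioms) (hfB : B.LocFinite)
    (hfC : C.LocFinite) (g : B.carrier ≃ C.carrier) (hw : ∀ b, C.wt (g b) = B.wt b)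
    (hF : ∀ b, C.FinStr (g b) ↔ B.FinStr b) (hP : ∀ b, C.Pos (g b) ↔ B.Pos b) :
    Equivalent B C := by
  refine equivalent_of_ncard_stratum hB hC hfB hfC fun s i j => ?_
  rw [← Set.ncard_image_of_injective _ g.injective]
  congr 1
  ext c
  constructor
  · rintro ⟨b, ⟨h1, h2, h3⟩, rfl⟩
    exact ⟨(hw b).trans h1, (hF b).trans h2, (hP b).trans h3⟩
  · rintro ⟨h1, h2, h3⟩
    obtain ⟨b, rfl⟩ := g.surjective c
    exact ⟨b, ⟨(hw b).symm.trans h1, (hF b).symm.trans h2, (hP b).symm.trans h3⟩, rfl⟩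

theorem Equivalent.ncard_roots_eq (hC : C.Axioms) (h : Equivalent B C) (W : Label) :
    (B.roots W).ncard = (C.roots W).ncard := by
  obtain ⟨g, hg⟩ := h
  rw [← Set.ncard_image_of_injective _ g.injective]
  congr 1
  ext c
  obtain ⟨b, rfl⟩ := g.surjective c
  rw [g.injective.mem_set_image]
  have he : C.e (some (g b)) = _ := hg.map_e (some b)
  simp only [roots, Set.mem_ofPred_eq, he, Option.map_eq_none_iff,
    (Equivalent.embedding hg).rootLabel_eq hC.e_zero]

/-- The direct sum of the indecomposable crystals with multiplicities `n`. -/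
def ofMult (n : Label → ℕ) : CrystalData.{0} :=
  directSum fun p : Σ W : Label, Fin (n W) => p.1.crystal

theorem ofMult_axioms (n : Label → ℕ) : (ofMult n).Axioms :=
  directSum_axioms fun p => p.1.crystal_axioms

theorem ncard_roots_ofMult (n : Label → ℕ) (W : Label) : ((ofMult n).roots W).ncard = n W := by
  have key := fun p : Σ W : Label, Fin (n W) =>
    directSum_embedding (fun p : Σ W : Label, Fin (n W) => p.1.crystal_axioms) p
  have hl : ∀ p : Σ W : Label, Fin (n W), ∀ c, (ofMult n).rootLabel ⟨p, c⟩ =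
      p.1.crystal.rootLabel c := fun p c => (key p).rootLabel_eq rfl c
  have he : ∀ p : Σ W : Label, Fin (n W), ∀ c, (ofMult n).e (some ⟨p, c⟩) = none ↔
      c = p.1.top := by
    intro p c
    rw [← Label.e_eq_none_iff]
    exact Option.map_eq_none_iff
  have : (ofMult n).roots W =
      Set.range fun k : Fin (n W) => (⟨⟨W, k⟩, W.top⟩ : (ofMult n).carrier) := by
    ext ⟨⟨W', k⟩, c⟩
    constructor
    · rintro ⟨h1, h2⟩
      obtain rfl := (he _ _).mp h1
      rw [hl, rootLabel_top] at h2
      dsimp only at h2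
      subst h2
      exact ⟨k, rfl⟩
    · rintro ⟨k', h⟩
      cases h
      exact ⟨(he _ _).mpr rfl, (hl _ _).trans (rootLabel_top W)⟩
  have hinj : Function.Injective fun k : Fin (n W) => (⟨⟨W, k⟩, W.top⟩ : (ofMult n).carrier) := by
    intro k k' h
    cases h
    rfl
  rw [this, ← Set.image_univ]
  refine (Set.ncard_image_of_injective _ hinj).trans ?_
  rw [Set.ncard_univ, Nat.card_eq_fintype_card, Fintype.card_fin]

/-- The multiplicities are determined by the crystal. -/
theorem ofMult_injective {n n' : Label → ℕ} (h : Equivalent (ofMult n) (ofMult n')) : n = n' := by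
  funext W
  rw [← ncard_roots_ofMult n, h.ncard_roots_eq (ofMult_axioms n'), ncard_roots_ofMult]

/-- The weights are bounded above, with finitely many elements of each weight. -/
def WeightFinite (B : CrystalData.{u}) : Prop := B.LocFinite ∧ ∃ n : ℤ, ∀ b, B.wt b < n

theorem WeightFinite.tensor (hB : B.WeightFinite) (hC : C.WeightFinite) :
    (B.tensor C).WeightFinite := by
  obtain ⟨hB, n, hn⟩ := hB
  obtain ⟨hC, m, hm⟩ := hC
  refine ⟨fun s => ?_, n + m, fun b => ?_⟩
  · refine ((Set.finite_Icc (s - m) n).biUnion (t := fun t => {b | B.wt b = t} ×ˢ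
      {c | C.wt c = s - t}) fun t _ => (hB t).prod (hC (s - t))).subset ?_
    rintro ⟨b, c⟩ h
    change B.wt b + C.wt c = s at h
    have := hn b; have := hm c
    simp only [Set.mem_iUnion, Set.mem_Icc, Set.mem_prod, Set.mem_ofPred_eq]
    exact ⟨B.wt b, ⟨by omega, by omega⟩, rfl, by omega⟩
  · have := hn b.1; have := hm b.2
    change B.wt b.1 + C.wt b.2 < _
    omega

end CrystalData

namespace QuantumSl2

open CrystalData

theorem Label.weightFinite (W : Label) : W.crystal.WeightFinite := by
  cases W with
  | simple r =>
    refine ⟨fun s => Set.toFinite (α := Fin (r + 1)) _, r + 1, fun j => ?_⟩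
    change (r : ℤ) - 2 * (Fin.val j : ℤ) < r + 1; omega
  | verma s =>
    refine ⟨fun t => Set.Finite.subset (Set.finite_Iic (α := ℕ) (s - t).toNat) fun j hj => ?_,
      s + 1, fun j => ?_⟩
    · change ℕ at j
      change s - 2 * (j : ℤ) = t at hj
      change j ≤ _; omega
    · change ℕ at j
      change s - 2 * (j : ℤ) < s + 1; omega
  | tilting r =>
    refine ⟨fun t => ?_, r + 1, ?_⟩
    · refine Set.Finite.subset (((Set.finite_Iic (α := ℕ) (r - t).toNat).image Sum.inl).union
        ((Set.finite_Iic (α := ℕ) (r - t).toNat).image Sum.inr)) ?_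
      rintro (j | j) hj
      · refine Or.inl ⟨j, ?_, rfl⟩
        change (r : ℤ) - 2 * (j : ℤ) = t at hj
        change j ≤ _; omega
      · refine Or.inr ⟨j, ?_, rfl⟩
        change -(r : ℤ) - 2 - 2 * (j : ℤ) = t at hj
        change j ≤ _; omega
    · rintro (j | j)
      · change (r : ℤ) - 2 * (j : ℤ) < r + 1; omega
      · change -(r : ℤ) - 2 - 2 * (j : ℤ) < r + 1; omega
  | dualVerma r =>
    refine ⟨fun t => ?_, r + 1, ?_⟩
    · refine Set.Finite.subset ((Set.toFinite (Set.range Sum.inl)).union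
        ((Set.finite_Iic (α := ℕ) (r - t).toNat).image Sum.inr)) ?_
      rintro (j | j) hj
      · exact Or.inl ⟨j, rfl⟩
      · refine Or.inr ⟨j, ?_, rfl⟩
        change -(r : ℤ) - 2 - 2 * (j : ℤ) = t at hj
        change j ≤ _; omega
    · rintro (j | j)
      · change (r : ℤ) - 2 * (Fin.val j : ℤ) < r + 1; omega
      · change -(r : ℤ) - 2 - 2 * (j : ℤ) < r + 1; omega

end QuantumSl2

namespace CrystalData

open QuantumSl2

/-! ### Commutativity and associativity -/

section

variable {X Y Z : CrystalData.{u}}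

theorem tensor_comm_of_weightFinite (hX : X.Axioms) (hY : Y.Axioms) (fX : X.WeightFinite)
    (fY : Y.WeightFinite) : Equivalent (X.tensor Y) (Y.tensor X) := by
  refine equivalent_of_equiv (hX.tensor hY) (hY.tensor hX) (fX.tensor fY).1 (fY.tensor fX).1
    (Equiv.prodComm _ _) (fun b => add_comm _ _) (fun b => ?_) (fun b => ?_)
  · exact (hY.tensor_finStr hX).trans (and_comm.trans (hX.tensor_finStr hY).symm)
  · exact (hY.tensor_pos hX).trans (and_comm.trans (hX.tensor_pos hY).symm)

theorem tensor_assoc_of_weightFinite (hX : X.Axioms) (hY : Y.Axioms) (hZ : Z.Axioms)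
    (fX : X.WeightFinite) (fY : Y.WeightFinite) (fZ : Z.WeightFinite) :
    Equivalent (X.tensor (Y.tensor Z)) ((X.tensor Y).tensor Z) := by
  refine equivalent_of_equiv (hX.tensor (hY.tensor hZ)) ((hX.tensor hY).tensor hZ)
    (fX.tensor (fY.tensor fZ)).1 ((fX.tensor fY).tensor fZ).1
    (Equiv.prodAssoc _ _ _).symm (fun b => add_assoc _ _ _) (fun b => ?_) (fun b => ?_)
  · refine ((hX.tensor hY).tensor_finStr hZ).trans ?_
    refine Iff.trans ?_ (hX.tensor_finStr (hY.tensor hZ)).symm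
    refine (and_congr_left' (hX.tensor_finStr hY)).trans ?_
    exact and_assoc.trans (and_congr_right' (hY.tensor_finStr hZ).symm)
  · refine ((hX.tensor hY).tensor_pos hZ).trans ?_
    refine Iff.trans ?_ (hX.tensor_pos (hY.tensor hZ)).symm
    refine (and_congr_left' (hX.tensor_pos hY)).trans ?_
    exact and_assoc.trans (and_congr_right' (hY.tensor_pos hZ).symm)

/-- The tensor product of branched crystals is commutative: both sides are direct sums of products
of two indecomposable crystals, and these have finitely many elements of each weight, so that they
are determined by counting. -/
theorem tensor_comm (hX : X.Axioms) (hY : Y.Axioms) : Equivalent (X.tensor Y) (Y.tensor X) := by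
  have dX := hX.decomposition
  have dY := hY.decomposition
  have cX := fun x : {x // X.e (some x) = none} => (X.rootLabel x).crystal_axioms
  have cY := fun x : {x // Y.e (some x) = none} => (Y.rootLabel x).crystal_axioms
  refine (dX.symm.tensor dY.symm rfl).trans ((tensor_directSum cX cY).symm.trans ?_)
  refine Equivalent.trans ?_ ((tensor_directSum cY cX).trans (dY.tensor dX hX.e_zero))
  refine directSum_congr (fun p => (cY p.1).tensor (cX p.2)) (Equiv.prodComm _ _) fun p => ?_
  exact tensor_comm_of_weightFinite (cX _) (cY _) (Label.weightFinite _) (Label.weightFinite _)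

theorem tensor_assoc_directSum {I J K : Type u} {A : I → CrystalData.{v}}
    {B : J → CrystalData.{v}} {C : K → CrystalData.{v}} (hA : ∀ i, (A i).Axioms)
    (hB : ∀ j, (B j).Axioms) (hC : ∀ k, (C k).Axioms) (fA : ∀ i, (A i).WeightFinite)
    (fB : ∀ j, (B j).WeightFinite) (fC : ∀ k, (C k).WeightFinite) :
    Equivalent ((directSum A).tensor ((directSum B).tensor (directSum C)))
      (((directSum A).tensor (directSum B)).tensor (directSum C)) := by
  have hBC := fun p : J × K => (hB p.1).tensor (hC p.2)
  have hAB := fun p : I × J => (hA p.1).tensor (hB p.2)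
  have h1 : Equivalent ((directSum A).tensor ((directSum B).tensor (directSum C))) _ :=
    ((Equivalent.refl _).tensor (tensor_directSum hB hC).symm rfl).trans
      (tensor_directSum hA hBC).symm
  have h2 : Equivalent _ (((directSum A).tensor (directSum B)).tensor (directSum C)) :=
    (tensor_directSum hAB hC).trans ((tensor_directSum hA hB).tensor (Equivalent.refl _) rfl)
  refine h1.trans (Equivalent.trans ?_ h2)
  refine directSum_congr (fun p => (hAB p.1).tensor (hC p.2)) (Equiv.prodAssoc _ _ _).symm
    fun p => ?_
  exact tensor_assoc_of_weightFinite (hA _) (hB _) (hC _) (fA _) (fB _) (fC _)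

/-- The tensor product of branched crystals is associative: both sides are direct sums of products
of three indecomposable crystals, which are determined by counting. -/
theorem tensor_assoc (hX : X.Axioms) (hY : Y.Axioms) (hZ : Z.Axioms) :
    Equivalent (X.tensor (Y.tensor Z)) ((X.tensor Y).tensor Z) := by
  have dX := hX.decomposition
  have dY := hY.decomposition
  have dZ := hZ.decomposition
  have h := tensor_assoc_directSum
    (fun x : {x // X.e (some x) = none} => (X.rootLabel x).crystal_axioms)
    (fun x : {x // Y.e (some x) = none} => (Y.rootLabel x).crystal_axioms)
    (fun x : {x // Z.e (some x) = none} => (Z.rootLabel x).crystal_axioms)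
    (fun x => (X.rootLabel x).weightFinite) (fun x => (Y.rootLabel x).weightFinite)
    (fun x => (Z.rootLabel x).weightFinite)
  exact ((dX.symm.tensor (dY.symm.tensor dZ.symm rfl) rfl).trans h).trans
    ((dX.tensor dY hY.e_zero).tensor dZ hZ.e_zero)

end

end CrystalData

namespace QuantumSl2

/-! ### Scalars -/

theorem q_zpow_injective : Function.Injective fun n : ℤ => (q : Kq) ^ n := by
  have h : ∀ n : ℕ, q ^ n = (1 : Kq) → n = 0 := by
    intro n hn
    by_contra hne
    refine RatFunc.transcendental_X (K := ℂ) ⟨Polynomial.X ^ n - 1, ?_, ?_⟩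
    · exact (Polynomial.monic_X_pow_sub_C 1 hne).ne_zero
    · simp [hn]
  intro m n hmn
  simp only at hmn
  have h1 : (q : Kq) ^ (m - n) = 1 := by
    rw [zpow_sub₀ q_ne_zero, hmn, div_self (zpow_ne_zero _ q_ne_zero)]
  have h2 : (q : Kq) ^ (m - n).natAbs = 1 := by
    rcases Int.natAbs_eq (m - n) with h | h
    · rw [h, zpow_natCast] at h1; exact h1
    · rw [h, zpow_neg, zpow_natCast, inv_eq_one] at h1; exact h1
  have := h _ h2
  omega

theorem q_zpow_eq {m n : ℤ} : (q : Kq) ^ m = q ^ n ↔ m = n := q_zpow_injective.eq_iff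

theorem q_sub_inv_ne_zero : (q - q⁻¹ : Kq) ≠ 0 := by
  intro h
  have := (q_zpow_eq (m := 1) (n := -1)).mp (by simpa using sub_eq_zero.mp h)
  omega

/-- The `q`-integer `[n] = (qⁿ - q⁻ⁿ) / (q - q⁻¹)`. -/
noncomputable def qint (n : ℤ) : Kq := (q - q⁻¹)⁻¹ * (q ^ n - q ^ (-n))

theorem qint_zero : qint 0 = 0 := by simp [qint]

theorem qint_ne_zero {n : ℤ} (h : n ≠ 0) : qint n ≠ 0 := by
  refine mul_ne_zero (inv_ne_zero q_sub_inv_ne_zero) (sub_ne_zero.mpr fun h' => h ?_)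
  have := q_zpow_eq.mp h'
  omega

theorem qint_neg (n : ℤ) : qint (-n) = - qint n := by
  simp only [qint, neg_neg]; ring

theorem qint_one : qint 1 = 1 := by
  simp only [qint, zpow_one, zpow_neg]
  exact inv_mul_cancel₀ q_sub_inv_ne_zero

theorem qint_mul_sub (m n : ℤ) :
    qint (m + 1) * qint n - qint m * qint (n + 1) = qint (n - m) := by
  have h := q_sub_inv_ne_zero
  have hq := q_ne_zero
  have hm := zpow_ne_zero m hq
  have hn := zpow_ne_zero n hq
  have key : ∀ x y : Kq, x ≠ 0 → y ≠ 0 → (x * q - (x * q)⁻¹) * (y - y⁻¹) -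
      (x - x⁻¹) * (y * q - (y * q)⁻¹) = (q - q⁻¹) * (y * x⁻¹ - (y * x⁻¹)⁻¹) := by
    intro x y hx hy
    have : (q : Kq) ≠ 0 := hq
    field_simp
    ring
  have := key _ _ hm hn
  simp only [qint, zpow_neg, zpow_add₀ hq, zpow_one, zpow_sub₀ hq, div_eq_mul_inv]
  calc _ = (q - q⁻¹)⁻¹ * ((q - q⁻¹)⁻¹ * ((q ^ m * q - (q ^ m * q)⁻¹) * (q ^ n - (q ^ n)⁻¹) -
      (q ^ m - (q ^ m)⁻¹) * (q ^ n * q - (q ^ n * q)⁻¹))) := by ring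
    _ = _ := by rw [this, inv_mul_cancel_left₀ h]

open UqMod in
/-- The Casimir eigenvalues of two weights agree only when the weights do up to the dot action of
the Weyl group. -/
theorem casimirValue_eq {s t : ℤ} (h : casimirValue s = casimirValue t) : s = t ∨ s = -t - 2 := by
  have hq := q_ne_zero
  have hd : ((q - q⁻¹ : Kq) ^ 2)⁻¹ ≠ 0 := inv_ne_zero (pow_ne_zero 2 q_sub_inv_ne_zero)
  have h1 := mul_right_cancel₀ hd h
  have hx := zpow_ne_zero (s + 1) hq
  have hy := zpow_ne_zero (t + 1) hq
  rw [show -s - 1 = -(s + 1) by ring, show -t - 1 = -(t + 1) by ring, zpow_neg, zpow_neg] at h1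
  have key : ∀ x y : Kq, x ≠ 0 → y ≠ 0 → x + x⁻¹ = y + y⁻¹ → x = y ∨ x = y⁻¹ := by
    intro x y hx hy h
    have : (x - y) * (x * y - 1) = 0 := by
      field_simp at h
      linear_combination h
    rcases mul_eq_zero.mp this with h | h
    · exact Or.inl (sub_eq_zero.mp h)
    · exact Or.inr (eq_inv_of_mul_eq_one_left (sub_eq_zero.mp h))
  rcases key _ _ hx hy h1 with h | h
  · left; have := q_zpow_eq.mp h; omega
  · right; rw [← zpow_neg] at h; have := q_zpow_eq.mp h; omega

namespace UqMod

/-! ### Homomorphisms -/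

section

variable {M : UqMod.{u}} {N : UqMod.{v}} {P : UqMod.{w}}

/-- A linear map commuting with the action of `U_q(sl₂)`. -/
def IsHom (g : M.carrier →ₗ[Kq] N.carrier) : Prop :=
  ∀ (a : Uq) (m : M.carrier), g (M.ρ a m) = N.ρ a (g m)

theorem ρ_mul (a b : Uq) (m : M.carrier) : M.ρ (a * b) m = M.ρ a (M.ρ b m) := by
  rw [map_mul, Module.End.mul_apply]

theorem Kinv_of_K {m : M.carrier} {s : ℤ} (h : M.ρ K m = q ^ s • m) :
    M.ρ Kinv m = q ^ (-s) • m := by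
  have h1 : M.ρ Kinv (M.ρ K m) = m := by
    rw [← ρ_mul, satisfies_gen.kinv_k, map_one, Module.End.one_apply]
  rw [h, map_smul] at h1
  rw [← h1, smul_smul, zpow_neg, inv_mul_cancel₀ (zpow_ne_zero _ q_ne_zero), one_smul, h1]

theorem uq_induction {p : Uq → Prop} (h1 : ∀ c : Kq, p (algebraMap Kq Uq c)) (hE : p E) (hF : p F)
    (hK : p K) (hK' : p Kinv) (hadd : ∀ a b, p a → p b → p (a + b))
    (hmul : ∀ a b, p a → p b → p (a * b)) (a : Uq) : p a := by
  obtain ⟨x, rfl⟩ := RingQuot.mkAlgHom_surjective Kq Rel a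
  induction x using FreeAlgebra.induction with
  | grade0 c => rw [AlgHom.commutes]; exact h1 c
  | grade1 g => cases g <;> assumption
  | mul a b ha hb => rw [map_mul]; exact hmul _ _ ha hb
  | add a b ha hb => rw [map_add]; exact hadd _ _ ha hb

/-- It suffices to check commutation with the generators `e, f, k`. -/
theorem isHom_of_gen {g : M.carrier →ₗ[Kq] N.carrier} (hE : ∀ m, g (M.ρ E m) = N.ρ E (g m))
    (hF : ∀ m, g (M.ρ F m) = N.ρ F (g m)) (hK : ∀ m, g (M.ρ K m) = N.ρ K (g m)) : IsHom g := by
  intro a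
  induction a using uq_induction with
  | h1 c => intro m; simp [Module.algebraMap_end_apply]
  | hE => exact hE
  | hF => exact hF
  | hK => exact hK
  | hK' =>
    intro m
    have h1 : M.ρ K (M.ρ Kinv m) = m := by
      rw [← ρ_mul, satisfies_gen.k_kinv, map_one, Module.End.one_apply]
    have h2 : N.ρ Kinv (N.ρ K (g (M.ρ Kinv m))) = g (M.ρ Kinv m) := by
      rw [← ρ_mul, satisfies_gen.kinv_k, map_one, Module.End.one_apply]
    rw [← h2, ← hK, h1]
  | hadd a b ha hb => intro m; rw [map_add, map_add, LinearMap.add_apply, LinearMap.add_apply,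
      map_add, ha, hb]
  | hmul a b ha hb => intro m; rw [ρ_mul, ρ_mul, ha, hb]

theorem Iso.symm (h : Iso M N) : Iso N M := by
  obtain ⟨g, hg⟩ := h
  refine ⟨g.symm, fun a m => ?_⟩
  rw [LinearEquiv.symm_apply_eq, hg, LinearEquiv.apply_symm_apply]

theorem Iso.trans (h : Iso M N) (h' : Iso N P) : Iso M P := by
  obtain ⟨g, hg⟩ := h
  obtain ⟨g', hg'⟩ := h'
  exact ⟨g.trans g', fun a m => by simp only [LinearEquiv.trans_apply, hg, hg']⟩

theorem iso_of_bijective {g : M.carrier →ₗ[Kq] N.carrier} (hg : IsHom g)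
    (hb : Function.Bijective g) : Iso M N :=
  ⟨LinearEquiv.ofBijective g hb, hg⟩

end

section tensor

variable {M M' : UqMod.{u}} {N N' : UqMod.{v}}

/-- The tensor `m ⊗ n` as an element of the module `M ⊗ N`. -/
noncomputable def tmul (m : M.carrier) (n : N.carrier) : (M.tensor N).carrier := m ⊗ₜ[Kq] n

theorem tensor_ext {X : Type w} [AddCommGroup X] [Module Kq X]
    {g h : (M.tensor N).carrier →ₗ[Kq] X} (H : ∀ m n, g (tmul m n) = h (tmul m n)) : g = h :=
  TensorProduct.ext' H

theorem tmul_smul (c : Kq) (m : M.carrier) (n : N.carrier) : tmul m (c • n) = c • tmul m n :=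
  TensorProduct.tmul_smul c m n

theorem smul_tmul (c : Kq) (m : M.carrier) (n : N.carrier) : tmul (c • m) n = c • tmul m n := rfl

theorem tmul_zero (m : M.carrier) : tmul m (0 : N.carrier) = 0 := TensorProduct.tmul_zero _ m

theorem zero_tmul (n : N.carrier) : tmul (0 : M.carrier) n = 0 := TensorProduct.zero_tmul _ n

theorem tensor_ρ (a : Uq) : (M.tensor N).ρ a =
    Module.endTensorEndAlgHom (R := Kq) (S := Kq) (A := Kq)
      (Algebra.TensorProduct.map M.ρ N.ρ (comul a)) := rfl

theorem tensor_E (m : M.carrier) (n : N.carrier) :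
    (M.tensor N).ρ E (tmul m n) = tmul (M.ρ E m) (N.ρ K n) + tmul m (N.ρ E n) := by
  have : comul E = E ⊗ₜ K + 1 ⊗ₜ E := lift_gen satisfies_comul .e
  rw [tensor_ρ, this, map_add, Algebra.TensorProduct.map_tmul, Algebra.TensorProduct.map_tmul,
    map_add, map_one]
  rfl

theorem tensor_F (m : M.carrier) (n : N.carrier) :
    (M.tensor N).ρ F (tmul m n) = tmul (M.ρ F m) n + tmul (M.ρ Kinv m) (N.ρ F n) := by
  have : comul F = F ⊗ₜ 1 + Kinv ⊗ₜ F := lift_gen satisfies_comul .f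
  rw [tensor_ρ, this, map_add, Algebra.TensorProduct.map_tmul, Algebra.TensorProduct.map_tmul,
    map_add, map_one]
  rfl

theorem tensor_K (m : M.carrier) (n : N.carrier) :
    (M.tensor N).ρ K (tmul m n) = tmul (M.ρ K m) (N.ρ K n) := by
  have : comul K = K ⊗ₜ K := lift_gen satisfies_comul .k
  rw [tensor_ρ, this, Algebra.TensorProduct.map_tmul]
  rfl

theorem Iso.tensor {M : UqMod.{u}} {M' : UqMod.{v}} {N : UqMod.{u}} {N' : UqMod.{v}}
    (h : Iso M M') (h' : Iso N N') : Iso (M.tensor N) (M'.tensor N') := by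
  obtain ⟨g, hg⟩ := h
  obtain ⟨g', hg'⟩ := h'
  let G : (M.tensor N).carrier ≃ₗ[Kq] (M'.tensor N').carrier := TensorProduct.congr g g'
  have hG : ∀ m n, G.toLinearMap (tmul m n) = tmul (g m) (g' n) := fun m n => rfl
  refine ⟨G, isHom_of_gen (g := G.toLinearMap) ?_ ?_ ?_⟩
  · refine LinearMap.congr_fun (f := G.toLinearMap ∘ₗ _) (g := _ ∘ₗ G.toLinearMap)
      (tensor_ext fun m n => ?_)
    simp only [LinearMap.comp_apply, hG, tensor_E, map_add, hg, hg']
  · refine LinearMap.congr_fun (f := G.toLinearMap ∘ₗ _) (g := _ ∘ₗ G.toLinearMap)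
      (tensor_ext fun m n => ?_)
    simp only [LinearMap.comp_apply, hG, tensor_F, map_add, hg, hg']
  · refine LinearMap.congr_fun (f := G.toLinearMap ∘ₗ _) (g := _ ∘ₗ G.toLinearMap)
      (tensor_ext fun m n => ?_)
    simp only [LinearMap.comp_apply, hG, tensor_K, hg, hg']

end tensor

end UqMod

end QuantumSl2

namespace CrystalData.Axioms

variable {B : CrystalData.{u}} (hB : B.Axioms)
include hB

/-- The top of a finite string is killed by `ẽ`, because the strings of branch points are
infinite. -/
theorem e_top_of_fin {b : B.carrier} (h : B.FinStr b) :
    B.e^[(B.ε b).toNat + 1] (some b) = none := by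
  obtain ⟨t, ht⟩ := hB.exists_down_of_le (n := (B.ε b).toNat) (c := b)
    (by have := hB.ε_nonneg b; omega)
  rw [Function.iterate_succ_apply', hB.down_e ht]
  have h1 := hB.down_ε ht
  have := hB.ε_nonneg b
  refine hB.e_eq_none_of_ε (by omega) fun hbr => ?_
  obtain ⟨z, hz⟩ := branch_iff.mp hbr
  exact hB.branch_not_fin hz ((hB.down_fin ht).mpr h)

end CrystalData.Axioms

namespace QuantumSl2

open CrystalData

namespace UqMod

/-! ### The module with a given crystal -/

section

/-- The basis vector with a given index, or zero. -/
noncomputable def finsuppVec {X : Type u} (x : Option X) : X →₀ Kq := x.elim 0 (Finsupp.single · 1)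

/-- The operator `f` on the space with basis `B`. -/
noncomputable def crystalF (B : CrystalData.{u}) : Module.End Kq (B.carrier →₀ Kq) :=
  Finsupp.linearCombination Kq fun b => finsuppVec (B.f (some b))

/-- The operator `k ^ t` on the space with basis `B`. -/
noncomputable def crystalK (B : CrystalData.{u}) (t : ℤ) : Module.End Kq (B.carrier →₀ Kq) :=
  Finsupp.linearCombination Kq fun b => (q : Kq) ^ (t * B.wt b) • finsuppVec (some b)

/-- The operator `e` on the space with basis `B`. The first term acts within an `f̃`-string, the
second one maps the string of a branch point `a` to the string of `ẽ a`. -/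
noncomputable def crystalE (B : CrystalData.{u}) : Module.End Kq (B.carrier →₀ Kq) :=
  Finsupp.linearCombination Kq fun b =>
    (qint (B.ε b) * qint (B.φ b + 1)) • finsuppVec (B.e (some b)) +
      finsuppVec (B.f^[(B.ε b).toNat] (B.e^[(B.ε b).toNat + 1] (some b)))

variable {B : CrystalData.{u}}

theorem crystalF_vec (h0 : B.f none = none) (x : Option B.carrier) :
    crystalF B (finsuppVec x) = finsuppVec (B.f x) := by
  cases x with
  | none => rw [h0]; exact map_zero _
  | some b => simp [crystalF, finsuppVec]

theorem crystalK_vec (t : ℤ) (b : B.carrier) :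
    crystalK B t (finsuppVec (some b)) = (q : Kq) ^ (t * B.wt b) • finsuppVec (some b) := by
  simp [crystalK, finsuppVec]

theorem crystalE_vec (b : B.carrier) :
    crystalE B (finsuppVec (some b)) =
    (qint (B.ε b) * qint (B.φ b + 1)) • finsuppVec (B.e (some b)) +
      finsuppVec (B.f^[(B.ε b).toNat] (B.e^[(B.ε b).toNat + 1] (some b))) := by
  simp [crystalE, finsuppVec]

theorem finsupp_hom_ext {X : Type u} {Y : Type v} [AddCommGroup Y] [Module Kq Y]
    {g h : (X →₀ Kq) →ₗ[Kq] Y} (H : ∀ x, g (finsuppVec (some x)) = h (finsuppVec (some x))) :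
    g = h :=
  Finsupp.lhom_ext' fun x => LinearMap.ext_ring (H x)

theorem crystalK_of_wt (t s : ℤ) (x : Option B.carrier) (h : ∀ b, x = some b → B.wt b = s) :
    crystalK B t (finsuppVec x) = (q : Kq) ^ (t * s) • finsuppVec x := by
  cases x with
  | none => simp [finsuppVec]
  | some b => rw [crystalK_vec, h b rfl]

theorem wt_iter_f (hB : B.Axioms) (n : ℕ) {s : ℤ} {x : Option B.carrier}
    (h : ∀ b, x = some b → B.wt b = s) {b : B.carrier} (hb : B.f^[n] x = some b) :
    B.wt b = s - 2 * n := by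
  induction n generalizing b with
  | zero => rw [h b hb]; simp
  | succ n ih =>
    rw [Function.iterate_succ_apply'] at hb
    cases hc : B.f^[n] x with
    | none => rw [hc, hB.f_zero] at hb; simp at hb
    | some c =>
      rw [hc] at hb
      have := hB.wt_f hb; have := ih hc; push_cast; omega

theorem wt_iter_e (hB : B.Axioms) (n : ℕ) {s : ℤ} {x : Option B.carrier}
    (h : ∀ b, x = some b → B.wt b = s) {b : B.carrier} (hb : B.e^[n] x = some b) :
    B.wt b = s + 2 * n := by
  induction n generalizing b with
  | zero => rw [h b hb]; simp
  | succ n ih =>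
    rw [Function.iterate_succ_apply'] at hb
    cases hc : B.e^[n] x with
    | none => rw [hc, hB.e_zero] at hb; simp at hb
    | some c =>
      rw [hc] at hb
      have := hB.wt_e hb; have := ih hc; push_cast; omega

/-- The commutation relation of `e` and `f` on a basis vector. -/
theorem crystalE_crystalF (hB : B.Axioms) (b : B.carrier) :
    crystalE B (crystalF B (finsuppVec (some b))) =
      crystalF B (crystalE B (finsuppVec (some b))) + qint (B.wt b) • finsuppVec (some b) := by
  have hε := hB.ε_nonneg b
  have hφ := hB.φ_eq b
  rw [crystalF_vec hB.f_zero, crystalE_vec, map_add, map_smul, crystalF_vec hB.f_zero,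
    crystalF_vec hB.f_zero, ← Function.iterate_succ_apply' B.f]
  have hfe : (qint (B.ε b) * qint (B.φ b + 1)) • finsuppVec (B.f (B.e (some b))) =
      (qint (B.ε b) * qint (B.φ b + 1)) • finsuppVec (some b) := by
    rcases hε.eq_or_lt with h | h
    · rw [← h, qint_zero, zero_mul, zero_smul, zero_smul]
    · obtain ⟨c, hc⟩ := hB.exists_f_of_ε_pos h
      rw [hB.e_f hc, hc]
  rw [hfe]
  cases hc : B.f (some b) with
  | none =>
    have h0 := hB.φ_bottom hc
    rw [hB.e_top_of_fin ⟨1, hc⟩, hB.iter_none, h0, zero_add, qint_one, mul_one,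
      show B.wt b = -B.ε b by omega, qint_neg, neg_smul]
    simp [finsuppVec]
  | some c =>
    have h1 := hB.ε_f hc
    have h2 := hB.φ_f hc
    rw [crystalE_vec, h1, h2, sub_add_cancel, hB.e_f hc,
      show (B.ε b + 1).toNat = (B.ε b).toNat + 1 by omega,
      Function.iterate_succ_apply B.e ((B.ε b).toNat + 1), hB.e_f hc,
      show B.wt b = B.φ b - B.ε b by omega, ← qint_mul_sub, sub_smul]
    abel

theorem crystal_satisfies (hB : B.Axioms) :
    Satisfies (crystalE B) (crystalF B) (crystalK B 1) (crystalK B (-1)) where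
  k_kinv := by
    refine finsupp_hom_ext fun b => ?_
    rw [Module.End.mul_apply, crystalK_vec, map_smul, crystalK_vec, smul_smul,
      ← zpow_add₀ q_ne_zero]
    simp
  kinv_k := by
    refine finsupp_hom_ext fun b => ?_
    rw [Module.End.mul_apply, crystalK_vec, map_smul, crystalK_vec, smul_smul,
      ← zpow_add₀ q_ne_zero]
    simp
  k_e := by
    refine finsupp_hom_ext fun b => ?_
    have h1 : ∀ c, B.e (some b) = some c → B.wt c = B.wt b + 2 := fun c hc => hB.wt_e hc
    have h2 : ∀ c, B.f^[(B.ε b).toNat] (B.e^[(B.ε b).toNat + 1] (some b)) = some c →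
        B.wt c = B.wt b + 2 := by
      intro c hc
      rw [wt_iter_f hB _ (fun d hd => wt_iter_e hB _ (s := B.wt b) (by simp +contextual) hd) hc]
      push_cast; ring
    rw [Module.End.mul_apply, Module.End.mul_apply, crystalK_vec, map_smul, map_smul, crystalE_vec,
      map_add, map_smul, crystalK_of_wt _ _ _ h1, crystalK_of_wt _ _ _ h2, LinearMap.smul_apply,
      crystalE_vec]
    rw [smul_comm (qint _ * _), ← smul_add, smul_smul, ← zpow_add₀ q_ne_zero]
    congr 1
    rw [← zpow_natCast]
    congr 1
    push_cast; ring
  k_f := by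
    refine finsupp_hom_ext fun b => ?_
    have h1 : ∀ c, B.f (some b) = some c → B.wt c = B.wt b - 2 := fun c hc => hB.wt_f hc
    rw [Module.End.mul_apply, Module.End.mul_apply, crystalK_vec, map_smul, map_smul,
      crystalF_vec hB.f_zero, crystalK_of_wt _ _ _ h1, LinearMap.smul_apply,
      crystalF_vec hB.f_zero, smul_smul, ← zpow_add₀ q_ne_zero]
    congr 1
    rw [← zpow_natCast, ← zpow_neg]
    congr 1
    push_cast; ring
  e_f := by
    refine finsupp_hom_ext fun b => ?_
    rw [LinearMap.sub_apply, Module.End.mul_apply, Module.End.mul_apply, crystalE_crystalF hB,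
      add_sub_cancel_left, LinearMap.smul_apply, LinearMap.sub_apply, crystalK_vec, crystalK_vec,
      ← sub_smul, smul_smul]
    simp [qint]

end

/-- The module with basis a branched crystal `B`, on which `f` and `k` act as `f̃` and `q ^ wt`. -/
noncomputable def ofCrystal {B : CrystalData.{u}} (hB : B.Axioms) : UqMod.{u} where
  carrier := B.carrier →₀ Kq
  ρ := lift (crystal_satisfies hB)

section

variable {B : CrystalData.{u}} (hB : B.Axioms)

/-- The basis `B` of the module with crystal `B`. -/
noncomputable def basis : Module.Basis B.carrier Kq (ofCrystal hB).carrier :=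
  Finsupp.basisSingleOne

/-- The basis vector with a given index, or zero. -/
noncomputable def vec (x : Option B.carrier) : (ofCrystal hB).carrier := finsuppVec x

theorem vec_none : vec hB none = 0 := rfl

theorem vec_some (b : B.carrier) : vec hB (some b) = basis hB b :=
  (congrFun Finsupp.coe_basisSingleOne b).symm

theorem ofCrystal_F (x : Option B.carrier) : (ofCrystal hB).ρ F (vec hB x) = vec hB (B.f x) :=
  (congrFun (congrArg DFunLike.coe (lift_gen (crystal_satisfies hB) .f)) _).trans
    (crystalF_vec hB.f_zero x)

theorem ofCrystal_K (b : B.carrier) :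
    (ofCrystal hB).ρ K (basis hB b) = (q : Kq) ^ B.wt b • basis hB b := by
  rw [← vec_some]
  refine (congrFun (congrArg DFunLike.coe (lift_gen (crystal_satisfies hB) .k)) _).trans
    ((crystalK_vec 1 b).trans ?_)
  rw [one_mul]
  rfl

theorem ofCrystal_E (b : B.carrier) :
    (ofCrystal hB).ρ E (basis hB b) = (qint (B.ε b) * qint (B.φ b + 1)) • vec hB (B.e (some b)) +
      vec hB (B.f^[(B.ε b).toNat] (B.e^[(B.ε b).toNat + 1] (some b))) := by
  rw [← vec_some]
  exact (congrFun (congrArg DFunLike.coe (lift_gen (crystal_satisfies hB) .e)) _).trans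
    (crystalE_vec b)

theorem ofCrystal_F_iter (n : ℕ) (x : Option B.carrier) :
    ((ofCrystal hB).ρ F ^ n) (vec hB x) = vec hB (B.f^[n] x) := by
  induction n generalizing x with
  | zero => rfl
  | succ n ih => rw [pow_succ, Module.End.mul_apply, ofCrystal_F, ih, Function.iterate_succ_apply]

end

/-- The commutation relation of `e` and `f` on a weight vector. -/
theorem ρ_E_F {M : UqMod.{u}} {s : ℤ} {m : M.carrier} (h : M.ρ K m = q ^ s • m) :
    M.ρ E (M.ρ F m) = M.ρ F (M.ρ E m) + qint s • m := by
  have h1 := congrArg (fun a => M.ρ a m) satisfies_gen.e_f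
  simp only [map_sub, LinearMap.sub_apply, map_smul, LinearMap.smul_apply, ρ_mul, h,
    Kinv_of_K h] at h1
  rw [← sub_smul, smul_smul] at h1
  rw [← sub_eq_iff_eq_add', h1]
  rfl

section

variable {B : CrystalData.{u}} {hB : B.Axioms} {V : UqMod.{v}}

/-- A linear map from the module with crystal `B` is a homomorphism if it is compatible with `f`
and `k` and, on the elements on top of an `f̃`-string, with `e`. -/
theorem isHom_ofCrystal {g : (ofCrystal hB).carrier →ₗ[Kq] V.carrier}
    (hF : ∀ b, g (vec hB (B.f (some b))) = V.ρ F (g (basis hB b)))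
    (hK : ∀ b, V.ρ K (g (basis hB b)) = (q : Kq) ^ B.wt b • g (basis hB b))
    (hE : ∀ b, B.ε b = 0 → V.ρ E (g (basis hB b)) = g (vec hB (B.e (some b)))) : IsHom g := by
  have hK' : g ∘ₗ (ofCrystal hB).ρ K = V.ρ K ∘ₗ g := (basis hB).ext fun b => by
    rw [LinearMap.comp_apply, LinearMap.comp_apply, ofCrystal_K, map_smul, hK]
  have hF' : g ∘ₗ (ofCrystal hB).ρ F = V.ρ F ∘ₗ g := (basis hB).ext fun b => by
    rw [LinearMap.comp_apply, LinearMap.comp_apply, ← hF, ← vec_some, ofCrystal_F]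
  have hF'' := LinearMap.congr_fun hF'
  simp only [LinearMap.comp_apply] at hF''
  refine isHom_of_gen (LinearMap.congr_fun (f := g ∘ₗ _) (g := _ ∘ₗ g) ((basis hB).ext fun b => ?_))
    hF'' (LinearMap.congr_fun hK')
  rw [LinearMap.comp_apply, LinearMap.comp_apply]
  obtain ⟨n, hn⟩ := Int.eq_ofNat_of_zero_le (hB.ε_nonneg b)
  induction n generalizing b with
  | zero =>
    rw [hE b hn, ofCrystal_E, hn]
    simp [qint_zero]
  | succ n ih =>
    obtain ⟨c, hc⟩ := hB.exists_f_of_ε_pos (c := b) (by omega)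
    have hbc : basis hB b = (ofCrystal hB).ρ F (basis hB c) := by
      rw [← vec_some, ← vec_some, ofCrystal_F, hc]
    rw [hbc, ρ_E_F (ofCrystal_K hB c), map_add, map_smul, hF'', hF'', ρ_E_F (hK c),
      ih c (by have := hB.ε_f hc; push_cast at hn; omega)]

end

end UqMod

end QuantumSl2

namespace QuantumSl2

/-! ### The Casimir element -/

theorem E_mul_F : (E * F : Uq) = F * E + (q - q⁻¹)⁻¹ • (K - Kinv) := by
  rw [← satisfies_gen.e_f]; abel

theorem F_mul_K : (F * K : Uq) = q ^ 2 • (K * F) := by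
  rw [K_mul_F, smul_smul, mul_inv_cancel₀ (pow_ne_zero 2 q_ne_zero), one_smul]

theorem E_mul_K : (E * K : Uq) = (q ^ 2)⁻¹ • (K * E) := by
  rw [K_mul_E, smul_smul, inv_mul_cancel₀ (pow_ne_zero 2 q_ne_zero), one_smul]

theorem Kinv_mul_F : (Kinv * F : Uq) = q ^ 2 • (F * Kinv) := by
  have h := congrArg (fun x => Kinv * (x * Kinv)) F_mul_K
  simpa [mul_assoc, satisfies_gen.k_kinv, ← mul_assoc Kinv K, satisfies_gen.kinv_k] using h

theorem add_smul_sub_add_smul {X : Type*} [AddCommGroup X] [Module Kq X] {c d p p' q₁ q₂ : Kq}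
    (h1 : c * p * q₁ + d = c * p) (h2 : c * p' * q₂ - d = c * p') (x y z : X) :
    x + d • (y - z) + c • (p • q₁ • y + p' • q₂ • z) = x + c • (p • y + p' • z) := by
  have h3 : x + d • (y - z) + c • (p • q₁ • y + p' • q₂ • z) =
      x + ((c * p * q₁ + d) • y + (c * p' * q₂ - d) • z) := by
    simp only [smul_add, smul_sub, add_smul, sub_smul, smul_smul, mul_assoc]; abel
  rw [h3, h1, h2, smul_add, smul_smul, smul_smul]

/-- The Casimir element is central. -/
theorem Casimir_comm (a : Uq) : Commute Casimir a := by
  have hd := q_sub_inv_ne_zero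
  have hq := q_ne_zero
  have h1 : ((q - q⁻¹) ^ 2)⁻¹ * q * (q ^ 2)⁻¹ + (q - q⁻¹)⁻¹ = ((q - q⁻¹) ^ 2)⁻¹ * q := by
    field_simp; ring
  have h2 : ((q - q⁻¹) ^ 2)⁻¹ * q⁻¹ * q ^ 2 - (q - q⁻¹)⁻¹ = ((q - q⁻¹) ^ 2)⁻¹ * q⁻¹ := by
    field_simp; ring
  have hK : Commute Casimir K := by
    unfold Commute SemiconjBy Casimir
    rw [add_mul, mul_add, mul_assoc, E_mul_K, mul_smul_comm, ← mul_assoc, F_mul_K, smul_mul_assoc,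
      smul_smul, inv_mul_cancel₀ (pow_ne_zero 2 hq), one_smul, mul_assoc]
    simp only [mul_smul_comm, smul_mul_assoc, add_mul, mul_add, satisfies_gen.k_kinv,
      satisfies_gen.kinv_k]
  have hK' : Commute Casimir Kinv := by
    have h := congrArg (fun x => Kinv * (x * Kinv)) hK.eq
    simp only [mul_assoc, satisfies_gen.k_kinv, mul_one] at h
    rw [← mul_assoc Kinv K, satisfies_gen.kinv_k, one_mul] at h
    exact h.symm
  induction a using UqMod.uq_induction with
  | h1 c => exact Algebra.commute_algebraMap_right c _
  | hE =>
    have h3 : E * Casimir = F * E * E + (q - q⁻¹)⁻¹ • (K * E - Kinv * E) +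
        ((q - q⁻¹) ^ 2)⁻¹ • (q • (q ^ 2)⁻¹ • (K * E) + q⁻¹ • q ^ 2 • (Kinv * E)) := by
      unfold Casimir
      rw [mul_add, ← mul_assoc, E_mul_F, add_mul, mul_smul_comm, mul_add, mul_smul_comm,
        mul_smul_comm, E_mul_K, E_mul_Kinv, smul_mul_assoc, sub_mul]
    have h4 : Casimir * E = F * E * E + ((q - q⁻¹) ^ 2)⁻¹ • (q • (K * E) + q⁻¹ • (Kinv * E)) := by
      unfold Casimir
      rw [add_mul, smul_mul_assoc, add_mul, smul_mul_assoc, smul_mul_assoc]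
    unfold Commute SemiconjBy
    rw [h3, h4]
    exact (add_smul_sub_add_smul h1 h2 _ _ _).symm
  | hF =>
    have h3 : Casimir * F = F * F * E + (q - q⁻¹)⁻¹ • (F * K - F * Kinv) +
        ((q - q⁻¹) ^ 2)⁻¹ • (q • (q ^ 2)⁻¹ • (F * K) + q⁻¹ • q ^ 2 • (F * Kinv)) := by
      unfold Casimir
      rw [add_mul, mul_assoc, E_mul_F, mul_add, smul_mul_assoc, add_mul, smul_mul_assoc,
        smul_mul_assoc, K_mul_F, Kinv_mul_F, mul_smul_comm, mul_sub, mul_assoc]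
    have h4 : F * Casimir = F * F * E + ((q - q⁻¹) ^ 2)⁻¹ • (q • (F * K) + q⁻¹ • (F * Kinv)) := by
      unfold Casimir
      rw [mul_add, mul_smul_comm, mul_add, mul_smul_comm, mul_smul_comm, mul_assoc]
    unfold Commute SemiconjBy
    rw [h3, h4]
    exact add_smul_sub_add_smul h1 h2 _ _ _
  | hK => exact hK
  | hK' => exact hK'
  | hadd a b ha hb => exact ha.add_right hb
  | hmul a b ha hb => exact ha.mul_right hb

namespace UqMod

variable {V : UqMod.{u}} {s : ℤ} {m : V.carrier}

theorem K_F_pow (h : V.ρ K m = q ^ s • m) (n : ℕ) :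
    V.ρ K ((V.ρ F ^ n) m) = q ^ (s - 2 * n) • (V.ρ F ^ n) m := by
  induction n with
  | zero => simpa using h
  | succ n ih =>
    have := mem_wt.mp (F_wt (mem_wt.mpr ih))
    rw [pow_succ', Module.End.mul_apply, this]
    congr 2; push_cast; ring

theorem K_E_pow (h : V.ρ K m = q ^ s • m) (n : ℕ) :
    V.ρ K ((V.ρ E ^ n) m) = q ^ (s + 2 * n) • (V.ρ E ^ n) m := by
  induction n with
  | zero => simpa using h
  | succ n ih =>
    have := mem_wt.mp (E_wt (mem_wt.mpr ih))
    rw [pow_succ', Module.End.mul_apply, this]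
    congr 2; push_cast; ring

/-- The action of `e` on the Verma module generated by a highest weight vector. -/
theorem E_F_pow (h : V.ρ K m = q ^ s • m) (h0 : V.ρ E m = 0) (n : ℕ) :
    V.ρ E ((V.ρ F ^ (n + 1)) m) = (qint (n + 1) * qint (s - n)) • (V.ρ F ^ n) m := by
  induction n with
  | zero =>
    rw [zero_add, pow_one, pow_zero, ρ_E_F h, h0, map_zero, zero_add, Module.End.one_apply]
    simp [qint_one]
  | succ n ih =>
    rw [pow_succ', Module.End.mul_apply, ρ_E_F (K_F_pow h (n + 1)), ih, map_smul,
      ← Module.End.mul_apply, ← pow_succ', ← add_smul]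
    congr 1
    have := qint_mul_sub (n + 1) (s - (n + 1))
    push_cast
    rw [sub_eq_iff_eq_add] at this
    rw [this, show s - (n + 1 : ℤ) - (n + 1) = s - 2 * (n + 1) by ring,
      show s - (n + 1 : ℤ) + 1 = s - n by ring]
    ring

/-- The scalar by which `eⁿ fⁿ` acts on a highest weight vector of weight `s`. -/
noncomputable def hwConst (s : ℤ) (n : ℕ) : Kq :=
  ∏ i ∈ Finset.range n, (qint (i + 1) * qint (s - i))

theorem hwConst_ne_zero {s : ℤ} {n : ℕ} (h : ∀ i : ℕ, i < n → s ≠ i) : hwConst s n ≠ 0 := by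
  refine Finset.prod_ne_zero_iff.mpr fun i hi => mul_ne_zero (qint_ne_zero (by omega))
    (qint_ne_zero ?_)
  have := h i (Finset.mem_range.mp hi)
  omega

theorem E_pow_F_pow (h : V.ρ K m = q ^ s • m) (h0 : V.ρ E m = 0) (n : ℕ) :
    (V.ρ E ^ n) ((V.ρ F ^ n) m) = hwConst s n • m := by
  induction n with
  | zero => simp [hwConst]
  | succ n ih =>
    rw [pow_succ, Module.End.mul_apply, E_F_pow h h0, map_smul, ih, smul_smul, hwConst, hwConst,
      Finset.prod_range_succ, mul_comm]

theorem Casimir_wt (h : V.ρ K m = q ^ s • m) :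
    V.ρ Casimir m = V.ρ F (V.ρ E m) + casimirValue s • m := by
  rw [Casimir, map_add, LinearMap.add_apply, ρ_mul, map_smul, map_add, map_smul, map_smul,
    LinearMap.smul_apply, LinearMap.add_apply, LinearMap.smul_apply, LinearMap.smul_apply, h,
    Kinv_of_K h, smul_smul, smul_smul, ← add_smul, smul_smul, casimirValue]
  congr 2
  rw [zpow_add₀ q_ne_zero, zpow_sub₀ q_ne_zero, zpow_one]
  ring

/-- The Casimir element minus its value on highest weight vectors of weight `r`. -/
noncomputable def blockElt (r : ℤ) : Uq := Casimir - algebraMap Kq Uq (casimirValue r)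

theorem blockElt_comm (r : ℤ) (n : ℕ) (a : Uq) : Commute (blockElt r ^ n) a :=
  ((Casimir_comm a).sub_left (Algebra.commute_algebraMap_left _ a)).pow_left n

theorem blockElt_wt (r : ℤ) (h : V.ρ K m = q ^ s • m) :
    V.ρ (blockElt r) m = V.ρ F (V.ρ E m) + (casimirValue s - casimirValue r) • m := by
  rw [blockElt, map_sub, LinearMap.sub_apply, Casimir_wt h, AlgHom.commutes,
    Module.algebraMap_end_apply, sub_smul, add_sub_assoc]

/-- `m` belongs to the generalized eigenspace of the Casimir element that contains the highest
weight vectors of weight `r`. -/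
def InBlock (V : UqMod.{u}) (r : ℤ) (m : V.carrier) : Prop := ∃ n, V.ρ (blockElt r ^ n) m = 0

theorem InBlock.map {r : ℤ} (h : V.InBlock r m) (a : Uq) : V.InBlock r (V.ρ a m) := by
  obtain ⟨n, hn⟩ := h
  exact ⟨n, by rw [← ρ_mul, (blockElt_comm r n a).eq, ρ_mul, hn, map_zero]⟩

theorem InBlock.map_pow {r : ℤ} (h : V.InBlock r m) (a : Uq) (n : ℕ) :
    V.InBlock r ((V.ρ a ^ n) m) := by
  rw [← _root_.map_pow]; exact h.map _

theorem InBlock.smul {r : ℤ} (h : V.InBlock r m) (c : Kq) : V.InBlock r (c • m) := by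
  obtain ⟨n, hn⟩ := h
  exact ⟨n, by rw [map_smul, hn, smul_zero]⟩

theorem InBlock.add {r : ℤ} {m' : V.carrier} (h : V.InBlock r m) (h' : V.InBlock r m') :
    V.InBlock r (m + m') := by
  obtain ⟨n, hn⟩ := h
  obtain ⟨n', hn'⟩ := h'
  refine ⟨n + n', ?_⟩
  rw [map_add, pow_add, ρ_mul _ _ m', hn', map_zero, (Commute.pow_pow_self _ n n').eq, ρ_mul, hn,
    map_zero, zero_add]

theorem inBlock_of_E_eq_zero (h : V.ρ K m = q ^ s • m) (h0 : V.ρ E m = 0) : V.InBlock s m :=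
  ⟨1, by rw [pow_one, blockElt_wt s h, h0, map_zero, sub_self, zero_smul, zero_add]⟩

theorem InBlock.eq_zero_of_E {r : ℤ} (hb : V.InBlock r m) (h : V.ρ K m = q ^ s • m)
    (h0 : V.ρ E m = 0) (hs : casimirValue s ≠ casimirValue r) : m = 0 := by
  obtain ⟨n, hn⟩ := hb
  have h1 : ∀ n : ℕ, V.ρ (blockElt r ^ n) m = (casimirValue s - casimirValue r) ^ n • m := by
    intro n
    induction n with
    | zero => simp
    | succ n ih =>
      rw [pow_succ', ρ_mul, ih, map_smul, blockElt_wt r h, h0, map_zero, zero_add, smul_smul,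
        pow_succ]
  rw [h1] at hn
  exact (smul_eq_zero.mp hn).resolve_left (pow_ne_zero _ (sub_ne_zero.mpr hs))

/-- On a block the operator `e` is injective except on the two critical weight spaces. -/
theorem InBlock.eq_zero_of_E_pow {r : ℤ} (hb : V.InBlock r m) (h : V.ρ K m = q ^ s • m) {n : ℕ}
    (h0 : (V.ρ E ^ n) m = 0)
    (hs : ∀ j : ℕ, j < n → casimirValue (s + 2 * j) ≠ casimirValue r) : m = 0 := by
  induction n generalizing m s with
  | zero => simpa using h0
  | succ n ih =>
    rw [pow_succ, Module.End.mul_apply] at h0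
    refine hb.eq_zero_of_E h ?_ (by simpa using hs 0 (Nat.succ_pos n))
    refine ih (hb.map E) (mem_wt.mp (E_wt (mem_wt.mpr h))) h0 fun j hj => ?_
    have := hs (j + 1) (by omega)
    rwa [show s + 2 + 2 * (j : ℤ) = s + 2 * ((j + 1 : ℕ) : ℤ) by push_cast; ring]

theorem casimirValue_ne {s r : ℤ} (h : s ≠ r) (h' : s ≠ -r - 2) :
    casimirValue s ≠ casimirValue r := fun hc => (casimirValue_eq hc).elim h h'

/-- In a block, `e t` for `t` of weight `-r - 2` comes from the highest weight vectors of weight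
`r`. -/
theorem InBlock.exists_top {r : ℕ} {t : V.carrier} (hb : V.InBlock r t)
    (h : V.ρ K t = q ^ (-(r : ℤ) - 2) • t) (h0 : (V.ρ E ^ (r + 2)) t = 0) :
    V.ρ E ((V.ρ E ^ (r + 1)) t) = 0 ∧
    V.ρ K ((V.ρ E ^ (r + 1)) t) = q ^ (r : ℤ) • (V.ρ E ^ (r + 1)) t ∧
    (hwConst r r)⁻¹ • (V.ρ F ^ r) ((V.ρ E ^ (r + 1)) t) = V.ρ E t := by
  have h1 : V.ρ E ((V.ρ E ^ (r + 1)) t) = 0 := by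
    rw [← Module.End.mul_apply, ← pow_succ', h0]
  have h2 : V.ρ K ((V.ρ E ^ (r + 1)) t) = q ^ (r : ℤ) • (V.ρ E ^ (r + 1)) t := by
    rw [K_E_pow h]; congr 2; push_cast; ring
  refine ⟨h1, h2, ?_⟩
  have hc : hwConst r r ≠ 0 := hwConst_ne_zero fun i hi => by omega
  have hEt : V.ρ K (V.ρ E t) = q ^ (-(r : ℤ)) • V.ρ E t := by
    rw [mem_wt.mp (E_wt (mem_wt.mpr h))]; congr 2; ring
  have hFx := K_F_pow h2 r
  rw [show (r : ℤ) - 2 * r = -r by ring] at hFx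
  set x := (V.ρ E ^ (r + 1)) t with hx
  have hbx : V.InBlock r x := hb.map_pow E _
  rw [← sub_eq_zero, sub_eq_add_neg, ← neg_one_smul Kq]
  refine InBlock.eq_zero_of_E_pow (n := r) (s := -r) (r := r)
    (((hbx.map_pow F r).smul _).add ((hb.map E).smul _)) ?_ ?_ fun j hj =>
      casimirValue_ne (by omega) (by omega)
  · rw [map_add, map_smul, map_smul, hFx, hEt, smul_add, smul_comm (q ^ _ : Kq),
      smul_comm (q ^ _ : Kq)]
  · rw [map_add, map_smul, map_smul, E_pow_F_pow h2 h1, smul_smul, inv_mul_cancel₀ hc, one_smul,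
      ← Module.End.mul_apply, ← pow_succ, ← hx, neg_one_smul, add_neg_cancel]

end UqMod

end QuantumSl2

namespace QuantumSl2

open CrystalData

namespace UqMod

/-! ### Generators of the indecomposable modules -/

section

variable {M : UqMod.{u}} {V : UqMod.{v}}

theorem IsHom.pow {g : M.carrier →ₗ[Kq] V.carrier} (hg : IsHom g) (a : Uq) (n : ℕ) (m : M.carrier) :
    g ((M.ρ a ^ n) m) = (V.ρ a ^ n) (g m) := by
  rw [← map_pow, ← map_pow, hg]

theorem casimirValue_neg (r : ℤ) : casimirValue (-r - 2) = casimirValue r := by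
  unfold casimirValue
  rw [add_comm]
  congr 3 <;> ring

/-- The space of possible images of the generator in a homomorphism from the indecomposable module
with label `W`. The generator is the vector of weight `-r - 2` on top of its `f̃`-string for `T(r)`
and `M(r)^σ`, and the highest weight vector otherwise. -/
def IsGen (V : UqMod.{u}) : Label → V.carrier → Prop
  | .simple r, x => V.ρ K x = q ^ (r : ℤ) • x ∧ V.ρ E x = 0 ∧ (V.ρ F ^ (r + 1)) x = 0
  | .verma s, x => V.ρ K x = q ^ s • x ∧ V.ρ E x = 0
  | .tilting r, x => V.ρ K x = q ^ (-(r : ℤ) - 2) • x ∧ V.InBlock r x ∧ (V.ρ E ^ (r + 2)) x = 0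
  | .dualVerma r, x => V.ρ K x = q ^ (-(r : ℤ) - 2) • x ∧ V.InBlock r x ∧
      (V.ρ E ^ (r + 2)) x = 0 ∧ (V.ρ F ^ (r + 1)) ((V.ρ E ^ (r + 1)) x) = 0

/-- The image of a basis vector, as a linear function of the image of the generator. -/
noncomputable def strand (V : UqMod.{u}) : (W : Label) → W.crystal.carrier → Module.End Kq V.carrier
  | .simple r => fun j : Fin (r + 1) => V.ρ F ^ (j : ℕ)
  | .verma _ => fun j : ℕ => V.ρ F ^ j
  | .tilting r => Sum.elim (fun j : ℕ => V.ρ F ^ j * ((hwConst r r)⁻¹ • V.ρ E ^ (r + 1)))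
      (fun j : ℕ => V.ρ F ^ j)
  | .dualVerma r =>
      Sum.elim (fun j : Fin (r + 1) => V.ρ F ^ (j : ℕ) * ((hwConst r r)⁻¹ • V.ρ E ^ (r + 1)))
        (fun j : ℕ => V.ρ F ^ j)

/-- The homomorphism from the module with crystal `B(W)` determined by the image of the
generator. -/
noncomputable def strandMap (V : UqMod.{u}) (W : Label) (x : V.carrier) :
    (ofCrystal W.crystal_axioms).carrier →ₗ[Kq] V.carrier :=
  (basis W.crystal_axioms).constr Kq fun c => V.strand W c x

theorem strandMap_basis (W : Label) (x : V.carrier) (c : W.crystal.carrier) :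
    V.strandMap W x (basis W.crystal_axioms c) = V.strand W c x :=
  Module.Basis.constr_basis _ _ _ _

theorem strandMap_vec (W : Label) (x : V.carrier) (c : Option W.crystal.carrier) :
    V.strandMap W x (vec W.crystal_axioms c) = c.elim 0 fun c => V.strand W c x := by
  cases c with
  | none => exact map_zero _
  | some c => rw [vec_some, strandMap_basis]; rfl

theorem pow_succ_apply' (T : Module.End Kq V.carrier) (n : ℕ) (x : V.carrier) :
    (T ^ (n + 1)) x = T ((T ^ n) x) := by
  rw [pow_succ', Module.End.mul_apply]

theorem strandMap_isHom_of {W : Label} {x : V.carrier}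
    (hF : ∀ c, ((W.crystal.f (some c)).elim 0 fun c => V.strand W c x) = V.ρ F (V.strand W c x))
    (hK : ∀ c, V.ρ K (V.strand W c x) = (q : Kq) ^ W.crystal.wt c • V.strand W c x)
    (hE : ∀ c, W.crystal.ε c = 0 →
      V.ρ E (V.strand W c x) = (W.crystal.e (some c)).elim 0 fun c => V.strand W c x) :
    IsHom (V.strandMap W x) := by
  refine isHom_ofCrystal (fun c => ?_) (fun c => ?_) (fun c hc => ?_)
  · rw [strandMap_basis, strandMap_vec, hF]
  · rw [strandMap_basis, hK]
  · rw [strandMap_basis, strandMap_vec, hE c hc]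

theorem finElt_elim {X : Type u} {r n : ℕ} {z : X} (g : ℕ → X) (h : n = r + 1 → g n = z)
    (hn : n ≤ r + 1) : ((finElt r n).elim z fun j => g j) = g n := by
  by_cases hj : n < r + 1
  · rw [finElt_eq_some.mpr (show ((⟨n, hj⟩ : Fin (r + 1)) : ℕ) = n from rfl)]
    rfl
  · rw [finElt_eq_none.mpr (by omega)]
    exact (h (by omega)).symm

theorem elim_map {X : Type u} {Y : Type v} {Z : Type w} (i : X → Y) (o : Option X) (z : Z)
    (g : Y → Z) : ((o.map i).elim z g) = o.elim z fun x => g (i x) := by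
  cases o <;> rfl

/-- If `x` satisfies the defining relations of `W`, then its strand map is a homomorphism. -/
theorem strandMap_isHom {W : Label} {x : V.carrier} (h : V.IsGen W x) :
    IsHom (V.strandMap W x) := by
  cases W with
  | simple r =>
    obtain ⟨hK, hE, hF⟩ := h
    refine strandMap_isHom_of (fun j => ?_) (fun j => K_F_pow hK _) (fun j hj => ?_)
    · exact (finElt_elim (fun n => (V.ρ F ^ n) x) (fun h => by rw [h, hF]) (by
        have := Fin.is_lt j; omega)).trans (pow_succ_apply' _ _ _)
    · have hj : (Fin.val j) = 0 := Int.natCast_eq_zero.mp hj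
      change V.ρ E ((V.ρ F ^ (Fin.val j)) x) = (finE r j).elim 0 _
      rw [finE_eq_none.mpr hj, hj]
      exact hE
  | verma s =>
    obtain ⟨hK, hE⟩ := h
    refine strandMap_isHom_of (fun j => pow_succ_apply' _ _ _) (fun j => K_F_pow hK _)
      (fun j hj => ?_)
    obtain rfl : j = (0 : ℕ) := Int.natCast_eq_zero.mp hj
    exact hE
  | tilting r =>
    obtain ⟨hK, hb, hE⟩ := h
    obtain ⟨h1, h2, h3⟩ := hb.exists_top hK hE
    refine strandMap_isHom_of ?_ ?_ ?_
    · rintro (j | j) <;> exact pow_succ_apply' _ _ _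
    · rintro (j | j)
      · exact K_F_pow (m := (hwConst r r)⁻¹ • (V.ρ E ^ (r + 1)) x)
          (by rw [map_smul, h2, smul_comm]) _
      · exact K_F_pow hK _
    · rintro (j | j) hj
      · obtain rfl : j = 0 := Int.natCast_eq_zero.mp hj
        change V.ρ E ((hwConst r r)⁻¹ • (V.ρ E ^ (r + 1)) x) = 0
        rw [map_smul, h1, smul_zero]
      · obtain rfl : j = 0 := Int.natCast_eq_zero.mp hj
        change V.ρ E x = (V.ρ F ^ r) ((hwConst r r)⁻¹ • (V.ρ E ^ (r + 1)) x)
        rw [map_smul, h3]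
  | dualVerma r =>
    obtain ⟨hK, hb, hE, hF⟩ := h
    obtain ⟨h1, h2, h3⟩ := hb.exists_top hK hE
    refine strandMap_isHom_of ?_ ?_ ?_
    · rintro (j | j)
      · refine (elim_map Sum.inl _ _ _).trans ?_
        refine (finElt_elim (fun n => (V.ρ F ^ n) ((hwConst r r)⁻¹ • (V.ρ E ^ (r + 1)) x))
          (fun h => by rw [h, map_smul, hF, smul_zero]) (by omega)).trans (pow_succ_apply' _ _ _)
      · exact pow_succ_apply' _ _ _
    · rintro (j | j)
      · exact K_F_pow (m := (hwConst r r)⁻¹ • (V.ρ E ^ (r + 1)) x)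
          (by rw [map_smul, h2, smul_comm]) _
      · exact K_F_pow hK _
    · rintro (j | j) hj
      · have hj : (j : ℕ) = 0 := Int.natCast_eq_zero.mp hj
        refine Eq.trans ?_ (elim_map Sum.inl _ _ _).symm
        rw [finE_eq_none.mpr hj]
        change V.ρ E ((V.ρ F ^ (j : ℕ)) ((hwConst r r)⁻¹ • (V.ρ E ^ (r + 1)) x)) = 0
        rw [hj, pow_zero, Module.End.one_apply, map_smul, h1, smul_zero]
      · obtain rfl : j = 0 := Int.natCast_eq_zero.mp hj
        change V.ρ E x = (V.ρ F ^ r) ((hwConst r r)⁻¹ • (V.ρ E ^ (r + 1)) x)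
        rw [map_smul, h3]

end

/-! ### Cyclic modules -/

section

variable {S : Set Uq} {M : UqMod.{u}}

/-- The generator of a cyclic module. -/
noncomputable def cgen (S : Set Uq) : (of (CyclicType S)).carrier :=
  Submodule.Quotient.mk (p := Submodule.span Uq S) 1

theorem ρ_cgen (a : Uq) : (of (CyclicType S)).ρ a (cgen S) =
    Submodule.Quotient.mk (p := Submodule.span Uq S) a := by
  change Submodule.Quotient.mk (a • (1 : Uq)) = _
  rw [smul_eq_mul, mul_one]

theorem cyclic_relation {a : Uq} (h : a ∈ S) : (of (CyclicType S)).ρ a (cgen S) = 0 := by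
  rw [ρ_cgen]
  exact (Submodule.Quotient.mk_eq_zero _).mpr (Submodule.subset_span h)

theorem cyclic_surj (x : (of (CyclicType S)).carrier) :
    ∃ a, (of (CyclicType S)).ρ a (cgen S) = x := by
  obtain ⟨a, ha⟩ := Submodule.Quotient.mk_surjective _ x
  exact ⟨a, (ρ_cgen a).trans ha⟩

theorem cyclic_lift {m : M.carrier} (hm : ∀ a ∈ S, M.ρ a m = 0) :
    ∃ g : (of (CyclicType S)).carrier →ₗ[Kq] M.carrier, IsHom g ∧ g (cgen S) = m := by
  let _ : Module Uq M.carrier := Module.compHom M.carrier (M.ρ : Uq →+* Module.End Kq M.carrier)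
  have hs : ∀ (a : Uq) (x : M.carrier), a • x = M.ρ a x := fun a x => rfl
  let g : (Uq ⧸ Submodule.span Uq S) →ₗ[Uq] M.carrier :=
    Submodule.liftQ _ (LinearMap.toSpanSingleton Uq M.carrier m) (Submodule.span_le.mpr fun a ha =>
      by
      simpa [hs] using hm a ha)
  refine ⟨{ toFun := g, map_add' := map_add g, map_smul' := fun c (x : CyclicType S) => ?_ },
    fun a (x : CyclicType S) => ?_, ?_⟩
  · have h1 : c • x = (algebraMap Kq Uq c) • x := (algebraMap_smul Uq c x).symm
    exact (congrArg g h1).trans ((map_smul g _ x).trans (by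
      rw [hs, AlgHom.commutes, Module.algebraMap_end_apply]; rfl))
  · exact map_smul g a x
  · change (LinearMap.toSpanSingleton Uq M.carrier m) 1 = m
    rw [LinearMap.toSpanSingleton_apply, one_smul]

end

end UqMod

end QuantumSl2

namespace QuantumSl2

open CrystalData

namespace UqMod

/-! ### The indecomposable modules -/

section

variable {V : UqMod.{u}}

/-- A subspace stable under `k` contains the weight components of its elements. -/
theorem mem_of_sum_mem {ι : Type v} {N : Submodule Kq V.carrier} (hN : ∀ x ∈ N, V.ρ K x ∈ N)
    {s : Finset ι} {w : ι → ℤ} (hw : Set.InjOn w s) {x : ι → V.carrier}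
    (hx : ∀ i ∈ s, V.ρ K (x i) = q ^ w i • x i) (h : ∑ i ∈ s, x i ∈ N) : ∀ i ∈ s, x i ∈ N := by
  classical
  induction s using Finset.induction_on generalizing x with
  | empty => simp
  | insert a s ha ih =>
    have h1 : ∑ i ∈ s, (q ^ w i - q ^ w a : Kq) • x i ∈ N := by
      have h2 : ∑ i ∈ s, (q ^ w i - q ^ w a : Kq) • x i =
          V.ρ K (∑ i ∈ insert a s, x i) - q ^ w a • ∑ i ∈ insert a s, x i := by
        rw [Finset.sum_insert ha, map_add, hx a (Finset.mem_insert_self _ _), smul_add,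
          add_sub_add_left_eq_sub, map_sum, Finset.smul_sum, ← Finset.sum_sub_distrib]
        refine Finset.sum_congr rfl fun i hi => ?_
        rw [hx i (Finset.mem_insert_of_mem hi), sub_smul]
      rw [h2]
      exact N.sub_mem (hN _ h) (N.smul_mem _ h)
    have h3 : ∀ i ∈ s, x i ∈ N := by
      intro i hi
      have h4 := ih (hw.mono (by simp)) (x := fun i => (q ^ w i - q ^ w a : Kq) • x i)
        (fun i hi => by
          rw [map_smul, hx i (Finset.mem_insert_of_mem hi), smul_comm]) h1 i hi
      have h5 : (q ^ w i - q ^ w a : Kq) ≠ 0 := by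
        refine sub_ne_zero.mpr fun h => ?_
        have := hw (by simp [hi]) (by simp) (q_zpow_eq.mp h)
        exact ha (this ▸ hi)
      exact (N.smul_mem_iff h5).mp h4
    intro i hi
    rcases Finset.mem_insert.mp hi with rfl | hi
    · rw [Finset.sum_insert ha] at h
      exact (N.add_mem_iff_left (N.sum_mem h3)).mp h
    · exact h3 i hi

end

theorem e_top (W : Label) : W.crystal.e (some W.top) = none := W.e_eq_none_iff.mpr rfl

/-- On top of an `f̃`-string `e` acts as `ẽ`. -/
theorem ofCrystal_E_top {B : CrystalData.{u}} (hB : B.Axioms) {b : B.carrier} (h : B.ε b = 0) :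
    (ofCrystal hB).ρ E (basis hB b) = vec hB (B.e (some b)) := by
  rw [ofCrystal_E, h, qint_zero, zero_mul, zero_smul, zero_add]
  rfl

theorem eval_sub_algebraMap {M : UqMod.{u}} (c : Kq) (m : M.carrier) :
    M.ρ (K - algebraMap Kq Uq c) m = M.ρ K m - c • m := by
  rw [map_sub, LinearMap.sub_apply, AlgHom.commutes, Module.algebraMap_end_apply]

/-! ### Recognition of the indecomposable modules -/

/-- The element of the crystal `B(W)` whose basis vector generates the module `W`. -/
def _root_.QuantumSl2.Label.gen : (W : Label) → W.crystal.carrier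
  | .simple _ => (0 : Fin _)
  | .verma _ => (0 : ℕ)
  | .tilting _ => (Sum.inr 0 : ℕ ⊕ ℕ)
  | .dualVerma r => (Sum.inr 0 : Fin (r + 1) ⊕ ℕ)

theorem strand_gen (V : UqMod.{u}) (W : Label) (x : V.carrier) : V.strand W W.gen x = x := by
  cases W <;> rfl

theorem verma_f_iter (s : ℤ) (n : ℕ) : (CrystalData.verma s).f^[n] (some (0 : ℕ)) = some n := by
  induction n with
  | zero => rfl
  | succ n ih => rw [Function.iterate_succ_apply', ih]; rfl

theorem tilting_f_iter_inl (r : ℕ) (n : ℕ) :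
    (CrystalData.tilting r).f^[n] (some (Sum.inl 0 : ℕ ⊕ ℕ)) = some (Sum.inl n : ℕ ⊕ ℕ) := by
  induction n with
  | zero => rfl
  | succ n ih => rw [Function.iterate_succ_apply', ih]; rfl

theorem tilting_f_iter_inr (r : ℕ) (n : ℕ) :
    (CrystalData.tilting r).f^[n] (some (Sum.inr 0 : ℕ ⊕ ℕ)) = some (Sum.inr n : ℕ ⊕ ℕ) := by
  induction n with
  | zero => rfl
  | succ n ih => rw [Function.iterate_succ_apply', ih]; rfl

/-- In the module with crystal `B(T(r))`, the operator `e ^ (r + 1)` maps the generator to a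
multiple of the highest weight vector. -/
theorem tilting_E_pow (r : ℕ) :
    ((ofCrystal (Label.tilting r).crystal_axioms).ρ E ^ (r + 1))
      (basis (Label.tilting r).crystal_axioms (Label.tilting r).gen) =
    hwConst r r • basis (Label.tilting r).crystal_axioms (Label.tilting r).top := by
  have h1 : (ofCrystal (Label.tilting r).crystal_axioms).ρ E
      (basis (Label.tilting r).crystal_axioms (Label.tilting r).gen) =
      ((ofCrystal (Label.tilting r).crystal_axioms).ρ F ^ r)
        (basis (Label.tilting r).crystal_axioms (Label.tilting r).top) := by
    refine (ofCrystal_E_top _ rfl).trans ?_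
    rw [← vec_some, ofCrystal_F_iter]
    exact congrArg (vec _) (tilting_f_iter_inl r r).symm
  have hK : (ofCrystal (Label.tilting r).crystal_axioms).ρ K
      (basis (Label.tilting r).crystal_axioms (Label.tilting r).top) =
      q ^ (r : ℤ) • basis (Label.tilting r).crystal_axioms (Label.tilting r).top := by
    refine (ofCrystal_K _ _).trans ?_
    congr 2
  rw [pow_succ, Module.End.mul_apply, h1, E_pow_F_pow hK]
  exact (ofCrystal_E_top _ rfl).trans (by rw [e_top, vec_none])

theorem strand_basis_gen_verma (s : ℤ) (c : (Label.verma s).crystal.carrier) :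
    (ofCrystal (Label.verma s).crystal_axioms).strand (.verma s) c
      (basis (Label.verma s).crystal_axioms (Label.verma s).gen) =
    basis (Label.verma s).crystal_axioms c := by
  rw [← vec_some, ← vec_some]
  exact (ofCrystal_F_iter _ _ _).trans (congrArg (vec _) (verma_f_iter s c))

theorem strand_basis_gen_tilting (r : ℕ) (c : (Label.tilting r).crystal.carrier) :
    (ofCrystal (Label.tilting r).crystal_axioms).strand (.tilting r) c
      (basis (Label.tilting r).crystal_axioms (Label.tilting r).gen) =
    basis (Label.tilting r).crystal_axioms c := by
  have hc : hwConst r r ≠ 0 := hwConst_ne_zero fun i hi => by omega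
  rcases c with j | j
  · change ((ofCrystal (Label.tilting r).crystal_axioms).ρ F ^ j) ((hwConst r r)⁻¹ •
      ((ofCrystal (Label.tilting r).crystal_axioms).ρ E ^ (r + 1)) _) = _
    rw [tilting_E_pow, smul_smul, inv_mul_cancel₀ hc, one_smul, ← vec_some, ofCrystal_F_iter]
    refine (congrArg (vec _) (tilting_f_iter_inl r j)).trans ?_
    exact vec_some _ _
  · rw [← vec_some]
    refine (ofCrystal_F_iter _ _ _).trans ((congrArg (vec _) (tilting_f_iter_inr r j)).trans ?_)
    exact vec_some _ _

theorem IsHom.strand {M : UqMod.{u}} {V : UqMod.{v}} {g : M.carrier →ₗ[Kq] V.carrier}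
    (hg : IsHom g) (W : Label) (c : W.crystal.carrier) (x : M.carrier) :
    g (M.strand W c x) = V.strand W c (g x) := by
  cases W with
  | simple r => exact hg.pow _ _ _
  | verma s => exact hg.pow _ _ _
  | tilting r =>
    rcases c with j | j
    · refine (hg.pow F j ((hwConst r r)⁻¹ • (M.ρ E ^ (r + 1)) x)).trans ?_
      rw [map_smul, hg.pow]
      rfl
    · exact hg.pow _ _ _
  | dualVerma r =>
    rcases c with j | j
    · refine (hg.pow F j ((hwConst r r)⁻¹ • (M.ρ E ^ (r + 1)) x)).trans ?_
      rw [map_smul, hg.pow]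
      rfl
    · exact hg.pow _ _ _

/-- A module generated by a vector `x` with the properties of the generator of `W` is isomorphic
to the module with crystal `B(W)` if it has a homomorphism to the latter. -/
theorem strandMap_bijective_of_cyclic {V : UqMod.{u}} {W : Label} {x : V.carrier}
    (hW : ∀ c, (ofCrystal W.crystal_axioms).strand W c (basis W.crystal_axioms W.gen) =
      basis W.crystal_axioms c)
    (hx : V.IsGen W x) (hgen : ∀ y, ∃ a, V.ρ a x = y)
    (hg : ∃ g : V.carrier →ₗ[Kq] (ofCrystal W.crystal_axioms).carrier,
      IsHom g ∧ g x = basis W.crystal_axioms W.gen) :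
    Function.Bijective (V.strandMap W x) := by
  obtain ⟨g, hg, hg0⟩ := hg
  have hh := strandMap_isHom hx
  have hgh : ∀ n, g (V.strandMap W x n) = n := by
    refine LinearMap.congr_fun (f := g ∘ₗ _) (g := LinearMap.id)
      ((basis W.crystal_axioms).ext fun c => ?_)
    rw [LinearMap.comp_apply, strandMap_basis, LinearMap.id_apply, hg.strand, hg0, hW]
  refine ⟨Function.LeftInverse.injective hgh, fun y => ?_⟩
  obtain ⟨a, rfl⟩ := hgen y
  refine ⟨(ofCrystal W.crystal_axioms).ρ a (basis W.crystal_axioms W.gen), ?_⟩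
  rw [hh, strandMap_basis, strand_gen]


/-! ### Verma modules -/

/-- The highest weight vector of the Verma module. -/
noncomputable def vgen (s : ℤ) : (verma s).carrier := cgen _

theorem verma_gen_K (s : ℤ) : (verma s).ρ K (vgen s) = q ^ s • vgen s := by
  have := cyclic_relation (S := {E, K - algebraMap Kq Uq (q ^ s)})
    (a := K - algebraMap Kq Uq (q ^ s)) (by simp)
  rw [eval_sub_algebraMap, sub_eq_zero] at this
  exact this

theorem verma_gen_E (s : ℤ) : (verma s).ρ E (vgen s) = 0 :=
  cyclic_relation (S := {E, K - algebraMap Kq Uq (q ^ s)}) (by simp)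

theorem verma_isGen (s : ℤ) : (verma s).IsGen (.verma s) (vgen s) :=
  ⟨verma_gen_K s, verma_gen_E s⟩

theorem verma_cyclic {s : ℤ} (x : (verma s).carrier) : ∃ a, (verma s).ρ a (vgen s) = x :=
  cyclic_surj x

theorem verma_lift {M : UqMod.{u}} {s : ℤ} {m : M.carrier} (hK : M.ρ K m = q ^ s • m)
    (hE : M.ρ E m = 0) : ∃ g : (verma s).carrier →ₗ[Kq] M.carrier, IsHom g ∧ g (vgen s) = m := by
  refine cyclic_lift fun a ha => ?_
  rcases ha with rfl | rfl
  · exact hE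
  · rw [eval_sub_algebraMap, hK, sub_self]

theorem verma_bijective (s : ℤ) :
    Function.Bijective ((verma s).strandMap (.verma s) (vgen s)) := by
  refine strandMap_bijective_of_cyclic (strand_basis_gen_verma s) (verma_isGen s) verma_cyclic
    (verma_lift ?_ ?_)
  · refine (ofCrystal_K _ _).trans ?_
    congr 2
    change s - 2 * ((0 : ℕ) : ℤ) = s
    simp
  · exact (ofCrystal_E_top _ rfl).trans (congrArg (vec _) (e_top (.verma s)))

theorem verma_iso (s : ℤ) : Iso (ofCrystal (Label.verma s).crystal_axioms) (verma s) :=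
  iso_of_bijective (strandMap_isHom (verma_isGen s)) (verma_bijective s)

/-- The basis vectors `f^j m_s` of the Verma module. -/
theorem exists_vermaBasis (s : ℤ) : ∃ β : Module.Basis ℕ Kq (verma s).carrier,
    ∀ j, β j = ((verma s).ρ F ^ j) (vgen s) :=
  ⟨(basis (Label.verma s).crystal_axioms).map (LinearEquiv.ofBijective _ (verma_bijective s)),
    fun _ => ((basis (Label.verma s).crystal_axioms).map_apply _ _).trans (strandMap_basis _ _ _)⟩

/-! ### Simple modules -/

/-- A proper submodule of the Verma module has no components in the weights of the simple
quotient. -/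
theorem repr_eq_zero_of_ne_top {r : ℕ} (β : Module.Basis ℕ Kq (verma r).carrier)
    (hβ : ∀ j, β j = ((verma r).ρ F ^ j) (vgen r)) {N : Submodule Uq (VermaType r)} (hN : N ≠ ⊤)
    {n : VermaType r} (hn : n ∈ N) {j : ℕ} (hj : j ≤ r) : β.repr n j = 0 := by
  by_contra hne
  apply hN
  let N' : Submodule Kq (verma r).carrier := N.restrictScalars Kq
  have hN' : ∀ a, ∀ x ∈ N', (verma r).ρ a x ∈ N' := fun a x hx => N.smul_mem a hx
  have h1 : ∑ i ∈ (β.repr n).support, β.repr n i • β i ∈ N' := by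
    have : ∑ i ∈ (β.repr n).support, β.repr n i • β i = n := β.linearCombination_repr n
    rw [this]; exact hn
  have h2 := mem_of_sum_mem (V := verma r) (hN' K) (w := fun i : ℕ => (r : ℤ) - 2 * i)
    (fun _ _ _ _ h => by simpa using h)
    (fun i _ => by rw [map_smul, hβ, K_F_pow (verma_gen_K r), smul_comm]) h1 j
    (Finsupp.mem_support_iff.mpr hne)
  have h2 : ((verma r).ρ F ^ j) (vgen r) ∈ N' := by
    rw [← hβ]; exact (Submodule.smul_mem_iff _ hne).mp h2
  have h3 : ((verma r).ρ E ^ j) (((verma r).ρ F ^ j) (vgen r)) ∈ N' := by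
    rw [← map_pow]
    exact hN' _ _ h2
  rw [E_pow_F_pow (verma_gen_K r) (verma_gen_E r)] at h3
  have h4 : vgen r ∈ N' :=
    (Submodule.smul_mem_iff _ (hwConst_ne_zero fun i hi => by omega)).mp h3
  rw [eq_top_iff]
  intro x _
  obtain ⟨a, ha⟩ := verma_cyclic (s := r) x
  have := hN' a _ h4
  rw [ha] at this
  exact this

theorem simple_iso (r : ℕ) : Iso (ofCrystal (Label.simple r).crystal_axioms) (simple r) := by
  obtain ⟨β, hβ⟩ := exists_vermaBasis r
  let S : Submodule Uq (VermaType r) := sSup {N | N ≠ ⊤}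
  -- The sum of all proper submodules has no components in the weights `r, r - 2, …, -r`.
  have hS : ∀ n : VermaType r, n ∈ S → ∀ j ≤ r, β.repr n j = 0 := by
    intro n hn j hj
    have hn' : n ∈ ⨆ N : {N : Submodule Uq (VermaType r) | N ≠ ⊤}, N.1 := by
      rw [← sSup_eq_iSup']
      exact hn
    refine Submodule.iSup_induction _ (motive := fun n : VermaType r => β.repr n j = 0) hn'
      (fun N x hx => repr_eq_zero_of_ne_top β hβ N.2 hx hj) ?_ fun x y hx hy => ?_
    · exact DFunLike.congr_fun (map_zero β.repr) j
    · exact (DFunLike.congr_fun (map_add β.repr x y) j).trans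
        ((congrArg₂ (· + ·) hx hy).trans (add_zero _))
  -- It contains `f ^ (r + 1) m_r`, because this vector generates a proper submodule.
  obtain ⟨g, hg, hg0⟩ := verma_lift (M := ofCrystal (Label.simple r).crystal_axioms) (s := r)
    (m := basis (Label.simple r).crystal_axioms (Label.simple r).gen)
    ((ofCrystal_K _ _).trans (by congr 2))
    ((ofCrystal_E_top _ rfl).trans (congrArg (vec _) (e_top (.simple r))))
  let N : Submodule Uq (VermaType r) :=
    { carrier := {x | g x = 0}
      add_mem' := fun {x y} hx hy => (map_add g x y).trans ((congrArg₂ _ hx hy).trans (add_zero _))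
      zero_mem' := map_zero g
      smul_mem' := fun a x hx => (hg a x).trans ((congrArg _ hx).trans (map_zero _)) }
  have hN : N ≠ ⊤ := by
    intro h
    have hm : ∀ x : VermaType r, x ∈ N := fun x => h ▸ Submodule.mem_top
    exact (basis (Label.simple r).crystal_axioms).ne_zero _ (hg0.symm.trans (hm (vgen r)))
  let π : (verma r).carrier →ₗ[Kq] (simple r).carrier :=
    { toFun := S.mkQ, map_add' := map_add S.mkQ, map_smul' := fun c x => rfl }
  have hπ : IsHom π := fun a x => rfl
  have hπ0 : ∀ x : VermaType r, π x = 0 ↔ x ∈ S := fun x => Submodule.Quotient.mk_eq_zero S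
  have hFS : π (((verma r).ρ F ^ (r + 1)) (vgen r)) = 0 := by
    refine (hπ0 _).mpr ((le_sSup (show N ∈ {N | N ≠ ⊤} from hN) : N ≤ S) ?_)
    refine (hg.pow F (r + 1) _).trans ?_
    rw [hg0, ← vec_some, ofCrystal_F_iter]
    have : ∀ n ≤ r + 1, (CrystalData.simple r).f^[n] (some (0 : Fin (r + 1))) = finElt r n := by
      intro n
      induction n with
      | zero => intro _; rfl
      | succ n ih =>
        intro hn
        rw [Function.iterate_succ_apply', ih (by omega),
          finElt_eq_some.mpr (show ((⟨n, by omega⟩ : Fin (r + 1)) : ℕ) = n from rfl)]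
        rfl
    exact congrArg (vec _) ((this _ le_rfl).trans (finElt_eq_none.mpr (by omega)))
  have hgen : (simple r).IsGen (.simple r) (π (vgen r)) := by
    refine ⟨?_, ?_, ?_⟩
    · rw [← hπ, verma_gen_K, map_smul]
    · rw [← hπ, verma_gen_E, map_zero]
    · rw [← hπ.pow]; exact hFS
  have hh := strandMap_isHom hgen
  refine iso_of_bijective hh ⟨?_, fun y => ?_⟩
  · let l : (ofCrystal (Label.simple r).crystal_axioms).carrier →ₗ[Kq] (verma r).carrier :=
      (basis (Label.simple r).crystal_axioms).constr Kq fun j => β (Fin.val (n := r + 1) j)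
    have hl : ∀ z, (simple r).strandMap (.simple r) (π (vgen r)) z = π (l z) := by
      refine LinearMap.congr_fun (g := π ∘ₗ l)
        ((basis (Label.simple r).crystal_axioms).ext fun c => ?_)
      rw [strandMap_basis, LinearMap.comp_apply, Module.Basis.constr_basis, hβ, hπ.pow]
      rfl
    have hl' : ∀ z (c : (Label.simple r).crystal.carrier),
        β.repr (l z) (Fin.val (n := r + 1) c) =
            (basis (Label.simple r).crystal_axioms).repr z c := by
      intro z c
      refine LinearMap.congr_fun (f := β.coord (Fin.val (n := r + 1) c) ∘ₗ l)
        (g := (basis (Label.simple r).crystal_axioms).coord c)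
        ((basis (Label.simple r).crystal_axioms).ext fun d => ?_) z
      rw [LinearMap.comp_apply, Module.Basis.constr_basis, Module.Basis.coord_apply,
        Module.Basis.coord_apply, Module.Basis.repr_self, Module.Basis.repr_self]
      by_cases h : d = c
      · rw [h, Finsupp.single_eq_same, Finsupp.single_eq_same]
      · rw [Finsupp.single_eq_of_ne (Ne.symm h),
          Finsupp.single_eq_of_ne fun h' => h (Fin.ext h'.symm)]
    refine (injective_iff_map_eq_zero _).mpr fun z hz => ?_
    rw [hl] at hz
    refine (basis (Label.simple r).crystal_axioms).repr.map_eq_zero_iff.mp (Finsupp.ext fun c => ?_)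
    rw [← hl']
    exact hS _ ((hπ0 _).mp hz) _ (by have := Fin.is_lt (n := r + 1) c; omega)
  · obtain ⟨x, rfl⟩ : ∃ x, π x = y := S.mkQ_surjective y
    obtain ⟨a, rfl⟩ := verma_cyclic x
    refine ⟨(ofCrystal (Label.simple r).crystal_axioms).ρ a
      (basis (Label.simple r).crystal_axioms (Label.simple r).gen), ?_⟩
    rw [hh, strandMap_basis, strand_gen, hπ]

end UqMod

end QuantumSl2

namespace QuantumSl2

open CrystalData

namespace UqMod

/-! ### The modules `T(r)` -/

/-- The generator of `T(r)`. -/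
noncomputable def tgen (r : ℕ) : (tilting r).carrier := cgen _

theorem tilting_isGen (r : ℕ) : (tilting r).IsGen (.tilting r) (tgen r) := by
  refine ⟨?_, ⟨2, cyclic_relation (by simp [blockElt])⟩, ?_⟩
  · have h : (tilting r).ρ (K - algebraMap Kq Uq (q ^ (-(r : ℤ) - 2))) (tgen r) = 0 :=
      cyclic_relation (by simp)
    rwa [eval_sub_algebraMap, sub_eq_zero] at h
  · rw [← map_pow]
    exact cyclic_relation (by simp)

theorem tilting_lift {M : UqMod.{u}} {r : ℕ} {m : M.carrier}
    (hE : (M.ρ E ^ (r + 2)) m = 0) (hK : M.ρ K m = q ^ (-(r : ℤ) - 2) • m)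
    (hb : M.ρ (blockElt r ^ 2) m = 0) :
    ∃ g : (tilting r).carrier →ₗ[Kq] M.carrier, IsHom g ∧ g (tgen r) = m := by
  refine cyclic_lift fun a ha => ?_
  rcases ha with rfl | rfl | rfl
  · rw [map_pow]; exact hE
  · rw [eval_sub_algebraMap, hK, sub_self]
  · exact hb

theorem tilting_iso (r : ℕ) : Iso (ofCrystal (Label.tilting r).crystal_axioms) (tilting r) := by
  set hA := (Label.tilting r).crystal_axioms
  have hx0 : (ofCrystal hA).ρ E (basis hA (Label.tilting r).top) = 0 :=
    (ofCrystal_E_top _ rfl).trans (by rw [e_top, vec_none])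
  have hKx : (ofCrystal hA).ρ K (basis hA (Label.tilting r).top) =
      q ^ (r : ℤ) • basis hA (Label.tilting r).top := by
    refine (ofCrystal_K _ _).trans ?_
    congr 2
  have hK : (ofCrystal hA).ρ K (basis hA (Label.tilting r).gen) =
      q ^ (-(r : ℤ) - 2) • basis hA (Label.tilting r).gen := by
    refine (ofCrystal_K _ _).trans ?_
    congr 2
    change -(r : ℤ) - 2 - 2 * ((0 : ℕ) : ℤ) = _
    simp
  have hE : (ofCrystal hA).ρ E (basis hA (Label.tilting r).gen) =
      ((ofCrystal hA).ρ F ^ r) (basis hA (Label.tilting r).top) := by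
    refine (ofCrystal_E_top _ rfl).trans ?_
    rw [← vec_some, ofCrystal_F_iter]
    exact congrArg (vec _) (tilting_f_iter_inl r r).symm
  refine iso_of_bijective (strandMap_isHom (tilting_isGen r)) (strandMap_bijective_of_cyclic
    (strand_basis_gen_tilting r) (tilting_isGen r) cyclic_surj (tilting_lift ?_ hK ?_))
  · rw [pow_succ', Module.End.mul_apply, tilting_E_pow, map_smul, hx0, smul_zero]
  · have hc : Commute (blockElt r) (F ^ (r + 1)) := by simpa using blockElt_comm r 1 (F ^ (r + 1))
    rw [pow_two, ρ_mul, blockElt_wt _ hK, casimirValue_neg, sub_self, zero_smul, add_zero, hE,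
      ← pow_succ_apply', ← map_pow, ← ρ_mul,
      hc.eq, ρ_mul,
      blockElt_wt _ hKx, hx0, map_zero, sub_self, zero_smul, zero_add, map_zero]

/-! ### The restricted duals of Verma modules -/

theorem bar_qint (n : ℤ) : bar (qint n) = qint n := by
  simp only [qint, map_mul, map_inv₀, map_sub, map_zpow₀, bar_q, inv_inv, inv_zpow', neg_neg]
  rw [← neg_sub q q⁻¹, inv_neg (a := q - q⁻¹), ← neg_sub (q ^ n), neg_mul_neg]

section

variable {r : ℕ} (β : Module.Basis ℕ Kq (verma r).carrier)
  (hβ : ∀ j, β j = ((verma r).ρ F ^ j) (vgen r))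

/-- The value of a functional at `f^j m_r`, as a linear function of the functional. -/
noncomputable def dualEval (j : ℕ) : (verma r).dual.carrier →ₗ[Kq] Kq where
  toFun g := g.1 (β j)
  map_add' _ _ := rfl
  map_smul' _ _ := rfl

theorem dual_ext {g h : (verma r).dual.carrier} (H : ∀ j, dualEval β j g = dualEval β j h) :
    g = h :=
  Subtype.ext (β.ext H)

theorem dual_E (g : (verma r).dual.carrier) (m : (verma r).carrier) :
    ((verma r).dual.ρ E g).1 m = g.1 ((verma r).ρ F m) :=
  congrArg (fun g => g.1 m) (LinearMap.congr_fun (lift_gen (verma r).satisfies_dual .e) g)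

theorem dual_F (g : (verma r).dual.carrier) (m : (verma r).carrier) :
    ((verma r).dual.ρ F g).1 m = g.1 ((verma r).ρ E m) :=
  congrArg (fun g => g.1 m) (LinearMap.congr_fun (lift_gen (verma r).satisfies_dual .f) g)

theorem dual_K (g : (verma r).dual.carrier) (m : (verma r).carrier) :
    ((verma r).dual.ρ K g).1 m = g.1 ((verma r).ρ Kinv m) :=
  congrArg (fun g => g.1 m) (LinearMap.congr_fun (lift_gen (verma r).satisfies_dual .k) g)

include hβ

theorem vermaBasis_K (j : ℕ) : (verma r).ρ K (β j) = q ^ ((r : ℤ) - 2 * j) • β j := by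
  rw [hβ]; exact K_F_pow (verma_gen_K r) j

theorem vermaBasis_wt {s : ℤ} {m : (verma r).carrier} (hm : m ∈ (verma r).wt s) {j : ℕ}
    (h : β.repr m j ≠ 0) : s = r - 2 * j := by
  have h1 : ∀ m, β.repr ((verma r).ρ K m) j = q ^ ((r : ℤ) - 2 * j) * β.repr m j := by
    refine LinearMap.congr_fun (f := β.coord j ∘ₗ (verma r).ρ K)
      (g := (q ^ ((r : ℤ) - 2 * j) : Kq) • β.coord j) (β.ext fun i => ?_)
    rw [LinearMap.comp_apply, vermaBasis_K β hβ, map_smul, LinearMap.smul_apply,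
      Module.Basis.coord_apply, Module.Basis.repr_self]
    by_cases hij : i = j
    · rw [hij]
    · rw [Finsupp.single_eq_of_ne (Ne.symm hij), smul_zero, smul_zero]
  have h2 := h1 m
  rw [mem_wt.mp hm, map_smul, Finsupp.smul_apply, smul_eq_mul] at h2
  exact q_zpow_eq.mp (mul_right_cancel₀ h h2)

/-- The functional dual to `f^j m_r`. -/
noncomputable def dualVec (j : ℕ) : (verma r).dual.carrier :=
  (⟨{ toFun := fun m => bar (β.repr m j)
      map_add' := fun m n => by rw [map_add, Finsupp.add_apply, map_add]
      map_smul' := fun c m => by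
        rw [map_smul, Finsupp.smul_apply, smul_eq_mul, map_mul, smul_eq_mul] },
    (Set.finite_singleton ((r : ℤ) - 2 * j)).subset fun s ⟨_, hm, hne⟩ =>
      vermaBasis_wt β hβ hm fun h => hne (by simp [h])⟩ : (verma r).dualSpace)

theorem dualEval_dualVec (i j : ℕ) :
    dualEval β i (dualVec β hβ j) = if i = j then 1 else 0 := by
  change bar (β.repr (β i) j) = _
  rw [Module.Basis.repr_self, Finsupp.single_apply]
  split_ifs <;> simp

theorem dualEval_E (g : (verma r).dual.carrier) (j : ℕ) :
    dualEval β j ((verma r).dual.ρ E g) = dualEval β (j + 1) g := by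
  refine (dual_E g _).trans (congrArg g.1 ?_)
  rw [hβ, hβ, pow_succ', Module.End.mul_apply]

theorem dualEval_F_zero (g : (verma r).dual.carrier) :
    dualEval β 0 ((verma r).dual.ρ F g) = 0 := by
  refine (dual_F g _).trans ?_
  rw [hβ, pow_zero, Module.End.one_apply, verma_gen_E, map_zero]

theorem dualEval_F_succ (g : (verma r).dual.carrier) (j : ℕ) :
    dualEval β (j + 1) ((verma r).dual.ρ F g) =
      (qint (j + 1) * qint (r - j)) * dualEval β j g := by
  refine (dual_F g _).trans ?_
  rw [hβ, E_F_pow (verma_gen_K r) (verma_gen_E r), ← hβ, LinearMap.map_smulₛₗ, map_mul, bar_qint,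
    bar_qint]
  rfl

theorem dualEval_K (g : (verma r).dual.carrier) (j : ℕ) :
    dualEval β j ((verma r).dual.ρ K g) = q ^ ((r : ℤ) - 2 * j) * dualEval β j g := by
  refine (dual_K g _).trans ?_
  rw [Kinv_of_K (vermaBasis_K β hβ j), LinearMap.map_smulₛₗ, map_zpow₀, bar_q, inv_zpow', neg_neg]
  rfl

theorem dualVec_K (j : ℕ) : (verma r).dual.ρ K (dualVec β hβ j) =
    q ^ ((r : ℤ) - 2 * j) • dualVec β hβ j := by
  refine dual_ext β fun i => ?_
  rw [dualEval_K β hβ, map_smul, dualEval_dualVec, smul_eq_mul]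
  split_ifs with h
  · rw [h]
  · rw [mul_zero, mul_zero]

theorem dualVec_E (j : ℕ) : (verma r).dual.ρ E (dualVec β hβ (j + 1)) = dualVec β hβ j := by
  refine dual_ext β fun i => ?_
  rw [dualEval_E β hβ, dualEval_dualVec, dualEval_dualVec]
  simp

theorem dualVec_E_pow (j n : ℕ) :
    ((verma r).dual.ρ E ^ n) (dualVec β hβ (j + n)) = dualVec β hβ j := by
  induction n with
  | zero => rfl
  | succ n ih => rw [pow_succ, Module.End.mul_apply, ← add_assoc, dualVec_E, ih]

theorem dualVec_E_zero : (verma r).dual.ρ E (dualVec β hβ 0) = 0 := by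
  refine dual_ext β fun i => ?_
  rw [dualEval_E β hβ, dualEval_dualVec, map_zero, if_neg (Nat.succ_ne_zero i)]

theorem dualVec_F (j : ℕ) : (verma r).dual.ρ F (dualVec β hβ j) =
    (qint (j + 1) * qint (r - j)) • dualVec β hβ (j + 1) := by
  refine dual_ext β fun i => ?_
  rw [map_smul, dualEval_dualVec]
  cases i with
  | zero => rw [dualEval_F_zero β hβ, if_neg (Nat.succ_ne_zero j).symm, smul_zero]
  | succ i =>
    rw [dualEval_F_succ β hβ, dualEval_dualVec]
    by_cases h : i = j
    · simp [h]
    · simp [h]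

theorem dualVec_F_pow (j n : ℕ) : ((verma r).dual.ρ F ^ n) (dualVec β hβ j) =
    (∏ i ∈ Finset.range n, (qint ((j + i : ℕ) + 1) * qint (r - (j + i : ℕ)))) •
      dualVec β hβ (j + n) := by
  induction n with
  | zero => simp
  | succ n ih =>
    rw [pow_succ', Module.End.mul_apply, ih, map_smul, dualVec_F, smul_smul,
      Finset.prod_range_succ, add_assoc]

theorem dualVec_isGen : (verma r).dual.IsGen (.dualVerma r) (dualVec β hβ (r + 1)) := by
  have hK : (verma r).dual.ρ K (dualVec β hβ (r + 1)) =
      q ^ (-(r : ℤ) - 2) • dualVec β hβ (r + 1) := by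
    rw [dualVec_K]; congr 2; push_cast; ring
  have hFr : (verma r).dual.ρ F (dualVec β hβ r) = 0 := by
    rw [dualVec_F, sub_self, qint_zero, mul_zero, zero_smul]
  have hE : ((verma r).dual.ρ E ^ (r + 1)) (dualVec β hβ (r + 1)) = dualVec β hβ 0 := by
    have := dualVec_E_pow β hβ 0 (r + 1)
    rwa [zero_add] at this
  refine ⟨hK, ⟨1, ?_⟩, ?_, ?_⟩
  · rw [pow_one, blockElt_wt _ hK, dualVec_E, hFr, casimirValue_neg, sub_self, zero_smul, add_zero]
  · rw [pow_succ', Module.End.mul_apply, hE, dualVec_E_zero]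
  · rw [hE, pow_succ', Module.End.mul_apply, dualVec_F_pow, map_smul, zero_add, hFr, smul_zero]

end

/-- The position of an element of `B(M(r)^σ)` on the `ẽ`-string ending at the highest weight
element. -/
def dualIndex (r : ℕ) : (Label.dualVerma r).crystal.carrier → ℕ :=
  Sum.elim (fun j : Fin (r + 1) => (j : ℕ)) (fun j : ℕ => r + 1 + j)

theorem dualIndex_injective (r : ℕ) : Function.Injective (dualIndex r) := by
  rintro (⟨i, hi⟩ | i) (⟨j, hj⟩ | j) h
  · exact congrArg Sum.inl (Fin.ext h)
  · change i = r + 1 + j at h; omega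
  · change r + 1 + i = j at h; omega
  · change r + 1 + i = r + 1 + j at h
    exact congrArg Sum.inr (by omega)

theorem dualIndex_surjective (r : ℕ) : Function.Surjective (dualIndex r) := by
  intro n
  by_cases h : n < r + 1
  · exact ⟨(Sum.inl ⟨n, h⟩ : Fin (r + 1) ⊕ ℕ), rfl⟩
  · exact ⟨(Sum.inr (n - (r + 1)) : Fin (r + 1) ⊕ ℕ), by change r + 1 + (n - (r + 1)) = n; omega⟩

theorem dualVerma_iso (r : ℕ) :
    Iso (ofCrystal (Label.dualVerma r).crystal_axioms) (verma r).dual := by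
  obtain ⟨β, hβ⟩ := exists_vermaBasis r
  set hA := (Label.dualVerma r).crystal_axioms
  have hgen := dualVec_isGen β hβ
  -- Basis vectors are mapped to nonzero multiples of the dual basis.
  have hst : ∀ c, ∃ a : Kq, a ≠ 0 ∧ (verma r).dual.strand (.dualVerma r) c (dualVec β hβ (r + 1)) =
      a • dualVec β hβ (dualIndex r c) := by
    have hprod : ∀ j n : ℕ, (∀ i < n, r ≠ j + i) →
        (∏ i ∈ Finset.range n, (qint ((j + i : ℕ) + 1) * qint (r - (j + i : ℕ)))) ≠ 0 :=
      fun j n h => Finset.prod_ne_zero_iff.mpr fun i hi => mul_ne_zero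
        (qint_ne_zero (by omega)) (qint_ne_zero (by
          have := h i (Finset.mem_range.mp hi); omega))
    rintro (j | j)
    · refine ⟨(hwConst r r)⁻¹ * _, mul_ne_zero (inv_ne_zero (hwConst_ne_zero fun i hi => by omega))
        (hprod 0 j fun i hi => by have := j.2; omega), ?_⟩
      change ((verma r).dual.ρ F ^ (j : ℕ)) ((hwConst r r)⁻¹ •
        ((verma r).dual.ρ E ^ (r + 1)) (dualVec β hβ (r + 1))) = _
      have h := dualVec_E_pow β hβ 0 (r + 1)
      rw [zero_add] at h
      rw [h, map_smul, dualVec_F_pow, smul_smul, zero_add]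
      rfl
    · exact ⟨_, hprod (r + 1) j fun i hi => by omega, dualVec_F_pow β hβ _ _⟩
  choose a ha hst using hst
  refine iso_of_bijective (strandMap_isHom hgen)
    ⟨(injective_iff_map_eq_zero _).mpr fun z hz => ?_, fun g => ?_⟩
  · refine (basis hA).repr.map_eq_zero_iff.mp (Finsupp.ext fun c => ?_)
    have h1 : dualEval β (dualIndex r c) ((verma r).dual.strandMap (.dualVerma r)
        (dualVec β hβ (r + 1)) z) = a c * (basis hA).repr z c := by
      refine LinearMap.congr_fun (f := dualEval β (dualIndex r c) ∘ₗ _)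
        (g := a c • (basis hA).coord c) ((basis hA).ext fun d => ?_) z
      rw [LinearMap.comp_apply, strandMap_basis, hst, map_smul, dualEval_dualVec,
        LinearMap.smul_apply, Module.Basis.coord_apply, Module.Basis.repr_self]
      by_cases h : d = c
      · rw [h, if_pos rfl, Finsupp.single_eq_same]
      · rw [if_neg fun h' => h (dualIndex_injective r h'.symm),
          Finsupp.single_eq_of_ne (Ne.symm h), smul_zero, smul_zero]
    rw [hz, map_zero] at h1
    exact (mul_eq_zero.mp h1.symm).resolve_left (ha c)
  · have hr : ∀ j, dualVec β hβ j ∈ LinearMap.range ((verma r).dual.strandMap (.dualVerma r)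
        (dualVec β hβ (r + 1))) := by
      intro j
      obtain ⟨c, rfl⟩ := dualIndex_surjective r j
      refine ⟨(a c)⁻¹ • basis hA c, ?_⟩
      rw [map_smul, strandMap_basis, hst, smul_smul, inv_mul_cancel₀ (ha c), one_smul]
    have hfin : {j : ℕ | dualEval β j g ≠ 0}.Finite := by
      refine (Set.Finite.preimage (f := fun j : ℕ => (r : ℤ) - 2 * j)
        (fun i _ j _ h => by simpa using h) g.2).subset fun j hj => ?_
      exact ⟨β j, mem_wt.mpr (vermaBasis_K β hβ j), hj⟩
    have hg : g = ∑ j ∈ hfin.toFinset, dualEval β j g • dualVec β hβ j := by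
      refine dual_ext β fun i => ?_
      rw [map_sum]
      simp only [map_smul, dualEval_dualVec, smul_eq_mul, mul_ite, mul_one, mul_zero]
      rw [Finset.sum_ite_eq]
      split_ifs with h
      · rfl
      · simpa using h
    have hg' : g ∈ LinearMap.range ((verma r).dual.strandMap (.dualVerma r)
        (dualVec β hβ (r + 1))) := by
      rw [hg]
      exact Submodule.sum_mem _ fun j _ => Submodule.smul_mem _ _ (hr j)
    exact hg'

/-- Every indecomposable module has a basis indexed by its crystal, with the action of
`ofCrystal`. -/
theorem label_iso (W : Label) : Iso (ofCrystal W.crystal_axioms) W.toMod := by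
  cases W with
  | simple r => exact simple_iso r
  | verma s => exact verma_iso s
  | tilting r => exact tilting_iso r
  | dualVerma r => exact dualVerma_iso r

end UqMod

end QuantumSl2

namespace QuantumSl2

open CrystalData

namespace UqMod

/-! ### Direct sums of modules -/

theorem Iso.directSum {I : Type u} {M : I → UqMod.{v}} {N : I → UqMod.{w}}
    (h : ∀ i, Iso (M i) (N i)) : Iso (directSum M) (directSum N) := by
  choose g hg using h
  let G : (UqMod.directSum M).carrier ≃ₗ[Kq] (UqMod.directSum N).carrier :=
    DFinsupp.mapRange.linearEquiv g
  exact ⟨G, fun a x => DFinsupp.ext fun i => hg i a _⟩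

/-- The module with crystal a direct sum is a direct sum. -/
theorem ofCrystal_directSum {J : Type u} {B : J → CrystalData.{v}} (hB : ∀ j, (B j).Axioms) :
    Iso (UqMod.ofCrystal (directSum_axioms hB)) (directSum fun j => UqMod.ofCrystal (hB j)) := by
  classical
  let G : (UqMod.ofCrystal (directSum_axioms hB)).carrier ≃ₗ[Kq]
      (directSum fun j => UqMod.ofCrystal (hB j)).carrier := sigmaFinsuppLequivDFinsupp Kq
  let s : ∀ j, (UqMod.ofCrystal (hB j)).carrier →ₗ[Kq]
      (directSum fun j => UqMod.ofCrystal (hB j)).carrier := fun j =>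
    DFinsupp.lsingle (R := Kq) (M := fun j => (UqMod.ofCrystal (hB j)).carrier) j
  have hs : ∀ j, IsHom (s j) := by
    intro j a m
    exact (DFinsupp.mapRange_single (f := fun j => (UqMod.ofCrystal (hB j)).ρ a)
      (hf := fun j => map_zero _)).symm
  have hG : ∀ b : (CrystalData.directSum B).carrier,
      G.toLinearMap (basis (directSum_axioms hB) b) = s b.1 (basis (hB b.1) b.2) := by
    intro b
    rw [← vec_some, ← vec_some]
    exact sigmaFinsuppEquivDFinsupp_single (N := Kq) b 1
  have hG' : ∀ j (x : Option (B j).carrier), G.toLinearMap (vec (directSum_axioms hB)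
      (x.map (incl B j))) = s j (vec (hB j) x) := by
    rintro j (_ | b)
    · exact (map_zero G.toLinearMap).trans (map_zero (s j)).symm
    · rw [Option.map_some, vec_some, vec_some, hG]; rfl
  refine ⟨G, isHom_ofCrystal (g := G.toLinearMap) (fun b => ?_) (fun b => ?_) fun b hb => ?_⟩
  · rw [hG, ← hs, ← vec_some, ofCrystal_F]
    exact hG' b.1 ((B b.1).f (some b.2))
  · rw [hG, ← hs, ofCrystal_K, map_smul]
    rfl
  · rw [hG, ← hs]
    exact (congrArg (s b.1) (ofCrystal_E_top (hB b.1) hb)).trans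
      (hG' b.1 ((B b.1).e (some b.2))).symm

theorem hasMult_iff {V : UqMod.{u}} {n : Label → ℕ} :
    V.HasMult n ↔ Iso V (ofCrystal (ofMult_axioms n)) := by
  have h : Iso (ofCrystal (ofMult_axioms n)) (directSum fun p : Σ W : Label, Fin (n W) =>
      p.1.toMod) :=
    (ofCrystal_directSum fun p : Σ W : Label, Fin (n W) => p.1.crystal_axioms).trans
      (Iso.directSum fun p => label_iso p.1)
  exact ⟨fun hV => Iso.trans hV h.symm, fun hV => hV.trans h⟩

end UqMod

end QuantumSl2

namespace QuantumSl2

open CrystalData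

namespace UqMod

/-! ### Weight bases and the category `𝒪` -/

/-- The index `i` of a basis gives a vector of weight `wt i`. -/
def IsWtBasis {V : UqMod.{u}} {ι : Type v} (β : Module.Basis ι Kq V.carrier) (wt : ι → ℤ) : Prop :=
  ∀ i, V.ρ K (β i) = q ^ wt i • β i

/-- The weights of a basis are bounded above, and there are finitely many vectors of each weight. -/
def FinWt {ι : Type v} (wt : ι → ℤ) : Prop :=
  (∀ s : ℤ, {i | wt i = s}.Finite) ∧ ∃ n : ℤ, ∀ i, wt i < n

section

variable {V : UqMod.{u}} {ι : Type v} {β : Module.Basis ι Kq V.carrier} {wt : ι → ℤ}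

theorem IsWtBasis.repr_K (h : IsWtBasis β wt) (i : ι) (m : V.carrier) :
    β.repr (V.ρ K m) i = q ^ wt i * β.repr m i := by
  refine LinearMap.congr_fun (f := β.coord i ∘ₗ V.ρ K)
    (g := (q ^ wt i : Kq) • β.coord i) (β.ext fun j => ?_) m
  rw [LinearMap.comp_apply, h, map_smul, LinearMap.smul_apply,
    Module.Basis.coord_apply, Module.Basis.repr_self]
  by_cases hij : i = j
  · rw [hij]
  · rw [Finsupp.single_eq_of_ne hij, smul_zero, smul_zero]

theorem IsWtBasis.wt_eq (h : IsWtBasis β wt) {s : ℤ} {m : V.carrier} (hm : V.ρ K m = q ^ s • m)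
    {i : ι} (hi : β.repr m i ≠ 0) : wt i = s := by
  have h2 := h.repr_K i m
  rw [hm, map_smul, Finsupp.smul_apply, smul_eq_mul] at h2
  exact (q_zpow_eq.mp (mul_right_cancel₀ hi h2)).symm

theorem IsWtBasis.wt_eq_span (h : IsWtBasis β wt) (s : ℤ) :
    V.wt s = Submodule.span Kq (β '' {i | wt i = s}) := by
  ext m
  rw [β.mem_span_image]
  constructor
  · intro hm i hi
    exact h.wt_eq (mem_wt.mp hm) (Finsupp.mem_support_iff.mp hi)
  · intro hm
    rw [mem_wt]
    refine β.repr.injective (Finsupp.ext fun i => ?_)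
    rw [h.repr_K, map_smul, Finsupp.smul_apply, smul_eq_mul]
    by_cases hi : β.repr m i = 0
    · rw [hi, mul_zero, mul_zero]
    · rw [show wt i = s from hm (Finsupp.mem_support_iff.mpr hi)]

theorem wt_eq_eigenspace (V : UqMod.{u}) (s : ℤ) : V.wt s = (V.ρ K).eigenspace (q ^ s) :=
  Submodule.ext fun m => by rw [mem_wt, Module.End.mem_eigenspace_iff]

theorem wt_iSupIndep (V : UqMod.{u}) : iSupIndep V.wt := by
  have h := (V.ρ K).eigenspaces_iSupIndep.comp q_zpow_injective
  rwa [show (V.ρ K).eigenspace ∘ (fun n : ℤ => (q : Kq) ^ n) = V.wt from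
    funext fun s => (wt_eq_eigenspace V s).symm] at h

theorem IsWtBasis.inO (h : IsWtBasis β wt) (hf : FinWt wt) : V.InO where
  isInternal := by
    refine DirectSum.isInternal_submodule_of_iSupIndep_of_iSup_eq_top (wt_iSupIndep V) ?_
    rw [eq_top_iff, ← β.span_eq, Submodule.span_le]
    rintro _ ⟨i, rfl⟩
    exact Submodule.mem_iSup_of_mem (wt i) (mem_wt.mpr (h i))
  finite := fun s => by
    rw [h.wt_eq_span]
    exact Module.Finite.span_of_finite Kq ((hf.1 s).image β)
  bounded := by
    obtain ⟨n, hn⟩ := hf.2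
    refine ⟨n, fun s hs => ?_⟩
    rw [h.wt_eq_span, Submodule.span_eq_bot]
    rintro _ ⟨i, hi, rfl⟩
    have := hn i
    have hi : wt i = s := hi
    omega

theorem IsWtBasis.finWt (h : IsWtBasis β wt) (hV : V.InO) : FinWt wt := by
  refine ⟨fun s => ?_, ?_⟩
  · have := hV.finite s
    let f : {i | wt i = s} → V.wt s := fun i => ⟨β i, mem_wt.mpr ((h i).trans (by rw [i.2]))⟩
    have hf : LinearIndependent Kq f := by
      refine LinearIndependent.of_comp (V.wt s).subtype ?_
      exact β.linearIndependent.comp _ Subtype.val_injective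
    have := hf.finite
    exact Set.toFinite _
  · obtain ⟨n, hn⟩ := hV.bounded
    refine ⟨n, fun i => ?_⟩
    by_contra hi
    have h1 : β i ∈ V.wt (wt i) := mem_wt.mpr (h i)
    rw [hn _ (by omega)] at h1
    exact β.ne_zero i h1

theorem isWtBasis_ofCrystal {B : CrystalData.{u}} (hB : B.Axioms) : IsWtBasis (basis hB) B.wt :=
  ofCrystal_K hB

theorem IsWtBasis.map {N : UqMod.{w}} (h : IsWtBasis β wt) {g : V.carrier ≃ₗ[Kq] N.carrier}
    (hg : ∀ (a : Uq) (m : V.carrier), g (V.ρ a m) = N.ρ a (g m)) : IsWtBasis (β.map g) wt := by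
  intro i
  rw [Module.Basis.map_apply, ← hg, h, map_smul]

/-- The basis of a tensor product of modules. -/
noncomputable def tensorBasis {V : UqMod.{u}} {W : UqMod.{v}} {ι : Type w} {κ : Type w'}
    (β : Module.Basis ι Kq V.carrier) (γ : Module.Basis κ Kq W.carrier) :
    Module.Basis (ι × κ) Kq (V.tensor W).carrier :=
  β.tensorProduct γ

theorem tensorBasis_apply {V : UqMod.{u}} {W : UqMod.{v}} {ι : Type w} {κ : Type w'}
    (β : Module.Basis ι Kq V.carrier) (γ : Module.Basis κ Kq W.carrier) (p : ι × κ) :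
    tensorBasis β γ p = tmul (β p.1) (γ p.2) :=
  β.tensorProduct_apply' γ p

theorem tensorBasis_repr {V : UqMod.{u}} {W : UqMod.{v}} {ι : Type w} {κ : Type w'}
    (β : Module.Basis ι Kq V.carrier) (γ : Module.Basis κ Kq W.carrier) (m n i) :
    (tensorBasis β γ).repr (tmul m n) i = β.repr m i.1 * γ.repr n i.2 :=
  (β.tensorProduct_repr_tmul_apply γ m n i.1 i.2).trans (mul_comm _ _)

theorem IsWtBasis.tensor {W : UqMod.{w}} {κ : Type w'} {γ : Module.Basis κ Kq W.carrier}
    {wt' : κ → ℤ} (h : IsWtBasis β wt) (h' : IsWtBasis γ wt') :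
    IsWtBasis (tensorBasis β γ) fun p => wt p.1 + wt' p.2 := by
  intro p
  rw [tensorBasis_apply, tensor_K, h, h', smul_tmul, tmul_smul, smul_smul, zpow_add₀ q_ne_zero]

end

end UqMod

end QuantumSl2

namespace QuantumSl2

open CrystalData

namespace UqMod

/-! ### Two invariant subspaces -/

/-- The vectors killed by a power of `f`. -/
noncomputable def fTorsion (V : UqMod.{u}) : Submodule Kq V.carrier :=
  ⨆ n, LinearMap.ker (V.ρ F ^ n)

theorem ker_pow_mono (V : UqMod.{u}) : Monotone fun n => LinearMap.ker (V.ρ F ^ n) :=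
  monotone_nat_of_le_succ fun n m hm => by
    rw [LinearMap.mem_ker] at hm ⊢
    rw [pow_succ', Module.End.mul_apply, hm, map_zero]

theorem mem_fTorsion {V : UqMod.{u}} {m : V.carrier} :
    m ∈ V.fTorsion ↔ ∃ n, (V.ρ F ^ n) m = 0 := by
  rw [fTorsion, Submodule.mem_iSup_of_directed _ V.ker_pow_mono.directed_le]
  rfl

theorem mem_fTorsion_of_F {V : UqMod.{u}} {m : V.carrier} (h : V.ρ F m ∈ V.fTorsion) :
    m ∈ V.fTorsion := by
  obtain ⟨n, hn⟩ := mem_fTorsion.mp h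
  exact mem_fTorsion.mpr ⟨n + 1, by rw [pow_succ, Module.End.mul_apply, hn]⟩

/-- The vectors that are divisible by every power of `e`. -/
noncomputable def eDivisible (V : UqMod.{u}) : Submodule Kq V.carrier :=
  ⨅ n, LinearMap.range (V.ρ E ^ n)

theorem mem_eDivisible {V : UqMod.{u}} {m : V.carrier} :
    m ∈ V.eDivisible ↔ ∀ n, ∃ x, (V.ρ E ^ n) x = m := by
  simp [eDivisible, Submodule.mem_iInf]

theorem le_eDivisible {V : UqMod.{u}} {S : Submodule Kq V.carrier} (h : S ≤ S.map (V.ρ E)) :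
    S ≤ V.eDivisible := by
  intro m hm
  rw [mem_eDivisible]
  intro n
  induction n generalizing m with
  | zero => exact ⟨m, rfl⟩
  | succ n ih =>
    obtain ⟨x, hx, rfl⟩ := h hm
    obtain ⟨y, rfl⟩ := ih hx
    exact ⟨y, by rw [pow_succ', Module.End.mul_apply]⟩

/-- The subspace `N` is spanned by the basis vectors with index in `S`. -/
def IsCoord {V : UqMod.{u}} {ι : Type v} (β : Module.Basis ι Kq V.carrier)
    (N : Submodule Kq V.carrier) (S : Set ι) : Prop :=
  ∀ m, m ∈ N ↔ ∀ i, β.repr m i ≠ 0 → i ∈ S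

section

variable {V : UqMod.{u}} {ι : Type v} {β : Module.Basis ι Kq V.carrier}
  {N N' : Submodule Kq V.carrier} {S S' : Set ι}

theorem isCoord_span (β : Module.Basis ι Kq V.carrier) (S : Set ι) :
    IsCoord β (Submodule.span Kq (β '' S)) S := by
  intro m
  rw [β.mem_span_image]
  exact forall_congr' fun i => by rw [Finset.mem_coe, Finsupp.mem_support_iff]

theorem IsCoord.eq_span (h : IsCoord β N S) : N = Submodule.span Kq (β '' S) :=
  Submodule.ext fun m => (h m).trans (isCoord_span β S m).symm

theorem IsCoord.inf (h : IsCoord β N S) (h' : IsCoord β N' S') : IsCoord β (N ⊓ N') (S ∩ S') := by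
  intro m
  rw [Submodule.mem_inf, h, h']
  exact ⟨fun H i hi => ⟨H.1 i hi, H.2 i hi⟩,
    fun H => ⟨fun i hi => (H i hi).1, fun i hi => (H i hi).2⟩⟩

theorem IsCoord.finrank_eq (h : IsCoord β N S) : Module.finrank Kq N = S.ncard := by
  have hli : LinearIndependent Kq fun i : S => β i :=
    β.linearIndependent.comp _ Subtype.val_injective
  rw [h.eq_span, Set.image_eq_range]
  exact Module.finrank_eq_nat_card_basis (Module.Basis.span hli)

theorem IsWtBasis.isCoord {wt : ι → ℤ} (h : IsWtBasis β wt) (s : ℤ) :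
    IsCoord β (V.wt s) {i | wt i = s} := by
  rw [h.wt_eq_span]; exact isCoord_span β _

/-- The coordinate of a vector at an index, or zero. -/
noncomputable def ocoord (β : Module.Basis ι Kq V.carrier) (x : Option ι) : V.carrier →ₗ[Kq] Kq :=
  x.elim 0 β.coord

theorem ocoord_some (i : ι) (m : V.carrier) : ocoord β (some i) m = β.repr m i := rfl

theorem ocoord_none (m : V.carrier) : ocoord β none m = 0 := rfl

theorem ocoord_pair {W : UqMod.{w}} {κ : Type w'} {γ : Module.Basis κ Kq W.carrier} (x : Option ι)
    (y : Option κ) (m : V.carrier) (n : W.carrier) :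
    ocoord (tensorBasis β γ) (pair x y) (tmul m n) = ocoord β x m * ocoord γ y n := by
  rcases x with _ | i
  · exact (zero_mul _).symm
  rcases y with _ | j
  · exact (mul_zero _).symm
  exact tensorBasis_repr β γ m n (i, j)

/-- If coefficients of `e m` on `S` depend only on coefficients of `m` at indices in `S` of smaller
height, then `e`-divisible vectors vanish on `S`. -/
theorem repr_eq_zero_of_mem_eDivisible (ht : ι → ℕ)
    (h : ∀ i ∈ S, ∀ m, (∀ j ∈ S, ht j < ht i → β.repr m j = 0) → β.repr (V.ρ E m) i = 0)
    {m : V.carrier} (hm : m ∈ V.eDivisible) {i : ι} (hi : i ∈ S) : β.repr m i = 0 := by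
  have key : ∀ n, ∀ i ∈ S, ht i < n → ∀ m, β.repr ((V.ρ E ^ n) m) i = 0 := by
    intro n
    induction n with
    | zero => intro i _ hn; omega
    | succ n ih =>
      intro i hi hn m
      rw [pow_succ', Module.End.mul_apply]
      exact h i hi _ fun j hj hji => ih j hj (by omega) m
  obtain ⟨x, rfl⟩ := mem_eDivisible.mp hm (ht i + 1)
  exact key _ i hi (Nat.lt_succ_self _) x

/-- If a vector whose image under `f` is supported on `S` is itself supported on `S`, then
`f`-torsion vectors are supported on `S`. -/
theorem mem_of_mem_fTorsion
    (h : ∀ m, (∀ i, β.repr (V.ρ F m) i ≠ 0 → i ∈ S) → ∀ i, β.repr m i ≠ 0 → i ∈ S)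
    {m : V.carrier} (hm : m ∈ V.fTorsion) {i : ι} (hi : β.repr m i ≠ 0) : i ∈ S := by
  obtain ⟨n, hn⟩ := mem_fTorsion.mp hm
  induction n generalizing m i with
  | zero =>
    rw [pow_zero, Module.End.one_apply] at hn
    rw [hn, map_zero] at hi
    exact absurd rfl hi
  | succ n ih =>
    rw [pow_succ, Module.End.mul_apply] at hn
    exact h m (fun j hj => ih (mem_fTorsion.mpr ⟨n, hn⟩) hj hn) i hi

/-- To identify the `f`-torsion or the `e`-divisible vectors, check that basis vectors belong to the
subspace and that vectors of the subspace have no other components. -/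
theorem isCoord_of (h1 : ∀ i ∈ S, β i ∈ N) (h2 : ∀ m ∈ N, ∀ i, β.repr m i ≠ 0 → i ∈ S) :
    IsCoord β N S := by
  refine fun m => ⟨h2 m, fun h => ?_⟩
  have h3 : m ∈ Submodule.span Kq (β '' S) := (isCoord_span β S m).mpr h
  refine (Submodule.span_le.mpr ?_ : _ ≤ N) h3
  rintro _ ⟨i, hi, rfl⟩
  exact h1 i hi

end

/-- A basis of weight vectors indexed by a crystal that detects the two invariant subspaces. -/
structure CrystalBasis (B : CrystalData.{u}) {V : UqMod.{v}}
    (β : Module.Basis B.carrier Kq V.carrier) : Prop where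
  wt : IsWtBasis β B.wt
  fin : IsCoord β V.fTorsion {b | B.FinStr b}
  pos : IsCoord β V.eDivisible {b | ¬ B.Pos b}

section

variable {V : UqMod.{u}} {V' : UqMod.{v}} {g : V.carrier ≃ₗ[Kq] V'.carrier}
  (hg : ∀ (a : Uq) (m : V.carrier), g (V.ρ a m) = V'.ρ a (g m))
include hg

theorem iso_pow (a : Uq) (n : ℕ) (m : V.carrier) : g ((V.ρ a ^ n) m) = (V'.ρ a ^ n) (g m) :=
  IsHom.pow (g := g.toLinearMap) hg a n m

theorem CrystalBasis.map {B : CrystalData.{w}} {β : Module.Basis B.carrier Kq V.carrier}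
    (h : CrystalBasis B β) : CrystalBasis B (β.map g) where
  wt := h.wt.map hg
  fin := by
    intro m
    obtain ⟨m, rfl⟩ := g.surjective m
    have : g m ∈ V'.fTorsion ↔ m ∈ V.fTorsion := by
      rw [mem_fTorsion, mem_fTorsion]
      exact exists_congr fun n => by rw [← iso_pow hg, LinearEquiv.map_eq_zero_iff]
    rw [this, h.fin]
    simp
  pos := by
    intro m
    obtain ⟨m, rfl⟩ := g.surjective m
    have : g m ∈ V'.eDivisible ↔ m ∈ V.eDivisible := by
      rw [mem_eDivisible, mem_eDivisible]
      refine forall_congr' fun n => ⟨?_, ?_⟩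
      · rintro ⟨x, hx⟩
        obtain ⟨x, rfl⟩ := g.surjective x
        exact ⟨x, g.injective (by rw [iso_pow hg, hx])⟩
      · rintro ⟨x, rfl⟩
        exact ⟨g x, (iso_pow hg _ _ _).symm⟩
    rw [this, h.pos]
    simp

end

section

variable {B : CrystalData.{u}} (s : ℤ)

theorem ncard_fin_not_pos : ({b | B.wt b = s} ∩ {b | B.FinStr b} ∩ {b | ¬ B.Pos b}).ncard =
    (B.stratum s True False).ncard := by
  congr 1
  ext b
  simp only [stratum, Set.mem_inter_iff, Set.mem_ofPred_eq, iff_true, iff_false, and_assoc]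

variable (hf : B.LocFinite)
include hf

theorem _root_.CrystalData.LocFinite.ncard_fin : ({b | B.wt b = s} ∩ {b | B.FinStr b}).ncard =
    (B.stratum s True True).ncard + (B.stratum s True False).ncard := by
  rw [Set.ncard_split ((hf s).subset Set.inter_subset_left) B.Pos]
  congr 2 <;> ext b <;>
    simp only [stratum, Set.mem_inter_iff, Set.mem_ofPred_eq, iff_true, iff_false, and_assoc]

theorem _root_.CrystalData.LocFinite.ncard_not_pos : ({b | B.wt b = s} ∩ {b | ¬ B.Pos b}).ncard =
    (B.stratum s True False).ncard + (B.stratum s False False).ncard := by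
  rw [Set.ncard_split ((hf s).subset Set.inter_subset_left) B.FinStr]
  congr 2 <;> ext b <;>
    simp only [stratum, Set.mem_inter_iff, Set.mem_ofPred_eq, iff_true, iff_false] <;> tauto

theorem _root_.CrystalData.LocFinite.ncard_wt : {b | B.wt b = s}.ncard =
    (B.stratum s True True).ncard + (B.stratum s True False).ncard +
      ((B.stratum s False True).ncard + (B.stratum s False False).ncard) := by
  rw [Set.ncard_split (hf s) B.FinStr]
  refine congrArg₂ (· + ·) (hf.ncard_fin s) ?_
  rw [Set.ncard_split ((hf s).subset fun b h => h.1) B.Pos]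
  congr 2 <;> ext b <;>
    simp only [stratum, Set.mem_ofPred_eq, iff_true, iff_false, and_assoc]

end

/-- A module determines the crystal of a crystal basis. -/
theorem CrystalBasis.equivalent {B : CrystalData.{u}} {C : CrystalData.{v}} {V : UqMod.{w}}
    {β : Module.Basis B.carrier Kq V.carrier} {γ : Module.Basis C.carrier Kq V.carrier}
    (hβ : CrystalBasis B β) (hγ : CrystalBasis C γ) (hB : B.Axioms) (hC : C.Axioms)
    (fB : B.LocFinite) (fC : C.LocFinite) : Equivalent B C := by
  refine equivalent_of_ncard_stratum hB hC fB fC fun s i j => ?_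
  have h1 := (hβ.wt.isCoord s).finrank_eq.symm.trans (hγ.wt.isCoord s).finrank_eq
  have h2 := ((hβ.wt.isCoord s).inf hβ.fin).finrank_eq.symm.trans
    ((hγ.wt.isCoord s).inf hγ.fin).finrank_eq
  have h3 := ((hβ.wt.isCoord s).inf hβ.pos).finrank_eq.symm.trans
    ((hγ.wt.isCoord s).inf hγ.pos).finrank_eq
  have h4 := (((hβ.wt.isCoord s).inf hβ.fin).inf hβ.pos).finrank_eq.symm.trans
    (((hγ.wt.isCoord s).inf hγ.fin).inf hγ.pos).finrank_eq
  rw [fB.ncard_wt, fC.ncard_wt] at h1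
  rw [fB.ncard_fin, fC.ncard_fin] at h2
  rw [fB.ncard_not_pos, fC.ncard_not_pos] at h3
  rw [ncard_fin_not_pos, ncard_fin_not_pos] at h4
  by_cases hi : i <;> by_cases hj : j <;> simp only [hi, hj] <;> omega

end UqMod

end QuantumSl2

namespace CrystalData.Axioms

variable {B : CrystalData.{u}} (hB : B.Axioms)
include hB

/-- The element that `f̃` maps to a given element. -/
noncomputable def _root_.CrystalData.pred (B : CrystalData.{u}) (c : B.carrier) :
    Option B.carrier :=
  open Classical in if B.f (B.e (some c)) = some c then B.e (some c) else none

theorem pred_eq_some {b c : B.carrier} : B.pred c = some b ↔ B.f (some b) = some c := by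
  unfold pred
  constructor
  · intro h
    split_ifs at h with h'
    · rwa [h] at h'
  · intro h
    rw [if_pos] <;> rw [hB.e_f h]
    exact h

/-- The second term of the operator `e` maps an element below a branch point to the element at the
same distance below the place of branching. -/
theorem exists_branch_of {b c : B.carrier}
    (h : B.f^[(B.ε c).toNat] (B.e^[(B.ε c).toNat + 1] (some c)) = some b) :
    ∃ t z, B.Branch t z ∧ B.Down (B.ε c).toNat t c ∧ B.Down (B.ε c).toNat z b := by
  have hε := hB.ε_nonneg c
  obtain ⟨t, ht⟩ := hB.exists_down_of_le (n := (B.ε c).toNat) (c := c) (by omega)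
  rw [Function.iterate_succ_apply', hB.down_e ht] at h
  have htε := hB.down_ε ht
  cases hz : B.e (some t) with
  | none => rw [hz, hB.iter_none] at h; cases h
  | some z =>
    rw [hz] at h
    refine ⟨t, z, ⟨hz, fun h' => ?_⟩, ht, h⟩
    have := hB.ε_f h'
    have := hB.ε_nonneg z
    omega

/-- The element that the second term of the operator `e` maps to a given element. -/
noncomputable def _root_.CrystalData.under (B : CrystalData.{u}) (b : B.carrier) :
    Option B.carrier :=
  open Classical in
  if h : ∃ c, B.f^[(B.ε c).toNat] (B.e^[(B.ε c).toNat + 1] (some c)) = some b then some h.choose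
  else none

theorem under_eq_some {b c : B.carrier} : B.under b = some c ↔
    B.f^[(B.ε c).toNat] (B.e^[(B.ε c).toNat + 1] (some c)) = some b := by
  unfold under
  split_ifs with h
  · refine ⟨fun h' => ?_, fun h' => congrArg some ?_⟩
    · rw [← Option.some.inj h']; exact h.choose_spec
    · obtain ⟨t, z, hb, ht, hz⟩ := hB.exists_branch_of h.choose_spec
      obtain ⟨t', z', hb', ht', hz'⟩ := hB.exists_branch_of h'
      have h1 := hB.down_φ hz
      have h2 := hB.down_φ hz'
      have h3 := hB.φ_branch hb
      have h4 := hB.φ_branch hb'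
      rw [show (B.ε c).toNat = (B.ε h.choose).toNat by omega] at ht' hz'
      obtain rfl := hB.down_inj hz hz'
      obtain rfl := hB.branch_inj hb hb'
      exact down_fun ht ht'
  · exact ⟨fun h' => absurd h' (by simp), fun h' => absurd ⟨c, h'⟩ h⟩

theorem under_eq_none {b : B.carrier} (hb : B.Pos b) : B.under b = none := by
  by_contra h
  obtain ⟨c, hc⟩ := Option.ne_none_iff_exists'.mp h
  obtain ⟨t, z, hbr, ht, hz⟩ := hB.exists_branch_of (hB.under_eq_some.mp hc)
  have h1 := hB.φ_branch hbr
  have h2 := hB.down_φ hz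
  have h3 := hb.1
  rw [show (B.ε c).toNat = 0 by omega] at hz
  obtain rfl := down_zero.mp hz
  exact hb.2 (branch_up hbr)

/-- If the top of the string of `b` has weight at least `-1`, then it is killed by `ẽ`. -/
theorem e_top_of_φ {b : B.carrier} (h : -1 ≤ B.φ b + B.ε b) :
    B.e^[(B.ε b).toNat + 1] (some b) = none := by
  have hε := hB.ε_nonneg b
  obtain ⟨t, ht⟩ := hB.exists_down_of_le (n := (B.ε b).toNat) (c := b) (by omega)
  rw [Function.iterate_succ_apply', hB.down_e ht]
  have h1 := hB.down_ε ht
  have h2 := hB.down_φ ht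
  exact hB.e_eq_none_of_ε (by omega) (hB.not_branch_of_φ (by omega))

end CrystalData.Axioms

namespace QuantumSl2

open CrystalData

namespace UqMod

/-! ### The invariant subspaces in terms of crystals -/

section

variable {B : CrystalData.{u}} (hB : B.Axioms)

theorem repr_vec (x : Option B.carrier) (b : B.carrier) [Decidable (x = some b)] :
    (basis hB).repr (vec hB x) b = if x = some b then 1 else 0 := by
  rcases x with _ | c
  · rw [vec_none, map_zero, if_neg (by simp)]; rfl
  · rw [vec_some, Module.Basis.repr_self]
    by_cases h : c = b
    · rw [if_pos (by rw [h]), h, Finsupp.single_eq_same]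
    · rw [if_neg (by simpa using h), Finsupp.single_eq_of_ne (Ne.symm h)]

theorem ocoord_basis (x : Option B.carrier) (b : B.carrier) [Decidable (x = some b)] :
    ocoord (basis hB) x (basis hB b) = if x = some b then 1 else 0 := by
  rcases x with _ | c
  · rw [if_neg (by simp)]; rfl
  · rw [ocoord_some, Module.Basis.repr_self]
    by_cases h : b = c
    · rw [if_pos (by rw [h]), h, Finsupp.single_eq_same]
    · rw [if_neg (by simpa using Ne.symm h), Finsupp.single_eq_of_ne (Ne.symm h)]

theorem repr_F (m : (ofCrystal hB).carrier) (c : B.carrier) :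
    (basis hB).repr ((ofCrystal hB).ρ F m) c = ocoord (basis hB) (B.pred c) m := by
  classical
  refine LinearMap.congr_fun (f := (basis hB).coord c ∘ₗ (ofCrystal hB).ρ F)
    ((basis hB).ext fun b => ?_) m
  rw [LinearMap.comp_apply, ← vec_some, ofCrystal_F, Module.Basis.coord_apply, repr_vec, vec_some,
    ocoord_basis]
  simp only [hB.pred_eq_some]

theorem repr_E (b : B.carrier) (m : (ofCrystal hB).carrier) :
    (basis hB).repr ((ofCrystal hB).ρ E m) b =
      qint (B.ε b + 1) * qint (B.φ b) * ocoord (basis hB) (B.f (some b)) m +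
        ocoord (basis hB) (B.under b) m := by
  classical
  refine LinearMap.congr_fun (f := (basis hB).coord b ∘ₗ (ofCrystal hB).ρ E)
    (g := (qint (B.ε b + 1) * qint (B.φ b)) • ocoord (basis hB) (B.f (some b)) +
      ocoord (basis hB) (B.under b)) ((basis hB).ext fun c => ?_) m
  rw [LinearMap.comp_apply, ofCrystal_E, map_add, map_smul, Module.Basis.coord_apply,
    Module.Basis.coord_apply, repr_vec, repr_vec, LinearMap.add_apply, LinearMap.smul_apply,
    ocoord_basis, ocoord_basis, smul_eq_mul, smul_eq_mul]
  simp only [hB.under_eq_some]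
  congr 1
  by_cases h : B.f (some b) = some c
  · rw [if_pos h, if_pos (hB.e_f h), hB.ε_f h, hB.φ_f h, sub_add_cancel]
  · have h' : B.e (some c) = some b → qint (B.ε c) = 0 := by
      intro hc
      rw [hB.ε_top fun h'' => h (by rwa [hc] at h''), qint_zero]
    rw [if_neg h]
    by_cases hc : B.e (some c) = some b
    · rw [h' hc, zero_mul, zero_mul, mul_zero]
    · rw [if_neg hc, mul_zero, mul_zero]

theorem repr_E_of_pos {b : B.carrier} (hb : B.Pos b) (m : (ofCrystal hB).carrier) :
    (basis hB).repr ((ofCrystal hB).ρ E m) b =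
      qint (B.ε b + 1) * qint (B.φ b) * ocoord (basis hB) (B.f (some b)) m := by
  rw [repr_E, hB.under_eq_none hb, ocoord_none, add_zero]

theorem ocoord_eq_zero_of_not {ι : Type v} {V : UqMod.{w}} {β : Module.Basis ι Kq V.carrier}
    {x : Option ι} {m : V.carrier} (h : ∀ i, x = some i → β.repr m i = 0) : ocoord β x m = 0 := by
  rcases x with _ | i
  · rfl
  · exact h i rfl

/-- The basis vectors outside `Pos` are images under `e` of vectors of the same kind. -/
theorem exists_E_eq {b : B.carrier} (hb : ¬ B.Pos b) :
    vec hB (some b) ∈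
      (Submodule.span Kq (basis hB '' {b | ¬ B.Pos b})).map ((ofCrystal hB).ρ E) := by
  set S := Submodule.span Kq (basis hB '' {b | ¬ B.Pos b})
  have hS : ∀ {c}, ¬ B.Pos c → vec hB (some c) ∈ S := fun {c} hc => by
    rw [vec_some]; exact Submodule.subset_span ⟨c, hc, rfl⟩
  have hf : ∀ {b}, B.φ b ≠ 0 → ∃ c, B.f (some b) = some c := fun {b} h =>
    Option.ne_none_iff_exists'.mp fun h' => h (hB.φ_bottom h')
  have hE : ∀ {b c}, B.f (some b) = some c → (ofCrystal hB).ρ E (vec hB (some c)) =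
      (qint (B.ε b + 1) * qint (B.φ b)) • vec hB (some b) +
        vec hB (B.f^[(B.ε b).toNat + 1] (B.e^[(B.ε b).toNat + 1] (some b))) := by
    intro b c h
    have hε := hB.ε_nonneg b
    rw [vec_some, ofCrystal_E, hB.ε_f h, hB.φ_f h, sub_add_cancel, hB.e_f h,
      show (B.ε b + 1).toNat = (B.ε b).toNat + 1 by omega,
      Function.iterate_succ_apply _ ((B.ε b).toNat + 1), hB.e_f h]
  have hsmul : ∀ {b c}, B.φ b ≠ 0 → vec hB (some c) ∈ S → ∀ y ∈ S.map ((ofCrystal hB).ρ E),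
      (ofCrystal hB).ρ E (vec hB (some c)) =
        (qint (B.ε b + 1) * qint (B.φ b)) • vec hB (some b) + y →
      vec hB (some b) ∈ S.map ((ofCrystal hB).ρ E) := by
    intro b c h0 hc y hy h
    have hε := hB.ε_nonneg b
    have h1 : (qint (B.ε b + 1) * qint (B.φ b)) • vec hB (some b) ∈ S.map ((ofCrystal hB).ρ E) := by
      rw [← sub_eq_iff_eq_add.mpr h]
      exact Submodule.sub_mem _ (Submodule.mem_map_of_mem hc) hy
    exact (Submodule.smul_mem_iff _ (mul_ne_zero (qint_ne_zero (by omega)) (qint_ne_zero h0))).mp h1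
  -- First the strings whose top is killed by `ẽ`, where `e` has no second term.
  have h1 : ∀ {b}, B.φ b ≠ 0 → (∀ c, B.f (some b) = some c → ¬ B.Pos c) →
      B.e^[(B.ε b).toNat + 1] (some b) = none →
      vec hB (some b) ∈ S.map ((ofCrystal hB).ρ E) := by
    intro b h0 hp he
    obtain ⟨c, hc⟩ := hf h0
    refine hsmul h0 (hS (hp c hc)) 0 (Submodule.zero_mem _) ?_
    rw [hE hc, he, hB.iter_none, vec_none]
  have hneg : ∀ {b}, B.φ b < 0 → ∀ c, B.f (some b) = some c → ¬ B.Pos c := by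
    intro b h0 c hc hp
    have := hB.φ_f hc
    have := hp.1
    omega
  rcases lt_trichotomy (B.φ b) 0 with h0 | h0 | h0
  · obtain ⟨c, hc⟩ := hf h0.ne
    refine hsmul h0.ne (hS (hneg h0 c hc)) _ ?_ (hE hc)
    -- The second term is zero or a basis vector of a string whose top is killed by `ẽ`.
    cases hy : B.f^[(B.ε b).toNat + 1] (B.e^[(B.ε b).toNat + 1] (some b)) with
    | none => exact Submodule.zero_mem _
    | some y =>
      cases hz : B.e^[(B.ε b).toNat + 1] (some b) with
      | none => rw [hz, hB.iter_none] at hy; cases hy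
      | some z =>
        rw [hz] at hy
        have hε := hB.ε_nonneg b
        have hεz := hB.ε_nonneg z
        obtain ⟨t, ht⟩ := hB.exists_down_of_le (n := (B.ε b).toNat) (c := b) (by omega)
        rw [Function.iterate_succ_apply', hB.down_e ht] at hz
        have htε := hB.down_ε ht
        have hbr : B.Branch t z := by
          refine ⟨hz, fun h' => ?_⟩
          have := hB.ε_f h'
          omega
        have h2 := hB.φ_branch hbr
        have h3 := hB.down_φ hy
        have h4 := hB.down_ε hy
        exact h1 (by omega) (hneg (by omega)) (hB.e_top_of_φ (by omega))
  · have hu : B.Up b := by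
      by_contra hu
      exact hb ⟨h0.ge, hu⟩
    obtain ⟨a, ha⟩ := (hB.up_iff_of_φ_eq_zero h0).mp hu
    have h2 := hB.branch_φ ha
    have hε := hB.ε_nonneg b
    refine ⟨vec hB (some a), hS fun hp => ?_, ?_⟩
    · have := hp.1; omega
    · rw [vec_some, ofCrystal_E_top hB (hB.branch_ε ha), ha.1]
  · have hε := hB.ε_nonneg b
    refine h1 h0.ne' (fun c hc hp => ?_) (hB.e_top_of_φ (by omega))
    exact hb (hB.pos_of_pos hc hp)

theorem crystalBasis_ofCrystal : CrystalBasis B (basis hB) where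
  wt := isWtBasis_ofCrystal hB
  fin := by
    refine isCoord_of (fun b hb => ?_) fun m hm i hi =>
      mem_of_mem_fTorsion (fun m h b hb => ?_) hm hi
    · obtain ⟨n, hn⟩ := hb
      exact mem_fTorsion.mpr ⟨n, by rw [← vec_some, ofCrystal_F_iter, hn, vec_none]⟩
    · by_contra hfin
      obtain ⟨c, hc⟩ : ∃ c, B.f (some b) = some c := Option.ne_none_iff_exists'.mp fun h' =>
        hfin ⟨1, h'⟩
      refine hfin ((hB.f_fin hc).mpr (h c ?_))
      rw [repr_F, hB.pred_eq_some.mpr hc]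
      exact hb
  pos := by
    refine isCoord_of (fun b hb => ?_) fun m hm i hi hp => hi ?_
    · refine le_eDivisible (S := Submodule.span Kq (basis hB '' {b | ¬ B.Pos b}))
        (Submodule.span_le.mpr ?_) (Submodule.subset_span ⟨b, hb, rfl⟩)
      rintro _ ⟨c, hc, rfl⟩
      rw [← vec_some]
      exact exists_E_eq hB hc
    · refine repr_eq_zero_of_mem_eDivisible (S := {b | B.Pos b}) (fun b => (B.φ b).toNat) ?_ hm hp
      intro b hb x hx
      rw [repr_E_of_pos hB hb]
      by_cases h0 : B.φ b = 0
      · rw [h0, qint_zero, mul_zero, zero_mul]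
      · rw [ocoord_eq_zero_of_not, mul_zero]
        intro c hc
        have h1 := hB.φ_f hc
        have h2 := hb.1
        refine hx c ((hB.pos_f_iff hc (by omega)).mp hb) ?_
        omega

/-- On the module with a given crystal, the operator `e` is locally nilpotent. -/
theorem exists_E_pow (m : (ofCrystal hB).carrier) : ∃ n, ((ofCrystal hB).ρ E ^ n) m = 0 := by
  have hle : ∀ {n k : ℕ} {m : (ofCrystal hB).carrier}, n ≤ k → ((ofCrystal hB).ρ E ^ n) m = 0 →
      ((ofCrystal hB).ρ E ^ k) m = 0 := by
    intro n k m hk hm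
    obtain ⟨d, rfl⟩ := Nat.exists_eq_add_of_le' hk
    rw [pow_add, Module.End.mul_apply, hm, map_zero]
  have key : ∀ n x, B.e^[n] x = none → ((ofCrystal hB).ρ E ^ n) (vec hB x) = 0 := by
    intro n
    induction n with
    | zero => rintro x rfl; rfl
    | succ n ih =>
      rintro (_ | b) h
      · exact map_zero _
      have h1 : B.e^[n] (B.f^[(B.ε b).toNat] (B.e^[(B.ε b).toNat + 1] (some b))) = none := by
        cases hc : B.f^[(B.ε b).toNat] (B.e^[(B.ε b).toNat + 1] (some b)) with
        | none => exact hB.e_iter_none n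
        | some c =>
          obtain ⟨t, z, hbr, ht, hz⟩ := hB.exists_branch_of hc
          have hn : (B.ε b).toNat ≤ n := by
            by_contra hn
            obtain ⟨d, hd⟩ := Nat.exists_eq_add_of_le (show n + 1 ≤ (B.ε b).toNat by omega)
            have h2 := hB.down_e ht
            rw [hd, add_comm, Function.iterate_add_apply, h, hB.e_iter_none] at h2
            cases h2
          obtain ⟨d, rfl⟩ := Nat.exists_eq_add_of_le hn
          rw [add_comm, Function.iterate_add_apply, hB.down_e hz, ← hbr.1, ← hB.down_e ht,
            ← Function.iterate_succ_apply' B.e, ← Function.iterate_add_apply, Nat.succ_eq_add_one,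
            show d + ((B.ε b).toNat + 1) = (B.ε b).toNat + d + 1 by ring, h]
      rw [pow_succ, Module.End.mul_apply, vec_some, ofCrystal_E, map_add, map_smul, ih _ h1,
        ih _ (by rwa [← Function.iterate_succ_apply]), smul_zero, add_zero]
  induction (basis hB).mem_span m using Submodule.span_induction with
  | mem x hx =>
    obtain ⟨b, rfl⟩ := hx
    obtain ⟨l, x, hx, hl⟩ := hB.exists_root b
    exact ⟨l + 1, by rw [← vec_some]; exact key _ _ (by rw [Function.iterate_succ_apply', hl, hx])⟩
  | zero => exact ⟨0, map_zero _⟩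
  | smul c x _ hx =>
    obtain ⟨n, hn⟩ := hx
    exact ⟨n, by rw [map_smul, hn, smul_zero]⟩
  | add x y _ _ hx hy =>
    obtain ⟨n, hn⟩ := hx
    obtain ⟨k, hk⟩ := hy
    exact ⟨max n k, by rw [map_add, hle (le_max_left _ _) hn, hle (le_max_right _ _) hk, add_zero]⟩

/-- A vector killed by `e` has components only at elements killed by `ẽ` and at the images of
elements `c` with `φ(c) = 0` under `f̃`. -/
theorem e_eq_none_or_of_E_eq_zero {m : (ofCrystal hB).carrier} (hm : (ofCrystal hB).ρ E m = 0)
    {b : B.carrier} (hb : (basis hB).repr m b ≠ 0) : B.e (some b) = none ∨ B.φ b = -1 := by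
  have hE : ∀ c, qint (B.ε c + 1) * qint (B.φ c) * ocoord (basis hB) (B.f (some c)) m +
      ocoord (basis hB) (B.under c) m = 0 := by
    intro c
    rw [← repr_E, hm, map_zero]; rfl
  have hcoef : ∀ {b c}, B.f (some c) = some b → ocoord (basis hB) (B.under c) m = 0 →
      (basis hB).repr m b ≠ 0 → B.φ b = -1 := by
    intro b c hc hu hb
    have h := hE c
    have hε := hB.ε_nonneg c
    rw [hc, hu, add_zero, ocoord_some, mul_assoc, mul_eq_zero,
      or_iff_right (qint_ne_zero (by omega)), mul_eq_zero, or_iff_left hb] at h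
    have h0 : B.φ c = 0 := by
      by_contra h0
      exact qint_ne_zero h0 h
    rw [hB.φ_f hc, h0]; rfl
  -- The components below a branch point vanish.
  have hbr : ∀ {n t z d}, B.Branch t z → B.Down n t d → (basis hB).repr m d = 0 := by
    intro n t z d htz hd
    by_contra hne
    have hφ := hB.branch_φ htz
    have hφd := hB.down_φ hd
    have hεz := hB.ε_nonneg z
    cases n with
    | zero =>
      obtain rfl := Axioms.down_zero.mp hd
      have hu : B.under z = some t := by
        rw [hB.under_eq_some, hB.branch_ε htz]
        exact htz.1
      have h := hE z
      rw [hB.φ_branch htz, qint_zero, mul_zero, zero_mul, zero_add, hu] at h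
      exact hne h
    | succ n =>
      obtain ⟨c, hc, hcd⟩ := hB.down_succ.mp hd
      have hu : B.under c = none := by
        by_contra hu
        obtain ⟨d', hd'⟩ := Option.ne_none_iff_exists'.mp hu
        obtain ⟨t', z', hbr, -, hz'⟩ := hB.exists_branch_of (hB.under_eq_some.mp hd')
        have h1 := hB.down_φ hz'
        have h2 := hB.down_ε hz'
        have h3 := hB.φ_branch hbr
        have h4 := hB.ε_nonneg z'
        have h5 := hB.down_φ hc
        have h6 := hB.down_ε hc
        have h7 := hB.branch_ε htz
        omega
      have := hcoef hcd (by rw [hu, ocoord_none]) hne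
      push_cast at hφd
      omega
  by_cases he : B.e (some b) = none
  · exact Or.inl he
  right
  obtain ⟨c, hc⟩ := Option.ne_none_iff_exists'.mp he
  rcases hB.e_cases.mp hc with h | h
  · refine hcoef h ?_ hb
    refine ocoord_eq_zero_of_not fun d hd => ?_
    obtain ⟨t, z, htz, ht, -⟩ := hB.exists_branch_of (hB.under_eq_some.mp hd)
    exact hbr htz ht
  · exact absurd (hbr (n := 0) h (Axioms.down_zero.mpr rfl)) hb

end

end UqMod

end QuantumSl2

namespace QuantumSl2

open CrystalData

namespace UqMod

/-! ### Crystal bases of tensor products -/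

section

variable {V : UqMod.{u}} {W : UqMod.{v}}

/-- A subspace `D` with `D ⊆ e D` gives `e`-divisible vectors of tensor products with modules on
which `e` is locally nilpotent. -/
theorem tmul_left_mem_eDivisible {D : Submodule Kq V.carrier} (hD : D ≤ D.map (V.ρ E))
    (hW : ∀ w : W.carrier, ∃ n, (W.ρ E ^ n) w = 0) {v : V.carrier} (hv : v ∈ D) (w : W.carrier) :
    tmul v w ∈ (V.tensor W).eDivisible := by
  let S : Submodule Kq (V.tensor W).carrier :=
    Submodule.span Kq {x | ∃ v ∈ D, ∃ w, tmul v w = x}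
  have hS : ∀ {v}, v ∈ D → ∀ w : W.carrier, tmul v w ∈ S := fun {v} hv w =>
    Submodule.subset_span ⟨v, hv, w, rfl⟩
  refine le_eDivisible (S := S) (Submodule.span_le.mpr ?_) (hS hv w)
  rintro _ ⟨v, hv, w, rfl⟩
  -- Induction on the nilpotency of `e` on `w`: with `v = e x`, the vector `v ⊗ w` differs from an
  -- element of `e S` by `x ⊗ e k⁻¹ w`.
  obtain ⟨n, hn⟩ := hW w
  induction n generalizing v w with
  | zero =>
    rw [pow_zero, Module.End.one_apply] at hn
    rw [hn, tmul_zero]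
    exact Submodule.zero_mem _
  | succ n ih =>
    obtain ⟨x, hx, rfl⟩ := hD hv
    have h1 : (V.tensor W).ρ E (tmul x (W.ρ Kinv w)) =
        tmul (V.ρ E x) w + tmul x (W.ρ E (W.ρ Kinv w)) := by
      rw [tensor_E, ← ρ_mul K Kinv, satisfies_gen.k_kinv, map_one, Module.End.one_apply]
    have h2 : (W.ρ E ^ n) (W.ρ E (W.ρ Kinv w)) = 0 := by
      have h3 : ∀ n : ℕ, ∃ c : Kq, E ^ n * Kinv = c • (Kinv * E ^ n) := by
        intro n
        induction n with
        | zero => exact ⟨1, by simp⟩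
        | succ n ih =>
          obtain ⟨c, hc⟩ := ih
          refine ⟨c * q ^ 2, ?_⟩
          rw [pow_succ', mul_assoc, hc, mul_smul_comm, ← mul_assoc, E_mul_Kinv, smul_mul_assoc,
            smul_smul, mul_assoc]
      obtain ⟨c, hc⟩ := h3 (n + 1)
      rw [← Module.End.mul_apply, ← pow_succ, ← map_pow, ← ρ_mul, hc, map_smul,
        LinearMap.smul_apply, ρ_mul, map_pow, hn, map_zero, smul_zero]
    rw [SetLike.mem_coe, ← sub_eq_iff_eq_add.mpr h1]
    exact Submodule.sub_mem _ (Submodule.mem_map_of_mem (hS hx _)) (ih x hx _ h2)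

theorem tmul_right_mem_eDivisible {D : Submodule Kq W.carrier} (hD : D ≤ D.map (W.ρ E))
    (hK : ∀ w ∈ D, W.ρ K w ∈ D) (hV : ∀ v : V.carrier, ∃ n, (V.ρ E ^ n) v = 0) (v : V.carrier)
    {w : W.carrier} (hw : w ∈ D) : tmul v w ∈ (V.tensor W).eDivisible := by
  let S : Submodule Kq (V.tensor W).carrier :=
    Submodule.span Kq {x | ∃ v, ∃ w ∈ D, tmul v w = x}
  have hS : ∀ (v : V.carrier) {w}, w ∈ D → tmul v w ∈ S := fun v {w} hw =>
    Submodule.subset_span ⟨v, w, hw, rfl⟩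
  refine le_eDivisible (S := S) (Submodule.span_le.mpr ?_) (hS v hw)
  rintro _ ⟨v, w, hw, rfl⟩
  obtain ⟨n, hn⟩ := hV v
  induction n generalizing v w with
  | zero =>
    rw [pow_zero, Module.End.one_apply] at hn
    rw [hn, zero_tmul]
    exact Submodule.zero_mem _
  | succ n ih =>
    obtain ⟨x, hx, rfl⟩ := hD hw
    have h1 := tensor_E v x
    rw [SetLike.mem_coe, ← sub_eq_iff_eq_add'.mpr h1]
    refine Submodule.sub_mem _ (Submodule.mem_map_of_mem (hS v hx)) (ih _ _ (hK x hx) ?_)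
    rw [← Module.End.mul_apply, ← pow_succ, hn]

end

theorem isWtBasis_span_K {V : UqMod.{u}} {ι : Type v} {β : Module.Basis ι Kq V.carrier}
    {wt : ι → ℤ} (h : IsWtBasis β wt) (S : Set ι) {m : V.carrier}
    (hm : m ∈ Submodule.span Kq (β '' S)) : V.ρ K m ∈ Submodule.span Kq (β '' S) := by
  have h1 := isCoord_span β S
  rw [h1] at hm ⊢
  exact fun i hi => hm i fun h0 => hi (by rw [h.repr_K, h0, mul_zero])

theorem crystalBasis_reindex {B : CrystalData.{u}} {V : UqMod.{v}} {ι : Type w}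
    (β : Module.Basis ι Kq V.carrier) (e : ι ≃ B.carrier) (h1 : IsWtBasis β fun i => B.wt (e i))
    (h2 : IsCoord β V.fTorsion {i | B.FinStr (e i)})
    (h3 : IsCoord β V.eDivisible {i | ¬ B.Pos (e i)}) : CrystalBasis B (β.reindex e) where
  wt := fun b => by
    obtain ⟨i, rfl⟩ := e.surjective b
    rw [Module.Basis.reindex_apply, Equiv.symm_apply_apply, h1]
  fin := fun m => by
    rw [h2, e.forall_congr_left]
    simp
  pos := fun m => by
    rw [h3, e.forall_congr_left]
    simp

theorem le_map_E {B : CrystalData.{u}} (hB : B.Axioms) :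
    Submodule.span Kq (basis hB '' {b | ¬ B.Pos b}) ≤
      (Submodule.span Kq (basis hB '' {b | ¬ B.Pos b})).map ((ofCrystal hB).ρ E) := by
  refine Submodule.span_le.mpr ?_
  rintro _ ⟨c, hc, rfl⟩
  rw [← vec_some]
  exact exists_E_eq hB hc

section

variable {B : CrystalData.{u}} {B' : CrystalData.{v}} (hB : B.Axioms) (hB' : B'.Axioms)

theorem repr_tensor_F (m : ((ofCrystal hB).tensor (ofCrystal hB')).carrier) (c : B.carrier)
    (c' : B'.carrier) :
    (tensorBasis (basis hB) (basis hB')).repr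
      (((ofCrystal hB).tensor (ofCrystal hB')).ρ F m) (c, c') =
    ocoord (tensorBasis (basis hB) (basis hB')) (pair (B.pred c) (some c')) m +
      q ^ (-B.wt c) *
          ocoord (tensorBasis (basis hB) (basis hB')) (pair (some c) (B'.pred c')) m := by
  refine LinearMap.congr_fun (f := (tensorBasis (basis hB) (basis hB')).coord (c, c') ∘ₗ _)
    (g := _ + (q ^ (-B.wt c) : Kq) • _) (tensor_ext fun v w => ?_) m
  have hK : (basis hB).repr ((ofCrystal hB).ρ Kinv v) c = q ^ (-B.wt c) * (basis hB).repr v c := by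
    have h := (isWtBasis_ofCrystal hB).repr_K c ((ofCrystal hB).ρ Kinv v)
    rw [← ρ_mul, satisfies_gen.k_kinv, map_one, Module.End.one_apply] at h
    rw [h, ← mul_assoc, ← zpow_add₀ q_ne_zero, neg_add_cancel, zpow_zero, one_mul]
  rw [LinearMap.comp_apply, tensor_F, LinearMap.add_apply, LinearMap.smul_apply, ocoord_pair,
    ocoord_pair, map_add, Module.Basis.coord_apply, Module.Basis.coord_apply, tensorBasis_repr,
    tensorBasis_repr, repr_F, repr_F, hK, ocoord_some, ocoord_some, smul_eq_mul, mul_assoc]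

theorem repr_tensor_E {b : B.carrier} {b' : B'.carrier} (hb : B.Pos b) (hb' : B'.Pos b')
    (m : ((ofCrystal hB).tensor (ofCrystal hB')).carrier) :
    (tensorBasis (basis hB) (basis hB')).repr
      (((ofCrystal hB).tensor (ofCrystal hB')).ρ E m) (b, b') =
    q ^ B'.wt b' * (qint (B.ε b + 1) * qint (B.φ b)) *
        ocoord (tensorBasis (basis hB) (basis hB')) (pair (B.f (some b)) (some b')) m +
      qint (B'.ε b' + 1) * qint (B'.φ b') *
        ocoord (tensorBasis (basis hB) (basis hB')) (pair (some b) (B'.f (some b'))) m := by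
  refine LinearMap.congr_fun (f := (tensorBasis (basis hB) (basis hB')).coord (b, b') ∘ₗ _)
    (g := (q ^ B'.wt b' * (qint (B.ε b + 1) * qint (B.φ b)) : Kq) • _ +
      (qint (B'.ε b' + 1) * qint (B'.φ b') : Kq) • _) (tensor_ext fun v w => ?_) m
  have hK := (isWtBasis_ofCrystal hB').repr_K b' w
  rw [LinearMap.comp_apply, tensor_E, LinearMap.add_apply, LinearMap.smul_apply,
    LinearMap.smul_apply, ocoord_pair, ocoord_pair, map_add, Module.Basis.coord_apply,
    Module.Basis.coord_apply, tensorBasis_repr, tensorBasis_repr, repr_E_of_pos hB hb,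
    repr_E_of_pos hB' hb', hK,
    ocoord_some, ocoord_some, smul_eq_mul, smul_eq_mul]
  ring

/-- A vector is supported on products of finite strings if its image under `f` is. -/
theorem tensor_fTorsion_coord {m : ((ofCrystal hB).tensor (ofCrystal hB')).carrier}
    (h : ∀ p, (tensorBasis (basis hB) (basis hB')).repr
      (((ofCrystal hB).tensor (ofCrystal hB')).ρ F m) p ≠ 0 → B.FinStr p.1 ∧ B'.FinStr p.2)
    (p : B.carrier × B'.carrier) (hp : (tensorBasis (basis hB) (basis hB')).repr m p ≠ 0) :
    B.FinStr p.1 ∧ B'.FinStr p.2 := by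
  classical
  set T := tensorBasis (basis hB) (basis hB')
  have hsupp : ∀ p, p ∈ (T.repr m).support ↔ T.repr m p ≠ 0 := fun p => Finsupp.mem_support_iff
  constructor
  · -- Otherwise consider a component of this kind whose second factor has maximal weight.
    by_contra hfin
    obtain ⟨⟨b, b'⟩, hb, hmax⟩ :=
      ((T.repr m).support.filter fun p => ¬ B.FinStr p.1).exists_max_image
      (fun p => B'.wt p.2) ⟨p, Finset.mem_filter.mpr ⟨(hsupp p).mpr hp, hfin⟩⟩
    obtain ⟨hb, hbf⟩ := Finset.mem_filter.mp hb
    obtain ⟨c, hc⟩ := Option.ne_none_iff_exists'.mp fun h' => hbf ⟨1, h'⟩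
    have hc' : B.f (some b) = some c := hc
    have hcf : ¬ B.FinStr c := fun h' => hbf ((hB.f_fin hc').mpr h')
    refine hcf (h (c, b') ?_).1
    rw [repr_tensor_F, hB.pred_eq_some.mpr hc', ocoord_eq_zero_of_not (x := pair (some c) _),
      mul_zero,
      add_zero]
    · exact (hsupp _).mp hb
    · rintro ⟨d, d'⟩ hd
      by_contra h0
      cases hz : B'.pred b' with
      | none => rw [hz] at hd; cases hd
      | some z =>
        rw [hz] at hd
        rw [← (Option.some.inj hd : (c, z) = _)] at h0
        have h1 := hmax (c, z) (Finset.mem_filter.mpr ⟨(hsupp _).mpr h0, hcf⟩)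
        have h2 := hB'.wt_f (hB'.pred_eq_some.mp hz)
        simp only at h1
        omega
  · -- Symmetrically, consider such a component whose first factor has maximal weight.
    by_contra hfin
    obtain ⟨⟨b, b'⟩, hb, hmax⟩ :=
      ((T.repr m).support.filter fun p => ¬ B'.FinStr p.2).exists_max_image
      (fun p => B.wt p.1) ⟨p, Finset.mem_filter.mpr ⟨(hsupp p).mpr hp, hfin⟩⟩
    obtain ⟨hb, hbf⟩ := Finset.mem_filter.mp hb
    obtain ⟨c, hc⟩ := Option.ne_none_iff_exists'.mp fun h' => hbf ⟨1, h'⟩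
    have hc' : B'.f (some b') = some c := hc
    have hcf : ¬ B'.FinStr c := fun h' => hbf ((hB'.f_fin hc').mpr h')
    refine hcf (h (b, c) ?_).2
    rw [repr_tensor_F, hB'.pred_eq_some.mpr hc', ocoord_eq_zero_of_not (x := pair _ (some c)),
      zero_add]
    · exact mul_ne_zero (zpow_ne_zero _ q_ne_zero) ((hsupp _).mp hb)
    · rintro ⟨d, d'⟩ hd
      by_contra h0
      cases hz : B.pred b with
      | none => rw [hz] at hd; cases hd
      | some z =>
        rw [hz] at hd
        rw [← (Option.some.inj hd : (z, c) = _)] at h0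
        have h1 := hmax (z, c) (Finset.mem_filter.mpr ⟨(hsupp _).mpr h0, hcf⟩)
        have h2 := hB.wt_f (hB.pred_eq_some.mp hz)
        simp only at h1
        omega

theorem tmul_mem_fTorsion {b : B.carrier} {b' : B'.carrier} (hb : B.FinStr b) (hb' : B'.FinStr b') :
    tmul (vec hB (some b)) (vec hB' (some b')) ∈
      ((ofCrystal hB).tensor (ofCrystal hB')).fTorsion := by
  obtain ⟨n, hn⟩ : ∃ n : ℕ, B.φ b + B'.φ b' < n := ⟨(B.φ b + B'.φ b' + 1).toNat, by omega⟩
  induction n generalizing b b' with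
  | zero => have := hB.fin_φ hb; have := hB'.fin_φ hb'; omega
  | succ n ih =>
    refine mem_fTorsion_of_F ?_
    have hK : (ofCrystal hB).ρ Kinv (vec hB (some b)) = q ^ (-B.wt b) • vec hB (some b) := by
      rw [vec_some]; exact Kinv_of_K (ofCrystal_K hB b)
    rw [tensor_F, ofCrystal_F, ofCrystal_F, hK, smul_tmul]
    refine Submodule.add_mem _ ?_ (Submodule.smul_mem _ _ ?_)
    · cases hc : B.f (some b) with
      | none => rw [vec_none, zero_tmul]; exact Submodule.zero_mem _
      | some c => exact ih ((hB.f_fin hc).mp hb) hb' (by have := hB.φ_f hc; push_cast at hn; omega)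
    · cases hc : B'.f (some b') with
      | none => rw [vec_none, tmul_zero]; exact Submodule.zero_mem _
      | some c =>
        exact ih hb ((hB'.f_fin hc).mp hb') (by have := hB'.φ_f hc; push_cast at hn; omega)

/-- The `e`-divisible vectors have no component at `b ⊗ b'` with `b` and `b'` positive: there `e`
multiplies coordinates by quantum integers that vanish at `φ = 0`, so that induction on
`φ(b) + φ(b')` applies. -/
theorem tensor_eDivisible_coord {m : ((ofCrystal hB).tensor (ofCrystal hB')).carrier}
    (hm : m ∈ ((ofCrystal hB).tensor (ofCrystal hB')).eDivisible) {p : B.carrier × B'.carrier}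
    (hp : B.Pos p.1 ∧ B'.Pos p.2) : (tensorBasis (basis hB) (basis hB')).repr m p = 0 := by
  refine repr_eq_zero_of_mem_eDivisible (S := {p : B.carrier × B'.carrier | B.Pos p.1 ∧ B'.Pos p.2})
    (fun p => (B.φ p.1).toNat + (B'.φ p.2).toNat) ?_ hm hp
  rintro ⟨b, b'⟩ ⟨hb, hb'⟩ x hx
  simp only at hb hb'
  have h2 := hb.1
  have h2' := hb'.1
  have h3 : qint (B.φ b) * ocoord (tensorBasis (basis hB) (basis hB'))
      (pair (B.f (some b)) (some b')) x = 0 := by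
    by_cases h0 : B.φ b = 0
    · rw [h0, qint_zero, zero_mul]
    · rw [ocoord_eq_zero_of_not, mul_zero]
      intro p hp
      cases hc : B.f (some b) with
      | none => rw [hc] at hp; cases hp
      | some c =>
        rw [hc] at hp
        cases hp
        have h1 := hB.φ_f hc
        refine hx (c, b') ⟨(hB.pos_f_iff hc (by omega)).mp hb, hb'⟩ ?_
        change (B.φ c).toNat + (B'.φ b').toNat < (B.φ b).toNat + (B'.φ b').toNat
        omega
  have h4 : qint (B'.φ b') * ocoord (tensorBasis (basis hB) (basis hB'))
      (pair (some b) (B'.f (some b'))) x = 0 := by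
    by_cases h0 : B'.φ b' = 0
    · rw [h0, qint_zero, zero_mul]
    · rw [ocoord_eq_zero_of_not, mul_zero]
      intro p hp
      cases hc : B'.f (some b') with
      | none => rw [hc] at hp; cases hp
      | some c =>
        rw [hc] at hp
        cases hp
        have h1 := hB'.φ_f hc
        refine hx (b, c) ⟨hb, (hB'.pos_f_iff hc (by omega)).mp hb'⟩ ?_
        change (B.φ b).toNat + (B'.φ c).toNat < (B.φ b).toNat + (B'.φ b').toNat
        omega
  rw [repr_tensor_E hB hB' hb hb']
  linear_combination (q ^ B'.wt b' * qint (B.ε b + 1)) * h3 + qint (B'.ε b' + 1) * h4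

theorem isCoord_tensor_fTorsion : IsCoord (tensorBasis (basis hB) (basis hB'))
    ((ofCrystal hB).tensor (ofCrystal hB')).fTorsion
    {p : B.carrier × B'.carrier | B.FinStr p.1 ∧ B'.FinStr p.2} := by
  refine isCoord_of ?_ fun m hm p hp =>
    mem_of_mem_fTorsion (fun m h => tensor_fTorsion_coord hB hB' h) hm hp
  rintro ⟨b, b'⟩ ⟨hb, hb'⟩
  have := tmul_mem_fTorsion hB hB' hb hb'
  rw [vec_some, vec_some] at this
  rw [tensorBasis_apply]
  exact this

theorem isCoord_tensor_eDivisible :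
    IsCoord (tensorBasis (basis hB) (basis hB'))
      ((ofCrystal hB).tensor (ofCrystal hB')).eDivisible
      {p : B.carrier × B'.carrier | ¬ (B.Pos p.1 ∧ B'.Pos p.2)} := by
  refine isCoord_of ?_ fun m hm p hp h => hp (tensor_eDivisible_coord hB hB' hm h)
  rintro ⟨b, b'⟩ h
  rw [tensorBasis_apply]
  rcases not_and_or.mp h with h1 | h1
  · exact tmul_left_mem_eDivisible (le_map_E hB) (exists_E_pow hB')
      (Submodule.subset_span ⟨b, h1, rfl⟩) _
  · exact tmul_right_mem_eDivisible (le_map_E hB')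
      (fun w hw => isWtBasis_span_K (isWtBasis_ofCrystal hB') _ hw)
      (exists_E_pow hB) _ (Submodule.subset_span ⟨b', h1, rfl⟩)

/-- The tensor product of crystals is the crystal of the tensor product of modules. -/
theorem exists_crystalBasis_tensor :
    ∃ β : Module.Basis (B.tensor B').carrier Kq ((ofCrystal hB).tensor (ofCrystal hB')).carrier,
      CrystalBasis (B.tensor B') β := by
  let e : B.carrier × B'.carrier ≃ (B.tensor B').carrier := Equiv.refl _
  have h1 : {p : B.carrier × B'.carrier | B.FinStr p.1 ∧ B'.FinStr p.2} =
      {p | (B.tensor B').FinStr (e p)} := Set.ext fun p => (hB.tensor_finStr hB').symm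
  have h2 : {p : B.carrier × B'.carrier | ¬ (B.Pos p.1 ∧ B'.Pos p.2)} =
      {p | ¬ (B.tensor B').Pos (e p)} := Set.ext fun p => not_congr (hB.tensor_pos hB').symm
  have h3 := (isWtBasis_ofCrystal hB).tensor (isWtBasis_ofCrystal hB')
  have h4 := isCoord_tensor_fTorsion hB hB'
  have h5 := isCoord_tensor_eDivisible hB hB'
  rw [h1] at h4
  rw [h2] at h5
  exact ⟨_, crystalBasis_reindex (tensorBasis (basis hB) (basis hB')) e h3 h4 h5⟩

end

end UqMod

end QuantumSl2

/-! ### Decomposing a pair of operators -/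

theorem Submodule.exists_relCompl {k : Type u} {V : Type v} [Field k] [AddCommGroup V] [Module k V]
    {P Q : Submodule k V} (h : P ≤ Q) :
    ∃ R ≤ Q, P ⊓ R = ⊥ ∧ P ⊔ R = Q := by
  obtain ⟨R, hR⟩ := Submodule.exists_isCompl P
  refine ⟨R ⊓ Q, inf_le_right, ?_, ?_⟩
  · rw [← inf_assoc, hR.inf_eq_bot, bot_inf_eq]
  · rw [← sup_inf_assoc_of_le R h, hR.sup_eq_top, top_inf_eq]

/-- Representations of the quiver with two vertices `A` and `B` and arrows `a : A → B` and
`b : B → A` with `b ∘ a = 0` are sums of indecomposable representations; there are five of these,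
with bases `x₁`; `x₃, a x₃`; `x₄, b x₄`; `x₅, b x₅, a (b x₅)`; `y`. -/
theorem exists_quiver_decomposition {k : Type u} {V : Type v} [Field k] [AddCommGroup V]
    [Module k V] (A B : Submodule k V) (a b : V →ₗ[k] V) (ha : ∀ x ∈ A, a x ∈ B)
    (hb : ∀ x ∈ B, b x ∈ A) (hba : ∀ x ∈ A, b (a x) = 0) :
    ∃ X₁ X₃ C₄ C₅ Y : Submodule k V, (X₁ ≤ A ∧ X₃ ≤ A ∧ C₄ ≤ B ∧ C₅ ≤ B ∧ Y ≤ B) ∧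
      (∀ x ∈ X₁, a x = 0) ∧ (∀ x ∈ C₄, a (b x) = 0) ∧ (∀ y ∈ Y, b y = 0) ∧
      (∀ x₁ ∈ X₁, ∀ x₃ ∈ X₃, ∀ x₄ ∈ C₄, ∀ x₅ ∈ C₅, x₁ + x₃ + b x₅ + b x₄ = 0 →
        x₁ = 0 ∧ x₃ = 0 ∧ x₅ = 0 ∧ x₄ = 0) ∧
      (∀ y ∈ Y, ∀ x₃ ∈ X₃, ∀ x₅ ∈ C₅, y + a x₃ + a (b x₅) = 0 → y = 0 ∧ x₃ = 0 ∧ x₅ = 0) ∧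
      (∀ x ∈ A, ∃ x₁ ∈ X₁, ∃ x₃ ∈ X₃, ∃ x₄ ∈ C₄, ∃ x₅ ∈ C₅, x = x₁ + x₃ + b x₅ + b x₄) ∧
      (∀ x ∈ B, ∃ y ∈ Y, ∃ z ∈ A, ∃ x₄ ∈ C₄, ∃ x₅ ∈ C₅, x = y + a z + x₄ + x₅) := by
  have bot : ∀ {P Q : Submodule k V}, P ⊓ Q = ⊥ → ∀ {x}, x ∈ P → x ∈ Q → x = 0 :=
    fun {_ _} h {_} hP hQ => (Submodule.mem_bot k).mp (h ▸ ⟨hP, hQ⟩)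
  -- The subspace `C` is a complement of `B ∩ ker b` in `B`. Those `x ∈ C` with `a (b x) = 0` are
  -- the vectors `x₄`, and `C₅` is a complement of them in `C`.
  obtain ⟨C, hC, hKC, hKC'⟩ := Submodule.exists_relCompl
    (P := B ⊓ LinearMap.ker b) (Q := B) inf_le_left
  obtain ⟨C₅, hC₅, h45, h45'⟩ := Submodule.exists_relCompl
    (P := C ⊓ LinearMap.ker (a ∘ₗ b)) (Q := C) inf_le_left
  have hbC₄ : (C ⊓ LinearMap.ker (a ∘ₗ b)).map b ≤ A ⊓ LinearMap.ker a := by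
    rintro _ ⟨x, ⟨hx, hx'⟩, rfl⟩
    exact ⟨hb x (hC hx), hx'⟩
  -- The vectors `x₁` complement the `b x₄` in `A ∩ ker a`.
  obtain ⟨X₁, hX₁, h1, h1'⟩ := Submodule.exists_relCompl hbC₄
  have hbC : C.map b ⊔ (A ⊓ LinearMap.ker a) ≤ A := by
    refine sup_le ?_ inf_le_left
    rintro _ ⟨x, hx, rfl⟩
    exact hb x (hC hx)
  -- The vectors `x₃` complement `b C + (A ∩ ker a)` in `A`.
  obtain ⟨X₃, hX₃, h3, h3'⟩ := Submodule.exists_relCompl hbC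
  have haA : A.map a ≤ B ⊓ LinearMap.ker b := by
    rintro _ ⟨x, hx, rfl⟩
    exact ⟨ha x hx, hba x hx⟩
  -- The vectors `y` complement `a A` in `B ∩ ker b`.
  obtain ⟨Y, hY, hy, hy'⟩ := Submodule.exists_relCompl haA
  have mem3 : ∀ {x}, x ∈ A → a x = 0 → x ∈ C.map b ⊔ (A ⊓ LinearMap.ker a) := fun hx h =>
    Submodule.mem_sup_right ⟨hx, h⟩
  have memC : ∀ {x}, x ∈ C → b x ∈ C.map b ⊔ (A ⊓ LinearMap.ker a) := fun hx =>
    Submodule.mem_sup_left (Submodule.mem_map_of_mem hx)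
  have hc5 : ∀ {x}, x ∈ C₅ → a (b x) = 0 → x = 0 := fun hx h => bot h45 ⟨hC₅ hx, h⟩ hx
  refine ⟨X₁, X₃, C ⊓ LinearMap.ker (a ∘ₗ b), C₅, Y, ⟨hX₁.trans inf_le_left, hX₃,
    inf_le_left.trans hC, hC₅.trans hC, hY.trans inf_le_left⟩, fun x hx => (hX₁ hx).2,
    fun x hx => hx.2, fun y h => (hY h).2, ?_, ?_, ?_, ?_⟩
  · intro x₁ m₁ x₃ m₃ x₄ m₄ x₅ m₅ h
    have e3 : x₃ = 0 := by
      refine bot h3 ?_ m₃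
      have : x₃ = -(x₁ + b x₅ + b x₄) := by
        rw [eq_neg_iff_add_eq_zero, ← h]; abel
      rw [this]
      exact Submodule.neg_mem _ (Submodule.add_mem _ (Submodule.add_mem _
        (mem3 (hX₁ m₁).1 (hX₁ m₁).2) (memC (hC₅ m₅))) (memC m₄.1))
    have e5 : x₅ = 0 := by
      refine hc5 m₅ ?_
      have h' := congrArg a h
      have e1 : a x₁ = 0 := (hX₁ m₁).2
      have e4 : a (b x₄) = 0 := m₄.2
      rwa [e3, add_zero, map_add, map_add, e1, e4, zero_add, add_zero, map_zero] at h'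
    rw [e3, e5, map_zero, add_zero, add_zero] at h
    have e1 : x₁ = 0 := by
      refine bot h1 ?_ m₁
      rw [eq_neg_of_add_eq_zero_left h]
      exact Submodule.neg_mem _ (Submodule.mem_map_of_mem m₄)
    rw [e1, zero_add] at h
    exact ⟨e1, e3, e5, bot hKC ⟨hC m₄.1, h⟩ m₄.1⟩
  · intro y my x₃ m₃ x₅ m₅ h
    have ey : y = 0 := by
      refine bot hy ?_ my
      have : y = -(a (x₃ + b x₅)) := by
        rw [eq_neg_iff_add_eq_zero, map_add, ← add_assoc, h]
      rw [this]
      exact Submodule.neg_mem _ (Submodule.mem_map_of_mem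
        (Submodule.add_mem _ (hX₃ m₃) (hb _ (hC (hC₅ m₅)))))
    rw [ey, zero_add, ← map_add] at h
    have e3 : x₃ = 0 := by
      refine bot h3 ?_ m₃
      have : x₃ = (x₃ + b x₅) - b x₅ := by abel
      rw [this]
      exact Submodule.sub_mem _ (mem3 (Submodule.add_mem _ (hX₃ m₃) (hb _ (hC (hC₅ m₅)))) h)
        (memC (hC₅ m₅))
    rw [e3, zero_add] at h
    exact ⟨ey, e3, hc5 m₅ h⟩
  · intro x hx
    rw [← h3'] at hx
    obtain ⟨y, my, x₃, m₃, rfl⟩ := Submodule.mem_sup.mp hx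
    obtain ⟨_, ⟨c, mc, rfl⟩, z, mz, rfl⟩ := Submodule.mem_sup.mp my
    rw [← h45'] at mc
    obtain ⟨x₄, m₄, x₅, m₅, rfl⟩ := Submodule.mem_sup.mp mc
    rw [← h1'] at mz
    obtain ⟨_, ⟨x₄', m₄', rfl⟩, x₁, m₁, rfl⟩ := Submodule.mem_sup.mp mz
    exact ⟨x₁, m₁, x₃, m₃, x₄ + x₄', Submodule.add_mem _ m₄ m₄', x₅, m₅, by
      rw [map_add, map_add]; abel⟩
  · intro x hx
    rw [← hKC'] at hx
    obtain ⟨y, my, c, mc, rfl⟩ := Submodule.mem_sup.mp hx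
    rw [← h45'] at mc
    obtain ⟨x₄, m₄, x₅, m₅, rfl⟩ := Submodule.mem_sup.mp mc
    rw [← hy'] at my
    obtain ⟨_, ⟨z, mz, rfl⟩, y', my', rfl⟩ := Submodule.mem_sup.mp my
    exact ⟨y', my', z, mz, x₄, m₄, x₅, m₅, by abel⟩

namespace QuantumSl2

open CrystalData

namespace UqMod

/-! ### Systems of generators -/

/-- The highest weight vectors of weight `s`. -/
noncomputable def hwSpace (V : UqMod.{u}) (s : ℤ) : Submodule Kq V.carrier :=
  V.wt s ⊓ LinearMap.ker (V.ρ E)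

/-- The vectors of weight `-r - 2` in the block of `r`. -/
noncomputable def blockSpace (V : UqMod.{u}) (r : ℕ) : Submodule Kq V.carrier where
  carrier := {x | V.ρ K x = q ^ (-(r : ℤ) - 2) • x ∧ V.InBlock r x}
  zero_mem' := ⟨by rw [map_zero, smul_zero], 0, map_zero _⟩
  add_mem' := fun ⟨h, h'⟩ ⟨k, k'⟩ => ⟨by rw [map_add, h, k, smul_add], h'.add k'⟩
  smul_mem' := fun c _ ⟨h, h'⟩ => ⟨by rw [map_smul, h, smul_comm], h'.smul c⟩

section

variable {V : UqMod.{u}}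

theorem mem_hwSpace {s : ℤ} {x : V.carrier} :
    x ∈ V.hwSpace s ↔ V.ρ K x = q ^ s • x ∧ V.ρ E x = 0 := by
  rw [hwSpace, Submodule.mem_inf, mem_wt, LinearMap.mem_ker]

theorem InO.exists_E_pow (hV : V.InO) {s : ℤ} {m : V.carrier} (h : V.ρ K m = q ^ s • m) :
    ∃ n, (V.ρ E ^ n) m = 0 := by
  obtain ⟨n, hn⟩ := hV.bounded
  refine ⟨(n - s).toNat, ?_⟩
  have h1 := mem_wt.mpr (K_E_pow h (n - s).toNat)
  rw [hn _ (by omega)] at h1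
  exact (Submodule.mem_bot Kq).mp h1

/-- The block of `r ≥ -1` has no weights greater than `r`. -/
theorem InO.eq_zero_of_inBlock (hV : V.InO) {r t : ℤ} {m : V.carrier} (hb : V.InBlock r m)
    (h : V.ρ K m = q ^ t • m) (ht : r < t) (hr : -1 ≤ r) : m = 0 := by
  obtain ⟨n, hn⟩ := hV.exists_E_pow h
  exact hb.eq_zero_of_E_pow h hn fun j _ => casimirValue_ne (by omega) (by omega)

/-- Spaces of generators of the indecomposable summands: their vectors satisfy the relations of the
generators, the strands starting from them have independent highest weight vectors, and they
generate the highest weight vectors of weights `s ≥ -1` and the vectors of weight `-r - 2` in the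
block of `r`. -/
structure IsGenSystem (V : UqMod.{u}) (G : Label → Submodule Kq V.carrier) : Prop where
  gen : ∀ {W x}, x ∈ G W → V.IsGen W x
  indep : ∀ (r : ℕ) (y : Label → V.carrier), (∀ W, y W ∈ G W) →
    V.strand (.simple r) (Label.top _) (y (.simple r)) +
      V.strand (.verma r) (Label.top _) (y (.verma r)) +
      V.strand (.tilting r) (Label.top _) (y (.tilting r)) +
      V.strand (.dualVerma r) (Label.top _) (y (.dualVerma r)) = 0 →
    y (.simple r) = 0 ∧ y (.verma r) = 0 ∧ y (.tilting r) = 0 ∧ y (.dualVerma r) = 0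
  indep_neg : ∀ (r : ℕ) (y : Label → V.carrier), (∀ W, y W ∈ G W) →
    V.strand (.verma (-(r : ℤ) - 2)) (0 : ℕ) (y (.verma (-(r : ℤ) - 2))) +
      V.strand (.verma r) (r + 1 : ℕ) (y (.verma r)) +
      V.strand (.tilting r) (Sum.inl (r + 1) : ℕ ⊕ ℕ) (y (.tilting r)) = 0 →
    y (.verma (-(r : ℤ) - 2)) = 0 ∧ y (.verma r) = 0 ∧ y (.tilting r) = 0
  hw_le : ∀ N : Submodule Kq V.carrier, (∀ W x, x ∈ G W → ∀ c, V.strand W c x ∈ N) →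
    ∀ s : ℤ, -1 ≤ s → V.hwSpace s ≤ N
  block_le : ∀ N : Submodule Kq V.carrier, (∀ W x, x ∈ G W → ∀ c, V.strand W c x ∈ N) →
    (∀ x ∈ N, V.ρ F x ∈ N) → ∀ r : ℕ, V.blockSpace r ≤ N

/-- The generators of the Verma modules, separately for weights `r ≥ 0`, `-1` and `-r - 2`. -/
def vermaGens {X : Type u} (x y : ℕ → X) (z : X) : ℤ → X
  | .ofNat r => x r
  | .negSucc 0 => z
  | .negSucc (r + 1) => y r

theorem vermaGens_neg {X : Type u} (x y : ℕ → X) (z : X) (r : ℕ) :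
    vermaGens x y z (-(r : ℤ) - 2) = y r := by
  rw [show -(r : ℤ) - 2 = Int.negSucc (r + 1) by omega]
  rfl

/-- Each block of a module in `𝒪` has a system of generators: decompose the representation of the
quiver formed by its highest weight vectors of weight `r`, its vectors of weight `-r - 2`, the
operator `f^(r+1)` and a multiple of `e^(r+1)`. -/
theorem InO.exists_isGenSystem (hV : V.InO) : ∃ G, V.IsGenSystem G := by
  have hA : ∀ r : ℕ, ∀ x ∈ V.hwSpace r, (V.ρ F ^ (r + 1)) x ∈ V.blockSpace r := by
    intro r x hx
    obtain ⟨h1, h2⟩ := mem_hwSpace.mp hx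
    refine ⟨?_, (inBlock_of_E_eq_zero h1 h2).map_pow F _⟩
    rw [K_F_pow h1]
    congr 2; push_cast; ring
  have hE : ∀ r : ℕ, ∀ x ∈ V.blockSpace r, (V.ρ E ^ (r + 2)) x = 0 := by
    intro r x hx
    exact hV.eq_zero_of_inBlock (hx.2.map_pow E _) (K_E_pow hx.1 _) (by push_cast; omega) (by omega)
  have hB : ∀ r : ℕ, ∀ x ∈ V.blockSpace r,
      ((hwConst r r)⁻¹ • V.ρ E ^ (r + 1)) x ∈ V.hwSpace r := by
    intro r x hx
    obtain ⟨h1, h2, -⟩ := hx.2.exists_top hx.1 (hE r x hx)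
    exact Submodule.smul_mem _ _ (mem_hwSpace.mpr ⟨h2, h1⟩)
  have hBA : ∀ r : ℕ, ∀ x ∈ V.hwSpace r,
      ((hwConst r r)⁻¹ • V.ρ E ^ (r + 1)) ((V.ρ F ^ (r + 1)) x) = 0 := by
    intro r x hx
    obtain ⟨h1, h2⟩ := mem_hwSpace.mp hx
    have h0 : hwConst r (r + 1) = 0 := by
      rw [hwConst, Finset.prod_range_succ, sub_self, qint_zero, mul_zero, mul_zero]
    rw [LinearMap.smul_apply, E_pow_F_pow h1 h2, h0, zero_smul, smul_zero]
  choose X₁ X₃ C₄ C₅ Y hle h1 h4 hy hi hi' hs hs' using fun r : ℕ =>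
    exists_quiver_decomposition (V.hwSpace r) (V.blockSpace r) (V.ρ F ^ (r + 1))
      ((hwConst r r)⁻¹ • V.ρ E ^ (r + 1)) (hA r) (hB r) (hBA r)
  let G : Label → Submodule Kq V.carrier := fun
    | .simple r => X₁ r
    | .verma s => vermaGens X₃ Y (V.hwSpace (-1)) s
    | .tilting r => C₅ r
    | .dualVerma r => C₄ r
  have hY : ∀ r : ℕ, G (.verma (-(r : ℤ) - 2)) = Y r := fun r => vermaGens_neg _ _ _ _
  have hYE : ∀ r : ℕ, ∀ x ∈ Y r, V.ρ E x = 0 := by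
    intro r x hx
    obtain ⟨hK, hb⟩ := (hle r).2.2.2.2 hx
    have h0 := hy r x hx
    rw [LinearMap.smul_apply, smul_eq_zero,
      or_iff_right (inv_ne_zero (hwConst_ne_zero fun i hi => by omega)), pow_succ,
      Module.End.mul_apply] at h0
    refine (hb.map E).eq_zero_of_E_pow (mem_wt.mp (E_wt (mem_wt.mpr hK))) h0 fun j hj =>
      casimirValue_ne (by omega) (by omega)
  refine ⟨G, ?_, ?_, ?_, ?_, ?_⟩
  · rintro (r | s | r | r) x hx
    · obtain ⟨h, h'⟩ := mem_hwSpace.mp ((hle r).1 hx)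
      exact ⟨h, h', h1 r x hx⟩
    · rcases s with r | _ | r
      · exact mem_hwSpace.mp ((hle r).2.1 hx)
      · exact mem_hwSpace.mp hx
      · refine ⟨?_, hYE r x hx⟩
        rw [show Int.negSucc (r + 1) = -(r : ℤ) - 2 by omega]
        exact ((hle r).2.2.2.2 hx).1
    · have h := (hle r).2.2.2.1 hx
      exact ⟨h.1, h.2, hE r x h⟩
    · have h := (hle r).2.2.1 hx
      refine ⟨h.1, h.2, hE r x h, ?_⟩
      have h5 := h4 r x hx
      rw [LinearMap.smul_apply, map_smul, smul_eq_zero] at h5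
      exact h5.resolve_left (inv_ne_zero (hwConst_ne_zero fun i hi => by omega))
  · intro r y hG h
    exact hi r _ (hG (.simple r)) _ (hG (.verma r)) _ (hG (.dualVerma r)) _ (hG (.tilting r)) h
  · intro r y hG h
    have hG' := hG (.verma (-(r : ℤ) - 2))
    rw [hY] at hG'
    exact hi' r _ hG' _ (hG (.verma r)) _ (hG (.tilting r)) h
  · intro N hN s hs1 x hx
    rcases s with r | _ | r
    · obtain ⟨x₁, m₁, x₃, m₃, x₄, m₄, x₅, m₅, rfl⟩ := hs r x hx
      exact N.add_mem (N.add_mem (N.add_mem (hN (.simple r) x₁ m₁ (Label.top _))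
        (hN (.verma r) x₃ m₃ (Label.top _))) (hN (.tilting r) x₅ m₅ (Label.top _)))
        (hN (.dualVerma r) x₄ m₄ (Label.top _))
    · exact hN (.verma (Int.negSucc 0)) x hx (Label.top _)
    · omega
  · intro N hN hF r x hx
    obtain ⟨y, my, z, mz, x₄, m₄, x₅, m₅, rfl⟩ := hs' r x hx
    have hFn : ∀ n : ℕ, ∀ x ∈ N, (V.ρ F ^ n) x ∈ N := by
      intro n
      induction n with
      | zero => exact fun x hx => hx
      | succ n ih => intro x hx; rw [pow_succ', Module.End.mul_apply]; exact hF _ (ih x hx)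
    rw [← hY] at my
    refine N.add_mem (N.add_mem (N.add_mem (hN (.verma (-(r : ℤ) - 2)) y my (Label.top _))
      (hFn _ z ?_))
      (hN (.dualVerma r) x₄ m₄ (Sum.inr 0 : Fin (r + 1) ⊕ ℕ)))
      (hN (.tilting r) x₅ m₅ (Sum.inr 0 : ℕ ⊕ ℕ))
    obtain ⟨x₁, m₁, x₃, m₃, x₄, m₄, x₅, m₅, rfl⟩ := hs r z mz
    exact N.add_mem (N.add_mem (N.add_mem (hN (.simple r) x₁ m₁ (Label.top _))
      (hN (.verma r) x₃ m₃ (Label.top _))) (hN (.tilting r) x₅ m₅ (Label.top _)))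
      (hN (.dualVerma r) x₄ m₄ (Label.top _))

/-- The positions of the highest weight vectors of weight `s` in the indecomposable modules. -/
theorem IsGenSystem.exists_positions {G : Label → Submodule Kq V.carrier} (hG : V.IsGenSystem G)
    (s : ℤ) : ∃ (S : Finset Label) (h : ∀ W : Label, W.crystal.carrier),
      (∀ W c, W.crystal.wt c = s → W.crystal.e (some c) = none ∨ W.crystal.φ c = -1 →
        W ∈ S ∧ c = h W) ∧
      (∀ W ∈ S, W.crystal.wt (h W) = s) ∧
      ∀ y : Label → V.carrier, (∀ W, y W ∈ G W) → ∑ W ∈ S, V.strand W (h W) (y W) = 0 →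
        ∀ W ∈ S, y W = 0 := by
  classical
  have hε : ∀ W : Label, ∀ c, 0 ≤ W.crystal.ε c ∧ W.crystal.φ c = W.crystal.wt c + W.crystal.ε c :=
    fun W c => ⟨W.crystal_axioms.ε_nonneg c, W.crystal_axioms.φ_eq c⟩
  have htop : -1 ≤ s → ∀ (W : Label) (c : W.crystal.carrier), W.crystal.wt c = s →
      W.crystal.e (some c) = none ∨ W.crystal.φ c = -1 → c = W.top := by
    intro hs W c hw h
    obtain ⟨h1, h2⟩ := hε W c
    refine W.e_eq_none_iff.mp (h.elim id fun h => ?_)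
    have := W.crystal_axioms.e_top_of_φ (b := c) (by omega)
    rwa [show W.crystal.ε c = 0 by omega] at this
  have hwt : ∀ W : Label, W.crystal.wt W.top =
      match W with
      | .simple r => (r : ℤ)
      | .verma s => s
      | .tilting r => r
      | .dualVerma r => r := by
    rintro (r | s | r | r)
    · exact sub_zero _
    · exact sub_zero _
    · exact sub_zero _
    · exact sub_zero _
  -- The cases `s = r ≥ 0`, `s = -1` and `s = -r - 2` with `r ≥ 0`.
  rcases s with r | _ | r
  · refine ⟨{.simple r, .verma r, .tilting r, .dualVerma r}, Label.top, ?_, ?_, ?_⟩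
    · intro W c hw h
      obtain rfl := htop (by simp) W c hw h
      rw [hwt] at hw
      refine ⟨?_, rfl⟩
      rcases W with r' | s' | r' | r' <;> simp only [Int.ofNat_eq_natCast, Nat.cast_inj] at hw <;>
        simp [hw]
    · intro W hW
      simp only [Finset.mem_insert, Finset.mem_singleton] at hW
      rcases hW with rfl | rfl | rfl | rfl <;> rw [hwt] <;> rfl
    · intro y hy h W hW
      rw [Finset.sum_insert (by simp), Finset.sum_insert (by simp), Finset.sum_insert (by simp),
        Finset.sum_singleton, ← add_assoc, ← add_assoc] at h
      have := hG.indep r y hy h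
      simp only [Finset.mem_insert, Finset.mem_singleton] at hW
      rcases hW with rfl | rfl | rfl | rfl
      exacts [this.1, this.2.1, this.2.2.1, this.2.2.2]
  · refine ⟨{.verma (-1)}, Label.top, ?_, ?_, ?_⟩
    · intro W c hw h
      obtain rfl := htop (by simp) W c hw h
      rw [hwt] at hw
      refine ⟨?_, rfl⟩
      rcases W with r' | s' | r' | r' <;> simp only at hw
      · omega
      · simp [hw]
      · omega
      · omega
    · intro W hW
      rw [Finset.mem_singleton.mp hW, hwt]; rfl
    · intro y hy h W hW
      rw [Finset.sum_singleton] at h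
      rw [Finset.mem_singleton.mp hW]
      exact h
  · have hr : Int.negSucc (r + 1) = -(r : ℤ) - 2 := by omega
    rw [hr]
    let h : ∀ W : Label, W.crystal.carrier := fun
      | .simple r' => Label.top (.simple r')
      | .verma s' => if s' = r then (r + 1 : ℕ) else (0 : ℕ)
      | .tilting r' => (Sum.inl (r' + 1) : ℕ ⊕ ℕ)
      | .dualVerma r' => Label.top (.dualVerma r')
    -- In `M(r)` and `T(r)` the vectors `f^(r+1) b_0` and `f b_(r)` have this weight.
    refine ⟨{.verma (-(r : ℤ) - 2), .verma r, .tilting r}, h, ?_, ?_, ?_⟩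
    · rintro (r' | s' | r' | r') c hw h
      · exfalso
        obtain ⟨j, hj⟩ := c
        change (r' : ℤ) - 2 * (j : ℕ) = -(r : ℤ) - 2 at hw
        have h' := h.imp (Label.simple r').e_eq_none_iff.mp id
        rcases h' with h' | h'
        · have := congrArg Fin.val h'
          change j = 0 at this
          omega
        · change (r' : ℤ) - (j : ℕ) = -1 at h'
          omega
      · revert c
        intro (j : ℕ) hw h
        change s' - 2 * (j : ℤ) = -(r : ℤ) - 2 at hw
        by_cases h0 : j = 0
        · obtain rfl : s' = -(r : ℤ) - 2 := by omega
          refine ⟨by simp, h0.trans (if_neg (by omega)).symm⟩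
        · have h1 : s' - (j : ℤ) = -1 :=
            h.resolve_left fun h' => h0 ((Label.verma s').e_eq_none_iff.mp h')
          obtain rfl : s' = (r : ℤ) := by omega
          refine ⟨by simp, Eq.trans (show j = r + 1 by omega) (if_pos rfl).symm⟩
      · rcases c with j | j
        · change (r' : ℤ) - 2 * (j : ℕ) = -(r : ℤ) - 2 at hw
          have h1 : (r' : ℤ) - (j : ℕ) = -1 := by
            refine h.resolve_left fun h' => ?_
            have h2 := (Label.tilting r').e_eq_none_iff.mp h'
            have : j = 0 := Sum.inl_injective h2
            omega
          obtain rfl : r' = r := by omega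
          obtain rfl : j = r' + 1 := by omega
          exact ⟨by simp, rfl⟩
        · exfalso
          rcases h with h | h
          · have h2 := (Label.tilting r').e_eq_none_iff.mp h
            exact Sum.inr_ne_inl h2
          · change -(r' : ℤ) - 2 - (j : ℕ) = -1 at h
            omega
      · exfalso
        have h' := h.imp (Label.dualVerma r').e_eq_none_iff.mp id
        rcases c with ⟨j, hj⟩ | j
        · change (r' : ℤ) - 2 * (j : ℕ) = -(r : ℤ) - 2 at hw
          rcases h' with h' | h'
          · have := congrArg Fin.val (Sum.inl_injective h')
            change j = 0 at this
            omega
          · change (r' : ℤ) - (j : ℕ) = -1 at h'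
            omega
        · rcases h' with h' | h'
          · exact Sum.inr_ne_inl h'
          · change -(r' : ℤ) - 2 - (j : ℕ) = -1 at h'
            omega
    · intro W hW
      simp only [Finset.mem_insert, Finset.mem_singleton] at hW
      rcases hW with rfl | rfl | rfl
      · rw [show h (.verma (-(r : ℤ) - 2)) = (0 : ℕ) from if_neg (by omega)]
        exact sub_zero _
      · rw [show h (.verma r) = (r + 1 : ℕ) from if_pos rfl]
        change (r : ℤ) - 2 * ((r + 1 : ℕ) : ℤ) = _
        push_cast; ring
      · change (r : ℤ) - 2 * ((r + 1 : ℕ) : ℤ) = _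
        push_cast; ring
    · intro y hy h0 W hW
      have h1 : h (.verma (-(r : ℤ) - 2)) = (0 : ℕ) := if_neg (by omega)
      have h2 : h (.verma r) = (r + 1 : ℕ) := if_pos rfl
      rw [Finset.sum_insert (by simp; omega), Finset.sum_insert (by simp), Finset.sum_singleton,
        ← add_assoc, h1, h2] at h0
      have := hG.indep_neg r y hy h0
      simp only [Finset.mem_insert, Finset.mem_singleton] at hW
      rcases hW with rfl | rfl | rfl
      exacts [this.1, this.2.1, this.2.2]

end

end UqMod

end QuantumSl2

namespace QuantumSl2

open CrystalData

namespace UqMod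

/-! ### Existence of the decomposition -/

section

variable {V : UqMod.{u}}

/-- A submodule of a module in `𝒪` is the whole module if it contains the highest weight vectors of
weights `s ≥ -1` and the vectors of weight `-r - 2` in the blocks of `r ≥ 0`. -/
theorem InO.eq_top (hV : V.InO) {N : Submodule Kq V.carrier}
    (hN : ∀ (a : Uq), ∀ x ∈ N, V.ρ a x ∈ N) (h1 : ∀ s : ℤ, -1 ≤ s → V.hwSpace s ≤ N)
    (h2 : ∀ r : ℕ, V.blockSpace r ≤ N) : N = ⊤ := by
  have key : ∀ (n : ℕ) (s : ℤ) (v : V.carrier), V.ρ K v = q ^ s • v → (V.ρ E ^ n) v = 0 →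
      v ∈ N := by
    intro n
    induction n with
    | zero => intro s v _ h; rw [show v = 0 from h]; exact N.zero_mem
    | succ n ih =>
      intro s v hv h
      have hE : V.ρ E v ∈ N := ih (s + 2) _ (mem_wt.mp (E_wt (mem_wt.mpr hv))) (by
        rwa [← Module.End.mul_apply, ← pow_succ])
      obtain ⟨r, hrs⟩ : ∃ r : ℤ, (s = r ∧ -1 ≤ r) ∨ (s = -r - 2 ∧ 0 ≤ r) := by
        by_cases hs : -1 ≤ s
        exacts [⟨s, Or.inl ⟨rfl, hs⟩⟩, ⟨-s - 2, Or.inr (by omega)⟩]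
      have hc : casimirValue s = casimirValue r := by
        rcases hrs with ⟨rfl, -⟩ | ⟨rfl, -⟩
        exacts [rfl, casimirValue_neg r]
      have hT : ∀ x ∈ V.wt s, V.ρ (blockElt r) x = V.ρ F (V.ρ E x) := by
        intro x hx
        rw [blockElt_wt r (mem_wt.mp hx), hc, sub_self, zero_smul, add_zero]
      have hTwt : ∀ x ∈ V.wt s, V.ρ (blockElt r) x ∈ V.wt s := by
        intro x hx
        have := F_wt (E_wt hx)
        rwa [hT x hx, show s = s + 2 + -2 by ring]
      let I : Submodule Kq V.carrier := N ⊓ V.wt s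
      have := hV.finite s
      have : Module.Finite Kq I := Submodule.finiteDimensional_of_le inf_le_right
      have hTI : ∀ x ∈ I, V.ρ (blockElt r) x ∈ I := fun x hx => ⟨hN _ x hx.1, hTwt x hx.2⟩
      -- The Fitting decomposition of `I` moves `v` into the block of `r` modulo `I`.
      obtain ⟨m, hm, hm1⟩ := ((LinearMap.eventually_codisjoint_ker_pow_range_pow
        ((V.ρ (blockElt r)).restrict hTI)).and (Filter.eventually_ge_atTop 1)).exists
      obtain ⟨m, rfl⟩ := Nat.exists_eq_add_of_le' hm1
      have hvI : V.ρ (blockElt r) v ∈ I :=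
        ⟨by rw [hT v (mem_wt.mpr hv)]; exact hN F _ hE, hTwt v (mem_wt.mpr hv)⟩
      obtain ⟨k, hk, _, ⟨y, rfl⟩, hky⟩ := Submodule.mem_sup.mp
        (show (⟨_, hvI⟩ : I) ∈ _ by rw [hm.eq_top]; trivial)
      obtain ⟨i, hi⟩ : ∃ i : I, ((V.ρ (blockElt r)).restrict hTI ^ m) y = i := ⟨_, rfl⟩
      rw [pow_succ', Module.End.mul_apply, hi] at hky
      have hvi : V.ρ (blockElt r) (v - i) = k := by
        rw [map_sub, sub_eq_iff_eq_add]
        exact (congrArg Subtype.val hky).symm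
      have hb : V.InBlock r (v - i) := by
        refine ⟨m + 1 + 1, ?_⟩
        rw [pow_succ, ρ_mul, hvi, map_pow]
        have := congrArg Subtype.val (LinearMap.mem_ker.mp hk)
        rwa [Module.End.pow_restrict] at this
      have hw : V.ρ K (v - i) = q ^ s • (v - i) := by
        rw [map_sub, hv, mem_wt.mp i.2.2, smul_sub]
      rw [← sub_add_cancel v (i : V.carrier)]
      refine N.add_mem ?_ i.2.1
      rcases hrs with ⟨rfl, hr⟩ | ⟨rfl, hr⟩
      · exact h1 s hr (mem_hwSpace.mpr ⟨hw, hV.eq_zero_of_inBlock (hb.map E)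
          (mem_wt.mp (E_wt (mem_wt.mpr hw))) (by omega) hr⟩)
      · obtain ⟨r, rfl⟩ := Int.eq_ofNat_of_zero_le hr
        exact h2 r ⟨hw, hb⟩
  rw [eq_top_iff, ← hV.isInternal.submodule_iSup_eq_top, iSup_le_iff]
  intro s v hv
  obtain ⟨n, hn⟩ := hV.exists_E_pow (mem_wt.mp hv)
  exact key n s v (mem_wt.mp hv) hn

theorem exists_wt_of_isGen (V : UqMod.{u}) (W : Label) :
    ∃ s : ℤ, ∀ x, V.IsGen W x → V.ρ K x = q ^ s • x := by
  cases W with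
  | simple r => exact ⟨_, fun _ h => h.1⟩
  | verma s => exact ⟨_, fun _ h => h.1⟩
  | tilting r => exact ⟨_, fun _ h => h.1⟩
  | dualVerma r => exact ⟨_, fun _ h => h.1⟩

/-- A module in `𝒪` is a direct sum of indecomposable modules: the direct sum of the modules with
generators in bases of a system of generators maps isomorphically onto it. -/
theorem InO.exists_hasMult (hV : V.InO) : ∃ n, V.HasMult n := by
  classical
  obtain ⟨G, hG⟩ := hV.exists_isGenSystem
  have hfin : ∀ W, Module.Finite Kq (G W) := by
    intro W
    obtain ⟨s, hs⟩ := V.exists_wt_of_isGen W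
    have := hV.finite s
    exact Submodule.finiteDimensional_of_le (S₂ := V.wt s) fun x hx => mem_wt.mpr (hs x (hG.gen hx))
  let n : Label → ℕ := fun W => Module.finrank Kq (G W)
  let x : (Σ W : Label, Fin (n W)) → V.carrier := fun p => (Module.finBasis Kq (G p.1) p.2).1
  have hxG : ∀ p, x p ∈ G p.1 := fun p => (Module.finBasis Kq (G p.1) p.2).2
  have hx : ∀ p, V.IsGen p.1 (x p) := fun p => hG.gen (hxG p)
  let hB := ofMult_axioms n
  let Φ : (ofCrystal hB).carrier →ₗ[Kq] V.carrier :=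
    (basis hB).constr Kq fun b => V.strand b.1.1 b.2 (x b.1)
  have hΦb : ∀ b : (ofMult n).carrier, Φ (basis hB b) = V.strand b.1.1 b.2 (x b.1) := fun b =>
    (basis hB).constr_basis Kq _ b
  have hΦv : ∀ p (c : Option (Label.crystal p.1).carrier),
      Φ (vec hB (c.map (incl (fun p : Σ W : Label, Fin (n W) => p.1.crystal) p))) =
        V.strandMap p.1 (x p) (vec p.1.crystal_axioms c) := by
    rintro p (_ | c)
    · exact (map_zero Φ).trans (map_zero (V.strandMap p.1 (x p))).symm
    · exact (hΦb ⟨p, c⟩).trans (strandMap_basis p.1 (x p) c).symm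
  have hΦ : IsHom Φ := by
    refine isHom_ofCrystal (fun b => ?_) (fun b => ?_) fun b hb => ?_
    · rw [hΦb, ← strandMap_basis, ← strandMap_isHom (hx b.1), ← vec_some, ofCrystal_F]
      exact hΦv b.1 (b.1.1.crystal.f (some b.2))
    · rw [hΦb, ← strandMap_basis, ← strandMap_isHom (hx b.1), ofCrystal_K, map_smul]
      rfl
    · rw [hΦb, ← strandMap_basis, ← strandMap_isHom (hx b.1)]
      exact (congrArg _ (ofCrystal_E_top b.1.1.crystal_axioms hb)).trans
        (hΦv b.1 (b.1.1.crystal.e (some b.2))).symm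
  refine ⟨n, hasMult_iff.mpr (iso_of_bijective hΦ ⟨?_, ?_⟩).symm⟩
  · rw [← LinearMap.ker_eq_bot, Submodule.eq_bot_iff]
    intro z₀ hz₀
    by_contra hz₀0
    -- The last nonzero vector `e^m z₀` in the kernel is killed by `e`.
    obtain ⟨z, hz, hzE, hz0⟩ : ∃ z, Φ z = 0 ∧ (ofCrystal hB).ρ E z = 0 ∧ z ≠ 0 := by
      have hex := UqMod.exists_E_pow hB z₀
      obtain ⟨m, hm⟩ := Nat.exists_eq_succ_of_ne_zero
        (show Nat.find hex ≠ 0 from fun h => hz₀0 ((Nat.find_eq_zero hex).mp h))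
      refine ⟨((ofCrystal hB).ρ E ^ m) z₀, ?_, ?_, Nat.find_min hex (by omega)⟩
      · rw [hΦ.pow, LinearMap.mem_ker.mp hz₀, map_zero]
      · rw [← pow_succ_apply']
        have := Nat.find_spec hex
        rwa [hm] at this
    let ζ := (basis hB).repr z
    obtain ⟨b₀, hb₀⟩ : ∃ b, ζ b ≠ 0 := by
      by_contra! h
      exact hz0 ((basis hB).repr.map_eq_zero_iff.mp (Finsupp.ext h))
    have hζ : ∀ b, ζ b ≠ 0 → (ofMult n).e (some b) = none ∨ (ofMult n).φ b = -1 := fun b =>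
      e_eq_none_or_of_E_eq_zero hB hzE
    obtain ⟨S, h, hS, hSwt, hind⟩ := hG.exists_positions ((ofMult n).wt b₀)
    -- The component of weight `wt b₀` of a vanishing sum vanishes.
    have hsum : ∑ b ∈ ζ.support with (ofMult n).wt b = (ofMult n).wt b₀,
        ζ b • Φ (basis hB b) = 0 := by
      have h1 : ∑ b ∈ ζ.support, ζ b • Φ (basis hB b) = 0 := by
        rw [← hz]
        conv_rhs => rw [← (basis hB).linearCombination_repr z]
        rw [Finsupp.linearCombination_apply, Finsupp.sum, map_sum]
        exact Finset.sum_congr rfl fun b _ => (map_smul _ _ _).symm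
      rw [← Finset.sum_fiberwise_of_maps_to (t := ζ.support.image (ofMult n).wt)
        fun b hb => Finset.mem_image_of_mem _ hb] at h1
      refine (Submodule.mem_bot Kq).mp (mem_of_sum_mem (N := ⊥) (w := id)
        (fun x hx => by rw [(Submodule.mem_bot Kq).mp hx, map_zero]; exact zero_mem _)
        Function.injective_id.injOn ?_ ((Submodule.mem_bot Kq).mpr h1) _
        (Finset.mem_image_of_mem _ (Finsupp.mem_support_iff.mpr hb₀)))
      intro t _
      rw [map_sum, Finset.smul_sum]
      refine Finset.sum_congr rfl fun b hb => ?_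
      rw [map_smul, ← hΦ, ofCrystal_K, map_smul, smul_comm, (Finset.mem_filter.mp hb).2]
      rfl
    have hsum' : ∑ p ∈ S.sigma fun W => (Finset.univ : Finset (Fin (n W))),
        ζ ⟨p, h p.1⟩ • V.strand p.1 (h p.1) (x p) = 0 := by
      rw [← hsum]
      have hinj : Set.InjOn (fun p : Σ W : Label, Fin (n W) => (⟨p, h p.1⟩ : (ofMult n).carrier))
          (S.sigma fun W => (Finset.univ : Finset (Fin (n W)))) :=
        fun p _ p' _ hp => congrArg Sigma.fst hp
      rw [← Finset.sum_image (f := fun b : (ofMult n).carrier => ζ b • V.strand b.1.1 b.2 (x b.1))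
        hinj]
      symm
      refine (Finset.sum_congr rfl fun b _ => by rw [hΦb]).trans
        (Finset.sum_subset (fun b hb => ?_) fun b hb hb' => ?_)
      · obtain ⟨hb1, hb2⟩ := Finset.mem_filter.mp hb
        obtain ⟨h1, h2⟩ := hS b.1.1 b.2 hb2 ((hζ b (Finsupp.mem_support_iff.mp hb1)).imp_left
          Option.map_eq_none_iff.mp)
        exact Finset.mem_image.mpr ⟨b.1, Finset.mem_sigma.mpr ⟨h1, Finset.mem_univ _⟩,
          congrArg (Sigma.mk b.1) h2.symm⟩
      · obtain ⟨p, hp, rfl⟩ := Finset.mem_image.mp hb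
        have : ζ ⟨p, h p.1⟩ = 0 := by
          by_contra hne
          exact hb' (Finset.mem_filter.mpr ⟨Finsupp.mem_support_iff.mpr hne,
            hSwt p.1 (Finset.mem_sigma.mp hp).1⟩)
        rw [this, zero_smul]
    let y : Label → V.carrier := fun W => ∑ i : Fin (n W), ζ ⟨⟨W, i⟩, h W⟩ • x ⟨W, i⟩
    have hy := hind y (fun W => Submodule.sum_mem _ fun i _ =>
      Submodule.smul_mem _ _ (hxG ⟨W, i⟩)) (by
      rw [← hsum', Finset.sum_sigma]
      refine Finset.sum_congr rfl fun W _ => ?_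
      rw [map_sum]
      exact Finset.sum_congr rfl fun i _ => map_smul _ _ _)
    obtain ⟨⟨W, i⟩, c⟩ := b₀
    obtain ⟨h1, h2⟩ := hS W c rfl ((hζ _ hb₀).imp_left Option.map_eq_none_iff.mp)
    have h3 : ∑ i : Fin (n W), ζ ⟨⟨W, i⟩, h W⟩ • Module.finBasis Kq (G W) i = 0 := by
      refine Subtype.ext ?_
      rw [AddSubmonoidClass.coe_finsetSum]
      exact hy W h1
    refine hb₀ ?_
    rw [h2]
    exact Fintype.linearIndependent_iff.mp (Module.finBasis Kq (G W)).linearIndependent _ h3 i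
  · rw [← LinearMap.range_eq_top]
    have hst : ∀ (a : Uq), ∀ v ∈ LinearMap.range Φ, V.ρ a v ∈ LinearMap.range Φ := by
      rintro a _ ⟨m, rfl⟩
      exact ⟨_, hΦ a m⟩
    have hgen : ∀ W v, v ∈ G W → ∀ c, V.strand W c v ∈ LinearMap.range Φ := by
      intro W v hv c
      have h1 : v = ∑ i : Fin (n W), (Module.finBasis Kq (G W)).repr ⟨v, hv⟩ i • x ⟨W, i⟩ := by
        have := congrArg Subtype.val ((Module.finBasis Kq (G W)).sum_repr ⟨v, hv⟩)
        rw [AddSubmonoidClass.coe_finsetSum] at this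
        exact this.symm
      rw [h1, map_sum]
      refine Submodule.sum_mem _ fun i _ => ?_
      rw [map_smul]
      exact Submodule.smul_mem _ _ ⟨basis hB ⟨⟨W, i⟩, c⟩, hΦb ⟨⟨W, i⟩, c⟩⟩
    exact hV.eq_top hst (hG.hw_le _ hgen) (hG.block_le _ hgen (hst F))

end

end UqMod

end QuantumSl2

namespace QuantumSl2

open CrystalData

namespace UqMod

/-! ### The crystal of a module -/

section

variable {U V : UqMod.{u}}

theorem HasMult.exists_crystalBasis {n : Label → ℕ} (h : V.HasMult n) :
    ∃ β : Module.Basis (ofMult n).carrier Kq V.carrier, CrystalBasis (ofMult n) β := by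
  obtain ⟨g, hg⟩ := (hasMult_iff.mp h).symm
  exact ⟨_, (crystalBasis_ofCrystal (ofMult_axioms n)).map hg⟩

theorem CrystalBasis.weightFinite {B : CrystalData.{v}} {β : Module.Basis B.carrier Kq V.carrier}
    (h : CrystalBasis B β) (hV : V.InO) : B.WeightFinite :=
  h.wt.finWt hV

theorem InO.existsUnique_hasMult (hV : V.InO) : ∃! n, V.HasMult n := by
  obtain ⟨n, hn⟩ := hV.exists_hasMult
  refine ⟨n, hn, fun n' hn' => ?_⟩
  obtain ⟨β, hβ⟩ := hn.exists_crystalBasis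
  obtain ⟨γ, hγ⟩ := HasMult.exists_crystalBasis hn'
  exact ofMult_injective (hγ.equivalent hβ (ofMult_axioms _) (ofMult_axioms _)
    (hγ.weightFinite hV).1 (hβ.weightFinite hV).1)

theorem InO.hasMult_mult (hV : V.InO) : V.HasMult V.mult :=
  Classical.epsilon_spec hV.exists_hasMult

theorem crystal_axioms (V : UqMod.{u}) : V.crystal.Axioms := ofMult_axioms V.mult

theorem InO.nonempty_crystal (hV : V.InO) [Nontrivial V.carrier] : Nonempty V.crystal.carrier := by
  obtain ⟨β, -⟩ := hV.hasMult_mult.exists_crystalBasis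
  exact β.index_nonempty

theorem crystal_eq_of_equivalent (h : Equivalent U.crystal V.crystal) : U.crystal = V.crystal :=
  congrArg ofMult (ofMult_injective h)

/-- The crystal of a tensor product of modules is the tensor product of the crystals. -/
theorem InO.tensor (hU : U.InO) (hV : V.InO) : (U.tensor V).InO ∧
    Equivalent (U.crystal.tensor V.crystal) (U.tensor V).crystal := by
  obtain ⟨β, hβ⟩ := hU.hasMult_mult.exists_crystalBasis
  obtain ⟨γ, hγ⟩ := hV.hasMult_mult.exists_crystalBasis
  have hf := (hβ.weightFinite hU).tensor (hγ.weightFinite hV)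
  have hUV : (U.tensor V).InO := (hβ.wt.tensor hγ.wt).inO hf
  refine ⟨hUV, ?_⟩
  obtain ⟨g, hg⟩ := (Iso.tensor (hasMult_iff.mp hU.hasMult_mult)
    (hasMult_iff.mp hV.hasMult_mult)).symm
  obtain ⟨δ, hδ⟩ := exists_crystalBasis_tensor (ofMult_axioms U.mult) (ofMult_axioms V.mult)
  obtain ⟨η, hη⟩ := hUV.hasMult_mult.exists_crystalBasis
  exact (hδ.map hg).equivalent hη (U.crystal_axioms.tensor V.crystal_axioms) (ofMult_axioms _) hf.1
    (hη.weightFinite hUV).1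

end

end UqMod

end QuantumSl2

/-- (1) The crystal `B(V)` of a module `V ∈ 𝒪` is well defined: `V` is a direct sum of the
indecomposable modules, with unique multiplicities.
(2) `V ↦ B(V)` takes tensor products of modules to tensor products of crystals.
(3) The tensor product of branched crystals is commutative and associative. -/
theorem mainTheorem1 :
    (∀ V : QuantumSl2.UqMod.{u}, V.InO →
      (∃! n : QuantumSl2.Label → ℕ, V.HasMult n) ∧
      (Nontrivial V.carrier → V.crystal.IsBranched)) ∧
    (∀ U V W : QuantumSl2.UqMod.{u}, U.InO → V.InO → W.InO →
      (U.tensor V).InO ∧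
      CrystalData.Iso (U.crystal.tensor V.crystal) (U.tensor V).crystal ∧
      (U.tensor V).crystal = (V.tensor U).crystal ∧
      CrystalData.Iso (V.tensor U).crystal (V.crystal.tensor U.crystal) ∧
      CrystalData.Iso (U.crystal.tensor (V.crystal.tensor W.crystal))
        (U.tensor (V.tensor W)).crystal ∧
      (U.tensor (V.tensor W)).crystal = ((U.tensor V).tensor W).crystal ∧
      CrystalData.Iso ((U.tensor V).tensor W).crystal
        ((U.crystal.tensor V.crystal).tensor W.crystal)) ∧
    (∀ X Y Z : CrystalData.{v}, X.IsBranched → Y.IsBranched → Z.IsBranched →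
      (X.tensor Y).IsBranched ∧
      CrystalData.Iso (X.tensor Y) (Y.tensor X) ∧
      CrystalData.Iso (X.tensor (Y.tensor Z)) ((X.tensor Y).tensor Z)) := by
  refine ⟨fun V hV => ⟨hV.existsUnique_hasMult, fun _ =>
    V.crystal_axioms.isBranched hV.nonempty_crystal⟩, fun U V W hU hV hW => ?_,
    fun X Y Z hX hY hZ => ?_⟩
  · obtain ⟨hUV, eUV⟩ := hU.tensor hV
    obtain ⟨hVU, eVU⟩ := hV.tensor hU
    obtain ⟨hVW, eVW⟩ := hV.tensor hW
    obtain ⟨hl, el⟩ := hU.tensor hVW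
    obtain ⟨hr, er⟩ := hUV.tensor hW
    have aU := U.crystal_axioms
    have aV := V.crystal_axioms
    have aW := W.crystal_axioms
    have el' := (CrystalData.Equivalent.tensor (CrystalData.Equivalent.refl _) eVW
      (V.tensor W).crystal_axioms.e_zero).trans el
    have er' := (CrystalData.Equivalent.tensor eUV
      (CrystalData.Equivalent.refl _) aW.e_zero).trans er
    have comm := CrystalData.tensor_comm aU aV
    have assoc := CrystalData.tensor_assoc aU aV aW
    refine ⟨hUV, eUV.toIso, ?_, eVU.symm.toIso, el'.toIso, ?_, er'.symm.toIso⟩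
    · exact QuantumSl2.UqMod.crystal_eq_of_equivalent (eUV.symm.trans (comm.trans eVU))
    · exact QuantumSl2.UqMod.crystal_eq_of_equivalent (el'.symm.trans (assoc.trans er'))
  · have aX := hX.axioms
    have aY := hY.axioms
    have aZ := hZ.axioms
    have := hX.nonempty
    have := hY.nonempty
    exact ⟨(aX.tensor aY).isBranched (inferInstanceAs (Nonempty (X.carrier × Y.carrier))),
      (CrystalData.tensor_comm aX aY).toIso, (CrystalData.tensor_assoc aX aY aZ).toIso⟩
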